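/- Let $G$ be a differentiable ($C^\infty$, finite-dimensional) Lie groupoid with manifold of identities $I$, source $s$, target $t$, and algebroid $\mathfrak g=\ker(s_*)|_I$. Let $k\ge 0$ and let $J^k\mathfrak g$ be the bundle of $k$-jets of sections of $\mathfrak g$, with $t_*:J^k\mathfrak g\to T=TI$, $t_*(j^k_x\theta)=t_*(\theta(x))$. It is the algebroid of the groupoid $G_k$ of $k$-jets of bisections of $G$; for sections $\xi_k,\eta_k$ of $J^k\mathfrak g$ let $[\xi_k,\eta_k]_k=[\overline{\xi_k},\overline{\eta_k}]|_I$ be the algebroid bracket, where $\overline{\xi_k}$ is the right-invariant vector field on $G_k$ defined by $\xi_k$. Let $\rho_1,\rho_2$ be the projections of $I\times G$ on $I$ and $G$. Let $\mathcal R$ be the sheaf of $\rho_1$-projectable vector fields on $I\times G$ that are right invariant for $(a,X)\cdot Y=(a,XY)$ (in particular tangent to every $I\times s^{-1}(x)$), and let $\tilde{\mathcal V}_{\mathcal R}\subset\mathcal R$ be the subsheaf of fields tangent to $B(G)=\{(t(X),X): X\in G\}$. For $\Xi\in\mathcal R$ put $\Upsilon_k(\Xi)(x)=(\rho_1)_*\Xi(x,x)+j^k_x\big(y\mapsto(\rho_2)_*\Xi(x,y)\big)\in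 T_x\oplus J^k_x\mathfrak g$. Let $\Gamma(\tilde J^k\mathfrak g)$ be the sheaf of sections $\tilde\xi_k=\xi_H+\xi_k$ of $T\oplus J^k\mathfrak g$ with $\xi_H=t_*\xi_k$, and $\nu_k(\xi_H+\xi_k)=\xi_k$. For local sections $\tilde\xi_k,\tilde\eta_k$ of $\tilde J^k\mathfrak g$ there are, near each point, $\Xi,H\in\tilde{\mathcal V}_{\mathcal R}$ with $\Upsilon_k(\Xi)=\tilde\xi_k$, $\Upsilon_k(H)=\tilde\eta_k$, and the second bracket $[\![\tilde\xi_k,\tilde\eta_k]\!]^{\sim}_k:=\Upsilon_k([\Xi,H])\in\Gamma(\tilde J^k\mathfrak g)$ does not depend on their choice. Moreover $$[\xi_k,\eta_k]_k=\nu_k\big([\![\tilde\xi_k,\tilde\eta_k]\!]^{\sim}_k\big),\qquad \xi_k=\nu_k(\tilde\xi_k),\ \eta_k=\nu_k(\tilde\eta_k).$$ Hence $\nu_k:\Gamma(\tilde J^k\mathfrak g)\to\Gamma(J^k\mathfrak g)$ is an isomorphism of sheaves of Lie algebras: both brackets are Lie brackets compatible with restriction to open sets, and $\nu_k$ is linear,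 bijective on every open set, compatible with restriction, and preserves the brackets. Finally, let the first bracket $[\![\,,]\!]_{k+1}:(\mathcal T\oplus\Gamma(J^{k+1}\mathfrak g))^2\to\mathcal T\oplus\Gamma(J^k\mathfrak g)$, with $\mathcal T$ the sheaf of vector fields on $I$, be the (well-defined) map $[\![\Upsilon_{k+1}\Xi,\Upsilon_{k+1}H]\!]_{k+1}=\Upsilon_k([\Xi,H])$, $\Xi,H\in\mathcal R$, and let $D$ be the linear Spencer operator: for sections $\xi_{k+1}$ of $J^{k+1}\mathfrak g$ and $v$ of $T$, $i(v)D\xi_{k+1}$ at $x$ is the derivative at $x$ along $v(x)$ of the section $y\mapsto \pi_k\xi_{k+1}(y)-j^k_y\theta$ of $J^k\mathfrak g$ (which vanishes at $x$), where $\xi_{k+1}(x)=j^{k+1}_x\theta$ and $\pi_k:J^{k+1}\mathfrak g\to J^k\mathfrak g$ is the projection. If $\xi_{k+1},\eta_{k+1}$ are sections of $J^{k+1}\mathfrak g$ that project to $\xi_k,\eta_k$, then $$\nu_k\big([\![\tilde\xi_k,\tilde\eta_k]\!]^{\sim}_k\big)=i(\xi_H)D\eta_{k+1}-i(\eta_H)D\xi_{k+1}+[\![\xi_{k+1},\eta_{k+1}]\!]_{k+1}.$$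 -/

import Mathlib

open Set Filter TopologicalSpace
open scoped Manifold ContDiff Topology

noncomputable section

set_option linter.unusedSectionVars false

/-- A differentiable (Lie) groupoid `G` with manifold of identities `M`; `M` is modelled on `E`,
`G` on `F`.  The manifold of identities is included in `G` by `unit`; since `src ∘ unit = id` and
everything is smooth, `unit` is an embedding onto a regular submanifold.  The product `mul Y X`
is meaningful only for composable pairs (`src Y = tgt X`); its values elsewhere are irrelevant. -/
structure LieGroupoid (E F M G : Type*)
    [NormedAddCommGroup E] [NormedSpace ℝ E] [NormedAddCommGroup F] [NormedSpace ℝ F]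
    [TopologicalSpace M] [ChartedSpace E M] [TopologicalSpace G] [ChartedSpace F G] where
  src : G → M
  tgt : G → M
  unit : M → G
  mul : G → G → G
  inv : G → G
  smooth_src : ContMDiff 𝓘(ℝ, F) 𝓘(ℝ, E) ∞ src
  smooth_tgt : ContMDiff 𝓘(ℝ, F) 𝓘(ℝ, E) ∞ tgt
  smooth_unit : ContMDiff 𝓘(ℝ, E) 𝓘(ℝ, F) ∞ unit
  smooth_inv : ContMDiff 𝓘(ℝ, F) 𝓘(ℝ, F) ∞ inv
  smooth_mul : ContMDiffOn (𝓘(ℝ, F).prod 𝓘(ℝ, F)) 𝓘(ℝ, F) ∞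
    (fun p : G × G => mul p.1 p.2) {p | src p.1 = tgt p.2}
  submersion_src : ∀ X : G, Function.Surjective (mfderiv 𝓘(ℝ, F) 𝓘(ℝ, E) src X)
  submersion_tgt : ∀ X : G, Function.Surjective (mfderiv 𝓘(ℝ, F) 𝓘(ℝ, E) tgt X)
  src_unit : ∀ x, src (unit x) = x
  tgt_unit : ∀ x, tgt (unit x) = x
  src_mul : ∀ Y X, src Y = tgt X → src (mul Y X) = src X
  tgt_mul : ∀ Y X, src Y = tgt X → tgt (mul Y X) = tgt Y
  mul_assoc : ∀ Z Y X, src Z = tgt Y → src Y = tgt X → mul Z (mul Y X) = mul (mul Z Y) X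
  mul_unit : ∀ X, mul X (unit (src X)) = X
  unit_mul : ∀ X, mul (unit (tgt X)) X = X
  src_inv : ∀ X, src (inv X) = tgt X
  tgt_inv : ∀ X, tgt (inv X) = src X
  inv_mul : ∀ X, mul (inv X) X = unit (src X)
  mul_inv : ∀ X, mul X (inv X) = unit (tgt X)

namespace LieGroupoid

/-! ### Vector fields along a map -/

section Along

variable {E F N G : Type*}
  [NormedAddCommGroup E] [NormedSpace ℝ E] [NormedAddCommGroup F] [NormedSpace ℝ F]
  [TopologicalSpace N] [ChartedSpace E N] [TopologicalSpace G] [ChartedSpace F G]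

/-- The components of the tangent vector `v ∈ T_q G` in the preferred chart at `p`. -/
def chartVec (p q : G) (v : TangentSpace 𝓘(ℝ, F) q) : F :=
  mfderiv 𝓘(ℝ, F) 𝓘(ℝ, F) (extChartAt 𝓘(ℝ, F) p) q v

theorem chartVec_add (p q : G) (v w : TangentSpace 𝓘(ℝ, F) q) :
    chartVec p q (v + w) = chartVec p q v + chartVec p q w :=
  (mfderiv 𝓘(ℝ, F) 𝓘(ℝ, F) (extChartAt 𝓘(ℝ, F) p) q).map_add v w

theorem chartVec_smul (p q : G) (c : ℝ) (v : TangentSpace 𝓘(ℝ, F) q) :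
    chartVec p q (c • v) = c • chartVec p q v :=
  (mfderiv 𝓘(ℝ, F) 𝓘(ℝ, F) (extChartAt 𝓘(ℝ, F) p) q).map_smul c v

theorem chartVec_zero (p q : G) : chartVec p q (0 : TangentSpace 𝓘(ℝ, F) q) = 0 :=
  (mfderiv 𝓘(ℝ, F) 𝓘(ℝ, F) (extChartAt 𝓘(ℝ, F) p) q).map_zero

variable [IsManifold 𝓘(ℝ, F) ∞ G]

theorem trivializationAt_snd_eq_chartVec (p q : G) (hq : q ∈ (chartAt F p).source)
    (v : TangentSpace 𝓘(ℝ, F) q) :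
    (trivializationAt F (TangentSpace 𝓘(ℝ, F)) p (⟨q, v⟩ : TangentBundle 𝓘(ℝ, F) G)).2
      = chartVec p q v := by
  have h : (trivializationAt F (TangentSpace 𝓘(ℝ, F)) p).continuousLinearMapAt ℝ q v
      = chartVec p q v :=
    congrArg (fun L : TangentSpace 𝓘(ℝ, F) q →L[ℝ] F => L v)
      (TangentBundle.continuousLinearMapAt_trivializationAt (I := 𝓘(ℝ, F)) hq)
  rw [← h, Bundle.Trivialization.continuousLinearMapAt_apply,
    Bundle.Trivialization.linearMapAt_apply, if_pos]
  simpa using hq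

/-- A vector field along a smooth map is smooth at a point iff its components in a chart are. -/
theorem contMDiffAt_along_iff {f : N → G} {x : N} (p : G)
    (hf : ContMDiffAt 𝓘(ℝ, E) 𝓘(ℝ, F) ∞ f x) (hp : f x ∈ (chartAt F p).source)
    (θ : Π y : N, TangentSpace 𝓘(ℝ, F) (f y)) :
    ContMDiffAt 𝓘(ℝ, E) 𝓘(ℝ, F).tangent ∞ (fun y => (⟨f y, θ y⟩ : TangentBundle 𝓘(ℝ, F) G)) x ↔
      ContMDiffAt 𝓘(ℝ, E) 𝓘(ℝ, F) ∞ (fun y => chartVec p (f y) (θ y)) x := by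
  have h := (trivializationAt F (TangentSpace 𝓘(ℝ, F)) p).contMDiffAt_iff (IB := 𝓘(ℝ, F))
    (IM := 𝓘(ℝ, E)) (n := ∞)
    (f := fun y => (⟨f y, θ y⟩ : TangentBundle 𝓘(ℝ, F) G)) (x₀ := x)
    (by rw [Bundle.Trivialization.mem_source]; simpa using hp)
  refine h.trans ⟨fun h => h.2.congr_of_eventuallyEq ?_, fun h => ⟨hf, h.congr_of_eventuallyEq ?_⟩⟩
  all_goals
    filter_upwards [hf.continuousAt.preimage_mem_nhds ((chartAt F p).open_source.mem_nhds hp)]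
      with y hy
    rw [trivializationAt_snd_eq_chartVec p (f y) hy]

theorem contMDiffAt_along_zero {f : N → G} {x : N} (hf : ContMDiffAt 𝓘(ℝ, E) 𝓘(ℝ, F) ∞ f x) :
    ContMDiffAt 𝓘(ℝ, E) 𝓘(ℝ, F).tangent ∞
      (fun y => (⟨f y, 0⟩ : TangentBundle 𝓘(ℝ, F) G)) x := by
  rw [contMDiffAt_along_iff (f x) hf (mem_chart_source F (f x)) (fun _ => 0)]
  simp only [chartVec_zero]
  exact contMDiffAt_const

theorem contMDiffAt_along_add {f : N → G} {x : N} (hf : ContMDiffAt 𝓘(ℝ, E) 𝓘(ℝ, F) ∞ f x)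
    {θ μ : Π y : N, TangentSpace 𝓘(ℝ, F) (f y)}
    (hθ : ContMDiffAt 𝓘(ℝ, E) 𝓘(ℝ, F).tangent ∞
      (fun y => (⟨f y, θ y⟩ : TangentBundle 𝓘(ℝ, F) G)) x)
    (hμ : ContMDiffAt 𝓘(ℝ, E) 𝓘(ℝ, F).tangent ∞
      (fun y => (⟨f y, μ y⟩ : TangentBundle 𝓘(ℝ, F) G)) x) :
    ContMDiffAt 𝓘(ℝ, E) 𝓘(ℝ, F).tangent ∞
      (fun y => (⟨f y, (θ + μ) y⟩ : TangentBundle 𝓘(ℝ, F) G)) x := by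
  have hp := mem_chart_source F (f x)
  rw [contMDiffAt_along_iff (f x) hf hp] at hθ hμ ⊢
  simp only [Pi.add_apply, chartVec_add]
  exact hθ.add hμ

theorem contMDiffAt_along_smul {f : N → G} {x : N} (hf : ContMDiffAt 𝓘(ℝ, E) 𝓘(ℝ, F) ∞ f x)
    (c : ℝ) {θ : Π y : N, TangentSpace 𝓘(ℝ, F) (f y)}
    (hθ : ContMDiffAt 𝓘(ℝ, E) 𝓘(ℝ, F).tangent ∞
      (fun y => (⟨f y, θ y⟩ : TangentBundle 𝓘(ℝ, F) G)) x) :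
    ContMDiffAt 𝓘(ℝ, E) 𝓘(ℝ, F).tangent ∞
      (fun y => (⟨f y, (c • θ) y⟩ : TangentBundle 𝓘(ℝ, F) G)) x := by
  have hp := mem_chart_source F (f x)
  rw [contMDiffAt_along_iff (f x) hf hp] at hθ ⊢
  simp only [Pi.smul_apply, chartVec_smul]
  exact (contDiff_const_smul c).contMDiff.contMDiffAt.comp x hθ

end Along

variable {E F M G : Type*}
  [NormedAddCommGroup E] [NormedSpace ℝ E] [NormedAddCommGroup F] [NormedSpace ℝ F]
  [TopologicalSpace M] [ChartedSpace E M] [TopologicalSpace G] [ChartedSpace F G]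

/-! ### The algebroid and its jets -/

section Jets

variable [IsManifold 𝓘(ℝ, E) ∞ M] [IsManifold 𝓘(ℝ, F) ∞ G]

/-- The local sections, near `x`, of the algebroid `𝔤 = ker(src_*)|_M`: vector fields along
`unit` which on a neighbourhood of `x` are smooth and annihilated by `src_*`. -/
def localSections (𝒢 : LieGroupoid E F M G) (x : M) :
    Submodule ℝ (Π y : M, TangentSpace 𝓘(ℝ, F) (𝒢.unit y)) where
  carrier := {θ | ∀ᶠ y in 𝓝 x,
    ContMDiffAt 𝓘(ℝ, E) 𝓘(ℝ, F).tangent ∞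
      (fun z => (⟨𝒢.unit z, θ z⟩ : TangentBundle 𝓘(ℝ, F) G)) y ∧
    mfderiv 𝓘(ℝ, F) 𝓘(ℝ, E) 𝒢.src (𝒢.unit y) (θ y) = 0}
  zero_mem' := .of_forall fun y =>
    ⟨contMDiffAt_along_zero 𝒢.smooth_unit.contMDiffAt, map_zero _⟩
  add_mem' := by
    intro θ μ hθ hμ
    filter_upwards [hθ, hμ] with y h1 h2
    refine ⟨contMDiffAt_along_add 𝒢.smooth_unit.contMDiffAt h1.1 h2.1, ?_⟩
    rw [Pi.add_apply, map_add, h1.2, h2.2, add_zero]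
  smul_mem' := by
    intro c θ hθ
    filter_upwards [hθ] with y h1
    refine ⟨contMDiffAt_along_smul 𝒢.smooth_unit.contMDiffAt c h1.1, ?_⟩
    rw [Pi.smul_apply, map_smul, h1.2, smul_zero]

/-- The local expression of a section of `𝔤`, in the preferred chart of `M` at `x₀` and the
preferred chart of `G` at `unit x₀`. -/
def localExpr (𝒢 : LieGroupoid E F M G) (x₀ : M)
    (θ : Π y : M, TangentSpace 𝓘(ℝ, F) (𝒢.unit y)) (z : E) : F :=
  chartVec (𝒢.unit x₀) (𝒢.unit ((extChartAt 𝓘(ℝ, E) x₀).symm z))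
    (θ ((extChartAt 𝓘(ℝ, E) x₀).symm z))


theorem contDiffAt_localExpr (𝒢 : LieGroupoid E F M G) (x₀ : M) {x : M}
    (hx : x ∈ (chartAt E x₀).source) (hux : 𝒢.unit x ∈ (chartAt F (𝒢.unit x₀)).source)
    {θ : Π y : M, TangentSpace 𝓘(ℝ, F) (𝒢.unit y)} (hθ : θ ∈ localSections 𝒢 x) :
    ContDiffAt ℝ ∞ (localExpr 𝒢 x₀ θ) (extChartAt 𝓘(ℝ, E) x₀ x) := by
  have hx' : x ∈ (extChartAt 𝓘(ℝ, E) x₀).source := by rwa [extChartAt_source]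
  have h1 := (contMDiffAt_along_iff (𝒢.unit x₀) 𝒢.smooth_unit.contMDiffAt hux θ).1
    (Filter.Eventually.self_of_nhds hθ).1
  rw [← contMDiffAt_iff_contDiffAt]
  have h2 : ContMDiffAt 𝓘(ℝ, E) 𝓘(ℝ, E) ∞ (extChartAt 𝓘(ℝ, E) x₀).symm
      (extChartAt 𝓘(ℝ, E) x₀ x) :=
    (contMDiffOn_extChartAt_symm x₀).contMDiffAt (extChartAt_target_mem_nhds' ((extChartAt 𝓘(ℝ, E) x₀).map_source hx'))
  refine ContMDiffAt.comp (extChartAt 𝓘(ℝ, E) x₀ x)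
    (g := fun y => chartVec (𝒢.unit x₀) (𝒢.unit y) (θ y)) ?_ h2
  rwa [(extChartAt 𝓘(ℝ, E) x₀).left_inv hx']

theorem localExpr_add (𝒢 : LieGroupoid E F M G) (x₀ : M)
    (θ μ : Π y : M, TangentSpace 𝓘(ℝ, F) (𝒢.unit y)) :
    localExpr 𝒢 x₀ (θ + μ) = localExpr 𝒢 x₀ θ + localExpr 𝒢 x₀ μ := by
  funext z; exact chartVec_add _ _ _ _

theorem localExpr_smul (𝒢 : LieGroupoid E F M G) (x₀ : M) (c : ℝ)
    (θ : Π y : M, TangentSpace 𝓘(ℝ, F) (𝒢.unit y)) :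
    localExpr 𝒢 x₀ (c • θ) = c • localExpr 𝒢 x₀ θ := by
  funext z; exact chartVec_smul _ _ _ _

theorem localExpr_zero (𝒢 : LieGroupoid E F M G) (x₀ : M) : localExpr 𝒢 x₀ 0 = 0 := by
  funext z; exact chartVec_zero _ _

/-- The local sections of `𝔤` which vanish at `x` up to order `k`: all derivatives of order
at most `k` at `x` of the local expressions vanish. -/
def vanishing (𝒢 : LieGroupoid E F M G) (k : ℕ) (x : M) : Submodule ℝ (localSections 𝒢 x) where
  carrier := {θ | ∀ x₀ : M, x ∈ (chartAt E x₀).source →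
    𝒢.unit x ∈ (chartAt F (𝒢.unit x₀)).source → ∀ i : ℕ, i ≤ k →
      iteratedFDeriv ℝ i (localExpr 𝒢 x₀ θ.1) (extChartAt 𝓘(ℝ, E) x₀ x) = 0}
  zero_mem' := by
    intro x₀ _ _ i _
    rw [show ((0 : localSections 𝒢 x) : Π y : M, TangentSpace 𝓘(ℝ, F) (𝒢.unit y)) = 0 from rfl,
      localExpr_zero]
    simp
  add_mem' := by
    intro θ μ hθ hμ x₀ hx hux i hi
    rw [show (θ + μ).1 = θ.1 + μ.1 from rfl, localExpr_add, iteratedFDeriv_add_apply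
      ((contDiffAt_localExpr 𝒢 x₀ hx hux θ.2).of_le (mod_cast le_top))
      ((contDiffAt_localExpr 𝒢 x₀ hx hux μ.2).of_le (mod_cast le_top)),
      hθ x₀ hx hux i hi, hμ x₀ hx hux i hi, add_zero]
  smul_mem' := by
    intro c θ hθ x₀ hx hux i hi
    rw [show (c • θ).1 = c • θ.1 from rfl, localExpr_smul, iteratedFDeriv_const_smul_apply
      ((contDiffAt_localExpr 𝒢 x₀ hx hux θ.2).of_le (mod_cast le_top)),
      hθ x₀ hx hux i hi, smul_zero]

/-- The fibre at `x` of the bundle `J^k 𝔤` of `k`-jets of sections of the algebroid `𝔤`. -/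
def Jet (𝒢 : LieGroupoid E F M G) (k : ℕ) (x : M) : Type _ :=
  localSections 𝒢 x ⧸ vanishing 𝒢 k x

instance (𝒢 : LieGroupoid E F M G) (k : ℕ) (x : M) : AddCommGroup (Jet 𝒢 k x) :=
  inferInstanceAs (AddCommGroup (localSections 𝒢 x ⧸ vanishing 𝒢 k x))

instance (𝒢 : LieGroupoid E F M G) (k : ℕ) (x : M) : Module ℝ (Jet 𝒢 k x) :=
  inferInstanceAs (Module ℝ (localSections 𝒢 x ⧸ vanishing 𝒢 k x))

/-- The linear map which sends a local section of `𝔤` to its `k`-jet at `x`. -/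
def toJet (𝒢 : LieGroupoid E F M G) (k : ℕ) (x : M) : localSections 𝒢 x →ₗ[ℝ] Jet 𝒢 k x :=
  (vanishing 𝒢 k x).mkQ

theorem toJet_surjective (𝒢 : LieGroupoid E F M G) (k : ℕ) (x : M) :
    Function.Surjective (toJet 𝒢 k x) :=
  (vanishing 𝒢 k x).mkQ_surjective

theorem toJet_eq_iff (𝒢 : LieGroupoid E F M G) (k : ℕ) (x : M) (θ μ : localSections 𝒢 x) :
    toJet 𝒢 k x θ = toJet 𝒢 k x μ ↔ θ - μ ∈ vanishing 𝒢 k x :=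
  Submodule.Quotient.eq _

open Classical in
/-- The `k`-jet `j^k_x θ` of a local section `θ` of `𝔤` (`0` if `θ` is not a local section). -/
def jet (𝒢 : LieGroupoid E F M G) (k : ℕ) (x : M)
    (θ : Π y : M, TangentSpace 𝓘(ℝ, F) (𝒢.unit y)) : Jet 𝒢 k x :=
  if h : θ ∈ localSections 𝒢 x then toJet 𝒢 k x ⟨θ, h⟩ else 0

/-- A local section of `𝔤` representing the jet `j`. -/
def rep {𝒢 : LieGroupoid E F M G} {k : ℕ} {x : M} (j : Jet 𝒢 k x) :
    Π y : M, TangentSpace 𝓘(ℝ, F) (𝒢.unit y) :=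
  (Quotient.out (s := (vanishing 𝒢 k x).quotientRel) j : localSections 𝒢 x).1

theorem exists_rep {𝒢 : LieGroupoid E F M G} {k : ℕ} {x : M} (j : Jet 𝒢 k x) :
    ∃ h : rep j ∈ localSections 𝒢 x, toJet 𝒢 k x ⟨rep j, h⟩ = j :=
  ⟨(Quotient.out (s := (vanishing 𝒢 k x).quotientRel) j : localSections 𝒢 x).2, Quotient.out_eq j⟩

theorem vanishing_succ_le (𝒢 : LieGroupoid E F M G) (k : ℕ) (x : M) :
    vanishing 𝒢 (k + 1) x ≤ vanishing 𝒢 k x :=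
  fun _ hθ x₀ hx hux i hi => hθ x₀ hx hux i (hi.trans k.le_succ)

/-- The projection `π_k : J^{k+1} 𝔤 → J^k 𝔤`. -/
def jetProj (𝒢 : LieGroupoid E F M G) (k : ℕ) (x : M) : Jet 𝒢 (k + 1) x →ₗ[ℝ] Jet 𝒢 k x :=
  Submodule.factor (vanishing_succ_le 𝒢 k x)

/-- The anchor `t_*` on germs of sections: `θ ↦ t_* (θ x)`. -/
def anchorGerm (𝒢 : LieGroupoid E F M G) (x : M) :
    localSections 𝒢 x →ₗ[ℝ] TangentSpace 𝓘(ℝ, E) x where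
  toFun θ := (mfderiv 𝓘(ℝ, F) 𝓘(ℝ, E) 𝒢.tgt (𝒢.unit x) (θ.1 x) : E)
  map_add' θ μ := (mfderiv 𝓘(ℝ, F) 𝓘(ℝ, E) 𝒢.tgt (𝒢.unit x)).map_add (θ.1 x) (μ.1 x)
  map_smul' c θ := (mfderiv 𝓘(ℝ, F) 𝓘(ℝ, E) 𝒢.tgt (𝒢.unit x)).map_smul c (θ.1 x)

theorem eval_eq_zero_of_mem_vanishing (𝒢 : LieGroupoid E F M G) (k : ℕ) (x : M)
    {θ : localSections 𝒢 x} (hθ : θ ∈ vanishing 𝒢 k x) : θ.1 x = 0 := by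
  have h := hθ x (mem_chart_source E x) (mem_chart_source F (𝒢.unit x)) 0 (Nat.zero_le k)
  have h2 : localExpr 𝒢 x θ.1 (extChartAt 𝓘(ℝ, E) x x) = 0 := by
    simpa using congrArg (fun m => m (fun _ => (0 : E))) h
  unfold localExpr at h2
  rw [extChartAt_to_inv] at h2
  exact (isInvertible_mfderiv_extChartAt
    (mem_extChartAt_source (I := 𝓘(ℝ, F)) (𝒢.unit x))).injective
    (h2.trans (chartVec_zero _ _).symm)

/-- The anchor `t_* : J^k 𝔤 → T`, `j^k_x θ ↦ t_* (θ x)`. -/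
def anchor (𝒢 : LieGroupoid E F M G) (k : ℕ) (x : M) :
    Jet 𝒢 k x →ₗ[ℝ] TangentSpace 𝓘(ℝ, E) x :=
  (vanishing 𝒢 k x).liftQ (anchorGerm 𝒢 x) (by
    intro θ hθ
    rw [LinearMap.mem_ker]
    change (mfderiv 𝓘(ℝ, F) 𝓘(ℝ, E) 𝒢.tgt (𝒢.unit x) (θ.1 x) : E) = 0
    rw [eval_eq_zero_of_mem_vanishing 𝒢 k x hθ]
    exact map_zero _)

/-! ### Coordinates on jet bundles -/

/-- The space of Taylor coefficients up to order `k` of maps `E → F`. -/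
abbrev TaylorSpace (E F : Type*) [NormedAddCommGroup E] [NormedSpace ℝ E]
    [NormedAddCommGroup F] [NormedSpace ℝ F] (k : ℕ) : Type _ :=
  (i : Fin (k + 1)) → ContinuousMultilinearMap ℝ (fun _ : Fin (i : ℕ) => E) F

/-- The derivatives of order at most `k` of `h` at `z`. -/
def taylor (k : ℕ) (h : E → F) (z : E) : TaylorSpace E F k :=
  fun i => iteratedFDeriv ℝ (i : ℕ) h z

/-- The polynomial with Taylor coefficients `a` at `z₀`. -/
def taylorPoly {k : ℕ} (z₀ : E) (a : TaylorSpace E F k) (z : E) : F :=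
  ∑ i : Fin (k + 1), ((Nat.factorial (i : ℕ) : ℝ))⁻¹ • a i (fun _ => z - z₀)

/-- The fibre coordinates of a jet at `x`, in the chart of `J^k 𝔤` (as a subbundle of the bundle
of `k`-jets of vector fields along `unit`) induced by the preferred charts at `x₀` and at
`unit x₀`: the derivatives at `x` up to order `k` of the local expression of a representative.
For `x` in the domain of the chart it does not depend on the representative. -/
def jetCoord (𝒢 : LieGroupoid E F M G) (k : ℕ) (x₀ x : M) (j : Jet 𝒢 k x) : TaylorSpace E F k :=
  taylor k (localExpr 𝒢 x₀ (rep j)) (extChartAt 𝓘(ℝ, E) x₀ x)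

theorem jetCoord_toJet (𝒢 : LieGroupoid E F M G) (k : ℕ) {x₀ x : M}
    (hx : x ∈ (chartAt E x₀).source) (hux : 𝒢.unit x ∈ (chartAt F (𝒢.unit x₀)).source)
    (θ : localSections 𝒢 x) :
    jetCoord 𝒢 k x₀ x (toJet 𝒢 k x θ)
      = taylor k (localExpr 𝒢 x₀ θ.1) (extChartAt 𝓘(ℝ, E) x₀ x) := by
  obtain ⟨h, hj⟩ := exists_rep (toJet 𝒢 k x θ)
  set ρ : localSections 𝒢 x := ⟨rep (toJet 𝒢 k x θ), h⟩ with hρ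
  have hmem : ρ - θ ∈ vanishing 𝒢 k x := (toJet_eq_iff 𝒢 k x _ _).1 hj
  funext i
  have h0 := hmem x₀ hx hux i (Nat.lt_succ_iff.1 i.2)
  have hadd : localExpr 𝒢 x₀ ρ.1 = localExpr 𝒢 x₀ (ρ - θ).1 + localExpr 𝒢 x₀ θ.1 := by
    rw [← localExpr_add]
    congr 1
    exact (sub_add_cancel ρ.1 θ.1).symm
  change iteratedFDeriv ℝ (i : ℕ) (localExpr 𝒢 x₀ ρ.1) (extChartAt 𝓘(ℝ, E) x₀ x) = _
  rw [hadd, iteratedFDeriv_add_apply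
      ((contDiffAt_localExpr 𝒢 x₀ hx hux (ρ - θ).2).of_le (mod_cast le_top))
      ((contDiffAt_localExpr 𝒢 x₀ hx hux θ.2).of_le (mod_cast le_top)), h0, zero_add]
  rfl

theorem jetCoord_add (𝒢 : LieGroupoid E F M G) (k : ℕ) {x₀ x : M}
    (hx : x ∈ (chartAt E x₀).source) (hux : 𝒢.unit x ∈ (chartAt F (𝒢.unit x₀)).source)
    (j j' : Jet 𝒢 k x) :
    jetCoord 𝒢 k x₀ x (j + j') = jetCoord 𝒢 k x₀ x j + jetCoord 𝒢 k x₀ x j' := by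
  obtain ⟨θ, rfl⟩ := toJet_surjective 𝒢 k x j
  obtain ⟨μ, rfl⟩ := toJet_surjective 𝒢 k x j'
  rw [← map_add, jetCoord_toJet 𝒢 k hx hux, jetCoord_toJet 𝒢 k hx hux, jetCoord_toJet 𝒢 k hx hux,
    show (θ + μ).1 = θ.1 + μ.1 from rfl, localExpr_add]
  funext i
  exact iteratedFDeriv_add_apply
      ((contDiffAt_localExpr 𝒢 x₀ hx hux θ.2).of_le (mod_cast le_top))
      ((contDiffAt_localExpr 𝒢 x₀ hx hux μ.2).of_le (mod_cast le_top))

theorem jetCoord_smul (𝒢 : LieGroupoid E F M G) (k : ℕ) {x₀ x : M}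
    (hx : x ∈ (chartAt E x₀).source) (hux : 𝒢.unit x ∈ (chartAt F (𝒢.unit x₀)).source)
    (c : ℝ) (j : Jet 𝒢 k x) :
    jetCoord 𝒢 k x₀ x (c • j) = c • jetCoord 𝒢 k x₀ x j := by
  obtain ⟨θ, rfl⟩ := toJet_surjective 𝒢 k x j
  rw [← map_smul, jetCoord_toJet 𝒢 k hx hux, jetCoord_toJet 𝒢 k hx hux,
    show (c • θ).1 = c • θ.1 from rfl, localExpr_smul]
  funext i
  exact iteratedFDeriv_const_smul_apply
      ((contDiffAt_localExpr 𝒢 x₀ hx hux θ.2).of_le (mod_cast le_top))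

theorem jetCoord_jetProj (𝒢 : LieGroupoid E F M G) (k : ℕ) {x₀ x : M}
    (hx : x ∈ (chartAt E x₀).source) (hux : 𝒢.unit x ∈ (chartAt F (𝒢.unit x₀)).source)
    (j : Jet 𝒢 (k + 1) x) :
    jetCoord 𝒢 k x₀ x (jetProj 𝒢 k x j) =
      fun i : Fin (k + 1) => jetCoord 𝒢 (k + 1) x₀ x j i.castSucc := by
  obtain ⟨θ, rfl⟩ := toJet_surjective 𝒢 (k + 1) x j
  have h : jetProj 𝒢 k x (toJet 𝒢 (k + 1) x θ) = toJet 𝒢 k x θ := rfl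
  rw [h, jetCoord_toJet 𝒢 k hx hux, jetCoord_toJet 𝒢 (k + 1) hx hux]
  rfl

theorem eventually_mem_chart (𝒢 : LieGroupoid E F M G) (x₀ : M) :
    ∀ᶠ x in 𝓝 x₀, x ∈ (chartAt E x₀).source ∧ 𝒢.unit x ∈ (chartAt F (𝒢.unit x₀)).source :=
  Filter.Eventually.and ((chartAt E x₀).open_source.mem_nhds (mem_chart_source E x₀))
    (𝒢.smooth_unit.continuous.continuousAt.preimage_mem_nhds
      ((chartAt F (𝒢.unit x₀)).open_source.mem_nhds (mem_chart_source F (𝒢.unit x₀))))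

/-! ### The sheaves `𝒯`, `Γ(J^k 𝔤)`, `𝒯 ⊕ Γ(J^k 𝔤)` and `Γ(J̃^k 𝔤)` -/

/-- Sections on the open set `U` of the sheaf `𝒯` of smooth vector fields of `M`. -/
def VecSection (E : Type*) [NormedAddCommGroup E] [NormedSpace ℝ E] {M : Type*}
    [TopologicalSpace M] [ChartedSpace E M] [IsManifold 𝓘(ℝ, E) ∞ M] (U : Opens M) :
    Submodule ℝ (Π x : U, TangentSpace 𝓘(ℝ, E) (x : M)) where
  carrier := {v | ∀ x₀ : U, ContMDiffAt 𝓘(ℝ, E) 𝓘(ℝ, E).tangent ∞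
    (fun x : U => (⟨(x : M), v x⟩ : TangentBundle 𝓘(ℝ, E) M)) x₀}
  zero_mem' _ := contMDiffAt_along_zero contMDiff_subtype_val.contMDiffAt
  add_mem' hv hw x₀ := contMDiffAt_along_add contMDiff_subtype_val.contMDiffAt (hv x₀) (hw x₀)
  smul_mem' c _ hv x₀ := contMDiffAt_along_smul contMDiff_subtype_val.contMDiffAt c (hv x₀)

/-- `Γ(U, J^k 𝔤)`: the smooth sections of `J^k 𝔤` on the open set `U`. -/
def JetSection (𝒢 : LieGroupoid E F M G) (k : ℕ) (U : Opens M) :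
    Submodule ℝ (Π x : U, Jet 𝒢 k (x : M)) where
  carrier := {ξ | ∀ x₀ : U, ContMDiffAt 𝓘(ℝ, E) 𝓘(ℝ, TaylorSpace E F k) ∞
    (fun x : U => jetCoord 𝒢 k (x₀ : M) x (ξ x)) x₀}
  zero_mem' x₀ := by
    refine (contMDiffAt_const (c := (0 : TaylorSpace E F k))).congr_of_eventuallyEq ?_
    filter_upwards [continuous_subtype_val.continuousAt.eventually
      (eventually_mem_chart 𝒢 (x₀ : M))] with x hx
    simpa using jetCoord_smul 𝒢 k hx.1 hx.2 0 0
  add_mem' := by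
    intro ξ η hξ hη x₀
    refine ((hξ x₀).add (hη x₀)).congr_of_eventuallyEq ?_
    filter_upwards [continuous_subtype_val.continuousAt.eventually
      (eventually_mem_chart 𝒢 (x₀ : M))] with x hx
    exact jetCoord_add 𝒢 k hx.1 hx.2 (ξ x) (η x)
  smul_mem' := by
    intro c ξ hξ x₀
    refine ((contDiff_const_smul c).contMDiff.contMDiffAt.comp x₀ (hξ x₀)).congr_of_eventuallyEq ?_
    filter_upwards [continuous_subtype_val.continuousAt.eventually
      (eventually_mem_chart 𝒢 (x₀ : M))] with x hx
    exact jetCoord_smul 𝒢 k hx.1 hx.2 c (ξ x)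

/-- `(𝒯 ⊕ Γ(J^k 𝔤))(U)`, the sections of `T ⊕ J^k 𝔤`. -/
abbrev JetCheck (𝒢 : LieGroupoid E F M G) (k : ℕ) (U : Opens M) : Type _ :=
  VecSection E U × JetSection 𝒢 k U

/-- `Γ(U, J̃^k 𝔤)`: the sections `ξ_H + ξ_k` of `T ⊕ J^k 𝔤` with `ξ_H = t_* ξ_k`. -/
def JetTilde (𝒢 : LieGroupoid E F M G) (k : ℕ) (U : Opens M) :
    Submodule ℝ (JetCheck 𝒢 k U) where
  carrier := {p | ∀ x : U, p.1.1 x = anchor 𝒢 k x (p.2.1 x)}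
  zero_mem' _ := (map_zero _).symm
  add_mem' := by
    intro p q hp hq x
    change p.1.1 x + q.1.1 x = anchor 𝒢 k x (p.2.1 x + q.2.1 x)
    rw [map_add, hp x, hq x]
  smul_mem' := by
    intro c p hp x
    change c • p.1.1 x = anchor 𝒢 k x (c • p.2.1 x)
    rw [map_smul, hp x]

/-- The projection `ν_k : Γ(U, J̃^k 𝔤) → Γ(U, J^k 𝔤)`, `ξ_H + ξ_k ↦ ξ_k`. -/
def nu (𝒢 : LieGroupoid E F M G) (k : ℕ) (U : Opens M) :
    JetTilde 𝒢 k U →ₗ[ℝ] JetSection 𝒢 k U :=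
  (LinearMap.snd ℝ (VecSection E U) (JetSection 𝒢 k U)).comp (JetTilde 𝒢 k U).subtype

/-- The projection `π_k : Γ(U, J^{k+1} 𝔤) → Γ(U, J^k 𝔤)`. -/
def sectionProj (𝒢 : LieGroupoid E F M G) (k : ℕ) (U : Opens M)
    (ξ : JetSection 𝒢 (k + 1) U) : JetSection 𝒢 k U where
  val x := jetProj 𝒢 k x (ξ.1 x)
  property x₀ := by
    have h : ContDiff ℝ ∞ (fun (a : TaylorSpace E F (k + 1)) =>
        ((fun i : Fin (k + 1) => a i.castSucc) : TaylorSpace E F k)) :=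
      contDiff_pi.2 fun i => (ContinuousLinearMap.proj (R := ℝ)
        (φ := fun i : Fin (k + 1 + 1) => ContinuousMultilinearMap ℝ (fun _ : Fin (i : ℕ) => E) F)
        i.castSucc).contDiff
    refine (h.contMDiff.contMDiffAt.comp x₀ (ξ.2 x₀)).congr_of_eventuallyEq ?_
    filter_upwards [continuous_subtype_val.continuousAt.eventually
      (eventually_mem_chart 𝒢 (x₀ : M))] with x hx
    exact jetCoord_jetProj 𝒢 k hx.1 hx.2 (ξ.1 x)

/-- Restriction of sections of `𝒯`. -/
def resVec {U V : Opens M} (h : V ≤ U) (v : VecSection E U) : VecSection E V where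
  val x := v.1 ⟨x, h x.2⟩
  property x₀ := (v.2 ⟨x₀, h x₀.2⟩).comp x₀ (contMDiff_inclusion h).contMDiffAt

/-- Restriction of sections of `J^k 𝔤`. -/
def resJet {𝒢 : LieGroupoid E F M G} {k : ℕ} {U V : Opens M} (h : V ≤ U)
    (ξ : JetSection 𝒢 k U) : JetSection 𝒢 k V where
  val x := ξ.1 ⟨x, h x.2⟩
  property x₀ := (ξ.2 ⟨x₀, h x₀.2⟩).comp x₀ (contMDiff_inclusion h).contMDiffAt

/-- Restriction of sections of `J̃^k 𝔤`. -/
def resTilde {𝒢 : LieGroupoid E F M G} {k : ℕ} {U V : Opens M} (h : V ≤ U)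
    (ξ : JetTilde 𝒢 k U) : JetTilde 𝒢 k V :=
  ⟨(resVec h ξ.1.1, resJet h ξ.1.2), fun x => ξ.2 ⟨x, h x.2⟩⟩

/-! ### Right invariant vector fields on `G`, and the bracket of the algebroid `J^k 𝔤` -/

/-- The right action `v ↦ v · Y` of `Y` on the `src`-vertical vectors at `X`, where
`src X = tgt Y`: the derivative at `X` of `Z ↦ Z Y`, defined on the fibre `src⁻¹(tgt Y)`. -/
def act (𝒢 : LieGroupoid E F M G) (X Y : G) (v : TangentSpace 𝓘(ℝ, F) X) :
    TangentSpace 𝓘(ℝ, F) (𝒢.mul X Y) :=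
  mfderivWithin 𝓘(ℝ, F) 𝓘(ℝ, F) (fun Z => 𝒢.mul Z Y) (𝒢.src ⁻¹' {𝒢.tgt Y}) X v

/-- The right invariant vector field `X ↦ θ(tgt X) · X` on `G` defined by a section `θ` of `𝔤`;
its value at `X` is a tangent vector at `(unit (tgt X)) X = X`. -/
def rightInvariant (𝒢 : LieGroupoid E F M G) (θ : Π y : M, TangentSpace 𝓘(ℝ, F) (𝒢.unit y))
    (X : G) : TangentSpace 𝓘(ℝ, F) X :=
  (𝒢.act (𝒢.unit (𝒢.tgt X)) X (θ (𝒢.tgt X)) : F)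

open Classical in
/-- Extension by zero of a section of `J^k 𝔤` on `U`. -/
def extendJet {𝒢 : LieGroupoid E F M G} {k : ℕ} {U : Opens M} (ξ : JetSection 𝒢 k U) (y : M) :
    Jet 𝒢 k y :=
  if h : y ∈ U then ξ.1 ⟨y, h⟩ else 0

/-- The right invariant vector field `ξ̄_k` on the groupoid `G_k` of `k`-jets of bisections of `G`
defined by a section `ξ` of `J^k 𝔤 = 𝔤_k`, in coordinates.

`ξ̄_k` is tangent to the source fibre `G_k(x)`, which is a submanifold of the manifold of `k`-jets
at `x` of maps `M → G`.  The coordinates on the latter are the Taylor coefficients `a` at `x`,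
in the preferred charts at `x` and at `unit x`, of a map `φ : M → G`.  At `X = j^k_x φ`, with
target `y = tgt (φ x)`, one has `ξ̄_k(X) = ξ_k(y) · X = d/du (j^k_y ψ_u · j^k_x φ) =
d/du j^k_x (x' ↦ ψ_u (tgt (φ x')) φ(x'))` for bisections `ψ_u` with `ψ_0 = unit` whose derivative
at `u = 0` is a section `θ` with `j^k_y θ = ξ_k(y)`, i.e. `ξ̄_k(X)` is the `k`-jet at `x` of
`x' ↦ θ(tgt (φ x')) · φ(x')`.  This formula makes sense at jets of arbitrary maps `φ`, and it is
used at all of them, so that the vector field is defined on an open set of a vector space; on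
`G_k(x)` it is tangent to `G_k(x)`. -/
def rightInvariantJet (𝒢 : LieGroupoid E F M G) (k : ℕ) (x : M) {U : Opens M}
    (ξ : JetSection 𝒢 k U) (a : TaylorSpace E F k) : TaylorSpace E F k :=
  let z₀ : E := extChartAt 𝓘(ℝ, E) x x
  let φ : E → G := fun z => (extChartAt 𝓘(ℝ, F) (𝒢.unit x)).symm (taylorPoly z₀ a z)
  let θ := rep (extendJet ξ (𝒢.tgt (φ z₀)))
  taylor k (fun z => chartVec (𝒢.unit x) (φ z) (𝒢.rightInvariant θ (φ z))) z₀

/-- The coordinates of the unit `j^k_x unit` of `G_k`. -/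
def unitJet (𝒢 : LieGroupoid E F M G) (k : ℕ) (x : M) : TaylorSpace E F k :=
  taylor k (fun z => extChartAt 𝓘(ℝ, F) (𝒢.unit x) (𝒢.unit ((extChartAt 𝓘(ℝ, E) x).symm z)))
    (extChartAt 𝓘(ℝ, E) x x)

/-- `ζ` is the algebroid bracket `[ξ, η]_k = [ξ̄_k, η̄_k]|_M` of the algebroid `𝔤_k = J^k 𝔤` of the
groupoid `G_k`: at each `x`, `ζ(x)` is the value at the unit `j^k_x unit` of the Lie bracket of the
right invariant vector fields of `G_k` defined by `ξ` and `η`. -/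
def IsAlgebroidBracket {𝒢 : LieGroupoid E F M G} {k : ℕ} {U : Opens M}
    (ξ η ζ : JetSection 𝒢 k U) : Prop :=
  ∀ x : U, jetCoord 𝒢 k (x : M) x (ζ.1 x) =
    VectorField.lieBracket ℝ (𝒢.rightInvariantJet k x ξ) (𝒢.rightInvariantJet k x η)
      (𝒢.unitJet k x)

open Classical in
/-- The algebroid bracket `[ξ, η]_k` on `Γ(U, J^k 𝔤)`. -/
def algebroidBracket {𝒢 : LieGroupoid E F M G} {k : ℕ} {U : Opens M}
    (ξ η : JetSection 𝒢 k U) : JetSection 𝒢 k U :=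
  if h : ∃ ζ, IsAlgebroidBracket ξ η ζ then h.choose else 0

/-! ### Vector fields on `M × G` -/

/-- Vector fields (not necessarily smooth) on `M × G`. -/
abbrev Field (E F M G : Type*)
    [NormedAddCommGroup E] [NormedSpace ℝ E] [NormedAddCommGroup F] [NormedSpace ℝ F]
    [TopologicalSpace M] [ChartedSpace E M] [TopologicalSpace G] [ChartedSpace F G] : Type _ :=
  Π p : M × G, TangentSpace (𝓘(ℝ, E).prod 𝓘(ℝ, F)) p

/-- The component along `M`, i.e. `(ρ₁)_* Ξ(a, X) ∈ T_a M`. -/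
def Field.hor (Ξ : Field E F M G) (a : M) (X : G) : TangentSpace 𝓘(ℝ, E) a :=
  (Ξ (a, X) : E × F).1

/-- The component along `G`, i.e. `(ρ₂)_* Ξ(a, X) ∈ T_X G`. -/
def Field.ver (Ξ : Field E F M G) (a : M) (X : G) : TangentSpace 𝓘(ℝ, F) X :=
  (Ξ (a, X) : E × F).2

/-- The subset `{(a, X) | (a, tgt X) ∈ O}` of `M × G`, for `O ⊆ M × M`.  It is saturated for the
right action of `G`; as a right invariant field is determined by its values at the points
`(a, unit y)`, these are the natural domains of right invariant fields. -/
def saturation (𝒢 : LieGroupoid E F M G) (O : Set (M × M)) : Set (M × G) :=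
  {p | (p.1, 𝒢.tgt p.2) ∈ O}

/-- `Ξ` is a section of the sheaf `ℛ` over the saturation of `O`: a smooth, right invariant and
`ρ₁`-projectable vector field. -/
structure IsR (𝒢 : LieGroupoid E F M G) (O : Set (M × M)) (Ξ : Field E F M G) : Prop where
  smooth : ContMDiffOn (𝓘(ℝ, E).prod 𝓘(ℝ, F)) (𝓘(ℝ, E).prod 𝓘(ℝ, F)).tangent ∞
    (fun p => (⟨p, Ξ p⟩ : TangentBundle (𝓘(ℝ, E).prod 𝓘(ℝ, F)) (M × G))) (𝒢.saturation O)
  tangent_fibres : ∀ a X, (a, 𝒢.tgt X) ∈ O →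
    mfderiv 𝓘(ℝ, F) 𝓘(ℝ, E) 𝒢.src X (Ξ.ver a X) = 0
  hor_invariant : ∀ a X Y, 𝒢.src X = 𝒢.tgt Y → (a, 𝒢.tgt X) ∈ O →
    Ξ.hor a (𝒢.mul X Y) = Ξ.hor a X
  ver_invariant : ∀ a X Y, 𝒢.src X = 𝒢.tgt Y → (a, 𝒢.tgt X) ∈ O →
    Ξ.ver a (𝒢.mul X Y) = 𝒢.act X Y (Ξ.ver a X)
  projectable : ∀ a X X', (a, 𝒢.tgt X) ∈ O → (a, 𝒢.tgt X') ∈ O → Ξ.hor a X = Ξ.hor a X'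

/-- `Ξ` is a section over the saturation of `O` of the subsheaf `𝒱̃_ℛ` of `ℛ`: it is moreover
tangent to `B(G) = {(tgt X, X)}`, the image of `B : X ↦ (tgt X, X)`. -/
structure IsTildeV (𝒢 : LieGroupoid E F M G) (O : Set (M × M)) (Ξ : Field E F M G) : Prop
    extends IsR 𝒢 O Ξ where
  tangent_B : ∀ X, (𝒢.tgt X, 𝒢.tgt X) ∈ O → ∃ w : TangentSpace 𝓘(ℝ, F) X,
    mfderiv 𝓘(ℝ, F) (𝓘(ℝ, E).prod 𝓘(ℝ, F)) (fun Y : G => (𝒢.tgt Y, Y)) X w = Ξ (𝒢.tgt X, X)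

/-- `Υ_k(Ξ)` at `x`: the vector `(ρ₁)_* Ξ(x, x)` and the `k`-jet at `x` of the section
`y ↦ (ρ₂)_* Ξ(x, y)` of `𝔤`. -/
def upsilon (𝒢 : LieGroupoid E F M G) (k : ℕ) (Ξ : Field E F M G) (x : M) :
    TangentSpace 𝓘(ℝ, E) x × Jet 𝒢 k x :=
  (Ξ.hor x (𝒢.unit x), jet 𝒢 k x (fun y => Ξ.ver x (𝒢.unit y)))

/-- `Υ_k(Ξ) = p` on the part of the open set `U` over which `Ξ` is defined. -/
def Lifts {𝒢 : LieGroupoid E F M G} {k : ℕ} {U : Opens M} (O : Set (M × M)) (Ξ : Field E F M G)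
    (p : JetCheck 𝒢 k U) : Prop :=
  ∀ y : U, ((y : M), (y : M)) ∈ O → 𝒢.upsilon k Ξ y = (p.1.1 y, p.2.1 y)

/-- The Lie bracket of vector fields on `M × G`. -/
def fieldBracket (Ξ H : Field E F M G) : Field E F M G :=
  VectorField.mlieBracket (𝓘(ℝ, E).prod 𝓘(ℝ, F)) Ξ H

/-! ### First and second brackets, and the Spencer operator -/

/-- `r` is the first bracket of `p` and `q`: near each point of `U` there are `Ξ`, `H` in `ℛ` with
`Υ_{k+1}(Ξ) = p`, `Υ_{k+1}(H) = q`, and `r = Υ_k([Ξ, H])` for any choice of these. -/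
def IsFirstBracket {𝒢 : LieGroupoid E F M G} {k : ℕ} {U : Opens M}
    (p q : JetCheck 𝒢 (k + 1) U) (r : JetCheck 𝒢 k U) : Prop :=
  ∀ x : U,
    (∃ (O : Set (M × M)) (Ξ H : Field E F M G), IsOpen O ∧ ((x : M), (x : M)) ∈ O ∧
      IsR 𝒢 O Ξ ∧ IsR 𝒢 O H ∧ Lifts O Ξ p ∧ Lifts O H q) ∧
    ∀ (O : Set (M × M)) (Ξ H : Field E F M G), IsOpen O → ((x : M), (x : M)) ∈ O →
      IsR 𝒢 O Ξ → IsR 𝒢 O H → Lifts O Ξ p → Lifts O H q →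
      𝒢.upsilon k (fieldBracket Ξ H) x = (r.1.1 x, r.2.1 x)

open Classical in
/-- The first bracket of order `k + 1`,
`(𝒯 ⊕ Γ(J^{k+1} 𝔤)) × (𝒯 ⊕ Γ(J^{k+1} 𝔤)) → 𝒯 ⊕ Γ(J^k 𝔤)`. -/
def firstBracket {𝒢 : LieGroupoid E F M G} {k : ℕ} {U : Opens M}
    (p q : JetCheck 𝒢 (k + 1) U) : JetCheck 𝒢 k U :=
  if h : ∃ r, IsFirstBracket p q r then h.choose else 0

/-- `ζ` is the second bracket of `ξ` and `η`: near each point of `U` there are `Ξ`, `H` in `𝒱̃_ℛ`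
with `Υ_k(Ξ) = ξ`, `Υ_k(H) = η`, and `ζ = Υ_k([Ξ, H])` for any choice of these. -/
def IsSecondBracket {𝒢 : LieGroupoid E F M G} {k : ℕ} {U : Opens M}
    (ξ η ζ : JetTilde 𝒢 k U) : Prop :=
  ∀ x : U,
    (∃ (O : Set (M × M)) (Ξ H : Field E F M G), IsOpen O ∧ ((x : M), (x : M)) ∈ O ∧
      IsTildeV 𝒢 O Ξ ∧ IsTildeV 𝒢 O H ∧ Lifts O Ξ ξ.1 ∧ Lifts O H η.1) ∧
    ∀ (O : Set (M × M)) (Ξ H : Field E F M G), IsOpen O → ((x : M), (x : M)) ∈ O →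
      IsTildeV 𝒢 O Ξ → IsTildeV 𝒢 O H → Lifts O Ξ ξ.1 → Lifts O H η.1 →
      𝒢.upsilon k (fieldBracket Ξ H) x = (ζ.1.1.1 x, ζ.1.2.1 x)

open Classical in
/-- The second bracket of order `k` on `Γ(U, J̃^k 𝔤)`. -/
def secondBracket {𝒢 : LieGroupoid E F M G} {k : ℕ} {U : Opens M}
    (ξ η : JetTilde 𝒢 k U) : JetTilde 𝒢 k U :=
  if h : ∃ ζ, IsSecondBracket ξ η ζ then h.choose else 0

/-- `ζ = i(v) D ξ`, with `D ξ = j^1 (π_k ξ) - λ^1 ξ` the linear Spencer operator: at each `x`, if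
`ξ(x) = j^{k+1}_x θ`, then `ζ(x)` is the derivative at `x` along `v(x)` of the section
`y ↦ π_k ξ(y) - j^k_y θ` of the vector bundle `J^k 𝔤`, which vanishes at `x`. -/
def IsSpencer {𝒢 : LieGroupoid E F M G} {k : ℕ} {U : Opens M} (v : VecSection E U)
    (ξ : JetSection 𝒢 (k + 1) U) (ζ : JetSection 𝒢 k U) : Prop :=
  ∀ x : U, jetCoord 𝒢 k (x : M) x (ζ.1 x) =
    mfderiv 𝓘(ℝ, E) 𝓘(ℝ, TaylorSpace E F k)
      (fun y : U => jetCoord 𝒢 k (x : M) y (jetProj 𝒢 k y (ξ.1 y) - jet 𝒢 k y (rep (ξ.1 x))))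
      x (v.1 x)

open Classical in
/-- `i(v) D ξ`, where `D` is the linear Spencer operator. -/
def spencer {𝒢 : LieGroupoid E F M G} {k : ℕ} {U : Opens M} (v : VecSection E U)
    (ξ : JetSection 𝒢 (k + 1) U) : JetSection 𝒢 k U :=
  if h : ∃ ζ, IsSpencer v ξ ζ then h.choose else 0

/-- `b` is a (real) Lie bracket on `V`. -/
structure IsLieBracket {V : Type*} [AddCommGroup V] [Module ℝ V] (b : V → V → V) : Prop where
  add_left : ∀ x y z, b (x + y) z = b x z + b y z
  smul_left : ∀ (c : ℝ) x y, b (c • x) y = c • b x y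
  self : ∀ x, b x x = 0
  skew : ∀ x y, b x y = -b y x
  jacobi : ∀ x y z, b x (b y z) + b y (b z x) + b z (b x y) = 0

end Jets

end LieGroupoid

end

/-! Near an identity `unit x`, a field of `ℛ` reads in charts as a map `V = (V₁, V₂)` on `E × F`.
Its component `V₁` depends only on the point `a` of `M`, and for each `a` the map `V₂(a, ·)` is a
right invariant field on `G`. Then `Υ_k` records `V₁(x)` and the `k`-jet at `z = x` of `z ↦ V₂(x,
unit z)`.

Since `V₁` and `W₁` do not depend on the second slot, the `G`-component of `[V, W]` at `(x, unit z)`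
is `DW₂(V₁(x), V₂) - DV₂(W₁(x), W₂)`, where `V₂`, `W₂` are evaluated at `(x, unit z)`
(`taylor_lieBracket`). On the other side, if `V` represents `ξ`, the right invariant field on `G_k`
defined by `ξ` sends the jet of `φ` to the jet of `z ↦ V₂(tgt (φ x), φ z)`
(`rightInvariantJet_eventuallyEq`). Differentiating this at the unit along the field of `W`, the
chain rule gives the `k`-jet of `z ↦ DV₂(t_* W₂(x), W₂(x, unit z))` (`fderiv_jetField`). Hence the
algebroid bracket is given by the same formula as `[V, W]`, with `V₁(x)`, `W₁(x)` replaced by the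
anchors.

For fields in `𝒱̃_ℛ` the horizontal part is the anchor, so the two formulas coincide
(`jetCoord_upsilon_bracket_second`). This proves at once that the second bracket does not depend on
the lifts and that `ν_k` carries it to the algebroid bracket. It stays in `J̃^k 𝔤` because tangency
to `B(G)` passes to brackets.

In general the two formulas differ by the derivative of `W₂` in the `M`-slot alone, in the direction
`V₁(x) - t_* V₂(x)`, minus the same with `V` and `W` exchanged (`derivAlong_sub`). The `k`-jet of
such a derivative is a value of the Spencer operator (`fderiv_jetC_sub`). So the first bracket is
the algebroid bracket corrected by Spencer terms (`jetCoord_upsilon_bracket_first`); it depends only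
on the `(k + 1)`-jets, and the choice `V₁ = W₁ = 0` gives the last formula.

Three further facts are needed. Right invariant projectable fields are closed under brackets
(`IsLocalR.lieBracket`), which is shown by relatedness along parametrized source fibres. Sections of
`T ⊕ J^k 𝔤` have local lifts (`exists_lift`), built from Taylor polynomials. Bilinearity and
antisymmetry come from the formula on jets, while the Jacobi identity comes from that of vector
fields. -/

noncomputable section

set_option linter.unusedSectionVars false

namespace LieGroupoid

/-! ### Calculus of jets of maps between normed spaces -/

section Calculus

variable {P E F H : Type*}
  [NormedAddCommGroup P] [NormedSpace ℝ P] [NormedAddCommGroup E] [NormedSpace ℝ E]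
  [NormedAddCommGroup F] [NormedSpace ℝ F] [NormedAddCommGroup H] [NormedSpace ℝ H]

theorem taylor_eq_iff {k : ℕ} {f g : E → F} {z w : E} :
    taylor k f z = taylor k g w ↔ ∀ i ≤ k, iteratedFDeriv ℝ i f z = iteratedFDeriv ℝ i g w :=
  ⟨fun h i hi => congrFun h ⟨i, Nat.lt_succ_of_le hi⟩,
    fun h => funext fun i => h i (Nat.lt_succ_iff.1 i.2)⟩

theorem taylor_congr {k : ℕ} {f g : E → F} {z : E} (h : f =ᶠ[𝓝 z] g) :
    taylor k f z = taylor k g z :=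
  taylor_eq_iff.2 fun i _ => (Filter.EventuallyEq.iteratedFDeriv ℝ h i).self_of_nhds

theorem taylor_add {k : ℕ} {f g : E → F} {z : E} (hf : ContDiffAt ℝ ∞ f z)
    (hg : ContDiffAt ℝ ∞ g z) : taylor k (f + g) z = taylor k f z + taylor k g z :=
  funext fun _ => iteratedFDeriv_add_apply (hf.of_le (mod_cast le_top)) (hg.of_le (mod_cast le_top))

theorem taylor_neg {k : ℕ} (f : E → F) (z : E) : taylor k (-f) z = -taylor k f z :=
  funext fun _ => iteratedFDeriv_neg_apply

theorem taylor_sub {k : ℕ} {f g : E → F} {z : E} (hf : ContDiffAt ℝ ∞ f z)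
    (hg : ContDiffAt ℝ ∞ g z) : taylor k (f - g) z = taylor k f z - taylor k g z := by
  rw [sub_eq_add_neg, taylor_add hf (g := -g) hg.neg, taylor_neg, sub_eq_add_neg]

theorem taylor_eq_apply {k : ℕ} {f g : E → F} {z w : E} (h : taylor k f z = taylor k g w) :
    f z = g w := by
  simpa using congrArg (fun m => m (fun _ => (0 : E))) (taylor_eq_iff.1 h 0 (Nat.zero_le k))

theorem taylor_zero_apply (k : ℕ) (f : E → F) (z : E) (v : Fin ((0 : Fin (k + 1)) : ℕ) → E) :
    taylor k f z 0 v = f z := rfl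

/-- The `k`-jet of a composition only depends on the `k`-jets of the factors. -/
theorem taylor_comp_congr {k : ℕ} {f₁ f₂ : E → F} {g₁ g₂ : F → H} {z : E}
    (hf₁ : ContDiffAt ℝ ∞ f₁ z) (hf₂ : ContDiffAt ℝ ∞ f₂ z)
    (hg₁ : ContDiffAt ℝ ∞ g₁ (f₁ z)) (hg₂ : ContDiffAt ℝ ∞ g₂ (f₁ z))
    (hf : taylor k f₁ z = taylor k f₂ z) (hg : taylor k g₁ (f₁ z) = taylor k g₂ (f₁ z)) :
    taylor k (fun y => g₁ (f₁ y)) z = taylor k (fun y => g₂ (f₂ y)) z := by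
  have h0 : f₁ z = f₂ z := taylor_eq_apply hf
  refine taylor_eq_iff.2 fun i hi => ?_
  change iteratedFDeriv ℝ i (g₁ ∘ f₁) z = iteratedFDeriv ℝ i (g₂ ∘ f₂) z
  rw [iteratedFDeriv_comp hg₁ hf₁ (mod_cast le_top),
    iteratedFDeriv_comp (h0 ▸ hg₂) hf₂ (mod_cast le_top), ← h0]
  -- Faà di Bruno: the derivative of order `i` is a sum over ordered partitions of `i`, whose terms
  -- involve derivatives of `g` of order `c.length` and of `f` of orders `c.partSize m`, all at most
  -- `i`.
  unfold FormalMultilinearSeries.taylorComp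
  refine Finset.sum_congr rfl fun c _ => ?_
  unfold FormalMultilinearSeries.compAlongOrderedFinpartition
  have h1 : ftaylorSeries ℝ g₁ (f₁ z) c.length = ftaylorSeries ℝ g₂ (f₁ z) c.length :=
    taylor_eq_iff.1 hg _ (c.length_le.trans hi)
  have h2 : (fun m => ftaylorSeries ℝ f₁ z (c.partSize m))
      = fun m => ftaylorSeries ℝ f₂ z (c.partSize m) :=
    funext fun m => taylor_eq_iff.1 hf _ ((c.partSize_le m).trans hi)
  rw [h1, h2]

theorem taylor_prodMk_congr {k : ℕ} {f₁ f₂ : E → F} {g₁ g₂ : E → H} {z : E}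
    (hf₁ : ContDiffAt ℝ ∞ f₁ z) (hf₂ : ContDiffAt ℝ ∞ f₂ z)
    (hg₁ : ContDiffAt ℝ ∞ g₁ z) (hg₂ : ContDiffAt ℝ ∞ g₂ z)
    (hf : taylor k f₁ z = taylor k f₂ z) (hg : taylor k g₁ z = taylor k g₂ z) :
    taylor k (fun y => (f₁ y, g₁ y)) z = taylor k (fun y => (f₂ y, g₂ y)) z := by
  refine taylor_eq_iff.2 fun i hi => ?_
  rw [iteratedFDeriv_prodMk hf₁ hg₁ (mod_cast le_top),
    iteratedFDeriv_prodMk hf₂ hg₂ (mod_cast le_top), taylor_eq_iff.1 hf i hi,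
    taylor_eq_iff.1 hg i hi]

variable (E F) in
/-- The currying isomorphism `L(E, L^i(E; F)) → L^{i+1}(E; F)`. -/
def uncurryLeftL (i : ℕ) : (E →L[ℝ] ContinuousMultilinearMap ℝ (fun _ : Fin i => E) F) →L[ℝ]
    ContinuousMultilinearMap ℝ (fun _ : Fin (i + 1) => E) F :=
  ((continuousMultilinearCurryLeftEquiv ℝ (fun _ : Fin (i + 1) => E)
    F).symm.toContinuousLinearEquiv).toContinuousLinearMap

variable (E F) in
/-- The isomorphism `F → L^0(E; F)`. -/
def uncurryZeroL : F →L[ℝ] ContinuousMultilinearMap ℝ (fun _ : Fin 0 => E) F :=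
  ((continuousMultilinearCurryFin0 ℝ E F).symm.toContinuousLinearEquiv).toContinuousLinearMap

/-- Up to currying, the derivative of order `i + 1` is the `z`-derivative of the one of order `i`,
and one differentiation keeps smoothness jointly in the parameter and the point. -/
theorem contDiffAt_iteratedFDeriv_param (i : ℕ) {g : P × E → F} {p : P × E}
    (hg : ContDiffAt ℝ ∞ g p) :
    ContDiffAt ℝ ∞ (fun q : P × E => iteratedFDeriv ℝ i (fun z => g (q.1, z)) q.2) p := by
  induction i with
  | zero => exact ((continuousMultilinearCurryFin0 ℝ E F).symm.contDiff.contDiffAt).comp p hg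
  | succ i ih =>
    have hL : ContDiff ℝ ∞ (uncurryLeftL E F i) :=
      ContinuousLinearMap.contDiff (𝕜 := ℝ) (E := E →L[ℝ] ContinuousMultilinearMap ℝ
        (fun _ : Fin i => E) F) (F := ContinuousMultilinearMap ℝ (fun _ : Fin (i + 1) => E) F) _
    refine hL.contDiffAt.comp p (f := fun q : P × E =>
        fderiv ℝ (fun z => iteratedFDeriv ℝ i (fun z => g (q.1, z)) z) q.2) ?_
    refine ContDiffAt.fderiv (m := ∞) (n := ∞)
      (f := fun (q : P × E) z => iteratedFDeriv ℝ i (fun z => g (q.1, z)) z) ?_ contDiffAt_snd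
      (by simp)
    -- The parameter is now the whole pair `(c, z)`; the induction hypothesis is pulled back along
    -- `((c, z), z') ↦ (c, z')`.
    exact ContDiffAt.comp (p, p.2) (g := fun q : P × E =>
      iteratedFDeriv ℝ i (fun z => g (q.1, z)) q.2) (f := fun r : (P × E) × E => (r.1.1, r.2)) ih
      ((contDiffAt_fst.fst).prodMk contDiffAt_snd)

/-- The moving base point `ζ` is what sections of jet bundles require: there the jet at `y` is taken
of a map which itself depends on `y`. -/
theorem contDiffAt_taylor_param (k : ℕ) {g : P × E → F} {p : P} {ζ : P → E}
    (hg : ContDiffAt ℝ ∞ g (p, ζ p)) (hζ : ContDiffAt ℝ ∞ ζ p) :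
    ContDiffAt ℝ ∞ (fun q : P => taylor k (fun z => g (q, z)) (ζ q)) p :=
  contDiffAt_pi.2 fun i => ContDiffAt.comp p (contDiffAt_iteratedFDeriv_param i hg)
    (f := fun q => (q, ζ q)) (contDiffAt_id.prodMk hζ)

theorem fderiv_partial_left {g : P × E → F} {p : P × E} (hg : DifferentiableAt ℝ g p) (v : P) :
    fderiv ℝ (fun c => g (c, p.2)) p.1 v = fderiv ℝ g p (v, 0) := by
  have h : HasFDerivAt (fun c => g (c, p.2)) _ p.1 :=
    HasFDerivAt.comp p.1 (g := g) hg.hasFDerivAt (hasFDerivAt_prodMk_left p.1 p.2)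
  rw [h.fderiv]; rfl

theorem fderiv_partial_right {g : P × E → F} {p : P × E} (hg : DifferentiableAt ℝ g p) (v : E) :
    fderiv ℝ (fun z => g (p.1, z)) p.2 v = fderiv ℝ g p (0, v) := by
  have h : HasFDerivAt (fun z => g (p.1, z)) _ p.2 :=
    HasFDerivAt.comp p.2 (g := g) hg.hasFDerivAt (hasFDerivAt_prodMk_right p.1 p.2)
  rw [h.fderiv]; rfl

theorem eventually_differentiableAt {g : E → F} {p : E} (hg : ContDiffAt ℝ ∞ g p) :
    ∀ᶠ q in 𝓝 p, DifferentiableAt ℝ g q := by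
  have h : ContDiffAt ℝ 1 g p := hg.of_le (mod_cast le_top)
  exact (h.eventually (by simp)).mono fun q hq => hq.differentiableAt one_ne_zero

/-- Partial derivatives commute. -/
theorem fderiv_fderiv_partial {g : P × E → F} {p : P × E} (hg : ContDiffAt ℝ ∞ g p)
    (v : P) (w : E) :
    fderiv ℝ (fun c => fderiv ℝ (fun z => g (c, z)) p.2) p.1 v w
      = fderiv ℝ (fun z => fderiv ℝ (fun c => g (c, z)) p.1 v) p.2 w := by
  have hd := eventually_differentiableAt hg
  have h2 : DifferentiableAt ℝ (fderiv ℝ g) p :=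
    (hg.fderiv_right (m := 1) (by norm_cast)).differentiableAt one_ne_zero
  have hsymm : IsSymmSndFDerivAt ℝ g p := hg.isSymmSndFDerivAt (by simp; norm_cast)
  have e1 : (fun c => fderiv ℝ (fun z => g (c, z)) p.2) =ᶠ[𝓝 p.1]
      fun c => (fderiv ℝ g (c, p.2)).comp (ContinuousLinearMap.inr ℝ P E) := by
    have hc : Tendsto (fun c : P => (c, p.2)) (𝓝 p.1) (𝓝 p) :=
      (Continuous.prodMk_left p.2).tendsto p.1
    filter_upwards [hc.eventually hd] with c hc
    ext w
    exact fderiv_partial_right hc w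
  have e2 : (fun z => fderiv ℝ (fun c => g (c, z)) p.1 v) =ᶠ[𝓝 p.2]
      fun z => fderiv ℝ g (p.1, z) (v, 0) := by
    have hc : Tendsto (fun z : E => (p.1, z)) (𝓝 p.2) (𝓝 p) :=
      (Continuous.prodMk_right p.1).tendsto p.2
    filter_upwards [hc.eventually hd] with z hz
    exact fderiv_partial_left hz v
  have hL : HasFDerivAt (fun c => fderiv ℝ g (c, p.2)) _ p.1 :=
    HasFDerivAt.comp p.1 (g := fderiv ℝ g) h2.hasFDerivAt (hasFDerivAt_prodMk_left p.1 p.2)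
  have hR : HasFDerivAt (fun z => fderiv ℝ g (p.1, z)) _ p.2 :=
    HasFDerivAt.comp p.2 (g := fderiv ℝ g) h2.hasFDerivAt (hasFDerivAt_prodMk_right p.1 p.2)
  rw [e1.fderiv_eq, e2.fderiv_eq, (hL.clm_comp (hasFDerivAt_const _ _)).fderiv,
    (hR.clm_apply (hasFDerivAt_const _ _)).fderiv]
  -- Both sides are the second derivative of `g` at `p` on `(v, 0)` and `(0, w)`, in the two orders.
  simpa using hsymm.eq (v, 0) (0, w)

/-- Derivatives with respect to a parameter commute with iterated derivatives. -/
theorem fderiv_iteratedFDeriv_param (i : ℕ) {g : P × E → F} {c : P} (v : P) {z : E}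
    (hg : ∀ᶠ z' in 𝓝 z, ContDiffAt ℝ ∞ g (c, z')) :
    fderiv ℝ (fun c => iteratedFDeriv ℝ i (fun z => g (c, z)) z) c v
      = iteratedFDeriv ℝ i (fun z => fderiv ℝ (fun c => g (c, z)) c v) z := by
  induction i generalizing z with
  | zero =>
    have h0 : HasFDerivAt (fun c => g (c, z)) _ c := HasFDerivAt.comp c (g := g)
      (hg.self_of_nhds.differentiableAt (by simp)).hasFDerivAt (hasFDerivAt_prodMk_left c z)
    have := (uncurryZeroL E F).hasFDerivAt.comp c h0.differentiableAt.hasFDerivAt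
    exact congrArg (fun L => L v) this.fderiv
  | succ i ih =>
    set D : P × E → ContinuousMultilinearMap ℝ (fun _ : Fin i => E) F :=
      fun q => iteratedFDeriv ℝ i (fun z => g (q.1, z)) q.2 with hD
    have hDs : ContDiffAt ℝ ∞ D (c, z) := contDiffAt_iteratedFDeriv_param i hg.self_of_nhds
    set L := uncurryLeftL E F i
    have h1 : ContDiffAt ℝ ∞ (fun c => fderiv ℝ (fun z => D (c, z)) z) c := by
      refine ContDiffAt.fderiv (m := ∞) (n := ∞) (f := fun (c : P) z => D (c, z)) ?_
        contDiffAt_const (by simp)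
      exact hDs
    have h2 : fderiv ℝ (fun c => iteratedFDeriv ℝ (i + 1) (fun z => g (c, z)) z) c v
        = L (fderiv ℝ (fun c => fderiv ℝ (fun z => D (c, z)) z) c v) :=
      congrArg (fun L => L v)
        (L.hasFDerivAt.comp c (h1.differentiableAt (by simp)).hasFDerivAt).fderiv
    rw [h2, iteratedFDeriv_succ_eq_comp_left]
    change L _ = L _
    congr 1
    ext1 w
    -- The parameter derivative is exchanged with the outermost `z`-derivative. The inner one is
    -- treated by the induction hypothesis at all nearby points, which is why `hg` is assumed on a
    -- neighbourhood of `z`.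
    rw [fderiv_fderiv_partial (p := (c, z)) hDs v w]
    refine congrArg (fun L : E →L[ℝ] ContinuousMultilinearMap ℝ (fun _ : Fin i => E) F => L w)
      (Filter.EventuallyEq.fderiv_eq ?_)
    filter_upwards [hg.eventually_nhds] with z' hz'
    exact ih hz'

theorem fderiv_taylor_param (k : ℕ) {g : P × E → F} {c : P} (v : P) {z : E}
    (hg : ∀ᶠ z' in 𝓝 z, ContDiffAt ℝ ∞ g (c, z')) :
    fderiv ℝ (fun c => taylor k (fun z => g (c, z)) z) c v
      = taylor k (fun z => fderiv ℝ (fun c => g (c, z)) c v) z := by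
  have h : ∀ i : Fin (k + 1), DifferentiableAt ℝ
      (fun c => taylor k (fun z => g (c, z)) z i) c := fun i =>
    ((contDiffAt_pi.1 (contDiffAt_taylor_param k (ζ := fun _ => z) hg.self_of_nhds
      contDiffAt_const) i).differentiableAt (by simp))
  funext i
  rw [fderiv_pi h]
  exact fderiv_iteratedFDeriv_param i v hg

/-- The entries of the derivative of the `k`-jet prolongation are curried entries of the `(k +
1)`-jet. In the Spencer operator this cancels the variation of the base point. -/
theorem fderiv_taylor_eq_of_taylor_succ_eq (k : ℕ) {f g : E → F} {z : E}
    (hf : ContDiffAt ℝ ∞ f z) (hg : ContDiffAt ℝ ∞ g z)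
    (h : taylor (k + 1) f z = taylor (k + 1) g z) (v : E) :
    fderiv ℝ (taylor k f) z v = fderiv ℝ (taylor k g) z v := by
  have key : ∀ {f : E → F}, ContDiffAt ℝ ∞ f z → ∀ i : Fin (k + 1), fderiv ℝ (taylor k f) z v i
      = (continuousMultilinearCurryLeftEquiv ℝ (fun _ : Fin (i + 1) => E) F
        (iteratedFDeriv ℝ (i + 1) f z)) v := by
    intro f hf i
    have hd : ∀ i : Fin (k + 1), DifferentiableAt ℝ (fun z => taylor k f z i) z := fun i =>
      (hf.iteratedFDeriv_right (m := 1) (i := (i : ℕ)) (mod_cast le_top)).differentiableAt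
        one_ne_zero
    have := fderiv_pi hd
    rw [show (taylor k f) = fun z i => taylor k f z i from rfl, this]
    change fderiv ℝ (iteratedFDeriv ℝ (i : ℕ) f) z v = _
    rw [iteratedFDeriv_succ_eq_comp_left]
    simp
  funext i
  rw [key hf, key hg, taylor_eq_iff.1 h (i + 1) (by omega)]

/-- The Lie brackets of related vector fields are related. -/
theorem lieBracket_of_related {κ : P → E} {p : P} {V W : E → E} {v w : P → P}
    (hκ : ContDiffAt ℝ ∞ κ p) (hV : DifferentiableAt ℝ V (κ p)) (hW : DifferentiableAt ℝ W (κ p))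
    (hv : DifferentiableAt ℝ v p) (hw : DifferentiableAt ℝ w p)
    (hVv : ∀ᶠ q in 𝓝 p, V (κ q) = fderiv ℝ κ q (v q))
    (hWw : ∀ᶠ q in 𝓝 p, W (κ q) = fderiv ℝ κ q (w q)) :
    VectorField.lieBracket ℝ V W (κ p) = fderiv ℝ κ p (VectorField.lieBracket ℝ v w p) := by
  have hκd : DifferentiableAt ℝ κ p := hκ.differentiableAt (by simp)
  -- The relation `W ∘ κ = Dκ · w` is differentiated at `p`. In the difference of the two brackets
  -- the second derivative of `κ` disappears by symmetry, so `κ` need be neither injective nor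
  -- immersive.
  have e1 : fderiv ℝ (fun q => fderiv ℝ κ q (w q)) p = (fderiv ℝ W (κ p)).comp (fderiv ℝ κ p) := by
    rw [← fderiv_comp p hW hκd]
    exact Filter.EventuallyEq.fderiv_eq (hWw.mono fun q hq => hq.symm)
  have e2 : fderiv ℝ (fun q => fderiv ℝ κ q (v q)) p = (fderiv ℝ V (κ p)).comp (fderiv ℝ κ p) := by
    rw [← fderiv_comp p hV hκd]
    exact Filter.EventuallyEq.fderiv_eq (hVv.mono fun q hq => hq.symm)
  rw [VectorField.fderiv_apply_lieBracket (n := ∞) hκ (by simp; norm_cast) hw hv, e1, e2,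
    VectorField.lieBracket, hVv.self_of_nhds, hWw.self_of_nhds]
  rfl

/-- A translation is a parameter: this is the parametrized statement for `f (c + z)` at `c = 0`. -/
theorem fderiv_iteratedFDeriv (i : ℕ) {f : E → F} {z : E} (v : E)
    (hf : ∀ᶠ z' in 𝓝 z, ContDiffAt ℝ ∞ f z') :
    fderiv ℝ (iteratedFDeriv ℝ i f) z v = iteratedFDeriv ℝ i (fun z => fderiv ℝ f z v) z := by
  have h := fderiv_iteratedFDeriv_param i (g := fun q : E × E => f (q.1 + q.2)) (c := 0) v (z := z)
    (hf.mono fun z' hz' => ContDiffAt.comp (0, z') (g := f) (by simpa using hz')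
      (contDiffAt_fst.add contDiffAt_snd))
  simpa [iteratedFDeriv_comp_add_left, fderiv_comp_add_right] using h

/-- Iterated derivatives are symmetric. -/
theorem iteratedFDeriv_comp_perm {n : ℕ} {f : E → F} {z : E}
    (hf : ∀ᶠ z' in 𝓝 z, ContDiffAt ℝ ∞ f z') (v : Fin n → E) (σ : Equiv.Perm (Fin n)) :
    iteratedFDeriv ℝ n f z (v ∘ σ) = iteratedFDeriv ℝ n f z v := by
  -- Adjacent transpositions generate the symmetric group. The swap of the first two slots is the
  -- symmetry of the second derivative of `iteratedFDeriv ℝ n f`; a later swap is the inductive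
  -- statement for the derivative of `f` in the direction `v 0`.
  have hstep : ∀ (n : ℕ) (f : E → F), (∀ᶠ z' in 𝓝 z, ContDiffAt ℝ ∞ f z') →
      ∀ (v : Fin (n + 1) → E) (i : Fin n),
      iteratedFDeriv ℝ (n + 1) f z (v ∘ Equiv.swap i.castSucc i.succ)
        = iteratedFDeriv ℝ (n + 1) f z v := by
    intro n
    induction n with
    | zero => exact fun _ _ _ i => i.elim0
    | succ n ih =>
      intro f hf v i
      rcases Fin.eq_zero_or_eq_succ i with rfl | ⟨j, rfl⟩
      · have hD : ContDiffAt ℝ ∞ (iteratedFDeriv ℝ n f) z :=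
          hf.self_of_nhds.iteratedFDeriv_right (m := ∞) (by norm_cast)
        have hs : IsSymmSndFDerivAt ℝ (iteratedFDeriv ℝ n f) z :=
          hD.isSymmSndFDerivAt (by simp; norm_cast)
        have key : ∀ w : Fin (n + 2) → E, iteratedFDeriv ℝ (n + 2) f z w
            = fderiv ℝ (fderiv ℝ (iteratedFDeriv ℝ n f)) z (w 0) (w 1)
              (fun j => w j.succ.succ) := by
          intro w
          rw [iteratedFDeriv_succ_apply_left, fderiv_iteratedFDeriv (n + 1) _ hf,
            iteratedFDeriv_succ_apply_left]
          have e : (iteratedFDeriv ℝ n fun z => fderiv ℝ f z (w 0)) =ᶠ[𝓝 z]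
              fun z => fderiv ℝ (iteratedFDeriv ℝ n f) z (w 0) := by
            filter_upwards [hf.eventually_nhds] with z' hz'
            exact (fderiv_iteratedFDeriv n _ hz').symm
          have hd : DifferentiableAt ℝ (fderiv ℝ (iteratedFDeriv ℝ n f)) z :=
            (hD.fderiv_right (m := 1) (by norm_cast)).differentiableAt one_ne_zero
          rw [e.fderiv_eq, (hd.hasFDerivAt.clm_apply (hasFDerivAt_const _ _)).fderiv]
          simp only [ContinuousLinearMap.comp_zero, zero_add]
          change fderiv ℝ (fderiv ℝ (iteratedFDeriv ℝ n f)) z (w 1) (w 0) _ = _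
          rw [hs.eq]
          rfl
        rw [key, key]
        have e0 : (v ∘ Equiv.swap (Fin.castSucc 0) (Fin.succ 0)) 0 = v (1 : Fin (n + 2)) := by
          simp
        have e1 : (v ∘ Equiv.swap (Fin.castSucc 0) (Fin.succ 0)) 1 = v (0 : Fin (n + 2)) := by
          simp
        rw [e0, e1, hs.eq]
        congr 1
      · rw [iteratedFDeriv_succ_apply_left, iteratedFDeriv_succ_apply_left,
          fderiv_iteratedFDeriv _ _ hf, fderiv_iteratedFDeriv _ _ hf]
        have e0 : (v ∘ Equiv.swap (Fin.castSucc j.succ) (Fin.succ j.succ)) 0 = v 0 := by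
          simp only [Function.comp]
          rw [Equiv.swap_apply_of_ne_of_ne]
          · simp [Fin.ext_iff]
          · simp [Fin.ext_iff]
        have e1 : Fin.tail (v ∘ Equiv.swap (Fin.castSucc j.succ) (Fin.succ j.succ))
            = Fin.tail v ∘ Equiv.swap j.castSucc j.succ := by
          funext l
          simp only [Fin.tail, Function.comp, ← Fin.succ_castSucc]
          rw [← (Fin.succ_injective _).map_swap]
        rw [e0, e1]
        exact ih _ (hf.mono fun z' hz' => (hz'.fderiv_right (m := ∞) (by simp)).clm_apply
          contDiffAt_const) _ j
  cases n with
  | zero => exact congrArg _ (Subsingleton.elim _ _)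
  | succ n =>
    have hσ : σ ∈ Submonoid.closure (Set.range fun i : Fin n => Equiv.swap i.castSucc i.succ) := by
      rw [Equiv.Perm.mclosure_swap_castSucc_succ]; trivial
    induction hσ using Submonoid.closure_induction generalizing v with
    | mem τ hτ => obtain ⟨i, rfl⟩ := hτ; exact hstep n f hf v i
    | one => rfl
    | mul τ ρ _ _ h1 h2 =>
      rw [show (v ∘ ⇑(τ * ρ)) = (v ∘ τ) ∘ ρ from rfl, h2, h1]

/-- Taylor polynomials have the prescribed jets. -/
theorem taylor_taylorPoly {k : ℕ} {f : E → F} {z : E} (hf : ∀ᶠ z' in 𝓝 z, ContDiffAt ℝ ∞ f z') :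
    taylor k (taylorPoly z (taylor k f z)) z = taylor k f z := by
  classical
  -- The Taylor polynomial as a finite power series, with the factorials inside the coefficients.
  set p : FormalMultilinearSeries ℝ E F := fun n =>
    if n ≤ k then ((Nat.factorial n : ℝ))⁻¹ • iteratedFDeriv ℝ n f z else 0 with hp
  have hfin : ∀ m, k + 1 ≤ m → p m = 0 := fun m hm => if_neg (by omega)
  have hball := (p.hasFiniteFPowerSeriesOnBall_of_finite hfin)
  have hpoly : taylorPoly z (taylor k f z) = fun y => p.sum (y - z) := by
    funext y
    have : p.sum (y - z) = ∑ i ∈ Finset.range (k + 1), p i (fun _ => y - z) :=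
      tsum_eq_sum fun b hb => by
        rw [hfin b (by simpa using hb)]; rfl
    rw [this, taylorPoly, ← Fin.sum_univ_eq_sum_range (fun i => p i (fun _ => y - z))]
    refine Finset.sum_congr rfl fun i _ => ?_
    rw [hp]
    simp only [if_pos (Nat.lt_succ_iff.1 i.2)]
    rfl
  refine taylor_eq_iff.2 fun i hi => ?_
  rw [hpoly, iteratedFDeriv_comp_sub, sub_self]
  ext v
  have han : AnalyticOn ℝ p.sum univ := by
    have h := hball.cpolynomialOn
    rw [Metric.eball_top] at h
    exact (h.analyticOnNhd).analyticOn
  rw [hball.toHasFPowerSeriesOnBall.iteratedFDeriv_eq_sum han]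
  -- At its centre, the `i`-th derivative of a power series is the sum of its `i`-th coefficient
  -- over all permutations of the arguments. The coefficients are derivatives of `f`, hence
  -- symmetric, and the `i!` equal terms absorb the factor `1 / i!`.
  have hsymm : ∀ σ : Equiv.Perm (Fin i), p i (fun j => v (σ j))
      = ((Nat.factorial i : ℝ))⁻¹ • iteratedFDeriv ℝ i f z v := by
    intro σ
    simp only [hp, if_pos hi]
    exact congrArg (fun w => ((Nat.factorial i : ℝ))⁻¹ • w) (iteratedFDeriv_comp_perm hf v σ)
  rw [Finset.sum_congr rfl fun σ _ => hsymm σ, Finset.sum_const, Finset.card_univ,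
    Fintype.card_perm, Fintype.card_fin, ← Nat.cast_smul_eq_nsmul ℝ, smul_smul,
    mul_inv_cancel₀ (by positivity), one_smul]

end Calculus

end LieGroupoid

namespace LieGroupoid

/-! ### Tangent vectors and maps in the preferred charts -/

section Charts

variable {E F N G : Type*}
  [NormedAddCommGroup E] [NormedSpace ℝ E] [NormedAddCommGroup F] [NormedSpace ℝ F]
  [TopologicalSpace N] [ChartedSpace E N] [TopologicalSpace G] [ChartedSpace F G]
  {EN HN : Type*} [NormedAddCommGroup EN] [NormedSpace ℝ EN] [TopologicalSpace HN]
  {IN : ModelWithCorners ℝ EN HN} {L : Type*} [TopologicalSpace L] [ChartedSpace HN L]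
  {H : Type*} [NormedAddCommGroup H] [NormedSpace ℝ H]

variable [IsManifold 𝓘(ℝ, E) ∞ N] [IsManifold 𝓘(ℝ, F) ∞ G]

theorem contMDiffAt_extChartAt_of_mem {p q : G} (hq : q ∈ (extChartAt 𝓘(ℝ, F) p).source) :
    ContMDiffAt 𝓘(ℝ, F) 𝓘(ℝ, F) ∞ (extChartAt 𝓘(ℝ, F) p) q :=
  contMDiffAt_extChartAt' (by rwa [extChartAt_source] at hq)

theorem contMDiffAt_extChartAt_symm_of_mem {p : G} {z : F}
    (hz : z ∈ (extChartAt 𝓘(ℝ, F) p).target) :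
    ContMDiffAt 𝓘(ℝ, F) 𝓘(ℝ, F) ∞ (extChartAt 𝓘(ℝ, F) p).symm z :=
  (contMDiffOn_extChartAt_symm p).contMDiffAt (extChartAt_target_mem_nhds' hz)

theorem chartVec_injective {p q : G} (hq : q ∈ (extChartAt 𝓘(ℝ, F) p).source) :
    Function.Injective (chartVec (F := F) p q) :=
  (isInvertible_mfderiv_extChartAt hq).injective

/-- The tangent vector at `q` with components `w` in the preferred chart at `p`. -/
def vecOf (p q : G) (w : F) : TangentSpace 𝓘(ℝ, F) q :=
  mfderiv 𝓘(ℝ, F) 𝓘(ℝ, F) (extChartAt 𝓘(ℝ, F) p).symm (extChartAt 𝓘(ℝ, F) p q) w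

theorem chartVec_vecOf {p q : G} (hq : q ∈ (extChartAt 𝓘(ℝ, F) p).source) (w : F) :
    chartVec p q (vecOf p q w) = w := by
  have h := mfderiv_extChartAt_comp_mfderivWithin_extChartAt_symm' (I := 𝓘(ℝ, F)) hq
  rw [modelWithCornersSelf_coe, range_id, mfderivWithin_univ] at h
  exact congrArg (fun L : F →L[ℝ] F => L w) h

theorem vecOf_chartVec {p q : G} (hq : q ∈ (extChartAt 𝓘(ℝ, F) p).source)
    (v : TangentSpace 𝓘(ℝ, F) q) : vecOf p q (chartVec p q v) = v :=
  chartVec_injective hq (chartVec_vecOf hq _)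

theorem chartVec_self (p : G) (v : TangentSpace 𝓘(ℝ, F) p) : chartVec p p v = v :=
  congrArg (fun L : F →L[ℝ] F => L v) (mfderiv_extChartAt_self (I := 𝓘(ℝ, F)) (x := p))

/-- Components of the image of a tangent vector, for a map from an arbitrary manifold. -/
theorem chartVec_mfderiv {f : L → G} {q : L} (p : G) (hf : MDifferentiableAt IN 𝓘(ℝ, F) f q)
    (hq : f q ∈ (extChartAt 𝓘(ℝ, F) p).source) (v : TangentSpace IN q) :
    chartVec p (f q) (mfderiv IN 𝓘(ℝ, F) f q v)
      = mfderiv IN 𝓘(ℝ, F) (fun y => extChartAt 𝓘(ℝ, F) p (f y)) q v :=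
  (mfderiv_comp_apply q (mdifferentiableAt_extChartAt (by rwa [extChartAt_source] at hq)) hf v).symm

theorem mfderiv_eq_fderiv_chart {f : N → H} {q : N} (p : N)
    (hf : MDifferentiableAt 𝓘(ℝ, E) 𝓘(ℝ, H) f q) (hq : q ∈ (extChartAt 𝓘(ℝ, E) p).source)
    (v : TangentSpace 𝓘(ℝ, E) q) :
    mfderiv 𝓘(ℝ, E) 𝓘(ℝ, H) f q v = fderiv ℝ (fun z => f ((extChartAt 𝓘(ℝ, E) p).symm z))
      (extChartAt 𝓘(ℝ, E) p q) (chartVec p q v) := by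
  have hs : MDifferentiableAt 𝓘(ℝ, E) 𝓘(ℝ, E) (extChartAt 𝓘(ℝ, E) p).symm
      (extChartAt 𝓘(ℝ, E) p q) :=
    (contMDiffAt_extChartAt_symm_of_mem ((extChartAt 𝓘(ℝ, E) p).map_source hq)).mdifferentiableAt
      (by simp)
  have h := mfderiv_comp_apply_of_eq (extChartAt 𝓘(ℝ, E) p q) hf hs
    ((extChartAt 𝓘(ℝ, E) p).left_inv hq) (chartVec (F := E) p q v : E)
  have h1 : vecOf p q (chartVec p q v) = v := vecOf_chartVec hq v
  have h2 := congrArg (fun L : E →L[ℝ] H => L (chartVec p q v))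
    (mfderiv_eq_fderiv (f := fun z => f ((extChartAt 𝓘(ℝ, E) p).symm z))
      (x := extChartAt 𝓘(ℝ, E) p q))
  refine Eq.trans ?_ (h.symm.trans h2)
  exact (congrArg (mfderiv 𝓘(ℝ, E) 𝓘(ℝ, H) f q) h1).symm

variable (E F) in
/-- A map between manifolds in the preferred charts at `p` and `p'`. -/
def inCharts (p : N) (p' : G) (f : N → G) (z : E) : F :=
  extChartAt 𝓘(ℝ, F) p' (f ((extChartAt 𝓘(ℝ, E) p).symm z))

theorem chartVec_mfderiv_eq_fderiv {f : N → G} {q : N} (p : N) (p' : G)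
    (hf : MDifferentiableAt 𝓘(ℝ, E) 𝓘(ℝ, F) f q) (hq : q ∈ (extChartAt 𝓘(ℝ, E) p).source)
    (hq' : f q ∈ (extChartAt 𝓘(ℝ, F) p').source) (v : TangentSpace 𝓘(ℝ, E) q) :
    chartVec p' (f q) (mfderiv 𝓘(ℝ, E) 𝓘(ℝ, F) f q v)
      = fderiv ℝ (inCharts E F p p' f) (extChartAt 𝓘(ℝ, E) p q) (chartVec p q v) := by
  rw [chartVec_mfderiv p' hf hq']
  exact mfderiv_eq_fderiv_chart p
    ((mdifferentiableAt_extChartAt (by rwa [extChartAt_source] at hq')).comp q hf) hq v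

theorem contDiffAt_comp_symm {f : N → H} {q : N} (p : N)
    (hf : ContMDiffAt 𝓘(ℝ, E) 𝓘(ℝ, H) ∞ f q) (hq : q ∈ (extChartAt 𝓘(ℝ, E) p).source) :
    ContDiffAt ℝ ∞ (fun z => f ((extChartAt 𝓘(ℝ, E) p).symm z)) (extChartAt 𝓘(ℝ, E) p q) := by
  rw [← contMDiffAt_iff_contDiffAt]
  exact ContMDiffAt.comp_of_eq hf
    (contMDiffAt_extChartAt_symm_of_mem ((extChartAt 𝓘(ℝ, E) p).map_source hq))
    ((extChartAt 𝓘(ℝ, E) p).left_inv hq)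

theorem contDiffAt_inCharts {f : N → G} {q : N} (p : N) (p' : G)
    (hf : ContMDiffAt 𝓘(ℝ, E) 𝓘(ℝ, F) ∞ f q) (hq : q ∈ (extChartAt 𝓘(ℝ, E) p).source)
    (hq' : f q ∈ (extChartAt 𝓘(ℝ, F) p').source) :
    ContDiffAt ℝ ∞ (inCharts E F p p' f) (extChartAt 𝓘(ℝ, E) p q) :=
  contDiffAt_comp_symm p ((contMDiffAt_extChartAt_of_mem (F := F) hq').comp q hf) hq

/-- A vector field along a smooth map from an arbitrary manifold is smooth at a point iff its
components in a chart are. -/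
theorem contMDiffAt_along_iff' {f : L → G} {x : L} (p : G)
    (hf : ContMDiffAt IN 𝓘(ℝ, F) ∞ f x) (hp : f x ∈ (extChartAt 𝓘(ℝ, F) p).source)
    (θ : Π y : L, TangentSpace 𝓘(ℝ, F) (f y)) :
    ContMDiffAt IN 𝓘(ℝ, F).tangent ∞ (fun y => (⟨f y, θ y⟩ : TangentBundle 𝓘(ℝ, F) G)) x ↔
      ContMDiffAt IN 𝓘(ℝ, F) ∞ (fun y => chartVec p (f y) (θ y)) x := by
  rw [extChartAt_source] at hp
  have h := (trivializationAt F (TangentSpace 𝓘(ℝ, F)) p).contMDiffAt_iff (IB := 𝓘(ℝ, F))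
    (IM := IN) (n := ∞)
    (f := fun y => (⟨f y, θ y⟩ : TangentBundle 𝓘(ℝ, F) G)) (x₀ := x)
    (by rw [Bundle.Trivialization.mem_source]; simpa using hp)
  refine h.trans ⟨fun h => h.2.congr_of_eventuallyEq ?_, fun h => ⟨hf, h.congr_of_eventuallyEq ?_⟩⟩
  all_goals
    filter_upwards [hf.continuousAt.preimage_mem_nhds ((chartAt F p).open_source.mem_nhds hp)]
      with y hy
    rw [trivializationAt_snd_eq_chartVec p (f y) hy]

/-- Derivatives with respect to a parameter in a vector space are smooth. -/
theorem contMDiffAt_fderiv_param {g : N × F → H} {q : N} {w : F}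
    (hg : ContMDiffAt (𝓘(ℝ, E).prod 𝓘(ℝ, F)) 𝓘(ℝ, H) ∞ g (q, w)) :
    ContMDiffAt 𝓘(ℝ, E) 𝓘(ℝ, F →L[ℝ] H) ∞ (fun y => fderiv ℝ (fun w => g (y, w)) w) q := by
  set e := extChartAt 𝓘(ℝ, E) q
  have hq : q ∈ e.source := mem_extChartAt_source q
  have h1 : ContDiffAt ℝ ∞ (fun r : E × F => g (e.symm r.1, r.2)) (e q, w) := by
    rw [← contMDiffAt_iff_contDiffAt]
    refine ContMDiffAt.comp_of_eq hg (f := fun r : E × F => (e.symm r.1, r.2)) ?_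
      (Prod.ext (e.left_inv hq) rfl)
    refine ContMDiffAt.prodMk ?_ contDiffAt_snd.contMDiffAt
    exact ContMDiffAt.comp_of_eq (contMDiffAt_extChartAt_symm_of_mem (e.map_source hq))
      contDiffAt_fst.contMDiffAt rfl
  have h2 : ContDiffAt ℝ ∞ (fun z => fderiv ℝ (fun w => g (e.symm z, w)) w) (e q) :=
    ContDiffAt.fderiv (m := ∞) (n := ∞) (f := fun z w => g (e.symm z, w)) h1 contDiffAt_const
      (by simp)
  refine (h2.contMDiffAt.comp q (contMDiffAt_extChartAt_of_mem (F := E) hq)).congr_of_eventuallyEq ?_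
  filter_upwards [extChartAt_source_mem_nhds (I := 𝓘(ℝ, E)) q] with y hy
  simp only [Function.comp, e, (extChartAt 𝓘(ℝ, E) q).left_inv hy]

end Charts

/-! ### Implicit functions and parametrized fibres of a map with a section -/

section Implicit

variable {A B C : Type*} [NormedAddCommGroup A] [NormedSpace ℝ A] [CompleteSpace A]
  [NormedAddCommGroup B] [NormedSpace ℝ B] [CompleteSpace B]
  [NormedAddCommGroup C] [NormedSpace ℝ C] [CompleteSpace C]

/-- The implicit function theorem, with smoothness in a neighbourhood. -/
theorem exists_smooth_implicit {Φ : A × B → C} {u : A × B}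
    (hΦ : ∀ᶠ q in 𝓝 u, ContDiffAt ℝ ∞ Φ q)
    (hinv : (fderiv ℝ Φ u ∘L .inr ℝ A B).IsInvertible) :
    ∃ ψ : A → B, (∀ᶠ a in 𝓝 u.1, ContDiffAt ℝ ∞ ψ a) ∧ (∀ᶠ a in 𝓝 u.1, Φ (a, ψ a) = Φ u) ∧
      ∀ᶠ v in 𝓝 u, Φ v = Φ u ↔ ψ v.1 = v.2 := by
  have h0 := hΦ.self_of_nhds
  have hn : (∞ : WithTop ℕ∞) ≠ 0 := by simp
  set ψ := h0.implicitFunction hn hinv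
  have hψu : ψ u.1 = u.2 := h0.implicitFunction_apply_self hn hinv
  have hψ0 : ContDiffAt ℝ ∞ ψ u.1 := h0.contDiffAt_implicitFunction hn hinv
  have hψe := h0.eventually_apply_implicitFunction hn hinv
  have hψi := h0.eventually_apply_eq_iff_implicitFunction hn hinv
  refine ⟨ψ, ?_, hψe, hψi⟩
  have hcont : ∀ᶠ a in 𝓝 u.1, ContinuousAt ψ a :=
    (eventually_differentiableAt hψ0).mono fun a ha => ha.continuousAt
  have hinv' : ∀ᶠ q in 𝓝 u, (fderiv ℝ Φ q ∘L .inr ℝ A B).IsInvertible := by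
    have hc : ContinuousAt (fun q => fderiv ℝ Φ q ∘L .inr ℝ A B) u :=
      ((h0.fderiv_right (m := 1) (by norm_cast)).continuousAt).clm_comp continuousAt_const
    obtain ⟨T, hT⟩ := hinv
    exact hc.preimage_mem_nhds (hT ▸ ContinuousLinearEquiv.nhds T)
  have hg : Tendsto (fun a => (a, ψ a)) (𝓝 u.1) (𝓝 u) := by
    have : ContinuousAt (fun a => (a, ψ a)) u.1 := continuousAt_id.prodMk hψ0.continuousAt
    simpa only [ContinuousAt, hψu] using this
  filter_upwards [hcont, hg.eventually hΦ, hg.eventually hinv', hψe.eventually_nhds,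
    hψe] with a ha1 ha2 ha3 ha4 ha5
  -- Smoothness of order `∞` at one point does not spread to a neighbourhood. The implicit function
  -- theorem is therefore applied anew at `(a, ψ a)`, and its solution agrees with `ψ` near `a` by
  -- uniqueness.
  have hi := ha2.eventually_apply_eq_iff_implicitFunction hn ha3
  have hg' : Tendsto (fun b => (b, ψ b)) (𝓝 a) (𝓝 (a, ψ a)) := continuousAt_id.prodMk ha1
  refine (ha2.contDiffAt_implicitFunction hn ha3).congr_of_eventuallyEq ?_
  filter_upwards [hg'.eventually hi, ha4] with b hb1 hb2
  exact (hb1.1 (hb2.trans ha5.symm)).symm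

/-- A local retraction-like family of curves: for a smooth map `s` with local section `u`, a smooth
map `Z` with `s (Z (y, w)) = y`, `Z (y, 0) = u y` and `∂_w Z = id` on the kernel of `ds`. -/
theorem exists_slide_map {s : B → A} {u : A → B} {z₀ : A}
    (hu : ∀ᶠ z in 𝓝 z₀, ContDiffAt ℝ ∞ u z) (hs : ∀ᶠ q in 𝓝 (u z₀), ContDiffAt ℝ ∞ s q)
    (hsu : ∀ᶠ z in 𝓝 z₀, s (u z) = z) :
    ∃ Z : A × B → B, (∀ᶠ q in 𝓝 (z₀, (0 : B)), ContDiffAt ℝ ∞ Z q) ∧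
      (∀ᶠ q in 𝓝 (z₀, (0 : B)), s (Z q) = q.1) ∧ (∀ᶠ q in 𝓝 (z₀, (0 : B)),
        ∀ v, fderiv ℝ s (Z q) v = 0 → fderiv ℝ Z q (0, v) = v) ∧
      ∀ᶠ z in 𝓝 z₀, Z (z, 0) = u z := by
  have hu0 := hu.self_of_nhds
  have hs0 := hs.self_of_nhds
  set R : A →L[ℝ] B := fderiv ℝ u z₀
  have hsR : (fderiv ℝ s (u z₀)).comp R = ContinuousLinearMap.id ℝ A := by
    have h : HasFDerivAt (fun z => s (u z)) ((fderiv ℝ s (u z₀)).comp R) z₀ :=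
      (hs0.differentiableAt (by simp)).hasFDerivAt.comp z₀
        (hu0.differentiableAt (by simp)).hasFDerivAt
    rw [← h.fderiv, Filter.EventuallyEq.fderiv_eq hsu]
    exact fderiv_id
  -- The section is moved by `w` and corrected by `R e`, where the image of `R = du` is a complement
  -- of `ker ds`; `e` is determined by the requirement that the point lie in the fibre over `y`.
  -- This is solvable because the partial derivative of `Φ` in `e` at the base point is `ds ∘ du =
  -- id`.
  set Φ : (A × B) × A → A := fun q => s (u q.1.1 + q.1.2 + R q.2) - q.1.1 with hΦ
  set p : (A × B) × A := ((z₀, 0), 0) with hp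
  have hpin : Tendsto (fun q : (A × B) × A => u q.1.1 + q.1.2 + R q.2) (𝓝 p) (𝓝 (u z₀)) := by
    have : ContinuousAt (fun q : (A × B) × A => u q.1.1 + q.1.2 + R q.2) p := by
      refine ContinuousAt.add (ContinuousAt.add ?_ (by fun_prop)) (by fun_prop)
      exact ContinuousAt.comp (x := p) (g := u) hu0.continuousAt (by fun_prop)
    simpa [ContinuousAt, hp] using this
  have hfst : Tendsto (fun q : (A × B) × A => q.1.1) (𝓝 p) (𝓝 z₀) := by
    have : ContinuousAt (fun q : (A × B) × A => q.1.1) p := by fun_prop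
    simpa [ContinuousAt, hp] using this
  have hin : ∀ q : (A × B) × A, ContDiffAt ℝ ∞ u q.1.1 →
      ContDiffAt ℝ ∞ (fun q : (A × B) × A => u q.1.1 + q.1.2 + R q.2) q := by
    intro q hq
    refine ContDiffAt.add (ContDiffAt.add ?_ (by fun_prop)) (by fun_prop)
    exact ContDiffAt.comp q (g := u) hq (by fun_prop)
  have hΦs : ∀ᶠ q in 𝓝 p, ContDiffAt ℝ ∞ Φ q := by
    filter_upwards [hpin.eventually hs, hfst.eventually hu] with q h1 h2
    exact (ContDiffAt.comp q (g := s) h1 (hin q h2)).sub (by fun_prop)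
  have hinv : (fderiv ℝ Φ p ∘L .inr ℝ (A × B) A) = ContinuousLinearMap.id ℝ A := by
    have h1 : HasFDerivAt (fun e : A => Φ ((z₀, 0), e)) (fderiv ℝ Φ p ∘L .inr ℝ (A × B) A) 0 :=
      HasFDerivAt.comp (0 : A) (g := Φ) (hΦs.self_of_nhds.differentiableAt (by simp)).hasFDerivAt
        (hasFDerivAt_prodMk_right ((z₀, 0) : A × B) (0 : A))
    have h2 : HasFDerivAt (fun e : A => s (u z₀ + 0 + R e) - z₀) ((fderiv ℝ s (u z₀)).comp R) 0 := by
      refine HasFDerivAt.sub_const _ ?_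
      refine HasFDerivAt.comp (0 : A) (g := s) (f := fun e => u z₀ + 0 + R e) ?_
        (R.hasFDerivAt.const_add _)
      simpa using (hs0.differentiableAt (by simp)).hasFDerivAt
    rw [← hsR]
    exact h1.unique h2
  obtain ⟨ψ, hψs, hψe, hψi⟩ := exists_smooth_implicit hΦs
    (hinv ▸ ⟨ContinuousLinearEquiv.refl ℝ A, rfl⟩)
  have hΦp : Φ p = 0 := by
    simp only [hΦ, hp, add_zero, map_zero, hsu.self_of_nhds, sub_self]
  have hp1 : p.1 = (z₀, (0 : B)) := rfl
  rw [hp1] at hψs hψe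
  rw [hΦp] at hψe
  set Z : A × B → B := fun q => u q.1 + q.2 + R (ψ q) with hZ
  have hfst' : Tendsto (fun q : A × B => q.1) (𝓝 (z₀, (0 : B))) (𝓝 z₀) := continuousAt_fst
  have hZs : ∀ᶠ q in 𝓝 (z₀, (0 : B)), ContDiffAt ℝ ∞ Z q := by
    filter_upwards [hψs, hfst'.eventually hu] with q h1 h2
    refine ContDiffAt.add (ContDiffAt.add ?_ (by fun_prop)) (R.contDiff.contDiffAt.comp q h1)
    exact ContDiffAt.comp q (g := u) h2 contDiffAt_fst
  have hZe : ∀ᶠ q in 𝓝 (z₀, (0 : B)), s (Z q) = q.1 := by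
    filter_upwards [hψe] with q hq
    exact sub_eq_zero.1 hq
  have hψ0 : ∀ᶠ z in 𝓝 z₀, ψ (z, 0) = 0 := by
    have hc : Tendsto (fun z : A => (((z, 0), 0) : (A × B) × A)) (𝓝 z₀) (𝓝 p) := by
      have : Continuous (fun z : A => (((z, 0), 0) : (A × B) × A)) := by fun_prop
      exact this.tendsto z₀
    filter_upwards [hc.eventually hψi, hsu] with z hz h1
    refine hz.1 ?_
    rw [hΦp]
    simp [hΦ, h1]
  have hZ0 : ∀ᶠ z in 𝓝 z₀, Z (z, 0) = u z := by
    filter_upwards [hψ0] with z hz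
    simp [hZ, hz]
  refine ⟨Z, hZs, hZe, ?_, hZ0⟩
  have hZt : Tendsto Z (𝓝 (z₀, (0 : B))) (𝓝 (u z₀)) := by
    simpa [ContinuousAt, hZ0.self_of_nhds] using hZs.self_of_nhds.continuousAt
  -- The map `ds ∘ R` remains injective near `u z₀`. For `v` in `ker ds`, the correction `R (Dψ (0,
  -- v))` is killed by `ds` as well, since `Z` stays in the fibre; hence it is zero.
  have hinj : ∀ᶠ q in 𝓝 (u z₀), Function.Injective ((fderiv ℝ s q).comp R) := by
    have hc : ContinuousAt (fun q => (fderiv ℝ s q).comp R) (u z₀) :=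
      ((hs0.fderiv_right (m := 1) (by norm_cast)).continuousAt).clm_comp continuousAt_const
    have hn : range ((↑) : (A ≃L[ℝ] A) → A →L[ℝ] A) ∈ 𝓝 ((fderiv ℝ s (u z₀)).comp R) := by
      rw [hsR]
      exact ContinuousLinearEquiv.nhds (ContinuousLinearEquiv.refl ℝ A)
    filter_upwards [hc.preimage_mem_nhds hn] with q hq
    obtain ⟨T, hT⟩ : ∃ T : A ≃L[ℝ] A, (T : A →L[ℝ] A) = (fderiv ℝ s q).comp R := hq
    rw [← hT]
    exact T.injective
  filter_upwards [hZt.eventually hinj, hZt.eventually hs, hZs, hψs, hfst'.eventually hu,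
    hZe.eventually_nhds] with q h1 h2 h3 h4 h5 h6 v hv
  have hd : fderiv ℝ Z q (0, v) = v + R (fderiv ℝ ψ q (0, v)) := by
    have hq : HasFDerivAt Z _ q := HasFDerivAt.add (HasFDerivAt.add
      (HasFDerivAt.comp q (g := u) (h5.differentiableAt (by simp)).hasFDerivAt hasFDerivAt_fst)
      hasFDerivAt_snd) (R.hasFDerivAt.comp q (h4.differentiableAt (by simp)).hasFDerivAt)
    rw [hq.fderiv]
    simp
  have hsd : fderiv ℝ s (Z q) (fderiv ℝ Z q (0, v)) = 0 := by
    have hq : HasFDerivAt (fun q => s (Z q)) ((fderiv ℝ s (Z q)).comp (fderiv ℝ Z q)) q :=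
      (h2.differentiableAt (by simp)).hasFDerivAt.comp q
        (h3.differentiableAt (by simp)).hasFDerivAt
    have := (Filter.EventuallyEq.fderiv_eq h6).symm.trans hq.fderiv
    rw [fderiv_fst] at this
    exact (congrArg (fun L : A × B →L[ℝ] A => L (0, v)) this).symm
  rw [hd, map_add, hv, zero_add] at hsd
  have := h1 (a₁ := fderiv ℝ ψ q (0, v)) (a₂ := 0) (by simpa using hsd)
  rw [hd, this, map_zero, add_zero]

end Implicit

end LieGroupoid

namespace LieGroupoid

/-! ### Slides: parametrized source fibres near the identities -/

section SlideSection

variable {E F M G : Type*}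
  [NormedAddCommGroup E] [NormedSpace ℝ E] [NormedAddCommGroup F] [NormedSpace ℝ F]
  [TopologicalSpace M] [ChartedSpace E M] [TopologicalSpace G] [ChartedSpace F G]

/-- The source map in the preferred charts at `unit x₀` and `x₀`. -/
def srcC (𝒢 : LieGroupoid E F M G) (x₀ : M) : F → E := inCharts F E (𝒢.unit x₀) x₀ 𝒢.src

/-- The target map in the preferred charts at `unit x₀` and `x₀`. -/
def tgtC (𝒢 : LieGroupoid E F M G) (x₀ : M) : F → E := inCharts F E (𝒢.unit x₀) x₀ 𝒢.tgt

/-- The inclusion of the identities in the preferred charts at `x₀` and `unit x₀`. -/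
def unitC (𝒢 : LieGroupoid E F M G) (x₀ : M) : E → F := inCharts E F x₀ (𝒢.unit x₀) 𝒢.unit

/-- A smooth family, near `x₀`, of parametrized pieces of the source fibres through the
identities, in the preferred charts. -/
structure Slide (𝒢 : LieGroupoid E F M G) (x₀ : M) where
  toFun : E × F → F
  dom : Set (E × F)
  isOpen_dom : IsOpen dom
  mem_dom : (extChartAt 𝓘(ℝ, E) x₀ x₀, 0) ∈ dom
  smooth : ∀ q ∈ dom, ContDiffAt ℝ ∞ toFun q
  mem_target : ∀ q ∈ dom, toFun q ∈ (extChartAt 𝓘(ℝ, F) (𝒢.unit x₀)).target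
  src_eq : ∀ q ∈ dom, 𝒢.src ((extChartAt 𝓘(ℝ, F) (𝒢.unit x₀)).symm (toFun q))
    = (extChartAt 𝓘(ℝ, E) x₀).symm q.1
  zero_eq : ∀ z, (z, 0) ∈ dom → toFun (z, 0) = 𝒢.unitC x₀ z
  unit_mem : ∀ z, (z, 0) ∈ dom →
    𝒢.unit ((extChartAt 𝓘(ℝ, E) x₀).symm z) ∈ (extChartAt 𝓘(ℝ, F) (𝒢.unit x₀)).source
  deriv_eq : ∀ q ∈ dom, ∀ v, fderiv ℝ (𝒢.srcC x₀) (toFun q) v = 0 → fderiv ℝ toFun q (0, v) = v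

variable [IsManifold 𝓘(ℝ, E) ∞ M] [IsManifold 𝓘(ℝ, F) ∞ G]

theorem eventually_mem_chart_symm (𝒢 : LieGroupoid E F M G) (x₀ : M) :
    ∀ᶠ z in 𝓝 (extChartAt 𝓘(ℝ, E) x₀ x₀), z ∈ (extChartAt 𝓘(ℝ, E) x₀).target ∧
      𝒢.unit ((extChartAt 𝓘(ℝ, E) x₀).symm z) ∈ (extChartAt 𝓘(ℝ, F) (𝒢.unit x₀)).source := by
  refine Filter.Eventually.and (extChartAt_target_mem_nhds (I := 𝓘(ℝ, E)) x₀) ?_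
  have hc : Tendsto (extChartAt 𝓘(ℝ, E) x₀).symm (𝓝 (extChartAt 𝓘(ℝ, E) x₀ x₀)) (𝓝 x₀) := by
    have := continuousAt_extChartAt_symm (I := 𝓘(ℝ, E)) x₀
    rwa [ContinuousAt, extChartAt_to_inv] at this
  filter_upwards [hc.eventually (eventually_mem_chart 𝒢 x₀)] with z hz
  rw [extChartAt_source]
  exact hz.2

theorem contDiffAt_unitC (𝒢 : LieGroupoid E F M G) (x₀ : M) {z : E}
    (hz : z ∈ (extChartAt 𝓘(ℝ, E) x₀).target)
    (hu : 𝒢.unit ((extChartAt 𝓘(ℝ, E) x₀).symm z) ∈ (extChartAt 𝓘(ℝ, F) (𝒢.unit x₀)).source) :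
    ContDiffAt ℝ ∞ (𝒢.unitC x₀) z := by
  have := contDiffAt_inCharts x₀ (𝒢.unit x₀) (𝒢.smooth_unit.contMDiffAt)
    ((extChartAt 𝓘(ℝ, E) x₀).map_target hz) hu
  rwa [(extChartAt 𝓘(ℝ, E) x₀).right_inv hz] at this

theorem contDiffAt_srcC (𝒢 : LieGroupoid E F M G) (x₀ : M) {X : F}
    (hX : X ∈ (extChartAt 𝓘(ℝ, F) (𝒢.unit x₀)).target)
    (hs : 𝒢.src ((extChartAt 𝓘(ℝ, F) (𝒢.unit x₀)).symm X) ∈ (extChartAt 𝓘(ℝ, E) x₀).source) :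
    ContDiffAt ℝ ∞ (𝒢.srcC x₀) X := by
  have := contDiffAt_inCharts (𝒢.unit x₀) x₀ (𝒢.smooth_src.contMDiffAt)
    ((extChartAt 𝓘(ℝ, F) (𝒢.unit x₀)).map_target hX) hs
  rwa [(extChartAt 𝓘(ℝ, F) (𝒢.unit x₀)).right_inv hX] at this

theorem contDiffAt_tgtC (𝒢 : LieGroupoid E F M G) (x₀ : M) {X : F}
    (hX : X ∈ (extChartAt 𝓘(ℝ, F) (𝒢.unit x₀)).target)
    (hs : 𝒢.tgt ((extChartAt 𝓘(ℝ, F) (𝒢.unit x₀)).symm X) ∈ (extChartAt 𝓘(ℝ, E) x₀).source) :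
    ContDiffAt ℝ ∞ (𝒢.tgtC x₀) X := by
  have := contDiffAt_inCharts (𝒢.unit x₀) x₀ (𝒢.smooth_tgt.contMDiffAt)
    ((extChartAt 𝓘(ℝ, F) (𝒢.unit x₀)).map_target hX) hs
  rwa [(extChartAt 𝓘(ℝ, F) (𝒢.unit x₀)).right_inv hX] at this

theorem eventually_mem_chart_symm_src_tgt (𝒢 : LieGroupoid E F M G) (x₀ : M) :
    ∀ᶠ X in 𝓝 (extChartAt 𝓘(ℝ, F) (𝒢.unit x₀) (𝒢.unit x₀)),
      X ∈ (extChartAt 𝓘(ℝ, F) (𝒢.unit x₀)).target ∧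
      𝒢.src ((extChartAt 𝓘(ℝ, F) (𝒢.unit x₀)).symm X) ∈ (extChartAt 𝓘(ℝ, E) x₀).source ∧
      𝒢.tgt ((extChartAt 𝓘(ℝ, F) (𝒢.unit x₀)).symm X) ∈ (extChartAt 𝓘(ℝ, E) x₀).source := by
  have hc : Tendsto (extChartAt 𝓘(ℝ, F) (𝒢.unit x₀)).symm
      (𝓝 (extChartAt 𝓘(ℝ, F) (𝒢.unit x₀) (𝒢.unit x₀))) (𝓝 (𝒢.unit x₀)) := by
    have := continuousAt_extChartAt_symm (I := 𝓘(ℝ, F)) (𝒢.unit x₀)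
    rwa [ContinuousAt, extChartAt_to_inv] at this
  have hs : Tendsto 𝒢.src (𝓝 (𝒢.unit x₀)) (𝓝 x₀) := by
    simpa [ContinuousAt, 𝒢.src_unit] using (𝒢.smooth_src.continuous.continuousAt (x := 𝒢.unit x₀))
  have ht : Tendsto 𝒢.tgt (𝓝 (𝒢.unit x₀)) (𝓝 x₀) := by
    simpa [ContinuousAt, 𝒢.tgt_unit] using (𝒢.smooth_tgt.continuous.continuousAt (x := 𝒢.unit x₀))
  exact Filter.Eventually.and (extChartAt_target_mem_nhds (I := 𝓘(ℝ, F)) (𝒢.unit x₀))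
    (((hs.comp hc).eventually (extChartAt_source_mem_nhds (I := 𝓘(ℝ, E)) x₀)).and
      ((ht.comp hc).eventually (extChartAt_source_mem_nhds (I := 𝓘(ℝ, E)) x₀)))

theorem unitC_apply_self (𝒢 : LieGroupoid E F M G) (x₀ : M) :
    𝒢.unitC x₀ (extChartAt 𝓘(ℝ, E) x₀ x₀) = extChartAt 𝓘(ℝ, F) (𝒢.unit x₀) (𝒢.unit x₀) := by
  unfold unitC inCharts
  rw [extChartAt_to_inv]

/-- This is `exists_slide_map` for the source map and its section `unit` in charts. All conditions
hold near `(x₀, 0)`, hence on one open set, where they can be used pointwise. -/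
theorem exists_slide [CompleteSpace E] [CompleteSpace F] (𝒢 : LieGroupoid E F M G) (x₀ : M) :
    Nonempty (Slide 𝒢 x₀) := by
  set e := extChartAt 𝓘(ℝ, E) x₀ with he
  set φ := extChartAt 𝓘(ℝ, F) (𝒢.unit x₀) with hφ
  have hu : ∀ᶠ z in 𝓝 (e x₀), ContDiffAt ℝ ∞ (𝒢.unitC x₀) z :=
    (eventually_mem_chart_symm 𝒢 x₀).mono fun z hz => contDiffAt_unitC 𝒢 x₀ hz.1 hz.2
  have hs : ∀ᶠ X in 𝓝 (𝒢.unitC x₀ (e x₀)), ContDiffAt ℝ ∞ (𝒢.srcC x₀) X := by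
    rw [he, unitC_apply_self]
    exact (eventually_mem_chart_symm_src_tgt 𝒢 x₀).mono fun z hz =>
      contDiffAt_srcC 𝒢 x₀ hz.1 hz.2.1
  have hsu : ∀ᶠ z in 𝓝 (e x₀), 𝒢.srcC x₀ (𝒢.unitC x₀ z) = z := by
    filter_upwards [eventually_mem_chart_symm 𝒢 x₀] with z hz
    unfold srcC unitC inCharts
    rw [(extChartAt 𝓘(ℝ, F) (𝒢.unit x₀)).left_inv hz.2, 𝒢.src_unit,
      (extChartAt 𝓘(ℝ, E) x₀).right_inv hz.1]
  obtain ⟨Z, hZs, hZe, hZd, hZ0⟩ := exists_slide_map hu hs hsu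
  have hfst : Tendsto (fun q : E × F => q.1) (𝓝 (e x₀, (0 : F))) (𝓝 (e x₀)) := continuousAt_fst
  have hZt : Tendsto Z (𝓝 (e x₀, (0 : F))) (𝓝 (φ (𝒢.unit x₀))) := by
    have := hZs.self_of_nhds.continuousAt
    rwa [ContinuousAt, hZ0.self_of_nhds, he, unitC_apply_self] at this
  have hall := (hZs.and (hZe.and (hZd.and ((hfst.eventually hZ0).and
    ((hfst.eventually (eventually_mem_chart_symm 𝒢 x₀)).and
      (hZt.eventually (eventually_mem_chart_symm_src_tgt 𝒢 x₀)))))))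
  obtain ⟨Ω, hΩ, hΩo, hΩm⟩ := eventually_nhds_iff.1 hall
  refine ⟨⟨Z, Ω, hΩo, hΩm, fun q hq => (hΩ q hq).1,
    fun q hq => (hΩ q hq).2.2.2.2.2.1, fun q hq => ?_, fun z hz => (hΩ _ hz).2.2.2.1,
    fun z hz => (hΩ _ hz).2.2.2.2.1.2, fun q hq => (hΩ q hq).2.2.1⟩⟩
  have h := congrArg e.symm (hΩ q hq).2.1
  unfold srcC inCharts at h
  rwa [e.left_inv (hΩ q hq).2.2.2.2.2.2.1] at h

namespace Slide

variable {𝒢 : LieGroupoid E F M G} {x₀ : M} (S : Slide 𝒢 x₀)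

/-- The element of the source fibre of `y` with parameter `w`. -/
def el (y : M) (w : F) : G :=
  (extChartAt 𝓘(ℝ, F) (𝒢.unit x₀)).symm (S.toFun (extChartAt 𝓘(ℝ, E) x₀ y, w))

/-- The points `(y, w)` at which the family is well behaved. -/
def good : Set (M × F) :=
  {p | p.1 ∈ (extChartAt 𝓘(ℝ, E) x₀).source ∧ (extChartAt 𝓘(ℝ, E) x₀ p.1, p.2) ∈ S.dom}

theorem mem_good_self : (x₀, (0 : F)) ∈ S.good := ⟨mem_extChartAt_source x₀, S.mem_dom⟩

theorem good_mem_nhds {p : M × F} (hp : p ∈ S.good) : S.good ∈ 𝓝 p := by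
  have h1 : ContinuousAt (fun p : M × F => (extChartAt 𝓘(ℝ, E) x₀ p.1, p.2)) p :=
    ((continuousAt_extChartAt' hp.1).comp continuousAt_fst).prodMk continuousAt_snd
  exact Filter.inter_mem (continuousAt_fst.preimage_mem_nhds (extChartAt_source_mem_nhds' hp.1))
    (h1.preimage_mem_nhds (S.isOpen_dom.mem_nhds hp.2))

theorem el_mem_source {y : M} {w : F} (h : (y, w) ∈ S.good) :
    S.el y w ∈ (extChartAt 𝓘(ℝ, F) (𝒢.unit x₀)).source :=
  (extChartAt 𝓘(ℝ, F) (𝒢.unit x₀)).map_target (S.mem_target _ h.2)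

theorem src_el {y : M} {w : F} (h : (y, w) ∈ S.good) : 𝒢.src (S.el y w) = y :=
  (S.src_eq _ h.2).trans ((extChartAt 𝓘(ℝ, E) x₀).left_inv h.1)

theorem unit_mem_source {y : M} (h : (y, (0 : F)) ∈ S.good) :
    𝒢.unit y ∈ (extChartAt 𝓘(ℝ, F) (𝒢.unit x₀)).source := by
  have := S.unit_mem _ h.2
  rwa [(extChartAt 𝓘(ℝ, E) x₀).left_inv h.1] at this

theorem el_zero {y : M} (h : (y, (0 : F)) ∈ S.good) : S.el y 0 = 𝒢.unit y := by
  unfold el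
  rw [S.zero_eq _ h.2]
  unfold unitC inCharts
  rw [(extChartAt 𝓘(ℝ, E) x₀).left_inv h.1, (extChartAt 𝓘(ℝ, F) (𝒢.unit x₀)).left_inv
    (S.unit_mem_source h)]

theorem contMDiffAt_el {p : M × F} (h : p ∈ S.good) :
    ContMDiffAt (𝓘(ℝ, E).prod 𝓘(ℝ, F)) 𝓘(ℝ, F) ∞ (fun p : M × F => S.el p.1 p.2) p := by
  refine ContMDiffAt.comp p (contMDiffAt_extChartAt_symm_of_mem (S.mem_target _ h.2)) ?_
  refine ContMDiffAt.comp p (f := fun p : M × F => (extChartAt 𝓘(ℝ, E) x₀ p.1, p.2))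
    (g := S.toFun) (S.smooth _ h.2).contMDiffAt ?_
  exact ((contMDiffAt_extChartAt_of_mem h.1).comp p contMDiffAt_fst).prodMk_space contMDiffAt_snd

theorem contMDiffAt_el_right {y : M} {w : F} (h : (y, w) ∈ S.good) :
    ContMDiffAt 𝓘(ℝ, F) 𝓘(ℝ, F) ∞ (S.el y) w :=
  ContMDiffAt.comp w (S.contMDiffAt_el h) (f := fun w => (y, w))
    (contMDiffAt_const.prodMk contMDiffAt_id)

theorem eventually_good_right {y : M} {w : F} (h : (y, w) ∈ S.good) :
    ∀ᶠ w' in 𝓝 w, (y, w') ∈ S.good :=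
  (Continuous.prodMk_right y).continuousAt.preimage_mem_nhds (S.good_mem_nhds h)

/-- Since `∂_w` of a slide is the identity on `ker src_*`, a vertical vector is the velocity of `el
y` in the direction of its own chart components. Derivatives within a source fibre can thus be
computed along the free parameter `w`. -/
theorem mfderiv_el {y : M} {w : F} (h : (y, w) ∈ S.good)
    {v : TangentSpace 𝓘(ℝ, F) (S.el y w)}
    (hv : mfderiv 𝓘(ℝ, F) 𝓘(ℝ, E) 𝒢.src (S.el y w) v = 0) :
    mfderiv 𝓘(ℝ, F) 𝓘(ℝ, F) (S.el y) w (chartVec (F := F) (𝒢.unit x₀) (S.el y w) v) = v := by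
  set φ := extChartAt 𝓘(ℝ, F) (𝒢.unit x₀) with hφ
  set q : E × F := (extChartAt 𝓘(ℝ, E) x₀ y, w) with hq
  have hmem := S.el_mem_source h
  set ζ : F := chartVec (F := F) (𝒢.unit x₀) (S.el y w) v with hζ
  refine chartVec_injective hmem ?_
  have hd : MDifferentiableAt 𝓘(ℝ, F) 𝓘(ℝ, F) (S.el y) w :=
    (S.contMDiffAt_el_right h).mdifferentiableAt (by simp)
  have h1 := chartVec_mfderiv (𝒢.unit x₀) hd hmem ζ
  have hsymm : φ (S.el y w) = S.toFun q := φ.right_inv (S.mem_target _ h.2)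
  refine h1.trans ?_
  have h2 := congrArg (fun L : F →L[ℝ] F => L ζ)
    (mfderiv_eq_fderiv (f := fun w => φ (S.el y w)) (x := w))
  refine h2.trans ?_
  have he : (fun w => φ (S.el y w)) =ᶠ[𝓝 w] fun w => S.toFun (q.1, w) := by
    filter_upwards [S.eventually_good_right h] with w' hw'
    exact φ.right_inv (S.mem_target _ hw'.2)
  change fderiv ℝ (fun w => φ (S.el y w)) w _ = _
  rw [he.fderiv_eq]
  have h3 := fderiv_partial_right (g := S.toFun) (p := q)
    ((S.smooth _ h.2).differentiableAt (by simp)) ζ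
  refine h3.trans (S.deriv_eq _ h.2 _ ?_)
  have h4 := chartVec_mfderiv_eq_fderiv (𝒢.unit x₀) x₀
    (𝒢.smooth_src.contMDiffAt.mdifferentiableAt (by simp)) hmem
    (by rw [S.src_el h]; exact h.1) v
  rw [hv, chartVec_zero, ← hφ, hsymm] at h4
  exact h4.symm

end Slide

/-! ### The right action on curves -/

variable {V : Type*} [NormedAddCommGroup V] [NormedSpace ℝ V]

theorem mdifferentiableWithinAt_mul_right (𝒢 : LieGroupoid E F M G) {X Y : G}
    (h : 𝒢.src X = 𝒢.tgt Y) :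
    MDifferentiableWithinAt 𝓘(ℝ, F) 𝓘(ℝ, F) (fun Z => 𝒢.mul Z Y) (𝒢.src ⁻¹' {𝒢.tgt Y}) X := by
  have h1 : ContMDiffWithinAt 𝓘(ℝ, F) 𝓘(ℝ, F) ∞ (fun Z => 𝒢.mul Z Y) (𝒢.src ⁻¹' {𝒢.tgt Y}) X :=
    ContMDiffWithinAt.comp X (𝒢.smooth_mul (X, Y) h) (f := fun Z => (Z, Y))
      ((contMDiffAt_id.prodMk contMDiffAt_const).contMDiffWithinAt) (fun Z hZ => hZ)
  exact h1.mdifferentiableWithinAt (by simp)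

/-- The right action on the velocities of curves in a source fibre. -/
theorem act_mfderiv (𝒢 : LieGroupoid E F M G) {c : V → G} {w : V} {Y : G}
    (hc : MDifferentiableAt 𝓘(ℝ, V) 𝓘(ℝ, F) c w) (hs : ∀ᶠ w' in 𝓝 w, 𝒢.src (c w') = 𝒢.tgt Y)
    (v : V) :
    𝒢.act (c w) Y (mfderiv 𝓘(ℝ, V) 𝓘(ℝ, F) c w v)
      = mfderiv 𝓘(ℝ, V) 𝓘(ℝ, F) (fun w => 𝒢.mul (c w) Y) w v := by
  have h1 := (mdifferentiableWithinAt_mul_right 𝒢 hs.self_of_nhds).hasMFDerivWithinAt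
  -- The curve stays in the fibre near `w`, so the derivative within the fibre composes to an
  -- ordinary derivative.
  have h2 := (h1.comp w (hc.hasMFDerivAt.hasMFDerivWithinAt
    (s := {w' | 𝒢.src (c w') = 𝒢.tgt Y})) (fun w' hw' => hw')).hasMFDerivAt hs
  exact (congrArg (fun L : V →L[ℝ] F => L v) h2.mfderiv).symm

end SlideSection

end LieGroupoid

namespace LieGroupoid

/-! ### Right translation of vertical vectors as an operator on chart components -/

section RightOp

variable {E F M G : Type*}
  [NormedAddCommGroup E] [NormedSpace ℝ E] [NormedAddCommGroup F] [NormedSpace ℝ F]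
  [TopologicalSpace M] [ChartedSpace E M] [TopologicalSpace G] [ChartedSpace F G]
  [IsManifold 𝓘(ℝ, E) ∞ M] [IsManifold 𝓘(ℝ, F) ∞ G]

namespace Slide

variable {𝒢 : LieGroupoid E F M G} {x₀ : M} (S : Slide 𝒢 x₀)

/-- The left translate of `X` by the element of the source fibre of `tgt X` with parameter `w`. -/
def move (X : G) (w : F) : G := 𝒢.mul (S.el (𝒢.tgt X) w) X

theorem move_zero {X : G} (h : (𝒢.tgt X, (0 : F)) ∈ S.good) : S.move X 0 = X := by
  rw [move, S.el_zero h, 𝒢.unit_mul]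

theorem src_move {X : G} {w : F} (h : (𝒢.tgt X, w) ∈ S.good) : 𝒢.src (S.move X w) = 𝒢.src X :=
  𝒢.src_mul _ _ (S.src_el h)

theorem tgt_move {X : G} {w : F} (h : (𝒢.tgt X, w) ∈ S.good) :
    𝒢.tgt (S.move X w) = 𝒢.tgt (S.el (𝒢.tgt X) w) :=
  𝒢.tgt_mul _ _ (S.src_el h)

theorem contMDiffAt_move {X : G} {w : F} (h : (𝒢.tgt X, w) ∈ S.good) :
    ContMDiffAt (𝓘(ℝ, F).prod 𝓘(ℝ, F)) 𝓘(ℝ, F) ∞ (fun p : G × F => S.move p.1 p.2) (X, w) := by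
  have ht : ContMDiffAt (𝓘(ℝ, F).prod 𝓘(ℝ, F)) (𝓘(ℝ, E).prod 𝓘(ℝ, F)) ∞
      (fun p : G × F => (𝒢.tgt p.1, p.2)) (X, w) :=
    (𝒢.smooth_tgt.contMDiffAt.comp (X, w) contMDiffAt_fst).prodMk contMDiffAt_snd
  have h1 : ContMDiffAt (𝓘(ℝ, F).prod 𝓘(ℝ, F)) (𝓘(ℝ, F).prod 𝓘(ℝ, F)) ∞
      (fun p : G × F => (S.el (𝒢.tgt p.1) p.2, p.1)) (X, w) :=
    (ContMDiffAt.comp (X, w) (g := fun p : M × F => S.el p.1 p.2)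
      (f := fun p : G × F => (𝒢.tgt p.1, p.2)) (S.contMDiffAt_el h) ht).prodMk contMDiffAt_fst
  have hn : {p : G × F | (𝒢.tgt p.1, p.2) ∈ S.good} ∈ 𝓝 (X, w) :=
    ht.continuousAt.preimage_mem_nhds (S.good_mem_nhds h)
  -- The product is smooth only along composable pairs; the pairs `(el (tgt X) w, X)` are composable
  -- on a neighbourhood, which is enough.
  have h2 : ContMDiffWithinAt (𝓘(ℝ, F).prod 𝓘(ℝ, F)) 𝓘(ℝ, F) ∞
      (fun p : G × F => S.move p.1 p.2) {p : G × F | (𝒢.tgt p.1, p.2) ∈ S.good} (X, w) :=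
    ContMDiffWithinAt.comp (X, w) (f := fun p : G × F => (S.el (𝒢.tgt p.1) p.2, p.1))
      (𝒢.smooth_mul (S.el (𝒢.tgt X) w, X) (S.src_el h)) h1.contMDiffWithinAt
      fun p hp => S.src_el hp
  exact h2.contMDiffAt hn

theorem contMDiffAt_move_right {X : G} {w : F} (h : (𝒢.tgt X, w) ∈ S.good) :
    ContMDiffAt 𝓘(ℝ, F) 𝓘(ℝ, F) ∞ (S.move X) w :=
  ContMDiffAt.comp w (S.contMDiffAt_move h) (f := fun w => (X, w))
    (contMDiffAt_const.prodMk contMDiffAt_id)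

/-- The components, in the chart at `p`, of the right translate to `X` of a vertical vector at
`unit (tgt X)`, as a function of the components of the latter. -/
def rightOp (p X : G) : F →L[ℝ] F := fderiv ℝ (fun w => extChartAt 𝓘(ℝ, F) p (S.move X w)) 0

theorem contMDiffAt_rightOp {p X : G} (h : (𝒢.tgt X, (0 : F)) ∈ S.good)
    (hX : X ∈ (extChartAt 𝓘(ℝ, F) p).source) :
    ContMDiffAt 𝓘(ℝ, F) 𝓘(ℝ, F →L[ℝ] F) ∞ (S.rightOp p) X :=
  contMDiffAt_fderiv_param (g := fun q : G × F => extChartAt 𝓘(ℝ, F) p (S.move q.1 q.2))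
    (ContMDiffAt.comp (X, (0 : F)) (contMDiffAt_extChartAt_of_mem (F := F)
      (by rwa [S.move_zero h])) (S.contMDiffAt_move h))

theorem chartVec_mfderiv_move {p X : G} {w : F} (h : (𝒢.tgt X, w) ∈ S.good)
    (hX : S.move X w ∈ (extChartAt 𝓘(ℝ, F) p).source) (v : F) :
    chartVec p (S.move X w) (mfderiv 𝓘(ℝ, F) 𝓘(ℝ, F) (S.move X) w v)
      = fderiv ℝ (fun w => extChartAt 𝓘(ℝ, F) p (S.move X w)) w v :=
  (chartVec_mfderiv p ((S.contMDiffAt_move_right h).mdifferentiableAt (by simp)) hX v).trans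
    (congrArg (fun L : F →L[ℝ] F => L v) mfderiv_eq_fderiv)

theorem mfderiv_src_mfderiv_move {X : G} {w : F} (h : (𝒢.tgt X, w) ∈ S.good) (v : F) :
    mfderiv 𝓘(ℝ, F) 𝓘(ℝ, E) 𝒢.src (S.move X w) (mfderiv 𝓘(ℝ, F) 𝓘(ℝ, F) (S.move X) w v) = 0 := by
  have h1 := mfderiv_comp_apply w (𝒢.smooth_src.contMDiffAt.mdifferentiableAt (by simp))
    ((S.contMDiffAt_move_right h).mdifferentiableAt (by simp)) v
  refine h1.symm.trans ?_
  have h2 : 𝒢.src ∘ S.move X =ᶠ[𝓝 w] fun _ => 𝒢.src X := by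
    filter_upwards [S.eventually_good_right h] with w' hw'
    exact S.src_move hw'
  have h3 := h2.mfderiv_eq (I := 𝓘(ℝ, F)) (I' := 𝓘(ℝ, E))
  rw [mfderiv_const] at h3
  exact congrArg (fun L : F →L[ℝ] E => L v) h3

/-- `act` is a derivative within a fibre. Evaluated along the curve `el (tgt X)`, it becomes the
ordinary derivative in `w` of `w ↦ el (tgt X) w · X`, which depends smoothly on `X`. -/
theorem rightInvariant_eq {X : G} (h : (𝒢.tgt X, (0 : F)) ∈ S.good)
    {θ : Π y : M, TangentSpace 𝓘(ℝ, F) (𝒢.unit y)}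
    (hθ : mfderiv 𝓘(ℝ, F) 𝓘(ℝ, E) 𝒢.src (𝒢.unit (𝒢.tgt X)) (θ (𝒢.tgt X)) = 0) :
    (𝒢.rightInvariant θ X : F) = mfderiv 𝓘(ℝ, F) 𝓘(ℝ, F) (S.move X) 0
      (chartVec (F := F) (𝒢.unit x₀) (𝒢.unit (𝒢.tgt X)) (θ (𝒢.tgt X))) := by
  have h0 := S.el_zero h
  have h1 := 𝒢.act_mfderiv (Y := X) ((S.contMDiffAt_el_right h).mdifferentiableAt (by simp))
    ((S.eventually_good_right h).mono fun w hw => S.src_el hw)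
  have h2 := fun v => S.mfderiv_el h (v := v)
  rw [h0] at h1 h2
  exact (congrArg (𝒢.act (𝒢.unit (𝒢.tgt X)) X) (h2 _ hθ)).symm.trans (h1 _)

theorem chartVec_rightInvariant {p X : G} (h : (𝒢.tgt X, (0 : F)) ∈ S.good)
    (hX : X ∈ (extChartAt 𝓘(ℝ, F) p).source)
    {θ : Π y : M, TangentSpace 𝓘(ℝ, F) (𝒢.unit y)}
    (hθ : mfderiv 𝓘(ℝ, F) 𝓘(ℝ, E) 𝒢.src (𝒢.unit (𝒢.tgt X)) (θ (𝒢.tgt X)) = 0) :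
    chartVec p X (𝒢.rightInvariant θ X) = S.rightOp p X
      (chartVec (F := F) (𝒢.unit x₀) (𝒢.unit (𝒢.tgt X)) (θ (𝒢.tgt X))) := by
  have h1 := S.rightInvariant_eq h hθ
  have h2 := S.chartVec_mfderiv_move (p := p) h (by rwa [S.move_zero h])
    (chartVec (F := F) (𝒢.unit x₀) (𝒢.unit (𝒢.tgt X)) (θ (𝒢.tgt X)))
  rw [← rightOp, S.move_zero h] at h2
  rw [← h2]
  exact congrArg (chartVec (F := F) p X) h1

theorem mfderiv_src_rightInvariant {X : G} (h : (𝒢.tgt X, (0 : F)) ∈ S.good)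
    {θ : Π y : M, TangentSpace 𝓘(ℝ, F) (𝒢.unit y)}
    (hθ : mfderiv 𝓘(ℝ, F) 𝓘(ℝ, E) 𝒢.src (𝒢.unit (𝒢.tgt X)) (θ (𝒢.tgt X)) = 0) :
    mfderiv 𝓘(ℝ, F) 𝓘(ℝ, E) 𝒢.src X (𝒢.rightInvariant θ X) = 0 := by
  have h1 := S.rightInvariant_eq h hθ
  have h2 := S.mfderiv_src_mfderiv_move h
    (chartVec (F := F) (𝒢.unit x₀) (𝒢.unit (𝒢.tgt X)) (θ (𝒢.tgt X)))
  rw [S.move_zero h] at h2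
  exact (congrArg (mfderiv 𝓘(ℝ, F) 𝓘(ℝ, E) 𝒢.src X) h1).trans h2

/-- The target of a product is that of its left factor, so `move X` and `el (tgt X)` have the same
targets. This is why a right invariant field whose horizontal part is the anchor is tangent to
`B(G)`. -/
theorem mfderiv_tgt_rightInvariant {X : G} (h : (𝒢.tgt X, (0 : F)) ∈ S.good)
    {θ : Π y : M, TangentSpace 𝓘(ℝ, F) (𝒢.unit y)}
    (hθ : mfderiv 𝓘(ℝ, F) 𝓘(ℝ, E) 𝒢.src (𝒢.unit (𝒢.tgt X)) (θ (𝒢.tgt X)) = 0) :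
    (mfderiv 𝓘(ℝ, F) 𝓘(ℝ, E) 𝒢.tgt X (𝒢.rightInvariant θ X) : E)
      = mfderiv 𝓘(ℝ, F) 𝓘(ℝ, E) 𝒢.tgt (𝒢.unit (𝒢.tgt X)) (θ (𝒢.tgt X)) := by
  set ζ : F := chartVec (F := F) (𝒢.unit x₀) (𝒢.unit (𝒢.tgt X)) (θ (𝒢.tgt X))
  have h1 := S.rightInvariant_eq h hθ
  have ht : ∀ q, MDifferentiableAt 𝓘(ℝ, F) 𝓘(ℝ, E) 𝒢.tgt q := fun q =>
    𝒢.smooth_tgt.contMDiffAt.mdifferentiableAt (by simp)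
  have h2 := mfderiv_comp_apply (0 : F) (ht _)
    ((S.contMDiffAt_move_right h).mdifferentiableAt (by simp)) ζ
  have h3 := mfderiv_comp_apply (0 : F) (ht _)
    ((S.contMDiffAt_el_right h).mdifferentiableAt (by simp)) ζ
  have h4 := fun v => S.mfderiv_el h (v := v)
  have he : 𝒢.tgt ∘ S.move X =ᶠ[𝓝 0] 𝒢.tgt ∘ S.el (𝒢.tgt X) := by
    filter_upwards [S.eventually_good_right h] with w' hw'
    exact S.tgt_move hw'
  have h5 := he.mfderiv_eq (I := 𝓘(ℝ, F)) (I' := 𝓘(ℝ, E))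
  rw [S.el_zero h] at h3 h4
  rw [S.move_zero h] at h2
  exact (congrArg (mfderiv 𝓘(ℝ, F) 𝓘(ℝ, E) 𝒢.tgt X) h1).trans (h2.symm.trans
    ((congrArg (fun L : F →L[ℝ] E => L ζ) h5).trans (h3.trans
      (congrArg (mfderiv 𝓘(ℝ, F) 𝓘(ℝ, E) 𝒢.tgt (𝒢.unit (𝒢.tgt X))) (h4 _ hθ)))))

/-- Right translation commutes with the infinitesimal left translations. -/
theorem mfderiv_move_rightOp {X : G} {w : F} (h : (𝒢.tgt X, w) ∈ S.good)
    (h' : (𝒢.tgt (S.el (𝒢.tgt X) w), (0 : F)) ∈ S.good)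
    (hX : S.move X w ∈ (extChartAt 𝓘(ℝ, F) (𝒢.unit x₀)).source) (v : F) :
    fderiv ℝ (fun w => extChartAt 𝓘(ℝ, F) (𝒢.unit x₀) (S.move X w)) w
      (S.rightOp (𝒢.unit x₀) (S.el (𝒢.tgt X) w) v) = S.rightOp (𝒢.unit x₀) (S.move X w) v := by
  set Z := S.el (𝒢.tgt X) w with hZ
  have hZm : Z ∈ (extChartAt 𝓘(ℝ, F) (𝒢.unit x₀)).source := S.el_mem_source h
  have hsrc : 𝒢.src Z = 𝒢.tgt X := S.src_el h
  have htm : 𝒢.tgt (S.move X w) = 𝒢.tgt Z := S.tgt_move h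
  have hmd := (S.contMDiffAt_move_right h').mdifferentiableAt (by simp)
  -- The translate of `μ` by `X` is computed along two curves in the source fibre with velocity `μ`
  -- at `Z`: `move Z` at the parameter `0`, and `el (tgt X)` at the parameter `w`. Associativity
  -- identifies the first translated curve with `move (move X w)`.
  set μ : F := mfderiv 𝓘(ℝ, F) 𝓘(ℝ, F) (S.move Z) 0 v with hμ
  have hμv : mfderiv 𝓘(ℝ, F) 𝓘(ℝ, E) 𝒢.src Z μ = 0 := by
    have := S.mfderiv_src_mfderiv_move h' v
    rwa [S.move_zero h'] at this
  have hμc : chartVec (F := F) (𝒢.unit x₀) Z μ = S.rightOp (𝒢.unit x₀) Z v := by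
    have := S.chartVec_mfderiv_move (p := 𝒢.unit x₀) h' (by rwa [S.move_zero h']) v
    rwa [S.move_zero h'] at this
  have ha1 := 𝒢.act_mfderiv (Y := X) hmd
    ((S.eventually_good_right h').mono fun w' hw' => (S.src_move hw').trans hsrc) v
  rw [S.move_zero h'] at ha1
  have ha2 := 𝒢.act_mfderiv (Y := X) ((S.contMDiffAt_el_right h).mdifferentiableAt (by simp))
    ((S.eventually_good_right h).mono fun w hw => S.src_el hw) (S.rightOp (𝒢.unit x₀) Z v)
  have hel := S.mfderiv_el h hμv
  rw [← hZ, hμc] at hel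
  rw [← hZ, hel] at ha2
  have hcomp : (fun w' => 𝒢.mul (S.move Z w') X) =ᶠ[𝓝 0] S.move (S.move X w) := by
    filter_upwards [S.eventually_good_right h'] with w' hw'
    rw [move, move, htm, ← 𝒢.mul_assoc _ _ _ (S.src_el hw') hsrc]
    rfl
  have hd := hcomp.mfderiv_eq (I := 𝓘(ℝ, F)) (I' := 𝓘(ℝ, F))
  have key : (mfderiv 𝓘(ℝ, F) 𝓘(ℝ, F) (S.move X) w (S.rightOp (𝒢.unit x₀) Z v) : F)
      = mfderiv 𝓘(ℝ, F) 𝓘(ℝ, F) (S.move (S.move X w)) 0 v :=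
    ha2.symm.trans (ha1.trans (congrArg (fun L : F →L[ℝ] F => L v) hd))
  have h3 := S.chartVec_mfderiv_move (p := 𝒢.unit x₀) h hX (S.rightOp (𝒢.unit x₀) Z v)
  rw [← h3]
  have h'' : (𝒢.tgt (S.move X w), (0 : F)) ∈ S.good := by rwa [htm]
  have h4 := S.chartVec_mfderiv_move (p := 𝒢.unit x₀) h'' (by rwa [S.move_zero h'']) v
  rw [S.move_zero h''] at h4
  refine Eq.trans ?_ h4
  exact congrArg (chartVec (F := F) (𝒢.unit x₀) (S.move X w)) key

end Slide

/-- The right action is functorial. -/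
theorem act_rightInvariant [CompleteSpace E] [CompleteSpace F] (𝒢 : LieGroupoid E F M G) {X Y : G}
    (h : 𝒢.src X = 𝒢.tgt Y) {θ : Π y : M, TangentSpace 𝓘(ℝ, F) (𝒢.unit y)}
    (hθ : mfderiv 𝓘(ℝ, F) 𝓘(ℝ, E) 𝒢.src (𝒢.unit (𝒢.tgt X)) (θ (𝒢.tgt X)) = 0) :
    𝒢.act X Y (𝒢.rightInvariant θ X) = 𝒢.rightInvariant θ (𝒢.mul X Y) := by
  obtain ⟨S⟩ := exists_slide 𝒢 (𝒢.tgt X)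
  have hg : (𝒢.tgt X, (0 : F)) ∈ S.good := S.mem_good_self
  have ht : 𝒢.tgt (𝒢.mul X Y) = 𝒢.tgt X := 𝒢.tgt_mul _ _ h
  set ζ : F := chartVec (F := F) (𝒢.unit (𝒢.tgt X)) (𝒢.unit (𝒢.tgt X)) (θ (𝒢.tgt X)) with hζ
  have h1 := S.rightInvariant_eq hg hθ
  have h2 := S.rightInvariant_eq (X := 𝒢.mul X Y) (by rwa [ht]) (by rwa [ht])
  have ha := 𝒢.act_mfderiv (Y := Y) ((S.contMDiffAt_move_right hg).mdifferentiableAt (by simp))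
    ((S.eventually_good_right hg).mono fun w' hw' => (S.src_move hw').trans h) ζ
  rw [S.move_zero hg] at ha
  have he : (fun w => 𝒢.mul (S.move X w) Y) =ᶠ[𝓝 0] S.move (𝒢.mul X Y) := by
    filter_upwards [S.eventually_good_right hg] with w' hw'
    rw [Slide.move, Slide.move, ht, ← 𝒢.mul_assoc _ _ _ (S.src_el hw') h]
  have hd := he.mfderiv_eq (I := 𝓘(ℝ, F)) (I' := 𝓘(ℝ, F))
  rw [ht, ← hζ] at h2
  refine Eq.trans ?_ (ha.trans ((congrArg (fun L : F →L[ℝ] F => L ζ) hd).trans h2.symm))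
  exact congrArg (𝒢.act X Y) h1

end RightOp

end LieGroupoid

namespace LieGroupoid

/-! ### Smooth dependence of Taylor polynomials on centre, coefficients and point -/

section TaylorPoly

variable {E F : Type*} [NormedAddCommGroup E] [NormedSpace ℝ E]
  [NormedAddCommGroup F] [NormedSpace ℝ F]

/-- One argument is curried off at a time, and each step is a continuous bilinear evaluation. -/
theorem contDiff_apply_diag (i : ℕ) : ContDiff ℝ ∞
    (fun p : ContinuousMultilinearMap ℝ (fun _ : Fin i => E) F × E => p.1 (fun _ => p.2)) := by
  induction i generalizing F with
  | zero =>
    have h : ∀ p : ContinuousMultilinearMap ℝ (fun _ : Fin 0 => E) F × E,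
        p.1 (fun _ => p.2) = (continuousMultilinearCurryFin0 ℝ E F) p.1 := fun p => by
      rw [continuousMultilinearCurryFin0_apply]
      exact congrArg p.1 (Subsingleton.elim _ _)
    simp only [h]
    exact (continuousMultilinearCurryFin0 ℝ E F).contDiff.comp contDiff_fst
  | succ i ih =>
    have h : ∀ p : ContinuousMultilinearMap ℝ (fun _ : Fin (i + 1) => E) F × E,
        p.1 (fun _ => p.2) =
          (continuousMultilinearCurryLeftEquiv ℝ (fun _ : Fin (i + 1) => E) F p.1 p.2)
            (fun _ => p.2) := fun p => by
      change _ = p.1.curryLeft p.2 (fun _ => p.2)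
      rw [ContinuousMultilinearMap.curryLeft_apply]
      congr 1
      funext j
      refine Fin.cases rfl (fun j => rfl) j
    simp only [h]
    exact (ih (F := F)).comp (((((continuousMultilinearCurryLeftEquiv ℝ
      (fun _ : Fin (i + 1) => E) F).contDiff).comp contDiff_fst).clm_apply contDiff_snd).prodMk
        contDiff_snd)

theorem contDiff_taylorPoly (k : ℕ) : ContDiff ℝ ∞
    (fun p : (E × TaylorSpace E F k) × E => taylorPoly p.1.1 p.1.2 p.2) := by
  unfold taylorPoly
  refine ContDiff.sum fun i _ => ContDiff.const_smul _ ?_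
  exact (contDiff_apply_diag (i : ℕ)).comp
    ((((ContinuousLinearMap.proj (R := ℝ) (φ := fun i : Fin (k + 1) =>
      ContinuousMultilinearMap ℝ (fun _ : Fin (i : ℕ) => E) F) i).contDiff).comp
        (contDiff_snd.comp contDiff_fst)).prodMk
      (contDiff_snd.sub (contDiff_fst.comp contDiff_fst)))

theorem taylorPoly_add {k : ℕ} (z₀ : E) (a b : TaylorSpace E F k) (z : E) :
    taylorPoly z₀ (a + b) z = taylorPoly z₀ a z + taylorPoly z₀ b z := by
  simp [taylorPoly, Finset.sum_add_distrib]

theorem taylorPoly_smul {k : ℕ} (z₀ : E) (c : ℝ) (a : TaylorSpace E F k) (z : E) :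
    taylorPoly z₀ (c • a) z = c • taylorPoly z₀ a z := by
  simp only [taylorPoly, Finset.smul_sum, Pi.smul_apply, smul_apply]
  exact Finset.sum_congr rfl fun i _ => smul_comm _ _ _

/-- The polynomial functions with given Taylor coefficients depend smoothly and linearly on them. -/
theorem hasFDerivAt_taylorPoly {k : ℕ} (z₀ z : E) (a : TaylorSpace E F k) :
    ∃ L : TaylorSpace E F k →L[ℝ] F, (∀ b, L b = taylorPoly z₀ b z) ∧
      HasFDerivAt (fun b : TaylorSpace E F k => taylorPoly z₀ b z) L a := by
  have hc : ContDiff ℝ ∞ (fun b : TaylorSpace E F k => taylorPoly z₀ b z) :=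
    (contDiff_taylorPoly k).comp ((contDiff_const.prodMk contDiff_id).prodMk contDiff_const)
  let L : TaylorSpace E F k →L[ℝ] F :=
    { toFun := fun b => taylorPoly z₀ b z
      map_add' := fun a b => taylorPoly_add z₀ a b z
      map_smul' := fun c a => taylorPoly_smul z₀ c a z
      cont := hc.continuous }
  exact ⟨L, fun b => rfl, L.hasFDerivAt⟩

end TaylorPoly

/-! ### Change of charts for jets and smoothness of jet coordinates -/

section Jets

variable {E F M G : Type*}
  [NormedAddCommGroup E] [NormedSpace ℝ E] [NormedAddCommGroup F] [NormedSpace ℝ F]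
  [TopologicalSpace M] [ChartedSpace E M] [TopologicalSpace G] [ChartedSpace F G]
  [IsManifold 𝓘(ℝ, E) ∞ M] [IsManifold 𝓘(ℝ, F) ∞ G]

/-- The linear map relating the components of a vertical vector at an identity in two charts. -/
def transL (𝒢 : LieGroupoid E F M G) (x₀ x₁ : M) (w : E) : F →L[ℝ] F :=
  fderiv ℝ (fun q => extChartAt 𝓘(ℝ, F) (𝒢.unit x₁)
    ((extChartAt 𝓘(ℝ, F) (𝒢.unit x₀)).symm q)) (𝒢.unitC x₀ w)

theorem contDiffAt_transL (𝒢 : LieGroupoid E F M G) {x₀ x₁ x : M}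
    (hx₀ : x ∈ (extChartAt 𝓘(ℝ, E) x₀).source)
    (hu₀ : 𝒢.unit x ∈ (extChartAt 𝓘(ℝ, F) (𝒢.unit x₀)).source)
    (hu₁ : 𝒢.unit x ∈ (extChartAt 𝓘(ℝ, F) (𝒢.unit x₁)).source) :
    ContDiffAt ℝ ∞ (𝒢.transL x₀ x₁) (extChartAt 𝓘(ℝ, E) x₀ x) := by
  have h1 : ContDiffAt ℝ ∞ (𝒢.unitC x₀) (extChartAt 𝓘(ℝ, E) x₀ x) :=
    contDiffAt_inCharts x₀ (𝒢.unit x₀) 𝒢.smooth_unit.contMDiffAt hx₀ hu₀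
  have h2 : ContDiffAt ℝ ∞ (fun q => extChartAt 𝓘(ℝ, F) (𝒢.unit x₁)
      ((extChartAt 𝓘(ℝ, F) (𝒢.unit x₀)).symm q))
      (𝒢.unitC x₀ (extChartAt 𝓘(ℝ, E) x₀ x)) := by
    have := contDiffAt_comp_symm (𝒢.unit x₀) (contMDiffAt_extChartAt_of_mem (F := F) hu₁) hu₀
    unfold unitC inCharts
    rwa [(extChartAt 𝓘(ℝ, E) x₀).left_inv hx₀]
  exact (h2.fderiv_right (m := ∞) (by simp)).comp _ h1

theorem contDiffAt_chartChange {x₀ x₁ x : M} (hx₀ : x ∈ (extChartAt 𝓘(ℝ, E) x₀).source)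
    (hx₁ : x ∈ (extChartAt 𝓘(ℝ, E) x₁).source) :
    ContDiffAt ℝ ∞ (fun z => extChartAt 𝓘(ℝ, E) x₀ ((extChartAt 𝓘(ℝ, E) x₁).symm z))
      (extChartAt 𝓘(ℝ, E) x₁ x) :=
  contDiffAt_comp_symm x₁ (contMDiffAt_extChartAt_of_mem (F := E) hx₀) hx₁

/-- A change of charts composes with the transition map of `M` and applies `transL`, neither of
which depends on the section. Hence jets in one chart determine those in another. -/
theorem localExpr_change (𝒢 : LieGroupoid E F M G) {x₀ x₁ x : M}
    (hx₀ : x ∈ (extChartAt 𝓘(ℝ, E) x₀).source)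
    (hu₀ : 𝒢.unit x ∈ (extChartAt 𝓘(ℝ, F) (𝒢.unit x₀)).source)
    (hx₁ : x ∈ (extChartAt 𝓘(ℝ, E) x₁).source)
    (hu₁ : 𝒢.unit x ∈ (extChartAt 𝓘(ℝ, F) (𝒢.unit x₁)).source)
    (θ : Π y : M, TangentSpace 𝓘(ℝ, F) (𝒢.unit y)) :
    localExpr 𝒢 x₁ θ =ᶠ[𝓝 (extChartAt 𝓘(ℝ, E) x₁ x)] fun z =>
      𝒢.transL x₀ x₁ (extChartAt 𝓘(ℝ, E) x₀ ((extChartAt 𝓘(ℝ, E) x₁).symm z))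
        (localExpr 𝒢 x₀ θ (extChartAt 𝓘(ℝ, E) x₀ ((extChartAt 𝓘(ℝ, E) x₁).symm z))) := by
  have hc : Tendsto (extChartAt 𝓘(ℝ, E) x₁).symm (𝓝 (extChartAt 𝓘(ℝ, E) x₁ x)) (𝓝 x) := by
    have := continuousAt_extChartAt_symm' (I := 𝓘(ℝ, E)) hx₁
    rwa [ContinuousAt, (extChartAt 𝓘(ℝ, E) x₁).left_inv hx₁] at this
  have hcu : Tendsto 𝒢.unit (𝓝 x) (𝓝 (𝒢.unit x)) := 𝒢.smooth_unit.continuous.continuousAt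
  filter_upwards [hc.eventually (extChartAt_source_mem_nhds' hx₀),
    (hcu.comp hc).eventually (extChartAt_source_mem_nhds' hu₀),
    (hcu.comp hc).eventually (extChartAt_source_mem_nhds' hu₁)] with z h1 h2 h3
  unfold localExpr transL unitC inCharts
  rw [(extChartAt 𝓘(ℝ, E) x₀).left_inv h1]
  exact mfderiv_eq_fderiv_chart (𝒢.unit x₀)
    ((contMDiffAt_extChartAt_of_mem (F := F) h3).mdifferentiableAt (by simp)) h2 _

/-- Derivatives in one chart determine those in another chart. -/
theorem taylor_localExpr_change (𝒢 : LieGroupoid E F M G) {k : ℕ} {x₀ x₁ x : M}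
    (hx₀ : x ∈ (extChartAt 𝓘(ℝ, E) x₀).source)
    (hu₀ : 𝒢.unit x ∈ (extChartAt 𝓘(ℝ, F) (𝒢.unit x₀)).source)
    (hx₁ : x ∈ (extChartAt 𝓘(ℝ, E) x₁).source)
    (hu₁ : 𝒢.unit x ∈ (extChartAt 𝓘(ℝ, F) (𝒢.unit x₁)).source)
    {θ : Π y : M, TangentSpace 𝓘(ℝ, F) (𝒢.unit y)} {h : E → F}
    (hθ : ContDiffAt ℝ ∞ (localExpr 𝒢 x₀ θ) (extChartAt 𝓘(ℝ, E) x₀ x))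
    (hh : ContDiffAt ℝ ∞ h (extChartAt 𝓘(ℝ, E) x₀ x))
    (heq : taylor k (localExpr 𝒢 x₀ θ) (extChartAt 𝓘(ℝ, E) x₀ x)
      = taylor k h (extChartAt 𝓘(ℝ, E) x₀ x)) :
    taylor k (localExpr 𝒢 x₁ θ) (extChartAt 𝓘(ℝ, E) x₁ x) = taylor k (fun z =>
      𝒢.transL x₀ x₁ (extChartAt 𝓘(ℝ, E) x₀ ((extChartAt 𝓘(ℝ, E) x₁).symm z))
        (h (extChartAt 𝓘(ℝ, E) x₀ ((extChartAt 𝓘(ℝ, E) x₁).symm z))))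
      (extChartAt 𝓘(ℝ, E) x₁ x) := by
  rw [taylor_congr (localExpr_change 𝒢 hx₀ hu₀ hx₁ hu₁ θ)]
  have hl := (extChartAt 𝓘(ℝ, E) x₁).left_inv hx₁
  have hτ := contDiffAt_chartChange hx₀ hx₁
  have hL := contDiffAt_transL 𝒢 hx₀ hu₀ hu₁
  refine taylor_comp_congr (f₁ := fun z => extChartAt 𝓘(ℝ, E) x₀
    ((extChartAt 𝓘(ℝ, E) x₁).symm z)) (f₂ := fun z => extChartAt 𝓘(ℝ, E) x₀
    ((extChartAt 𝓘(ℝ, E) x₁).symm z)) (g₁ := fun w => 𝒢.transL x₀ x₁ w (localExpr 𝒢 x₀ θ w))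
    (g₂ := fun w => 𝒢.transL x₀ x₁ w (h w)) hτ hτ ?_ ?_ rfl ?_
  · simp only [hl]; exact hL.clm_apply hθ
  · simp only [hl]; exact hL.clm_apply hh
  · simp only [hl]
    have happ : ContDiff ℝ ∞ (fun p : (F →L[ℝ] F) × F => p.1 p.2) :=
      contDiff_fst.clm_apply contDiff_snd
    exact taylor_comp_congr (f₁ := fun w => (𝒢.transL x₀ x₁ w, localExpr 𝒢 x₀ θ w))
      (f₂ := fun w => (𝒢.transL x₀ x₁ w, h w)) (g₁ := fun p : (F →L[ℝ] F) × F => p.1 p.2)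
      (g₂ := fun p : (F →L[ℝ] F) × F => p.1 p.2) (hL.prodMk hθ) (hL.prodMk hh)
      happ.contDiffAt happ.contDiffAt (taylor_prodMk_congr hL hL hθ hh rfl heq) rfl

theorem contDiffAt_localExpr' (𝒢 : LieGroupoid E F M G) {x₀ x : M}
    (hx : x ∈ (extChartAt 𝓘(ℝ, E) x₀).source)
    (hux : 𝒢.unit x ∈ (extChartAt 𝓘(ℝ, F) (𝒢.unit x₀)).source)
    {θ : Π y : M, TangentSpace 𝓘(ℝ, F) (𝒢.unit y)} (hθ : θ ∈ localSections 𝒢 x) :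
    ContDiffAt ℝ ∞ (localExpr 𝒢 x₀ θ) (extChartAt 𝓘(ℝ, E) x₀ x) :=
  contDiffAt_localExpr 𝒢 x₀ (by rwa [extChartAt_source] at hx) (by rwa [extChartAt_source] at hux)
    hθ

theorem taylor_zero_fun (k : ℕ) (z : E) : taylor k (0 : E → F) z = 0 := by
  funext i
  exact congrFun (iteratedFDeriv_fun_zero (𝕜 := ℝ) (n := (i : ℕ))) z

/-- `vanishing` tests every chart, but if `θ - μ` has zero jet in one chart, then
`taylor_localExpr_change` compares it with the zero map in every other. -/
theorem toJet_eq_of_taylor (𝒢 : LieGroupoid E F M G) {k : ℕ} {x₀ x : M}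
    (hx : x ∈ (extChartAt 𝓘(ℝ, E) x₀).source)
    (hux : 𝒢.unit x ∈ (extChartAt 𝓘(ℝ, F) (𝒢.unit x₀)).source) {θ μ : localSections 𝒢 x}
    (h : taylor k (localExpr 𝒢 x₀ θ.1) (extChartAt 𝓘(ℝ, E) x₀ x)
      = taylor k (localExpr 𝒢 x₀ μ.1) (extChartAt 𝓘(ℝ, E) x₀ x)) :
    toJet 𝒢 k x θ = toJet 𝒢 k x μ := by
  rw [toJet_eq_iff]
  intro x₁ hx₁ hu₁ i hi
  have hθ := contDiffAt_localExpr' 𝒢 hx hux θ.2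
  have hμ := contDiffAt_localExpr' 𝒢 hx hux μ.2
  have hsub : localExpr 𝒢 x₀ (θ - μ).1 = localExpr 𝒢 x₀ θ.1 - localExpr 𝒢 x₀ μ.1 := by
    have := localExpr_add 𝒢 x₀ (θ - μ).1 μ.1
    rw [show (θ - μ).1 + μ.1 = θ.1 from sub_add_cancel θ.1 μ.1] at this
    rw [this, add_sub_cancel_right]
  have h0 : taylor k (localExpr 𝒢 x₀ (θ - μ).1) (extChartAt 𝓘(ℝ, E) x₀ x)
      = taylor k (0 : E → F) (extChartAt 𝓘(ℝ, E) x₀ x) := by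
    rw [hsub, taylor_sub hθ hμ, h, sub_self, taylor_zero_fun]
  have h1 := taylor_localExpr_change 𝒢 (x₁ := x₁) (h := fun _ => (0 : F)) hx hux (by rwa [extChartAt_source])
    (by rwa [extChartAt_source]) (contDiffAt_localExpr' 𝒢 hx hux (θ - μ).2)
    contDiffAt_const h0
  simp only [map_zero] at h1
  have h2 := congrFun h1 ⟨i, Nat.lt_succ_of_le hi⟩
  exact h2.trans (congrFun (iteratedFDeriv_fun_zero (𝕜 := ℝ) (n := i)) _)

theorem jetCoord_toJet' (𝒢 : LieGroupoid E F M G) (k : ℕ) {x₀ x : M}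
    (hx : x ∈ (extChartAt 𝓘(ℝ, E) x₀).source)
    (hux : 𝒢.unit x ∈ (extChartAt 𝓘(ℝ, F) (𝒢.unit x₀)).source) (θ : localSections 𝒢 x) :
    jetCoord 𝒢 k x₀ x (toJet 𝒢 k x θ)
      = taylor k (localExpr 𝒢 x₀ θ.1) (extChartAt 𝓘(ℝ, E) x₀ x) :=
  jetCoord_toJet 𝒢 k (by rwa [extChartAt_source] at hx) (by rwa [extChartAt_source] at hux) θ

theorem jetCoord_injective (𝒢 : LieGroupoid E F M G) (k : ℕ) {x₀ x : M}
    (hx : x ∈ (extChartAt 𝓘(ℝ, E) x₀).source)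
    (hux : 𝒢.unit x ∈ (extChartAt 𝓘(ℝ, F) (𝒢.unit x₀)).source) :
    Function.Injective (jetCoord 𝒢 k x₀ x) := by
  intro j j' h
  obtain ⟨θ, rfl⟩ := toJet_surjective 𝒢 k x j
  obtain ⟨μ, rfl⟩ := toJet_surjective 𝒢 k x j'
  rw [jetCoord_toJet' 𝒢 k hx hux, jetCoord_toJet' 𝒢 k hx hux] at h
  exact toJet_eq_of_taylor 𝒢 hx hux h

theorem jet_of_mem (𝒢 : LieGroupoid E F M G) (k : ℕ) {x : M}
    {θ : Π y : M, TangentSpace 𝓘(ℝ, F) (𝒢.unit y)} (h : θ ∈ localSections 𝒢 x) :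
    jet 𝒢 k x θ = toJet 𝒢 k x ⟨θ, h⟩ := dif_pos h

theorem extendJet_apply {𝒢 : LieGroupoid E F M G} {k : ℕ} {U : Opens M} (ξ : JetSection 𝒢 k U)
    {y : M} (hy : y ∈ U) : extendJet ξ y = ξ.1 ⟨y, hy⟩ := dif_pos hy

/-- The coordinates near `x₀`, in the chart of `M` at `x₀`, of a family of jets. -/
def jetC (𝒢 : LieGroupoid E F M G) {k : ℕ} (x₀ : M) (j : Π y : M, Jet 𝒢 k y) (z : E) :
    TaylorSpace E F k :=
  jetCoord 𝒢 k x₀ ((extChartAt 𝓘(ℝ, E) x₀).symm z) (j ((extChartAt 𝓘(ℝ, E) x₀).symm z))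

theorem mem_jetSection_iff (𝒢 : LieGroupoid E F M G) {k : ℕ} {U : Opens M}
    {ξ : Π x : U, Jet 𝒢 k (x : M)} {j : Π y : M, Jet 𝒢 k y} (hj : ∀ x : U, j x = ξ x) :
    ξ ∈ JetSection 𝒢 k U ↔ ∀ x : U,
      ContMDiffAt 𝓘(ℝ, E) 𝓘(ℝ, TaylorSpace E F k) ∞ (fun y : M => jetCoord 𝒢 k (x : M) y (j y)) x := by
  refine forall_congr' fun x => ?_
  rw [← contMDiffAt_subtype_iff]
  simp only [hj]

/-- The coordinates of a smooth section of `J^k 𝔤` are smooth in any chart. -/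
theorem contDiffAt_jetC (𝒢 : LieGroupoid E F M G) {k : ℕ} {x a : M} {j : Π y : M, Jet 𝒢 k y}
    (hj : ContMDiffAt 𝓘(ℝ, E) 𝓘(ℝ, TaylorSpace E F k) ∞ (fun y : M => jetCoord 𝒢 k a y (j y)) a)
    (hx : a ∈ (extChartAt 𝓘(ℝ, E) x).source)
    (hux : 𝒢.unit a ∈ (extChartAt 𝓘(ℝ, F) (𝒢.unit x)).source) :
    ContDiffAt ℝ ∞ (𝒢.jetC x j) (extChartAt 𝓘(ℝ, E) x a) := by
  have hl := (extChartAt 𝓘(ℝ, E) x).left_inv hx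
  have hx₀ := mem_extChartAt_source (I := 𝓘(ℝ, E)) a
  have hu₀ := mem_extChartAt_source (I := 𝓘(ℝ, F)) (𝒢.unit a)
  have hL := contDiffAt_transL 𝒢 hx₀ hu₀ hux
  have hτ := contDiffAt_chartChange hx₀ hx
  have hc := contDiffAt_comp_symm x hj hx
  set τ : E → E := fun z => extChartAt 𝓘(ℝ, E) a ((extChartAt 𝓘(ℝ, E) x).symm z) with hτd
  set c : E → TaylorSpace E F k := fun z => jetCoord 𝒢 k a ((extChartAt 𝓘(ℝ, E) x).symm z)
    (j ((extChartAt 𝓘(ℝ, E) x).symm z)) with hcd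
  have hz : τ (extChartAt 𝓘(ℝ, E) x a) = extChartAt 𝓘(ℝ, E) a a := by simp only [hτd, hl]
  -- Arbitrary representatives of the jets need not vary smoothly. They are replaced by the Taylor
  -- polynomials with the given coordinates as coefficients, carried to the chart at `x`: `p.1` is
  -- the point where the jet is prescribed, `p.2` the variable of the polynomial. That the
  -- polynomial need not be vertical is harmless, as only derivatives are compared.
  have hg : ContDiffAt ℝ ∞ (fun p : E × E => 𝒢.transL a x (τ p.2)
      (taylorPoly (τ p.1) (c p.1) (τ p.2)))
      (extChartAt 𝓘(ℝ, E) x a, extChartAt 𝓘(ℝ, E) x a) := by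
    have h1 : ContDiffAt ℝ ∞ (fun p : E × E => τ p.1)
        (extChartAt 𝓘(ℝ, E) x a, extChartAt 𝓘(ℝ, E) x a) :=
      ContDiffAt.comp _ (g := τ) hτ contDiffAt_fst
    have h2 : ContDiffAt ℝ ∞ (fun p : E × E => τ p.2)
        (extChartAt 𝓘(ℝ, E) x a, extChartAt 𝓘(ℝ, E) x a) :=
      ContDiffAt.comp _ (g := τ) hτ contDiffAt_snd
    have h3 : ContDiffAt ℝ ∞ (fun p : E × E => c p.1)
        (extChartAt 𝓘(ℝ, E) x a, extChartAt 𝓘(ℝ, E) x a) :=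
      ContDiffAt.comp _ (g := c) hc contDiffAt_fst
    rw [← hz] at hL
    exact (ContDiffAt.comp (extChartAt 𝓘(ℝ, E) x a, extChartAt 𝓘(ℝ, E) x a)
      (f := fun p : E × E => τ p.2) hL h2).clm_apply
      ((contDiff_taylorPoly k).contDiffAt.comp _ ((h1.prodMk h3).prodMk h2))
  refine (contDiffAt_taylor_param k hg contDiffAt_id).congr_of_eventuallyEq ?_
  have hcs : Tendsto (extChartAt 𝓘(ℝ, E) x).symm (𝓝 (extChartAt 𝓘(ℝ, E) x a)) (𝓝 a) := by
    have := continuousAt_extChartAt_symm' (I := 𝓘(ℝ, E)) hx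
    rwa [ContinuousAt, hl] at this
  have hcu : Tendsto 𝒢.unit (𝓝 a) (𝓝 (𝒢.unit a)) := 𝒢.smooth_unit.continuous.continuousAt
  filter_upwards [hcs.eventually (extChartAt_source_mem_nhds' hx₀),
    (hcu.comp hcs).eventually (extChartAt_source_mem_nhds' hu₀),
    (hcu.comp hcs).eventually (extChartAt_source_mem_nhds' hux),
    extChartAt_target_mem_nhds' ((extChartAt 𝓘(ℝ, E) x).map_source hx)] with z h1 h2 h3 h4
  have h5 := (extChartAt 𝓘(ℝ, E) x).map_target h4
  obtain ⟨θ, hθ⟩ := toJet_surjective 𝒢 k _ (j ((extChartAt 𝓘(ℝ, E) x).symm z))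
  have hsm := contDiffAt_localExpr' 𝒢 h1 h2 θ.2
  have hev : ∀ᶠ z' in 𝓝 (τ z), ContDiffAt ℝ ∞ (localExpr 𝒢 a θ.1) z' := by
    have hcs' : Tendsto (extChartAt 𝓘(ℝ, E) a).symm (𝓝 (τ z))
        (𝓝 ((extChartAt 𝓘(ℝ, E) x).symm z)) := by
      have := continuousAt_extChartAt_symm' (I := 𝓘(ℝ, E)) h1
      rwa [ContinuousAt, (extChartAt 𝓘(ℝ, E) a).left_inv h1] at this
    have hθm : ∀ᶠ y in 𝓝 ((extChartAt 𝓘(ℝ, E) x).symm z), θ.1 ∈ localSections 𝒢 y :=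
      eventually_eventually_nhds.2 θ.2
    have hcu' : Tendsto 𝒢.unit (𝓝 ((extChartAt 𝓘(ℝ, E) x).symm z))
      (𝓝 (𝒢.unit ((extChartAt 𝓘(ℝ, E) x).symm z))) := 𝒢.smooth_unit.continuous.continuousAt
    filter_upwards [hcs'.eventually hθm,
      hcs'.eventually (extChartAt_source_mem_nhds' h1),
      (hcu'.comp hcs').eventually (extChartAt_source_mem_nhds' h2),
      extChartAt_target_mem_nhds' ((extChartAt 𝓘(ℝ, E) a).map_source h1)] with z' k1 k2 k3 k4
    have := contDiffAt_localExpr' 𝒢 k2 k3 k1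
    rwa [(extChartAt 𝓘(ℝ, E) a).right_inv k4] at this
  have hcz : c z = taylor k (localExpr 𝒢 a θ.1) (τ z) := by
    simp only [hcd, ← hθ]
    exact jetCoord_toJet' 𝒢 k h1 h2 θ
  -- The coordinates come from an actual section, so they are symmetric and the polynomial
  -- reproduces them.
  have hpoly := taylor_taylorPoly (k := k) hev
  rw [← hcz] at hpoly
  have hpsm : ContDiffAt ℝ ∞ (taylorPoly (τ z) (c z)) (τ z) :=
    ((contDiff_taylorPoly k).comp ((contDiff_const (c := (τ z, c z))).prodMk
      contDiff_id)).contDiffAt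
  have := taylor_localExpr_change 𝒢 (x₁ := x) h1 h2 h5 h3 hsm hpsm (hcz.symm.trans hpoly.symm)
  unfold jetC
  rw [← hθ, jetCoord_toJet' 𝒢 k h5 h3, this, (extChartAt 𝓘(ℝ, E) x).right_inv h4]
  rfl

/-- `JetSection` tests at each point only the chart centred there; `contDiffAt_jetC` brings all
nearby points into the single chart at `x`. -/
theorem eventually_contDiffAt_jetC {𝒢 : LieGroupoid E F M G} {k : ℕ} {U : Opens M}
    (ξ : JetSection 𝒢 k U) {x : M} (hx : x ∈ U) :
    ∀ᶠ z in 𝓝 (extChartAt 𝓘(ℝ, E) x x), ContDiffAt ℝ ∞ (𝒢.jetC x (extendJet ξ)) z := by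
  have hc : Tendsto (extChartAt 𝓘(ℝ, E) x).symm (𝓝 (extChartAt 𝓘(ℝ, E) x x)) (𝓝 x) := by
    have := continuousAt_extChartAt_symm (I := 𝓘(ℝ, E)) x
    rwa [ContinuousAt, extChartAt_to_inv] at this
  filter_upwards [eventually_mem_chart_symm 𝒢 x, hc.eventually (U.isOpen.mem_nhds hx)]
    with z hz hU
  have := contDiffAt_jetC 𝒢 ((mem_jetSection_iff 𝒢 (fun y : U => extendJet_apply ξ y.2)).1 ξ.2
    ⟨_, hU⟩) ((extChartAt 𝓘(ℝ, E) x).map_target hz.1) hz.2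
  rwa [(extChartAt 𝓘(ℝ, E) x).right_inv hz.1] at this

/-- The anchor in coordinates. -/
theorem chartVec_anchor (𝒢 : LieGroupoid E F M G) {k : ℕ} {x₀ x : M}
    (hx : x ∈ (extChartAt 𝓘(ℝ, E) x₀).source)
    (hux : 𝒢.unit x ∈ (extChartAt 𝓘(ℝ, F) (𝒢.unit x₀)).source) (j : Jet 𝒢 k x) :
    chartVec x₀ x (anchor 𝒢 k x j) = fderiv ℝ (𝒢.tgtC x₀)
      (𝒢.unitC x₀ (extChartAt 𝓘(ℝ, E) x₀ x)) (jetCoord 𝒢 k x₀ x j 0 (fun _ => 0)) := by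
  obtain ⟨θ, rfl⟩ := toJet_surjective 𝒢 k x j
  rw [jetCoord_toJet' 𝒢 k hx hux, taylor_zero_apply]
  have h1 := chartVec_mfderiv_eq_fderiv (f := 𝒢.tgt) (𝒢.unit x₀) x₀
    (𝒢.smooth_tgt.contMDiffAt.mdifferentiableAt (by simp)) hux (by rwa [𝒢.tgt_unit]) (θ.1 x)
  rw [𝒢.tgt_unit] at h1
  unfold unitC inCharts localExpr
  rw [(extChartAt 𝓘(ℝ, E) x₀).left_inv hx]
  exact h1

end Jets

end LieGroupoid

namespace LieGroupoid

/-! ### Vector fields on `M × G` and their brackets in charts -/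

section Coord

variable {E F M G : Type*}
  [NormedAddCommGroup E] [NormedSpace ℝ E] [NormedAddCommGroup F] [NormedSpace ℝ F]
  [TopologicalSpace M] [ChartedSpace E M] [TopologicalSpace G] [ChartedSpace F G]

/-- The components of a vector field on `M × G` in the preferred charts at `x` and `g`. -/
def Field.coord (Ξ : Field E F M G) (x : M) (g : G) (q : E × F) : E × F :=
  (chartVec x ((extChartAt 𝓘(ℝ, E) x).symm q.1) (Ξ.hor ((extChartAt 𝓘(ℝ, E) x).symm q.1)
      ((extChartAt 𝓘(ℝ, F) g).symm q.2)),
    chartVec g ((extChartAt 𝓘(ℝ, F) g).symm q.2) (Ξ.ver ((extChartAt 𝓘(ℝ, E) x).symm q.1)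
      ((extChartAt 𝓘(ℝ, F) g).symm q.2)))

variable [IsManifold 𝓘(ℝ, E) ∞ M] [IsManifold 𝓘(ℝ, F) ∞ G]

/-- Smoothness of a vector field on `M × G` at a point. -/
def Field.SmoothAt (Ξ : Field E F M G) (p : M × G) : Prop :=
  ContMDiffAt (𝓘(ℝ, E).prod 𝓘(ℝ, F)) (𝓘(ℝ, E).prod 𝓘(ℝ, F)).tangent ∞
    (fun p => (⟨p, Ξ p⟩ : TangentBundle (𝓘(ℝ, E).prod 𝓘(ℝ, F)) (M × G))) p

theorem Field.smoothAt_iff {Ξ : Field E F M G} {p : M × G} {x : M} {g : G}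
    (hx : p.1 ∈ (extChartAt 𝓘(ℝ, E) x).source) (hg : p.2 ∈ (extChartAt 𝓘(ℝ, F) g).source) :
    Ξ.SmoothAt p ↔
      ContMDiffAt (𝓘(ℝ, E).prod 𝓘(ℝ, F)) 𝓘(ℝ, E) ∞
        (fun p : M × G => chartVec x p.1 (Ξ.hor p.1 p.2)) p ∧
      ContMDiffAt (𝓘(ℝ, E).prod 𝓘(ℝ, F)) 𝓘(ℝ, F) ∞
        (fun p : M × G => chartVec g p.2 (Ξ.ver p.1 p.2)) p := by
  have : IsManifold 𝓘(ℝ, E) 1 M := .of_le (n := ∞) (by simp)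
  have : IsManifold 𝓘(ℝ, F) 1 G := .of_le (n := ∞) (by simp)
  rw [← contMDiffAt_along_iff' x contMDiffAt_fst hx (fun p : M × G => Ξ.hor p.1 p.2),
    ← contMDiffAt_along_iff' g contMDiffAt_snd hg (fun p : M × G => Ξ.ver p.1 p.2)]
  constructor
  · intro h
    have h1 := (contMDiff_equivTangentBundleProd (I := 𝓘(ℝ, E)) (M := M) (I' := 𝓘(ℝ, F)) (M' := G)
      (n := ∞)).contMDiffAt.comp p h
    exact ⟨contMDiffAt_fst.comp p h1, contMDiffAt_snd.comp p h1⟩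
  · rintro ⟨h1, h2⟩
    exact (contMDiff_equivTangentBundleProd_symm (I := 𝓘(ℝ, E)) (M := M) (I' := 𝓘(ℝ, F)) (M' := G)
      (n := ∞)).contMDiffAt.comp p (h1.prodMk h2)

theorem Field.contDiffAt_coord {Ξ : Field E F M G} {x : M} {g : G} {q : E × F}
    (hx : q.1 ∈ (extChartAt 𝓘(ℝ, E) x).target) (hg : q.2 ∈ (extChartAt 𝓘(ℝ, F) g).target)
    (h : Ξ.SmoothAt ((extChartAt 𝓘(ℝ, E) x).symm q.1, (extChartAt 𝓘(ℝ, F) g).symm q.2)) :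
    ContDiffAt ℝ ∞ (Ξ.coord x g) q := by
  have h1 := (Field.smoothAt_iff ((extChartAt 𝓘(ℝ, E) x).map_target hx)
    ((extChartAt 𝓘(ℝ, F) g).map_target hg)).1 h
  have hs : ContMDiffAt 𝓘(ℝ, E × F) (𝓘(ℝ, E).prod 𝓘(ℝ, F)) ∞ (fun q : E × F =>
      ((extChartAt 𝓘(ℝ, E) x).symm q.1, (extChartAt 𝓘(ℝ, F) g).symm q.2)) q :=
    (ContMDiffAt.comp q (contMDiffAt_extChartAt_symm_of_mem (F := E) hx)
      contDiffAt_fst.contMDiffAt).prodMk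
      (ContMDiffAt.comp q (contMDiffAt_extChartAt_symm_of_mem (F := F) hg)
        contDiffAt_snd.contMDiffAt)
  have h2 := ContMDiffAt.comp q h1.1 hs
  have h3 := ContMDiffAt.comp q h1.2 hs
  rw [contMDiffAt_iff_contDiffAt] at h2 h3
  exact h2.prodMk h3

theorem mfderiv_extChartAt_prod {x : M} {g : G} {p : M × G}
    (hx : p.1 ∈ (extChartAt 𝓘(ℝ, E) x).source) (hg : p.2 ∈ (extChartAt 𝓘(ℝ, F) g).source)
    (v : E × F) :
    (mfderiv (𝓘(ℝ, E).prod 𝓘(ℝ, F)) 𝓘(ℝ, E × F) (extChartAt (𝓘(ℝ, E).prod 𝓘(ℝ, F)) (x, g)) p v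
      : E × F) = (chartVec (F := E) x p.1 v.1, chartVec (F := F) g p.2 v.2) := by
  have hp : p ∈ (extChartAt (𝓘(ℝ, E).prod 𝓘(ℝ, F)) (x, g)).source := by
    rw [extChartAt_prod]; exact ⟨hx, hg⟩
  have hd : MDifferentiableAt (𝓘(ℝ, E).prod 𝓘(ℝ, F)) 𝓘(ℝ, E × F)
      (extChartAt (𝓘(ℝ, E).prod 𝓘(ℝ, F)) (x, g)) p :=
    (contMDiffAt_extChartAt' (n := ∞) (by rwa [extChartAt_source] at hp)).mdifferentiableAt
      (by simp)
  refine Prod.ext ?_ ?_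
  · have h1 := mfderiv_comp_apply p (g := (Prod.fst : E × F → E)) (I'' := 𝓘(ℝ, E))
      (differentiableAt_fst.mdifferentiableAt) hd v
    have h2 := mfderiv_comp_apply p (g := extChartAt 𝓘(ℝ, E) x) (f := (Prod.fst : M × G → M))
      (I'' := 𝓘(ℝ, E)) ((contMDiffAt_extChartAt_of_mem (F := E) hx).mdifferentiableAt (by simp))
      (mdifferentiableAt_fst (I := 𝓘(ℝ, E)) (I' := 𝓘(ℝ, F))) v
    have h3 : (Prod.fst : E × F → E) ∘ (extChartAt (𝓘(ℝ, E).prod 𝓘(ℝ, F)) (x, g))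
        = extChartAt 𝓘(ℝ, E) x ∘ (Prod.fst : M × G → M) := by
      rw [extChartAt_prod]; rfl
    rw [mfderiv_fst] at h2
    rw [mfderiv_eq_fderiv, fderiv_fst] at h1
    rw [h3] at h1
    exact h1.symm.trans h2
  · have h1 := mfderiv_comp_apply p (g := (Prod.snd : E × F → F)) (I'' := 𝓘(ℝ, F))
      (differentiableAt_snd.mdifferentiableAt) hd v
    have h2 := mfderiv_comp_apply p (g := extChartAt 𝓘(ℝ, F) g) (f := (Prod.snd : M × G → G))
      (I'' := 𝓘(ℝ, F)) ((contMDiffAt_extChartAt_of_mem (F := F) hg).mdifferentiableAt (by simp))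
      (mdifferentiableAt_snd (I := 𝓘(ℝ, E)) (I' := 𝓘(ℝ, F))) v
    have h3 : (Prod.snd : E × F → F) ∘ (extChartAt (𝓘(ℝ, E).prod 𝓘(ℝ, F)) (x, g))
        = extChartAt 𝓘(ℝ, F) g ∘ (Prod.snd : M × G → G) := by
      rw [extChartAt_prod]; rfl
    rw [mfderiv_snd] at h2
    rw [mfderiv_eq_fderiv, fderiv_snd] at h1
    rw [h3] at h1
    exact h1.symm.trans h2

theorem mpullback_extChartAt_symm (Ξ : Field E F M G) {x : M} {g : G} {q : E × F}
    (hx : q.1 ∈ (extChartAt 𝓘(ℝ, E) x).target) (hg : q.2 ∈ (extChartAt 𝓘(ℝ, F) g).target) :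
    (VectorField.mpullback 𝓘(ℝ, E × F) (𝓘(ℝ, E).prod 𝓘(ℝ, F))
      (extChartAt (𝓘(ℝ, E).prod 𝓘(ℝ, F)) (x, g)).symm Ξ q : E × F) = Ξ.coord x g q := by
  have : IsManifold (𝓘(ℝ, E).prod 𝓘(ℝ, F)) 1 (M × G) := .of_le (n := ∞) (by simp)
  have hq : q ∈ (extChartAt (𝓘(ℝ, E).prod 𝓘(ℝ, F)) (x, g)).target := by
    rw [extChartAt_prod]; exact ⟨hx, hg⟩
  have h1 := mfderiv_extChartAt_comp_mfderivWithin_extChartAt_symm hq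
  have h2 := mfderivWithin_extChartAt_symm_comp_mfderiv_extChartAt hq
  have hr : range (𝓘(ℝ, E).prod 𝓘(ℝ, F)) = univ := ModelWithCorners.Boundaryless.range_eq_univ
  rw [hr, mfderivWithin_univ] at h1 h2
  rw [VectorField.mpullback_apply, ContinuousLinearMap.inverse_eq h2 h1]
  refine (mfderiv_extChartAt_prod (p := (extChartAt (𝓘(ℝ, E).prod 𝓘(ℝ, F)) (x, g)).symm q)
    ?_ ?_ _).trans ?_
  · rw [extChartAt_prod]; exact (extChartAt 𝓘(ℝ, E) x).map_target hx
  · rw [extChartAt_prod]; exact (extChartAt 𝓘(ℝ, F) g).map_target hg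
  · unfold Field.coord Field.hor Field.ver
    rw [extChartAt_prod]
    rfl

theorem mlieBracket_vectorSpace {V : Type*} [NormedAddCommGroup V] [NormedSpace ℝ V]
    (v w : V → V) (q : V) :
    (VectorField.mlieBracket 𝓘(ℝ, V) v w q : V) = VectorField.lieBracket ℝ v w q :=
  (congrFun (VectorField.mlieBracketWithin_univ (I := 𝓘(ℝ, V)) (V := v) (W := w)).symm q).trans
    ((congrFun (VectorField.mlieBracketWithin_eq_lieBracketWithin (V := v) (W := w)
      (s := univ)) q).trans (congrFun (VectorField.lieBracketWithin_univ (V := v) (W := w)) q))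

/-- `Field.coord` is the pullback by the inverse of the product chart (`mpullback_extChartAt_symm`),
and pullbacks commute with brackets. -/
theorem Field.coord_bracket [CompleteSpace E] [CompleteSpace F] {Ξ H : Field E F M G} {x : M}
    {g : G} {q : E × F}
    (hx : q.1 ∈ (extChartAt 𝓘(ℝ, E) x).target) (hg : q.2 ∈ (extChartAt 𝓘(ℝ, F) g).target)
    (hΞ : Ξ.SmoothAt ((extChartAt 𝓘(ℝ, E) x).symm q.1, (extChartAt 𝓘(ℝ, F) g).symm q.2))
    (hH : H.SmoothAt ((extChartAt 𝓘(ℝ, E) x).symm q.1, (extChartAt 𝓘(ℝ, F) g).symm q.2)) :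
    (fieldBracket Ξ H).coord x g q
      = VectorField.lieBracket ℝ (Ξ.coord x g) (H.coord x g) q := by
  have hq : q ∈ (extChartAt (𝓘(ℝ, E).prod 𝓘(ℝ, F)) (x, g)).target := by
    rw [extChartAt_prod]; exact ⟨hx, hg⟩
  have hqe : (extChartAt (𝓘(ℝ, E).prod 𝓘(ℝ, F)) (x, g)).symm q
      = ((extChartAt 𝓘(ℝ, E) x).symm q.1, (extChartAt 𝓘(ℝ, F) g).symm q.2) := by
    rw [extChartAt_prod]; rfl
  have hs : ContMDiffAt 𝓘(ℝ, E × F) (𝓘(ℝ, E).prod 𝓘(ℝ, F)) ∞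
      (extChartAt (𝓘(ℝ, E).prod 𝓘(ℝ, F)) (x, g)).symm q :=
    (contMDiffOn_extChartAt_symm (x, g)).contMDiffAt (extChartAt_target_mem_nhds' hq)
  have h2 : (2 : ℕ∞ω) ≤ ∞ := WithTop.coe_le_coe.2 (le_top : (2 : ℕ∞) ≤ ⊤)
  have : IsManifold (𝓘(ℝ, E).prod 𝓘(ℝ, F)) (minSmoothness ℝ 2) (M × G) :=
    .of_le (n := ∞) (by rwa [minSmoothness_of_isRCLikeNormedField])
  have h1 := VectorField.mpullback_mlieBracket (I := 𝓘(ℝ, E × F)) (I' := 𝓘(ℝ, E).prod 𝓘(ℝ, F))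
    (V := Ξ) (W := H) (x₀ := q) (f := (extChartAt (𝓘(ℝ, E).prod 𝓘(ℝ, F)) (x, g)).symm) (n := ∞)
    (by rw [hqe]; exact hΞ.mdifferentiableAt (by simp))
    (by rw [hqe]; exact hH.mdifferentiableAt (by simp)) hs
    (by rwa [minSmoothness_of_isRCLikeNormedField])
  refine (mpullback_extChartAt_symm (fieldBracket Ξ H) hx hg).symm.trans (h1.trans ((mlieBracket_vectorSpace _ _ q).trans ?_))
  have hn : ∀ᶠ q' in 𝓝 q, q'.1 ∈ (extChartAt 𝓘(ℝ, E) x).target ∧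
      q'.2 ∈ (extChartAt 𝓘(ℝ, F) g).target :=
    (continuousAt_fst.eventually ((isOpen_extChartAt_target x).mem_nhds hx)).and
      (continuousAt_snd.eventually ((isOpen_extChartAt_target g).mem_nhds hg))
  exact Filter.EventuallyEq.lieBracket_vectorField_eq (𝕜 := ℝ) (E := E × F)
    (hn.mono fun q' h => mpullback_extChartAt_symm Ξ h.1 h.2)
    (hn.mono fun q' h => mpullback_extChartAt_symm H h.1 h.2)

end Coord

end LieGroupoid

namespace LieGroupoid

/-! ### Right invariant projectable fields in charts are closed under brackets -/

section LocalFields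

variable {E F M G : Type*}
  [NormedAddCommGroup E] [NormedSpace ℝ E] [NormedAddCommGroup F] [NormedSpace ℝ F]
  [TopologicalSpace M] [ChartedSpace E M] [TopologicalSpace G] [ChartedSpace F G]
  [IsManifold 𝓘(ℝ, E) ∞ M] [IsManifold 𝓘(ℝ, F) ∞ G]

theorem tendsto_extChartAt_symm (x : M) :
    Tendsto (extChartAt 𝓘(ℝ, E) x).symm (𝓝 (extChartAt 𝓘(ℝ, E) x x)) (𝓝 x) := by
  have := continuousAt_extChartAt_symm (I := 𝓘(ℝ, E)) x
  rwa [ContinuousAt, extChartAt_to_inv] at this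

theorem unitC_apply (𝒢 : LieGroupoid E F M G) {x y : M}
    (hy : y ∈ (extChartAt 𝓘(ℝ, E) x).source) :
    𝒢.unitC x (extChartAt 𝓘(ℝ, E) x y) = extChartAt 𝓘(ℝ, F) (𝒢.unit x) (𝒢.unit y) := by
  unfold unitC inCharts
  rw [(extChartAt 𝓘(ℝ, E) x).left_inv hy]

theorem tgtC_apply (𝒢 : LieGroupoid E F M G) {x : M} {X : G}
    (hX : X ∈ (extChartAt 𝓘(ℝ, F) (𝒢.unit x)).source) :
    𝒢.tgtC x (extChartAt 𝓘(ℝ, F) (𝒢.unit x) X) = extChartAt 𝓘(ℝ, E) x (𝒢.tgt X) := by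
  unfold tgtC inCharts
  rw [(extChartAt 𝓘(ℝ, F) (𝒢.unit x)).left_inv hX]

theorem tgtC_apply_self (𝒢 : LieGroupoid E F M G) (x : M) :
    𝒢.tgtC x (extChartAt 𝓘(ℝ, F) (𝒢.unit x) (𝒢.unit x)) = extChartAt 𝓘(ℝ, E) x x := by
  rw [tgtC_apply 𝒢 (mem_extChartAt_source _), 𝒢.tgt_unit]

theorem tendsto_unitC (𝒢 : LieGroupoid E F M G) (x : M) :
    Tendsto (𝒢.unitC x) (𝓝 (extChartAt 𝓘(ℝ, E) x x))
      (𝓝 (extChartAt 𝓘(ℝ, F) (𝒢.unit x) (𝒢.unit x))) := by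
  have h := (eventually_mem_chart_symm 𝒢 x).self_of_nhds
  have := (contDiffAt_unitC 𝒢 x h.1 h.2).continuousAt
  rwa [ContinuousAt, unitC_apply_self] at this

theorem tendsto_tgtC (𝒢 : LieGroupoid E F M G) (x : M) :
    Tendsto (𝒢.tgtC x) (𝓝 (extChartAt 𝓘(ℝ, F) (𝒢.unit x) (𝒢.unit x)))
      (𝓝 (extChartAt 𝓘(ℝ, E) x x)) := by
  have h := (eventually_mem_chart_symm_src_tgt 𝒢 x).self_of_nhds
  have := (contDiffAt_tgtC 𝒢 x h.1 h.2.2).continuousAt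
  rwa [ContinuousAt, tgtC_apply_self] at this

namespace Slide

variable {𝒢 : LieGroupoid E F M G} {x : M} (S : Slide 𝒢 x)

theorem eventually_good : ∀ᶠ X in 𝓝 (extChartAt 𝓘(ℝ, F) (𝒢.unit x) (𝒢.unit x)),
    (𝒢.tgt ((extChartAt 𝓘(ℝ, F) (𝒢.unit x)).symm X), (0 : F)) ∈ S.good := by
  have h1 : Tendsto (fun X => (𝒢.tgt ((extChartAt 𝓘(ℝ, F) (𝒢.unit x)).symm X), (0 : F)))
      (𝓝 (extChartAt 𝓘(ℝ, F) (𝒢.unit x) (𝒢.unit x))) (𝓝 (x, (0 : F))) := by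
    refine Tendsto.prodMk_nhds ?_ tendsto_const_nhds
    have ht : Tendsto 𝒢.tgt (𝓝 (𝒢.unit x)) (𝓝 x) := by
      simpa [ContinuousAt, 𝒢.tgt_unit] using
        (𝒢.smooth_tgt.continuous.continuousAt (x := 𝒢.unit x))
    exact ht.comp (tendsto_extChartAt_symm (𝒢.unit x))
  exact h1.eventually (S.good_mem_nhds S.mem_good_self)

/-- The family of left translates of `X`, with a parameter in `E`, in the preferred charts. -/
def kap (X : G) (p : E × F) : E × F := (p.1, extChartAt 𝓘(ℝ, F) (𝒢.unit x) (S.move X p.2))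

/-- The family of elements of a source fibre, with a parameter in `E`, in the preferred charts. -/
def eps (y : M) (p : E × F) : E × F := (p.1, extChartAt 𝓘(ℝ, F) (𝒢.unit x) (S.el y p.2))

theorem contDiffAt_kap_snd {X : G} {w : F} (h : (𝒢.tgt X, w) ∈ S.good)
    (hX : S.move X w ∈ (extChartAt 𝓘(ℝ, F) (𝒢.unit x)).source) :
    ContDiffAt ℝ ∞ (fun w => extChartAt 𝓘(ℝ, F) (𝒢.unit x) (S.move X w)) w :=
  (ContMDiffAt.comp w (contMDiffAt_extChartAt_of_mem (F := F) hX)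
    (S.contMDiffAt_move_right h)).contDiffAt

theorem contDiffAt_kap {X : G} {p : E × F} (h : (𝒢.tgt X, p.2) ∈ S.good)
    (hX : S.move X p.2 ∈ (extChartAt 𝓘(ℝ, F) (𝒢.unit x)).source) :
    ContDiffAt ℝ ∞ (S.kap X) p :=
  contDiffAt_fst.prodMk ((S.contDiffAt_kap_snd h hX).comp p contDiffAt_snd)

theorem fderiv_kap {X : G} {p : E × F} (h : (𝒢.tgt X, p.2) ∈ S.good)
    (hX : S.move X p.2 ∈ (extChartAt 𝓘(ℝ, F) (𝒢.unit x)).source) (v : E × F) :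
    fderiv ℝ (S.kap X) p v = (v.1,
      fderiv ℝ (fun w => extChartAt 𝓘(ℝ, F) (𝒢.unit x) (S.move X w)) p.2 v.2) := by
  have h1 := ((S.contDiffAt_kap_snd h hX).differentiableAt (by simp)).hasFDerivAt
  have h2 : HasFDerivAt (S.kap X) _ p := hasFDerivAt_fst.prodMk (h1.comp p hasFDerivAt_snd)
  rw [h2.fderiv]
  rfl

theorem contDiffAt_eps {y : M} {p : E × F} (h : (y, p.2) ∈ S.good) :
    ContDiffAt ℝ ∞ (S.eps y) p :=
  contDiffAt_fst.prodMk (ContDiffAt.comp p (g := fun w => extChartAt 𝓘(ℝ, F) (𝒢.unit x) (S.el y w))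
    (ContMDiffAt.comp p.2 (contMDiffAt_extChartAt_of_mem (F := F) (S.el_mem_source h))
      (S.contMDiffAt_el_right h)).contDiffAt contDiffAt_snd)

/-- This is `mfderiv_move_rightOp` at `w = 0`. In particular `rightOp` at an identity is idempotent.
-/
theorem rightOp_rightOp_unit {X : G} (h : (𝒢.tgt X, (0 : F)) ∈ S.good)
    (hX : X ∈ (extChartAt 𝓘(ℝ, F) (𝒢.unit x)).source) (v : F) :
    S.rightOp (𝒢.unit x) X (S.rightOp (𝒢.unit x) (𝒢.unit (𝒢.tgt X)) v)
      = S.rightOp (𝒢.unit x) X v := by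
  have := S.mfderiv_move_rightOp h (by rwa [S.el_zero h, 𝒢.tgt_unit])
    (by rwa [S.move_zero h]) v
  rwa [S.el_zero h, S.move_zero h] at this

end Slide

/-- The local expressions, near the identity at `x`, of right invariant projectable fields. -/
structure IsLocalR {𝒢 : LieGroupoid E F M G} {x : M} (S : Slide 𝒢 x) (V : E × F → E × F) :
    Prop where
  smooth : ∀ᶠ q in 𝓝 (extChartAt 𝓘(ℝ, E) x x, extChartAt 𝓘(ℝ, F) (𝒢.unit x) (𝒢.unit x)),
    ContDiffAt ℝ ∞ V q
  hor : ∀ᶠ q in 𝓝 (extChartAt 𝓘(ℝ, E) x x, extChartAt 𝓘(ℝ, F) (𝒢.unit x) (𝒢.unit x)),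
    (V q).1 = (V (q.1, extChartAt 𝓘(ℝ, F) (𝒢.unit x) (𝒢.unit x))).1
  ver : ∀ᶠ q in 𝓝 (extChartAt 𝓘(ℝ, E) x x, extChartAt 𝓘(ℝ, F) (𝒢.unit x) (𝒢.unit x)),
    (V q).2 = S.rightOp (𝒢.unit x) ((extChartAt 𝓘(ℝ, F) (𝒢.unit x)).symm q.2)
      (V (q.1, 𝒢.unitC x (𝒢.tgtC x q.2))).2
  vertical : ∀ᶠ q in 𝓝 (extChartAt 𝓘(ℝ, E) x x, extChartAt 𝓘(ℝ, F) (𝒢.unit x) (𝒢.unit x)),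
    fderiv ℝ (𝒢.srcC x) q.2 (V q).2 = 0

namespace IsLocalR

variable {𝒢 : LieGroupoid E F M G} {x : M} {S : Slide 𝒢 x} {V W : E × F → E × F}

/-- Right invariance read along the left translates of `X`: the map `kap X` carries the field `V ∘
eps (tgt X)` of the parameter space to `V`. The point is that this parameter field depends on `X`
only through `tgt X`. -/
theorem related (hV : IsLocalR S V) :
    ∀ᶠ q in 𝓝 (extChartAt 𝓘(ℝ, E) x x, extChartAt 𝓘(ℝ, F) (𝒢.unit x) (𝒢.unit x)),
      ∀ᶠ p in 𝓝 (q.1, (0 : F)), V (S.kap ((extChartAt 𝓘(ℝ, F) (𝒢.unit x)).symm q.2) p)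
        = fderiv ℝ (S.kap ((extChartAt 𝓘(ℝ, F) (𝒢.unit x)).symm q.2)) p
          (V (S.eps (𝒢.tgt ((extChartAt 𝓘(ℝ, F) (𝒢.unit x)).symm q.2)) p)) := by
  set φ := extChartAt 𝓘(ℝ, F) (𝒢.unit x) with hφ
  set e := extChartAt 𝓘(ℝ, E) x with he
  have hQ := eventually_eventually_nhds.2 (hV.hor.and hV.ver)
  have hsnd : Tendsto (fun q : E × F => q.2) (𝓝 (e x, φ (𝒢.unit x))) (𝓝 (φ (𝒢.unit x))) :=
    continuousAt_snd
  have hfst : Tendsto (fun q : E × F => q.1) (𝓝 (e x, φ (𝒢.unit x))) (𝓝 (e x)) :=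
    continuousAt_fst
  have hU : Tendsto (fun q : E × F => (q.1, 𝒢.unitC x (𝒢.tgtC x q.2)))
      (𝓝 (e x, φ (𝒢.unit x))) (𝓝 (e x, φ (𝒢.unit x))) :=
    hfst.prodMk_nhds ((tendsto_unitC 𝒢 x).comp ((tendsto_tgtC 𝒢 x).comp hsnd))
  filter_upwards [hQ, hU.eventually hQ, hsnd.eventually S.eventually_good,
    hsnd.eventually (eventually_mem_chart_symm_src_tgt 𝒢 x)] with q h1 h2 h3 h4
  set X := φ.symm q.2 with hX
  have hXs : X ∈ φ.source := φ.map_target h4.1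
  have hXq : φ X = q.2 := φ.right_inv h4.1
  have hk0 : S.kap X (q.1, 0) = q := by
    unfold Slide.kap
    rw [S.move_zero h3, ← hφ, hXq]
  have he0 : S.eps (𝒢.tgt X) (q.1, 0) = (q.1, 𝒢.unitC x (𝒢.tgtC x q.2)) := by
    unfold Slide.eps
    rw [S.el_zero h3, ← hXq, tgtC_apply 𝒢 hXs, unitC_apply 𝒢 h3.1]
  have hkc := (S.contDiffAt_kap (p := (q.1, (0 : F))) h3 (by rwa [S.move_zero h3])).continuousAt
  have hec := (S.contDiffAt_eps (p := (q.1, (0 : F))) h3).continuousAt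
  rw [ContinuousAt, hk0] at hkc
  rw [ContinuousAt, he0] at hec
  have hs0 : Tendsto (fun p : E × F => p.2) (𝓝 (q.1, (0 : F))) (𝓝 0) := continuousAt_snd
  have hmc : Tendsto (S.move X) (𝓝 0) (𝓝 X) := by
    have := (S.contMDiffAt_move_right h3).continuousAt
    rwa [ContinuousAt, S.move_zero h3] at this
  have hlc : Tendsto (fun w => (𝒢.tgt (S.el (𝒢.tgt X) w), (0 : F))) (𝓝 0)
      (𝓝 (𝒢.tgt X, (0 : F))) := by
    refine Tendsto.prodMk_nhds ?_ tendsto_const_nhds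
    have := 𝒢.smooth_tgt.continuous.continuousAt.comp (S.contMDiffAt_el_right h3).continuousAt
    rwa [ContinuousAt, Function.comp_apply, S.el_zero h3, 𝒢.tgt_unit] at this
  filter_upwards [hkc.eventually h1, hec.eventually h2,
    hs0.eventually (S.eventually_good_right h3),
    hs0.eventually (hmc.eventually (extChartAt_source_mem_nhds' hXs)),
    hs0.eventually (hlc.eventually (S.good_mem_nhds h3))] with p k1 k2 k3 k4 k5
  have hel := S.el_mem_source k3
  rw [S.fderiv_kap k3 k4]
  have hsame : 𝒢.tgtC x (S.kap X p).2 = 𝒢.tgtC x (S.eps (𝒢.tgt X) p).2 := by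
    unfold Slide.kap Slide.eps
    rw [tgtC_apply 𝒢 k4, tgtC_apply 𝒢 hel, S.tgt_move k3]
  refine Prod.ext ?_ ?_
  · exact k1.1.trans k2.1.symm
  · rw [k1.2, k2.2, hsame]
    have ha : φ.symm (S.kap X p).2 = S.move X p.2 := φ.left_inv k4
    have hb : φ.symm (S.eps (𝒢.tgt X) p).2 = S.el (𝒢.tgt X) p.2 := φ.left_inv hel
    rw [ha, hb]
    exact (S.mfderiv_move_rightOp k3 k5 k4 _).symm

/-- Each property expresses a relation to another field, and brackets of related fields are related.
The first projection relates `V` to a field on `M`; the source map relates it to zero; `kap` relates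
it to a field of parameters, which gives right invariance. -/
theorem lieBracket (hV : IsLocalR S V) (hW : IsLocalR S W) :
    IsLocalR S (VectorField.lieBracket ℝ V W) := by
  set φ := extChartAt 𝓘(ℝ, F) (𝒢.unit x) with hφ
  set e := extChartAt 𝓘(ℝ, E) x with he
  have hsnd : Tendsto (fun q : E × F => q.2) (𝓝 (e x, φ (𝒢.unit x))) (𝓝 (φ (𝒢.unit x))) :=
    continuousAt_snd
  have hfst : Tendsto (fun q : E × F => q.1) (𝓝 (e x, φ (𝒢.unit x))) (𝓝 (e x)) :=
    continuousAt_fst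
  have hU : Tendsto (fun q : E × F => (q.1, 𝒢.unitC x (𝒢.tgtC x q.2)))
      (𝓝 (e x, φ (𝒢.unit x))) (𝓝 (e x, φ (𝒢.unit x))) :=
    hfst.prodMk_nhds ((tendsto_unitC 𝒢 x).comp ((tendsto_tgtC 𝒢 x).comp hsnd))
  have hU0 : Tendsto (fun q : E × F => (q.1, φ (𝒢.unit x)))
      (𝓝 (e x, φ (𝒢.unit x))) (𝓝 (e x, φ (𝒢.unit x))) :=
    hfst.prodMk_nhds tendsto_const_nhds
  have hdV := hV.smooth.mono fun q h => h.differentiableAt (by simp)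
  have hdW := hW.smooth.mono fun q h => h.differentiableAt (by simp)
  have hhor : ∀ᶠ q in 𝓝 (e x, φ (𝒢.unit x)), (VectorField.lieBracket ℝ V W q).1
      = VectorField.lieBracket ℝ (fun z => (V (z, φ (𝒢.unit x))).1)
        (fun z => (W (z, φ (𝒢.unit x))).1) q.1 := by
    filter_upwards [eventually_eventually_nhds.2 hV.hor, eventually_eventually_nhds.2 hW.hor,
      hdV, hdW, hU0.eventually hdV, hU0.eventually hdW] with q h1 h2 h3 h4 h5 h6
    have hc : ∀ {v : E × F → E × F}, DifferentiableAt ℝ v (q.1, φ (𝒢.unit x)) →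
        DifferentiableAt ℝ (fun z => (v (z, φ (𝒢.unit x))).1) q.1 := fun {v} hv =>
      differentiableAt_fst.comp q.1 (DifferentiableAt.comp q.1 (g := v) hv
        (differentiableAt_id.prodMk (differentiableAt_const _)))
    have := lieBracket_of_related (κ := (Prod.fst : E × F → E)) (p := q)
      (V := fun z => (V (z, φ (𝒢.unit x))).1) (W := fun z => (W (z, φ (𝒢.unit x))).1)
      (v := V) (w := W) contDiffAt_fst (hc h5) (hc h6) h3 h4
      (h1.mono fun q' h => by rw [fderiv_fst]; exact h.symm)
      (h2.mono fun q' h => by rw [fderiv_fst]; exact h.symm)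
    rw [fderiv_fst] at this
    exact this.symm
  refine ⟨?_, ?_, ?_, ?_⟩
  · filter_upwards [hV.smooth, hW.smooth] with q h1 h2
    exact h1.lieBracket_vectorField h2 (by simp)
  · filter_upwards [hhor, hU0.eventually hhor] with q h1 h2
    rw [h1, h2]
  · filter_upwards [hV.related, hW.related, hU.eventually hV.related, hU.eventually hW.related,
      hdV, hdW, hU.eventually hdV, hU.eventually hdW, hsnd.eventually S.eventually_good,
      hsnd.eventually (eventually_mem_chart_symm_src_tgt 𝒢 x)]
      with q h1 h2 h3 h4 h5 h6 h7 h8 h9 h10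
    set X := φ.symm q.2 with hX
    have hXs : X ∈ φ.source := φ.map_target h10.1
    have hXq : φ X = q.2 := φ.right_inv h10.1
    have hus : 𝒢.unit (𝒢.tgt X) ∈ φ.source := S.unit_mem_source h9
    have hu : 𝒢.unitC x (𝒢.tgtC x q.2) = φ (𝒢.unit (𝒢.tgt X)) := by
      rw [← hXq, tgtC_apply 𝒢 hXs, unitC_apply 𝒢 h9.1]
    have hus' : φ.symm (𝒢.unitC x (𝒢.tgtC x q.2)) = 𝒢.unit (𝒢.tgt X) := by
      rw [hu, φ.left_inv hus]
    replace h3 : ∀ᶠ p in 𝓝 (q.1, (0 : F)), V (S.kap (φ.symm (𝒢.unitC x (𝒢.tgtC x q.2))) p)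
        = fderiv ℝ (S.kap (φ.symm (𝒢.unitC x (𝒢.tgtC x q.2)))) p
          (V (S.eps (𝒢.tgt (φ.symm (𝒢.unitC x (𝒢.tgtC x q.2)))) p)) := h3
    replace h4 : ∀ᶠ p in 𝓝 (q.1, (0 : F)), W (S.kap (φ.symm (𝒢.unitC x (𝒢.tgtC x q.2))) p)
        = fderiv ℝ (S.kap (φ.symm (𝒢.unitC x (𝒢.tgtC x q.2)))) p
          (W (S.eps (𝒢.tgt (φ.symm (𝒢.unitC x (𝒢.tgtC x q.2)))) p)) := h4
    rw [hus', 𝒢.tgt_unit] at h3 h4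
    have he0 : S.eps (𝒢.tgt X) (q.1, 0) = (q.1, 𝒢.unitC x (𝒢.tgtC x q.2)) := by
      unfold Slide.eps
      rw [S.el_zero h9, hu]
    have hde := (S.contDiffAt_eps (p := (q.1, (0 : F))) h9).differentiableAt (by simp)
    have hVe : DifferentiableAt ℝ (V ∘ S.eps (𝒢.tgt X)) (q.1, 0) :=
      DifferentiableAt.comp _ (by rwa [he0]) hde
    have hWe : DifferentiableAt ℝ (W ∘ S.eps (𝒢.tgt X)) (q.1, 0) :=
      DifferentiableAt.comp _ (by rwa [he0]) hde
    -- Used for `Y = X` and for `Y = unit (tgt X)`. These have the same target, hence the same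
    -- parameter field, so both values of the bracket are images of one vector;
    -- `rightOp_rightOp_unit` compares them.
    have key : ∀ Y : G, (𝒢.tgt Y, (0 : F)) ∈ S.good → Y ∈ φ.source →
        DifferentiableAt ℝ V (q.1, φ Y) → DifferentiableAt ℝ W (q.1, φ Y) →
        (∀ᶠ p in 𝓝 (q.1, (0 : F)), V (S.kap Y p)
          = fderiv ℝ (S.kap Y) p (V (S.eps (𝒢.tgt X) p))) →
        (∀ᶠ p in 𝓝 (q.1, (0 : F)), W (S.kap Y p)
          = fderiv ℝ (S.kap Y) p (W (S.eps (𝒢.tgt X) p))) →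
        (VectorField.lieBracket ℝ V W (q.1, φ Y)).2 = S.rightOp (𝒢.unit x) Y
          (VectorField.lieBracket ℝ (V ∘ S.eps (𝒢.tgt X)) (W ∘ S.eps (𝒢.tgt X)) (q.1, 0)).2 := by
      intro Y k1 k2 k3 k4 k5 k6
      have hk0 : S.kap Y (q.1, 0) = (q.1, φ Y) := by
        unfold Slide.kap
        rw [S.move_zero k1]
      have := lieBracket_of_related (κ := S.kap Y) (p := (q.1, (0 : F))) (V := V) (W := W)
        (v := V ∘ S.eps (𝒢.tgt X)) (w := W ∘ S.eps (𝒢.tgt X))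
        (S.contDiffAt_kap k1 (by rwa [S.move_zero k1])) (by rwa [hk0]) (by rwa [hk0]) hVe hWe k5 k6
      rw [hk0, S.fderiv_kap k1 (by rwa [S.move_zero k1])] at this
      exact congrArg Prod.snd this
    have e1 := key X h9 hXs (by rwa [hXq]) (by rwa [hXq]) h1 h2
    have e2 := key (𝒢.unit (𝒢.tgt X)) (by rwa [𝒢.tgt_unit]) hus (by rwa [← hu]) (by rwa [← hu])
      h3 h4
    rw [hXq] at e1
    rw [← hu] at e2
    rw [e2, S.rightOp_rightOp_unit h9 hXs]
    exact e1
  · filter_upwards [eventually_eventually_nhds.2 hV.vertical,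
      eventually_eventually_nhds.2 hW.vertical, hdV, hdW,
      hsnd.eventually (eventually_mem_chart_symm_src_tgt 𝒢 x)] with q h1 h2 h3 h4 h5
    have hs := contDiffAt_srcC 𝒢 x h5.1 h5.2.1
    have hd : ∀ᶠ q' in 𝓝 q, ∀ v, fderiv ℝ (fun p : E × F => 𝒢.srcC x p.2) q' v
        = fderiv ℝ (𝒢.srcC x) q'.2 v.2 := by
      have hev : ∀ᶠ q' in 𝓝 q, DifferentiableAt ℝ (𝒢.srcC x) q'.2 :=
        continuousAt_snd.eventually (eventually_differentiableAt hs)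
      filter_upwards [hev] with q' hq' v
      have hf : HasFDerivAt (fun p : E × F => 𝒢.srcC x p.2) _ q' :=
        hq'.hasFDerivAt.comp q' hasFDerivAt_snd
      rw [hf.fderiv]
      rfl
    have := lieBracket_of_related (κ := fun p : E × F => 𝒢.srcC x p.2) (p := q)
      (V := fun _ => 0) (W := fun _ => 0) (v := V) (w := W)
      (hs.comp q contDiffAt_snd) (differentiableAt_const _) (differentiableAt_const _) h3 h4
      (by filter_upwards [h1, hd] with q' k1 k2; rw [k2, k1])
      (by filter_upwards [h2, hd] with q' k1 k2; rw [k2, k1])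
    rw [hd.self_of_nhds] at this
    rw [← this]
    simp [VectorField.lieBracket]

end IsLocalR

end LocalFields

end LieGroupoid

namespace LieGroupoid

/-! ### From fields of `ℛ` to local expressions, and `Υ_k` in charts -/

section FieldsToLocal

variable {E F M G : Type*}
  [NormedAddCommGroup E] [NormedSpace ℝ E] [NormedAddCommGroup F] [NormedSpace ℝ F]
  [TopologicalSpace M] [ChartedSpace E M] [TopologicalSpace G] [ChartedSpace F G]
  [IsManifold 𝓘(ℝ, E) ∞ M] [IsManifold 𝓘(ℝ, F) ∞ G]

namespace IsLocalR

variable {𝒢 : LieGroupoid E F M G} {x : M} {S : Slide 𝒢 x} {V W : E × F → E × F}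

theorem congr (hV : IsLocalR S V)
    (h : V =ᶠ[𝓝 (extChartAt 𝓘(ℝ, E) x x, extChartAt 𝓘(ℝ, F) (𝒢.unit x) (𝒢.unit x))] W) :
    IsLocalR S W := by
  set φ := extChartAt 𝓘(ℝ, F) (𝒢.unit x) with hφ
  set e := extChartAt 𝓘(ℝ, E) x with he
  have hsnd : Tendsto (fun q : E × F => q.2) (𝓝 (e x, φ (𝒢.unit x))) (𝓝 (φ (𝒢.unit x))) :=
    continuousAt_snd
  have hfst : Tendsto (fun q : E × F => q.1) (𝓝 (e x, φ (𝒢.unit x))) (𝓝 (e x)) :=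
    continuousAt_fst
  have hU : Tendsto (fun q : E × F => (q.1, 𝒢.unitC x (𝒢.tgtC x q.2)))
      (𝓝 (e x, φ (𝒢.unit x))) (𝓝 (e x, φ (𝒢.unit x))) :=
    hfst.prodMk_nhds ((tendsto_unitC 𝒢 x).comp ((tendsto_tgtC 𝒢 x).comp hsnd))
  have hU0 : Tendsto (fun q : E × F => (q.1, φ (𝒢.unit x)))
      (𝓝 (e x, φ (𝒢.unit x))) (𝓝 (e x, φ (𝒢.unit x))) :=
    hfst.prodMk_nhds tendsto_const_nhds
  refine ⟨?_, ?_, ?_, ?_⟩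
  · filter_upwards [hV.smooth, eventually_eventually_nhds.2 h] with q h1 h2
    exact h1.congr_of_eventuallyEq (EventuallyEq.symm h2)
  · filter_upwards [hV.hor, h, hU0.eventually h] with q h1 h2 h3
    rw [← h2, ← h3, h1]
  · filter_upwards [hV.ver, h, hU.eventually h] with q h1 h2 h3
    rw [← h2, ← h3, h1]
  · filter_upwards [hV.vertical, h] with q h1 h2
    rw [← h2, h1]

end IsLocalR

/-- Vector fields on `M × G` which are near `(x, unit x)` smooth, right invariant and
projectable. -/
structure Field.IsLocal {𝒢 : LieGroupoid E F M G} {x : M} (S : Slide 𝒢 x) (Ξ : Field E F M G) :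
    Prop where
  smooth : ∀ᶠ p in 𝓝 (x, 𝒢.unit x), Ξ.SmoothAt p
  local_expr : IsLocalR S (Ξ.coord x (𝒢.unit x))

variable {𝒢 : LieGroupoid E F M G} {x : M} {S : Slide 𝒢 x}

theorem tendsto_extChartAt_symm_prod (x : M) (g : G) :
    Tendsto (fun q : E × F => ((extChartAt 𝓘(ℝ, E) x).symm q.1, (extChartAt 𝓘(ℝ, F) g).symm q.2))
      (𝓝 (extChartAt 𝓘(ℝ, E) x x, extChartAt 𝓘(ℝ, F) g g)) (𝓝 (x, g)) :=
  ((tendsto_extChartAt_symm x).comp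
    (continuousAt_fst (p := (extChartAt 𝓘(ℝ, E) x x, extChartAt 𝓘(ℝ, F) g g)))).prodMk_nhds
    ((tendsto_extChartAt_symm g).comp
      (continuousAt_snd (p := (extChartAt 𝓘(ℝ, E) x x, extChartAt 𝓘(ℝ, F) g g))))

theorem eventually_mem_extChartAt_target_prod (x : M) (g : G) :
    ∀ᶠ q in 𝓝 (extChartAt 𝓘(ℝ, E) x x, extChartAt 𝓘(ℝ, F) g g),
      q.1 ∈ (extChartAt 𝓘(ℝ, E) x).target ∧ q.2 ∈ (extChartAt 𝓘(ℝ, F) g).target :=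
  ((continuousAt_fst (p := (extChartAt 𝓘(ℝ, E) x x, extChartAt 𝓘(ℝ, F) g g))).eventually
    (extChartAt_target_mem_nhds (I := 𝓘(ℝ, E)) x)).and
    ((continuousAt_snd (p := (extChartAt 𝓘(ℝ, E) x x, extChartAt 𝓘(ℝ, F) g g))).eventually (extChartAt_target_mem_nhds (I := 𝓘(ℝ, F)) g))

theorem Field.eventually_contDiffAt_coord {Ξ : Field E F M G} {g : G}
    (h : ∀ᶠ p in 𝓝 (x, g), Ξ.SmoothAt p) :
    ∀ᶠ q in 𝓝 (extChartAt 𝓘(ℝ, E) x x, extChartAt 𝓘(ℝ, F) g g),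
      ContDiffAt ℝ ∞ (Ξ.coord x g) q := by
  filter_upwards [eventually_mem_extChartAt_target_prod x g,
    (tendsto_extChartAt_symm_prod x g).eventually h] with q h1 h2
  exact Field.contDiffAt_coord h1.1 h1.2 h2

theorem Field.coord_apply (Ξ : Field E F M G) {x : M} {g : G} {a : M} {X : G}
    (ha : a ∈ (extChartAt 𝓘(ℝ, E) x).source) (hX : X ∈ (extChartAt 𝓘(ℝ, F) g).source) :
    Ξ.coord x g (extChartAt 𝓘(ℝ, E) x a, extChartAt 𝓘(ℝ, F) g X)
      = (chartVec x a (Ξ.hor a X), chartVec g X (Ξ.ver a X)) := by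
  unfold Field.coord
  rw [(extChartAt 𝓘(ℝ, E) x).left_inv ha, (extChartAt 𝓘(ℝ, F) g).left_inv hX]

theorem Field.smoothAt_of_coord {Ξ : Field E F M G} {x : M} {g : G} {p : M × G}
    (ha : p.1 ∈ (extChartAt 𝓘(ℝ, E) x).source) (hX : p.2 ∈ (extChartAt 𝓘(ℝ, F) g).source)
    (h : ContDiffAt ℝ ∞ (Ξ.coord x g) (extChartAt 𝓘(ℝ, E) x p.1, extChartAt 𝓘(ℝ, F) g p.2)) :
    Ξ.SmoothAt p := by
  rw [Field.smoothAt_iff ha hX]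
  have hc : ContMDiffAt (𝓘(ℝ, E).prod 𝓘(ℝ, F)) 𝓘(ℝ, E × F) ∞
      (fun p : M × G => (extChartAt 𝓘(ℝ, E) x p.1, extChartAt 𝓘(ℝ, F) g p.2)) p :=
    ((contMDiffAt_extChartAt_of_mem (F := E) ha).comp p contMDiffAt_fst).prodMk_space
      ((contMDiffAt_extChartAt_of_mem (F := F) hX).comp p contMDiffAt_snd)
  have h1 := ContMDiffAt.comp p (h.contMDiffAt) hc
  have hev : ∀ᶠ p' : M × G in 𝓝 p, p'.1 ∈ (extChartAt 𝓘(ℝ, E) x).source ∧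
      p'.2 ∈ (extChartAt 𝓘(ℝ, F) g).source :=
    (continuousAt_fst.eventually (extChartAt_source_mem_nhds' ha)).and
      (continuousAt_snd.eventually (extChartAt_source_mem_nhds' hX))
  constructor
  · refine (ContMDiffAt.comp p (contDiff_fst.contMDiff.contMDiffAt (n := ∞)
      (I := 𝓘(ℝ, E × F)) (I' := 𝓘(ℝ, E))) h1).congr_of_eventuallyEq ?_
    filter_upwards [hev] with p' hp'
    simp only [Function.comp_apply]
    rw [Ξ.coord_apply hp'.1 hp'.2]
  · refine (ContMDiffAt.comp p (contDiff_snd.contMDiff.contMDiffAt (n := ∞)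
      (I := 𝓘(ℝ, E × F)) (I' := 𝓘(ℝ, F))) h1).congr_of_eventuallyEq ?_
    filter_upwards [hev] with p' hp'
    simp only [Function.comp_apply]
    rw [Ξ.coord_apply hp'.1 hp'.2]

theorem Field.coord_bracket_eventuallyEq [CompleteSpace E] [CompleteSpace F]
    {Ξ H : Field E F M G} {g : G} (hΞ : ∀ᶠ p in 𝓝 (x, g), Ξ.SmoothAt p)
    (hH : ∀ᶠ p in 𝓝 (x, g), H.SmoothAt p) :
    (fieldBracket Ξ H).coord x g =ᶠ[𝓝 (extChartAt 𝓘(ℝ, E) x x, extChartAt 𝓘(ℝ, F) g g)]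
      VectorField.lieBracket ℝ (Ξ.coord x g) (H.coord x g) := by
  filter_upwards [eventually_mem_extChartAt_target_prod x g,
    (tendsto_extChartAt_symm_prod x g).eventually hΞ,
    (tendsto_extChartAt_symm_prod x g).eventually hH] with q h1 h2 h3
  exact Field.coord_bracket h1.1 h1.2 h2 h3

theorem Field.IsLocal.bracket [CompleteSpace E] [CompleteSpace F] {Ξ H : Field E F M G}
    (hΞ : Ξ.IsLocal S) (hH : H.IsLocal S) : (fieldBracket Ξ H).IsLocal S := by
  have hb := Field.coord_bracket_eventuallyEq hΞ.smooth hH.smooth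
  have hl := (hΞ.local_expr.lieBracket hH.local_expr).congr hb.symm
  refine ⟨?_, hl⟩
  have hc : Tendsto (fun p : M × G => (extChartAt 𝓘(ℝ, E) x p.1,
      extChartAt 𝓘(ℝ, F) (𝒢.unit x) p.2)) (𝓝 (x, 𝒢.unit x))
      (𝓝 (extChartAt 𝓘(ℝ, E) x x, extChartAt 𝓘(ℝ, F) (𝒢.unit x) (𝒢.unit x))) :=
    ((continuousAt_extChartAt x).tendsto.comp
      (continuousAt_fst (p := (x, 𝒢.unit x)))).prodMk_nhds
      ((continuousAt_extChartAt (𝒢.unit x)).tendsto.comp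
        (continuousAt_snd (p := (x, 𝒢.unit x))))
  filter_upwards [hc.eventually hl.smooth,
    (continuousAt_fst (p := (x, 𝒢.unit x))).eventually (extChartAt_source_mem_nhds (I := 𝓘(ℝ, E)) x),
    (continuousAt_snd (p := (x, 𝒢.unit x))).eventually (extChartAt_source_mem_nhds (I := 𝓘(ℝ, F)) (𝒢.unit x))]
    with p h1 h2 h3
  exact Field.smoothAt_of_coord h2 h3 h1

theorem eventually_mem_saturation {O : Set (M × M)} (hO : IsOpen O) (hx : (x, x) ∈ O) :
    ∀ᶠ p in 𝓝 (x, 𝒢.unit x), (p.1, 𝒢.tgt p.2) ∈ O := by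
  have hc : Continuous (fun p : M × G => (p.1, 𝒢.tgt p.2)) :=
    continuous_fst.prodMk (𝒢.smooth_tgt.continuous.comp continuous_snd)
  exact hc.continuousAt.eventually (hO.mem_nhds (by simpa [𝒢.tgt_unit] using hx))

theorem IsR.smoothAt {O : Set (M × M)} (hO : IsOpen O) {Ξ : Field E F M G} (h : IsR 𝒢 O Ξ)
    {p : M × G} (hp : (p.1, 𝒢.tgt p.2) ∈ O) : Ξ.SmoothAt p := by
  have hc : Continuous (fun p : M × G => (p.1, 𝒢.tgt p.2)) :=
    continuous_fst.prodMk (𝒢.smooth_tgt.continuous.comp continuous_snd)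
  exact h.smooth.contMDiffAt ((hO.preimage hc).mem_nhds hp)

theorem IsR.ver_eq {O : Set (M × M)} {Ξ : Field E F M G} (h : IsR 𝒢 O Ξ)
    {a : M} {X : G} (hp : (a, 𝒢.tgt X) ∈ O) :
    Ξ.ver a X = 𝒢.rightInvariant (fun y => Ξ.ver a (𝒢.unit y)) X := by
  have h1 := h.ver_invariant a (𝒢.unit (𝒢.tgt X)) X (𝒢.src_unit _) (by rwa [𝒢.tgt_unit])
  have h2 : ∀ Y, Y = X → (Ξ.ver a Y : F) = Ξ.ver a X := fun Y hY => by rw [hY]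
  exact (h2 _ (𝒢.unit_mul X)).symm.trans h1

/-- A saturated domain contains `(a, unit (tgt X))` along with `(a, X)`. Invariance for the product
`unit (tgt X) · X = X` then becomes the formula with `rightOp`. -/
theorem IsR.isLocal {O : Set (M × M)} (hO : IsOpen O) (hx : (x, x) ∈ O)
    {Ξ : Field E F M G} (h : IsR 𝒢 O Ξ) (S : Slide 𝒢 x) : Ξ.IsLocal S := by
  have hs : ∀ᶠ p in 𝓝 (x, 𝒢.unit x), Ξ.SmoothAt p :=
    (eventually_mem_saturation hO hx).mono fun p hp => h.smoothAt hO hp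
  refine ⟨hs, ?_⟩
  have hsat := (tendsto_extChartAt_symm_prod (E := E) (F := F) x (𝒢.unit x)).eventually
    (eventually_mem_saturation (𝒢 := 𝒢) hO hx)
  have hdiag : ∀ᶠ q : E × F in 𝓝 (extChartAt 𝓘(ℝ, E) x x,
      extChartAt 𝓘(ℝ, F) (𝒢.unit x) (𝒢.unit x)), ((extChartAt 𝓘(ℝ, E) x).symm q.1, x) ∈ O := by
    have hc : Tendsto (fun q : E × F => ((extChartAt 𝓘(ℝ, E) x).symm q.1, x))
        (𝓝 (extChartAt 𝓘(ℝ, E) x x, extChartAt 𝓘(ℝ, F) (𝒢.unit x) (𝒢.unit x))) (𝓝 (x, x)) :=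
      ((tendsto_extChartAt_symm x).comp (continuousAt_fst (p := (extChartAt 𝓘(ℝ, E) x x,
        extChartAt 𝓘(ℝ, F) (𝒢.unit x) (𝒢.unit x))))).prodMk_nhds tendsto_const_nhds
    exact hc.eventually (hO.mem_nhds hx)
  have hsnd : Tendsto (fun q : E × F => q.2) (𝓝 (extChartAt 𝓘(ℝ, E) x x,
      extChartAt 𝓘(ℝ, F) (𝒢.unit x) (𝒢.unit x)))
      (𝓝 (extChartAt 𝓘(ℝ, F) (𝒢.unit x) (𝒢.unit x))) := continuousAt_snd
  refine ⟨Field.eventually_contDiffAt_coord hs, ?_, ?_, ?_⟩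
  · filter_upwards [hsat, hdiag] with q h1 h2
    change chartVec x _ _ = chartVec x _ _
    rw [extChartAt_to_inv]
    exact congrArg _ (h.projectable _ _ _ h1 (by rwa [𝒢.tgt_unit]))
  · filter_upwards [hsat, hsnd.eventually S.eventually_good,
      hsnd.eventually (eventually_mem_chart_symm_src_tgt 𝒢 x)] with q h1 h2 h3
    have hXs := (extChartAt 𝓘(ℝ, F) (𝒢.unit x)).map_target h3.1
    have hu : 𝒢.unitC x (𝒢.tgtC x q.2) = extChartAt 𝓘(ℝ, F) (𝒢.unit x)
        (𝒢.unit (𝒢.tgt ((extChartAt 𝓘(ℝ, F) (𝒢.unit x)).symm q.2))) := unitC_apply 𝒢 h2.1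
    have h4 := S.chartVec_rightInvariant (p := 𝒢.unit x) h2 hXs
      (θ := fun y => Ξ.ver ((extChartAt 𝓘(ℝ, E) x).symm q.1) (𝒢.unit y))
      (h.tangent_fibres _ _ (by rwa [𝒢.tgt_unit]))
    change chartVec (𝒢.unit x) _ _ = S.rightOp _ _ (chartVec (𝒢.unit x) _ _)
    rw [h.ver_eq h1, h4, hu, (extChartAt 𝓘(ℝ, F) (𝒢.unit x)).left_inv (S.unit_mem_source h2)]
  · filter_upwards [hsat, hsnd.eventually (eventually_mem_chart_symm_src_tgt 𝒢 x)] with q h1 h2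
    have h3 := chartVec_mfderiv_eq_fderiv (f := 𝒢.src) (𝒢.unit x) x
      (𝒢.smooth_src.contMDiffAt.mdifferentiableAt (by simp))
      ((extChartAt 𝓘(ℝ, F) (𝒢.unit x)).map_target h2.1) h2.2.1
      (Ξ.ver ((extChartAt 𝓘(ℝ, E) x).symm q.1) _)
    rw [h.tangent_fibres _ _ h1, (extChartAt 𝓘(ℝ, F) (𝒢.unit x)).right_inv h2.1] at h3
    exact h3.symm.trans (chartVec_zero _ _)

namespace Field.IsLocal

variable {Ξ : Field E F M G}

theorem eventually_mem_localSections (h : Ξ.IsLocal S) :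
    ∀ᶠ y in 𝓝 x, (fun y' => Ξ.ver y (𝒢.unit y')) ∈ localSections 𝒢 y := by
  have hd : Tendsto (fun p : M × M => (p.1, 𝒢.unit p.2)) (𝓝 (x, x)) (𝓝 (x, 𝒢.unit x)) :=
    (continuousAt_fst (p := (x, x))).tendsto.prodMk_nhds
      ((𝒢.smooth_unit.continuous.continuousAt (x := x)).tendsto.comp
        (continuousAt_snd (p := (x, x))))
  have hu : Tendsto (fun p : M × M => 𝒢.unit p.2) (𝓝 (x, x)) (𝓝 (𝒢.unit x)) :=
    (continuous_snd.tendsto _).comp hd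
  have hc : Tendsto (fun p : M × M => (extChartAt 𝓘(ℝ, E) x p.1,
      extChartAt 𝓘(ℝ, F) (𝒢.unit x) (𝒢.unit p.2))) (𝓝 (x, x))
      (𝓝 (extChartAt 𝓘(ℝ, E) x x, extChartAt 𝓘(ℝ, F) (𝒢.unit x) (𝒢.unit x))) :=
    ((continuousAt_extChartAt x).tendsto.comp
      (continuousAt_fst (p := (x, x)))).prodMk_nhds
      ((continuousAt_extChartAt (𝒢.unit x)).tendsto.comp hu)
  have hall := (hd.eventually h.smooth).and ((hc.eventually h.local_expr.vertical).and
    (((continuousAt_fst (p := (x, x))).eventually (extChartAt_source_mem_nhds (I := 𝓘(ℝ, E)) x)).and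
      (((continuousAt_snd (p := (x, x))).eventually (extChartAt_source_mem_nhds (I := 𝓘(ℝ, E)) x)).and
        (hu.eventually (extChartAt_source_mem_nhds (I := 𝓘(ℝ, F)) (𝒢.unit x))))))
  have hdiag : Tendsto (fun y : M => (y, y)) (𝓝 x) (𝓝 (x, x)) :=
    tendsto_id.prodMk_nhds tendsto_id
  filter_upwards [hdiag.eventually (eventually_eventually_nhds.2 hall)] with y hy
  have hy' : Tendsto (fun y' : M => (y, y')) (𝓝 y) (𝓝 (y, y)) :=
    tendsto_const_nhds.prodMk_nhds tendsto_id
  filter_upwards [hy'.eventually hy] with y' ⟨h1, h2, h3, h4, h5⟩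
  constructor
  · rw [contMDiffAt_along_iff' (𝒢.unit x) 𝒢.smooth_unit.contMDiffAt h5]
    exact ContMDiffAt.comp y' (f := fun y' => (y, 𝒢.unit y'))
      ((Field.smoothAt_iff (p := (y, 𝒢.unit y')) h3 h5).1 h1).2
      (contMDiffAt_const.prodMk 𝒢.smooth_unit.contMDiffAt)
  · rw [Ξ.coord_apply h3 h5] at h2
    have hs : 𝒢.src (𝒢.unit y') ∈ (extChartAt 𝓘(ℝ, E) x).source := by rwa [𝒢.src_unit]
    have h6 := chartVec_mfderiv_eq_fderiv (f := 𝒢.src) (𝒢.unit x) x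
      (𝒢.smooth_src.contMDiffAt.mdifferentiableAt (by simp)) h5 hs (Ξ.ver y (𝒢.unit y'))
    exact chartVec_injective (F := E) hs (h6.trans (h2.trans (chartVec_zero _ _).symm))

/-- The point `z` plays two roles: it is frozen in the first slot of the field, and it is the base
point at which the jet in the second slot is taken. The Spencer operator measures the dependence on
the frozen slot. -/
theorem jetC_upsilon (h : Ξ.IsLocal S) (k : ℕ) :
    ∀ᶠ z in 𝓝 (extChartAt 𝓘(ℝ, E) x x), 𝒢.jetC x (fun y => (𝒢.upsilon k Ξ y).2) z
      = taylor k (fun z' => (Ξ.coord x (𝒢.unit x) (z, 𝒢.unitC x z')).2) z := by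
  filter_upwards [eventually_eventually_nhds.2 (eventually_mem_chart_symm 𝒢 x),
    (tendsto_extChartAt_symm x).eventually h.eventually_mem_localSections] with z h1 h2
  have h1' := h1.self_of_nhds
  unfold jetC upsilon
  simp only
  rw [jet_of_mem 𝒢 k h2, jetCoord_toJet' 𝒢 k ((extChartAt 𝓘(ℝ, E) x).map_target h1'.1) h1'.2,
    (extChartAt 𝓘(ℝ, E) x).right_inv h1'.1]
  refine taylor_congr ?_
  filter_upwards [h1] with z' hz'
  unfold localExpr Field.coord unitC inCharts
  rw [(extChartAt 𝓘(ℝ, F) (𝒢.unit x)).left_inv hz'.2]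

theorem chartVec_upsilon (Ξ : Field E F M G) (k : ℕ) :
    ∀ᶠ z in 𝓝 (extChartAt 𝓘(ℝ, E) x x), chartVec x ((extChartAt 𝓘(ℝ, E) x).symm z)
      ((𝒢.upsilon k Ξ ((extChartAt 𝓘(ℝ, E) x).symm z)).1)
      = (Ξ.coord x (𝒢.unit x) (z, 𝒢.unitC x z)).1 := by
  filter_upwards [eventually_mem_chart_symm 𝒢 x] with z hz
  unfold upsilon Field.coord unitC inCharts
  rw [(extChartAt 𝓘(ℝ, F) (𝒢.unit x)).left_inv hz.2]

end Field.IsLocal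

end FieldsToLocal

end LieGroupoid

namespace LieGroupoid

/-! ### The bracket on jets, the bracket of fields and the Spencer derivative -/

section Formulas

variable {E F M G : Type*}
  [NormedAddCommGroup E] [NormedSpace ℝ E] [NormedAddCommGroup F] [NormedSpace ℝ F]
  [TopologicalSpace M] [ChartedSpace E M] [TopologicalSpace G] [ChartedSpace F G]
  [IsManifold 𝓘(ℝ, E) ∞ M] [IsManifold 𝓘(ℝ, F) ∞ G]

/-- The local expression `V` of a right invariant field represents the family of jets `j`
near `x`. -/
def Represents {𝒢 : LieGroupoid E F M G} {k : ℕ} (x : M) (V : E × F → E × F)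
    (j : Π y : M, Jet 𝒢 k y) : Prop :=
  ∀ᶠ z in 𝓝 (extChartAt 𝓘(ℝ, E) x x),
    𝒢.jetC x j z = taylor k (fun z' => (V (z, 𝒢.unitC x z')).2) z

/-- The local expression of `rightInvariantJet` in terms of a right invariant field. -/
def jetField (𝒢 : LieGroupoid E F M G) (k : ℕ) (x : M) (V : E × F → E × F)
    (c : TaylorSpace E F k) : TaylorSpace E F k :=
  taylor k (fun z => (V (𝒢.tgtC x (taylorPoly (extChartAt 𝓘(ℝ, E) x x) c
    (extChartAt 𝓘(ℝ, E) x x)), taylorPoly (extChartAt 𝓘(ℝ, E) x x) c z)).2)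
    (extChartAt 𝓘(ℝ, E) x x)

variable {𝒢 : LieGroupoid E F M G} {x : M} {S : Slide 𝒢 x} {V W : E × F → E × F} {k : ℕ}

theorem eventually_contDiffAt_unitC (𝒢 : LieGroupoid E F M G) (x : M) :
    ∀ᶠ z in 𝓝 (extChartAt 𝓘(ℝ, E) x x), ContDiffAt ℝ ∞ (𝒢.unitC x) z :=
  (eventually_mem_chart_symm 𝒢 x).mono fun _ hz => contDiffAt_unitC 𝒢 x hz.1 hz.2

theorem taylor_taylorPoly_unitJet (𝒢 : LieGroupoid E F M G) (x : M) (k : ℕ) :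
    taylor k (taylorPoly (extChartAt 𝓘(ℝ, E) x x) (𝒢.unitJet k x)) (extChartAt 𝓘(ℝ, E) x x)
      = taylor k (𝒢.unitC x) (extChartAt 𝓘(ℝ, E) x x) :=
  taylor_taylorPoly (eventually_contDiffAt_unitC 𝒢 x)

theorem taylorPoly_unitJet_self (𝒢 : LieGroupoid E F M G) (x : M) (k : ℕ) :
    taylorPoly (extChartAt 𝓘(ℝ, E) x x) (𝒢.unitJet k x) (extChartAt 𝓘(ℝ, E) x x)
      = extChartAt 𝓘(ℝ, F) (𝒢.unit x) (𝒢.unit x) := by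
  rw [taylor_eq_apply (taylor_taylorPoly_unitJet 𝒢 x k), unitC_apply_self]

theorem contDiff_taylorPoly_left (k : ℕ) (z₀ z : E) :
    ContDiff ℝ ∞ (fun c : TaylorSpace E F k => taylorPoly z₀ c z) :=
  (contDiff_taylorPoly k).comp ((contDiff_const.prodMk contDiff_id).prodMk contDiff_const)

theorem contDiff_taylorPoly_right {k : ℕ} (z₀ : E) (c : TaylorSpace E F k) :
    ContDiff ℝ ∞ (taylorPoly z₀ c) :=
  (contDiff_taylorPoly k).comp ((contDiff_const (c := (z₀, c))).prodMk contDiff_id)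

theorem Slide.contDiffAt_rightOp {X : F}
    (h : (𝒢.tgt ((extChartAt 𝓘(ℝ, F) (𝒢.unit x)).symm X), (0 : F)) ∈ S.good)
    (hX : X ∈ (extChartAt 𝓘(ℝ, F) (𝒢.unit x)).target) :
    ContDiffAt ℝ ∞ (fun X => S.rightOp (𝒢.unit x) ((extChartAt 𝓘(ℝ, F) (𝒢.unit x)).symm X)) X := by
  have hs := (extChartAt 𝓘(ℝ, F) (𝒢.unit x)).map_target hX
  have := contDiffAt_comp_symm (𝒢.unit x) (S.contMDiffAt_rightOp h hs) hs
  rwa [(extChartAt 𝓘(ℝ, F) (𝒢.unit x)).right_inv hX] at this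

theorem eventually_verticality {θ : Π y : M, TangentSpace 𝓘(ℝ, F) (𝒢.unit y)} {y : M}
    (h : θ ∈ localSections 𝒢 y) :
    ∀ᶠ y' in 𝓝 y, mfderiv 𝓘(ℝ, F) 𝓘(ℝ, E) 𝒢.src (𝒢.unit y') (θ y') = 0 :=
  h.mono fun _ h => h.2

/-- The right invariant field on jets in terms of a representing right invariant field. -/
theorem rightInvariantJet_eventuallyEq {U : Opens M} {ξ : JetSection 𝒢 k U} (hV : IsLocalR S V)
    (hr : Represents x V (extendJet ξ)) :
    𝒢.rightInvariantJet k x ξ =ᶠ[𝓝 (𝒢.unitJet k x)] 𝒢.jetField k x V := by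
  set φ := extChartAt 𝓘(ℝ, F) (𝒢.unit x) with hφ
  set e := extChartAt 𝓘(ℝ, E) x with he
  have hpc : Tendsto (fun c : TaylorSpace E F k => taylorPoly (e x) c (e x))
      (𝓝 (𝒢.unitJet k x)) (𝓝 (φ (𝒢.unit x))) := by
    have := (contDiff_taylorPoly_left (F := F) k (e x) (e x)).continuous.tendsto (𝒢.unitJet k x)
    rwa [taylorPoly_unitJet_self] at this
  have hyc := (tendsto_tgtC 𝒢 x).comp hpc
  have hpair : Tendsto (fun c : TaylorSpace E F k => (𝒢.tgtC x (taylorPoly (e x) c (e x)),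
      taylorPoly (e x) c (e x))) (𝓝 (𝒢.unitJet k x)) (𝓝 (e x, φ (𝒢.unit x))) :=
    hyc.prodMk_nhds hpc
  have huc := (tendsto_unitC 𝒢 x).comp hyc
  have hpairu : Tendsto (fun c : TaylorSpace E F k => (𝒢.tgtC x (taylorPoly (e x) c (e x)),
      𝒢.unitC x (𝒢.tgtC x (taylorPoly (e x) c (e x))))) (𝓝 (𝒢.unitJet k x))
      (𝓝 (e x, φ (𝒢.unit x))) := hyc.prodMk_nhds huc
  filter_upwards [hyc.eventually hr, hpair.eventually (eventually_eventually_nhds.2 hV.ver),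
    hpairu.eventually hV.smooth,
    hpc.eventually (eventually_eventually_nhds.2 S.eventually_good),
    hpc.eventually (eventually_eventually_nhds.2 (eventually_mem_chart_symm_src_tgt 𝒢 x)),
    hyc.eventually (eventually_mem_chart_symm 𝒢 x)] with c h1 h2 h3 h4 h5 h6
  simp only [Function.comp_apply] at h1 h6
  set X₀ := taylorPoly (e x) c (e x) with hX₀
  set y := 𝒢.tgt (φ.symm X₀) with hy
  have hty : 𝒢.tgtC x X₀ = e y := rfl
  have hys : y ∈ e.source := h5.self_of_nhds.2.2
  have hesy : e.symm (𝒢.tgtC x X₀) = y := by rw [hty, e.left_inv hys]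
  rw [hesy] at h6
  obtain ⟨hθ, -⟩ := exists_rep (extendJet ξ y)
  set θ := rep (extendJet ξ y) with hθd
  -- The chosen representative `θ` and the section given by `V` over `y` have the same `k`-jet at
  -- `y`. Only this jet matters, as is seen by pushing it successively through `tgt`, `rightOp` and
  -- the polynomial map.
  have hjet : taylor k (localExpr 𝒢 x θ) (e y)
      = taylor k (fun z' => (V (e y, 𝒢.unitC x z')).2) (e y) := by
    rw [← hty, ← h1]
    unfold jetC
    rw [← he, hesy]
    rfl
  have hpz : Tendsto (taylorPoly (e x) c) (𝓝 (e x)) (𝓝 X₀) :=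
    (contDiff_taylorPoly_right (e x) c).continuous.tendsto _
  have hA := S.contDiffAt_rightOp h4.self_of_nhds h5.self_of_nhds.1
  have ht : ContDiffAt ℝ ∞ (𝒢.tgtC x) X₀ :=
    contDiffAt_tgtC 𝒢 x h5.self_of_nhds.1 h5.self_of_nhds.2.2
  have hl : ContDiffAt ℝ ∞ (localExpr 𝒢 x θ) (e y) := contDiffAt_localExpr' 𝒢 hys h6.2 hθ
  have hu : ContDiffAt ℝ ∞ (𝒢.unitC x) (e y) :=
    contDiffAt_unitC 𝒢 x (e.map_source hys) (by rw [← he, e.left_inv hys]; exact h6.2)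
  have hv : ContDiffAt ℝ ∞ (fun z' => (V (e y, 𝒢.unitC x z')).2) (e y) :=
    contDiffAt_snd.comp _ (ContDiffAt.comp _ (g := V) h3 (contDiffAt_const.prodMk hu))
  have happ : ContDiff ℝ ∞ (fun p : (F →L[ℝ] F) × F => p.1 p.2) :=
    contDiff_fst.clm_apply contDiff_snd
  have e1 : taylor k (fun X => localExpr 𝒢 x θ (𝒢.tgtC x X)) X₀
      = taylor k (fun X => (V (e y, 𝒢.unitC x (𝒢.tgtC x X))).2) X₀ :=
    taylor_comp_congr (g₁ := localExpr 𝒢 x θ) ht ht hl hv rfl hjet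
  have hl2 : ContDiffAt ℝ ∞ (fun X => localExpr 𝒢 x θ (𝒢.tgtC x X)) X₀ :=
    ContDiffAt.comp X₀ (g := localExpr 𝒢 x θ) hl ht
  have hv2 : ContDiffAt ℝ ∞ (fun X => (V (e y, 𝒢.unitC x (𝒢.tgtC x X))).2) X₀ :=
    ContDiffAt.comp X₀ (g := fun z' => (V (e y, 𝒢.unitC x z')).2) hv ht
  have e2 : taylor k (fun X => S.rightOp (𝒢.unit x) (φ.symm X) (localExpr 𝒢 x θ (𝒢.tgtC x X))) X₀
      = taylor k (fun X => S.rightOp (𝒢.unit x) (φ.symm X)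
          (V (e y, 𝒢.unitC x (𝒢.tgtC x X))).2) X₀ :=
    taylor_comp_congr (g₁ := fun p : (F →L[ℝ] F) × F => p.1 p.2)
      (g₂ := fun p : (F →L[ℝ] F) × F => p.1 p.2) (hA.prodMk hl2) (hA.prodMk hv2)
      happ.contDiffAt happ.contDiffAt (taylor_prodMk_congr hA hA hl2 hv2 rfl e1) rfl
  have hpoly := (contDiff_taylorPoly_right (e x) c).contDiffAt (x := e x)
  have e3 := taylor_comp_congr (k := k) hpoly hpoly
    (g₁ := fun X => S.rightOp (𝒢.unit x) (φ.symm X) (localExpr 𝒢 x θ (𝒢.tgtC x X)))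
    (g₂ := fun X => S.rightOp (𝒢.unit x) (φ.symm X) (V (e y, 𝒢.unitC x (𝒢.tgtC x X))).2)
    (hA.clm_apply hl2) (hA.clm_apply hv2) rfl e2
  have hvert : ∀ᶠ X in 𝓝 X₀, mfderiv 𝓘(ℝ, F) 𝓘(ℝ, E) 𝒢.src (𝒢.unit (𝒢.tgt (φ.symm X)))
      (θ (𝒢.tgt (φ.symm X))) = 0 := by
    have hc : Tendsto (fun X => 𝒢.tgt (φ.symm X)) (𝓝 X₀) (𝓝 y) :=
      (𝒢.smooth_tgt.continuous.tendsto _).comp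
        (contMDiffAt_extChartAt_symm_of_mem (F := F) h5.self_of_nhds.1).continuousAt
    exact hc.eventually (eventually_verticality hθ)
  have e4 : (fun z => chartVec (𝒢.unit x) (φ.symm (taylorPoly (e x) c z))
      (𝒢.rightInvariant θ (φ.symm (taylorPoly (e x) c z)))) =ᶠ[𝓝 (e x)] fun z =>
      S.rightOp (𝒢.unit x) (φ.symm (taylorPoly (e x) c z))
        (localExpr 𝒢 x θ (𝒢.tgtC x (taylorPoly (e x) c z))) := by
    filter_upwards [hpz.eventually h4, hpz.eventually h5, hpz.eventually hvert] with z k1 k2 k3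
    rw [S.chartVec_rightInvariant k1 (φ.map_target k2.1) k3]
    have : e.symm (𝒢.tgtC x (taylorPoly (e x) c z)) = 𝒢.tgt (φ.symm (taylorPoly (e x) c z)) :=
      e.left_inv k2.2.2
    unfold localExpr
    rw [← he, this]
  -- Right invariance of `V`: its value at an identity, translated, is its value at the translated
  -- point.
  have e5 : (fun z => S.rightOp (𝒢.unit x) (φ.symm (taylorPoly (e x) c z))
      (V (e y, 𝒢.unitC x (𝒢.tgtC x (taylorPoly (e x) c z)))).2) =ᶠ[𝓝 (e x)] fun z =>
      (V (e y, taylorPoly (e x) c z)).2 := by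
    have hc : Tendsto (fun z => (e y, taylorPoly (e x) c z)) (𝓝 (e x)) (𝓝 (e y, X₀)) :=
      tendsto_const_nhds.prodMk_nhds hpz
    filter_upwards [hc.eventually h2] with z hz
    exact hz.symm
  exact (taylor_congr e4).trans (e3.trans (taylor_congr e5))

/-- The derivative of the `G`-component of `V` along the identities, in the directions `h` of `M`
and `W` of `G`. -/
def derivAlong (𝒢 : LieGroupoid E F M G) (x : M) (V W : E × F → E × F) (h : E) (z : E) : F :=
  (fderiv ℝ V (extChartAt 𝓘(ℝ, E) x x, 𝒢.unitC x z)
    (h, (W (extChartAt 𝓘(ℝ, E) x x, 𝒢.unitC x z)).2)).2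

/-- The anchor of the value at `x` of `V`. -/
def anchorC (𝒢 : LieGroupoid E F M G) (x : M) (V : E × F → E × F) : E :=
  fderiv ℝ (𝒢.tgtC x) (extChartAt 𝓘(ℝ, F) (𝒢.unit x) (𝒢.unit x))
    (V (extChartAt 𝓘(ℝ, E) x x, extChartAt 𝓘(ℝ, F) (𝒢.unit x) (𝒢.unit x))).2

theorem IsLocalR.contDiffAt_derivAlong (hV : IsLocalR S V) (hW : IsLocalR S W) (h : E) :
    ContDiffAt ℝ ∞ (𝒢.derivAlong x V W h) (extChartAt 𝓘(ℝ, E) x x) := by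
  have hu := (eventually_contDiffAt_unitC 𝒢 x).self_of_nhds
  have h1 : ContDiffAt ℝ ∞ (fun z => (extChartAt 𝓘(ℝ, E) x x, 𝒢.unitC x z))
      (extChartAt 𝓘(ℝ, E) x x) := contDiffAt_const.prodMk hu
  have hV' := hV.smooth.self_of_nhds
  have hW' := hW.smooth.self_of_nhds
  rw [← unitC_apply_self] at hV' hW'
  have h2 := ContDiffAt.comp (extChartAt 𝓘(ℝ, E) x x) (hV'.fderiv_right (m := ∞) (by simp)) h1
  have h3 := ContDiffAt.comp (extChartAt 𝓘(ℝ, E) x x) hW' h1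
  exact contDiffAt_snd.comp _ (h2.clm_apply (contDiffAt_const.prodMk (contDiffAt_snd.comp _ h3)))

/-- The derivative of `jetField V` in the direction of `jetField W` at the unit. -/
theorem fderiv_jetField (hV : IsLocalR S V) (hW : IsLocalR S W) :
    fderiv ℝ (𝒢.jetField k x V) (𝒢.unitJet k x) (𝒢.jetField k x W (𝒢.unitJet k x))
      = taylor k (𝒢.derivAlong x V W (𝒢.anchorC x W)) (extChartAt 𝓘(ℝ, E) x x) := by
  set φ := extChartAt 𝓘(ℝ, F) (𝒢.unit x) with hφ
  set e := extChartAt 𝓘(ℝ, E) x with he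
  set b := 𝒢.jetField k x W (𝒢.unitJet k x) with hb
  set p := taylorPoly (e x) (𝒢.unitJet k x) with hp
  have hp0 : p (e x) = φ (𝒢.unit x) := taylorPoly_unitJet_self 𝒢 x k
  have hps : ContDiff ℝ ∞ p := contDiff_taylorPoly_right _ _
  have hpT : taylor k p (e x) = taylor k (𝒢.unitC x) (e x) := taylor_taylorPoly_unitJet 𝒢 x k
  have hus := (eventually_contDiffAt_unitC 𝒢 x).self_of_nhds
  have htc := (eventually_mem_chart_symm_src_tgt 𝒢 x).self_of_nhds
  have hts : ContDiffAt ℝ ∞ (𝒢.tgtC x) (φ (𝒢.unit x)) := contDiffAt_tgtC 𝒢 x htc.1 htc.2.2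
  have hpt : Tendsto (fun z => (e x, p z)) (𝓝 (e x)) (𝓝 (e x, φ (𝒢.unit x))) := by
    refine tendsto_const_nhds.prodMk_nhds ?_
    have := hps.continuous.tendsto (e x)
    rwa [hp0] at this
  have htp : 𝒢.tgtC x (p (e x)) = e x := by rw [hp0, tgtC_apply_self]
  have hg : ∀ᶠ z in 𝓝 (e x), ContDiffAt ℝ ∞ (fun q : TaylorSpace E F k × E =>
      (V (𝒢.tgtC x (taylorPoly (e x) q.1 (e x)), taylorPoly (e x) q.1 q.2)).2)
      (𝒢.unitJet k x, z) := by
    filter_upwards [hpt.eventually hV.smooth] with z hz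
    have h1 : ContDiffAt ℝ ∞ (fun q : TaylorSpace E F k × E =>
        𝒢.tgtC x (taylorPoly (e x) q.1 (e x))) (𝒢.unitJet k x, z) := by
      refine ContDiffAt.comp (g := 𝒢.tgtC x) _ ?_
        ((contDiff_taylorPoly_left k (e x) (e x)).comp contDiff_fst).contDiffAt
      simp only
      rw [← hp, hp0]
      exact hts
    have h2 : ContDiffAt ℝ ∞ (fun q : TaylorSpace E F k × E => taylorPoly (e x) q.1 q.2)
        (𝒢.unitJet k x, z) :=
      ((contDiff_taylorPoly k).comp ((contDiff_const.prodMk contDiff_fst).prodMk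
        contDiff_snd)).contDiffAt
    refine contDiffAt_snd.comp _ (ContDiffAt.comp _ (g := V) ?_ (h1.prodMk h2))
    simp only
    rw [← hp, htp]
    exact hz
  have h1 := fderiv_taylor_param k b hg
  -- The coefficients `c` enter twice: through the target of the polynomial at `e x`, which occupies
  -- the first slot of `V`, and through the polynomial itself. The variation of the former in the
  -- direction `b` becomes the anchor of `W`.
  have h2 : (fun z => fderiv ℝ (fun c : TaylorSpace E F k =>
      (V (𝒢.tgtC x (taylorPoly (e x) c (e x)), taylorPoly (e x) c z)).2) (𝒢.unitJet k x) b)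
      =ᶠ[𝓝 (e x)] fun z => (fderiv ℝ V (e x, p z) (fderiv ℝ (𝒢.tgtC x) (φ (𝒢.unit x))
        (taylorPoly (e x) b (e x)), taylorPoly (e x) b z)).2 := by
    filter_upwards [hpt.eventually hV.smooth] with z hz
    obtain ⟨L₀, hL₀, hd₀⟩ := hasFDerivAt_taylorPoly (e x) (e x) (𝒢.unitJet k x)
    obtain ⟨L, hL, hd⟩ := hasFDerivAt_taylorPoly (e x) z (𝒢.unitJet k x)
    have ht' : HasFDerivAt (𝒢.tgtC x) (fderiv ℝ (𝒢.tgtC x) (φ (𝒢.unit x))) (p (e x)) := by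
      rw [hp0]; exact (hts.differentiableAt (by simp)).hasFDerivAt
    have hpr := (ht'.comp (𝒢.unitJet k x) hd₀).prodMk hd
    have hV' : HasFDerivAt V (fderiv ℝ V (e x, p z)) (𝒢.tgtC x (p (e x)), p z) := by
      rw [htp]; exact (hz.differentiableAt (by simp)).hasFDerivAt
    have hc := hasFDerivAt_snd.comp (𝒢.unitJet k x) (hV'.comp (𝒢.unitJet k x) hpr)
    have hc' : HasFDerivAt (fun c : TaylorSpace E F k =>
      (V (𝒢.tgtC x (taylorPoly (e x) c (e x)), taylorPoly (e x) c z)).2) _ (𝒢.unitJet k x) := hc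
    rw [hc'.fderiv, ← hL, ← hL₀]
    rfl
  have hWp : ∀ᶠ z in 𝓝 (e x), ContDiffAt ℝ ∞ (fun z => (W (e x, p z)).2) z := by
    filter_upwards [hpt.eventually hW.smooth] with z hz
    exact contDiffAt_snd.comp _ (ContDiffAt.comp z (g := W) hz
      (contDiffAt_const.prodMk hps.contDiffAt))
  have hbW : b = taylor k (fun z => (W (e x, p z)).2) (e x) := by
    rw [hb]
    unfold jetField
    rw [← he, ← hp, htp]
  -- `b` is the jet of an actual map, so its Taylor polynomial has the jet `b`.
  have hbT : taylor k (taylorPoly (e x) b) (e x) = taylor k (fun z => (W (e x, p z)).2) (e x) := by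
    rw [hbW]
    exact taylor_taylorPoly hWp
  have hW0 := hW.smooth.self_of_nhds
  have hWu : taylor k (fun z => (W (e x, p z)).2) (e x)
      = taylor k (fun z => (W (e x, 𝒢.unitC x z)).2) (e x) := by
    have hWs : ContDiffAt ℝ ∞ (fun X => (W (e x, X)).2) (p (e x)) := by
      rw [hp0]
      exact contDiffAt_snd.comp _ (ContDiffAt.comp _ (g := W) hW0
        (contDiffAt_const.prodMk contDiffAt_id))
    exact taylor_comp_congr (g₁ := fun X => (W (e x, X)).2) (g₂ := fun X => (W (e x, X)).2)
      hps.contDiffAt hus hWs hWs hpT rfl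
  have hb0 : taylorPoly (e x) b (e x) = (W (e x, φ (𝒢.unit x))).2 := by
    rw [taylor_eq_apply hbT, hp0]
  have hWus : ContDiffAt ℝ ∞ (fun z => (W (e x, 𝒢.unitC x z)).2) (e x) := by
    refine contDiffAt_snd.comp _ (ContDiffAt.comp _ (g := W) ?_ (contDiffAt_const.prodMk hus))
    rw [unitC_apply_self]; exact hW0
  have hbs := (contDiff_taylorPoly_right (F := F) (e x) b).contDiffAt (x := e x)
  have hGs : ContDiffAt ℝ ∞ (fun q : F × F => (fderiv ℝ V (e x, q.1)
      (𝒢.anchorC x W, q.2)).2) (p (e x), taylorPoly (e x) b (e x)) := by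
    have hf : ContDiffAt ℝ ∞ (fun q : F × F => fderiv ℝ V (e x, q.1))
        (p (e x), taylorPoly (e x) b (e x)) := by
      refine ContDiffAt.comp _ (g := fderiv ℝ V) ?_ (contDiffAt_const.prodMk contDiffAt_fst)
      rw [hp0]
      exact hV.smooth.self_of_nhds.fderiv_right (m := ∞) (by simp)
    exact contDiffAt_snd.comp _ (hf.clm_apply (contDiffAt_const.prodMk contDiffAt_snd))
  -- The polynomials `p` and `taylorPoly (e x) b` enter only through their `k`-jets, which are those
  -- of `unitC` and of `W₂` along the identities.
  have h3 := taylor_comp_congr (k := k) (g₁ := fun q : F × F => (fderiv ℝ V (e x, q.1)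
      (𝒢.anchorC x W, q.2)).2) (g₂ := fun q : F × F => (fderiv ℝ V (e x, q.1)
      (𝒢.anchorC x W, q.2)).2) (hps.contDiffAt.prodMk hbs) (hus.prodMk hWus) hGs hGs
      (taylor_prodMk_congr hps.contDiffAt hus hbs hWus hpT (hbT.trans hWu)) rfl
  refine h1.trans ((taylor_congr h2).trans ?_)
  rw [hb0]
  exact h3

/-- The bracket of right invariant fields on jets at the unit. -/
theorem lieBracket_rightInvariantJet {U : Opens M} {ξ η : JetSection 𝒢 k U} (hV : IsLocalR S V)
    (hW : IsLocalR S W) (hξ : Represents x V (extendJet ξ)) (hη : Represents x W (extendJet η)) :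
    VectorField.lieBracket ℝ (𝒢.rightInvariantJet k x ξ) (𝒢.rightInvariantJet k x η)
      (𝒢.unitJet k x)
      = taylor k (𝒢.derivAlong x W V (𝒢.anchorC x V)) (extChartAt 𝓘(ℝ, E) x x)
        - taylor k (𝒢.derivAlong x V W (𝒢.anchorC x W)) (extChartAt 𝓘(ℝ, E) x x) := by
  rw [Filter.EventuallyEq.lieBracket_vectorField_eq (rightInvariantJet_eventuallyEq hV hξ)
    (rightInvariantJet_eventuallyEq hW hη), VectorField.lieBracket, fderiv_jetField hV hW,
    fderiv_jetField hW hV]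

theorem jetCoord_sub' (𝒢 : LieGroupoid E F M G) (k : ℕ) {x₀ x : M}
    (hx : x ∈ (extChartAt 𝓘(ℝ, E) x₀).source)
    (hux : 𝒢.unit x ∈ (extChartAt 𝓘(ℝ, F) (𝒢.unit x₀)).source) (j j' : Jet 𝒢 k x) :
    jetCoord 𝒢 k x₀ x (j - j') = jetCoord 𝒢 k x₀ x j - jetCoord 𝒢 k x₀ x j' := by
  rw [extChartAt_source] at hx hux
  rw [eq_sub_iff_add_eq, ← jetCoord_add 𝒢 k hx hux, sub_add_cancel]

theorem Represents.jetProj {j : Π y : M, Jet 𝒢 (k + 1) y} (h : Represents x V j) :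
    Represents x V (fun y => jetProj 𝒢 k y (j y)) := by
  filter_upwards [h, eventually_mem_chart_symm 𝒢 x] with z h1 h2
  have h3 := (extChartAt 𝓘(ℝ, E) x).map_target h2.1
  have h4 := h2.2
  rw [extChartAt_source] at h3 h4
  unfold jetC at h1 ⊢
  rw [jetCoord_jetProj 𝒢 k h3 h4, h1]
  rfl

/-- The derivative of the `G`-component of `V` along the identities, in the direction `v`. -/
def derivFst (𝒢 : LieGroupoid E F M G) (x : M) (V : E × F → E × F) (v : E) (z : E) : F :=
  (fderiv ℝ V (extChartAt 𝓘(ℝ, E) x x, 𝒢.unitC x z) (v, 0)).2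

/-- The derivative defining the Spencer operator, in terms of a right invariant field. -/
theorem fderiv_jetC_sub (hV : IsLocalR S V) {j : Π y : M, Jet 𝒢 (k + 1) y}
    (hr : Represents x V j) (v : E) :
    fderiv ℝ (𝒢.jetC x (fun y => LieGroupoid.jetProj 𝒢 k y (j y) - jet 𝒢 k y (rep (j x))))
      (extChartAt 𝓘(ℝ, E) x x) v = taylor k (𝒢.derivFst x V v) (extChartAt 𝓘(ℝ, E) x x) := by
  set e := extChartAt 𝓘(ℝ, E) x with he
  obtain ⟨hθ, -⟩ := exists_rep (j x)
  set θ := rep (j x) with hθd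
  have hc : Tendsto e.symm (𝓝 (e x)) (𝓝 x) := tendsto_extChartAt_symm x
  have hθs : ContDiffAt ℝ ∞ (localExpr 𝒢 x θ) (e x) :=
    contDiffAt_localExpr' 𝒢 (mem_extChartAt_source x) (mem_extChartAt_source _) hθ
  have hdiag : Tendsto (fun z => (z, z)) (𝓝 (e x)) (𝓝 (e x, e x)) :=
    tendsto_id.prodMk_nhds tendsto_id
  have hux : Tendsto (fun z => (e x, 𝒢.unitC x z)) (𝓝 (e x))
      (𝓝 (e x, extChartAt 𝓘(ℝ, F) (𝒢.unit x) (𝒢.unit x))) :=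
    tendsto_const_nhds.prodMk_nhds (tendsto_unitC 𝒢 x)
  have h1 : 𝒢.jetC x (fun y => LieGroupoid.jetProj 𝒢 k y (j y) - jet 𝒢 k y θ) =ᶠ[𝓝 (e x)]
      fun z => taylor k (fun z' => (V (z, 𝒢.unitC x z')).2) z - taylor k (localExpr 𝒢 x θ) z := by
    have hθm : ∀ᶠ y in 𝓝 x, θ ∈ localSections 𝒢 y := eventually_eventually_nhds.2 hθ
    filter_upwards [hr.jetProj, eventually_mem_chart_symm 𝒢 x, hc.eventually hθm] with z h1 h2 h3
    have h4 := e.map_target h2.1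
    unfold jetC at h1 ⊢
    rw [jetCoord_sub' 𝒢 k h4 h2.2, h1, jet_of_mem 𝒢 k h3, jetCoord_toJet' 𝒢 k h4 h2.2,
      ← he, e.right_inv h2.1]
  have hg : ∀ᶠ z' in 𝓝 (e x), ContDiffAt ℝ ∞
      (fun p : E × E => (V (p.1, 𝒢.unitC x p.2)).2) (e x, z') := by
    filter_upwards [hux.eventually hV.smooth, eventually_contDiffAt_unitC 𝒢 x] with z' k1 k2
    exact contDiffAt_snd.comp _ (ContDiffAt.comp _ (g := V) k1
      (contDiffAt_fst.prodMk (ContDiffAt.comp _ (g := 𝒢.unitC x) k2 contDiffAt_snd)))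
  have hg0 := hg.self_of_nhds
  -- The two roles of the point are separated: `p.1` is frozen in `V`, `p.2` is the base point of
  -- the jet. The section to be differentiated is the restriction to the diagonal minus the
  -- prolongation of `θ`.
  have hH : ContDiffAt ℝ ∞ (fun p : E × E => taylor k (fun z' => (V (p.1, 𝒢.unitC x z')).2) p.2)
      (e x, e x) := by
    refine contDiffAt_taylor_param (P := E × E) k
      (g := fun p : (E × E) × E => (V (p.1.1, 𝒢.unitC x p.2)).2) (p := (e x, e x))
      (ζ := fun p => p.2) ?_ contDiffAt_snd
    exact ContDiffAt.comp ((e x, e x), e x) (g := fun p : E × E => (V (p.1, 𝒢.unitC x p.2)).2)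
      (f := fun p : (E × E) × E => (p.1.1, p.2)) hg0
      ((contDiffAt_fst.comp _ contDiffAt_fst).prodMk contDiffAt_snd)
  have hHd := hH.differentiableAt (by simp)
  have hθT : ContDiffAt ℝ ∞ (taylor k (localExpr 𝒢 x θ)) (e x) :=
    contDiffAt_taylor_param (P := E) k (g := fun p : E × E => localExpr 𝒢 x θ p.2)
      (ζ := fun z => z) (ContDiffAt.comp _ (g := localExpr 𝒢 x θ) hθs contDiffAt_snd) contDiffAt_id
  have hTθ : taylor (k + 1) (fun z' => (V (e x, 𝒢.unitC x z')).2) (e x)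
      = taylor (k + 1) (localExpr 𝒢 x θ) (e x) := by
    rw [← hr.self_of_nhds]
    unfold jetC
    rw [← he, e.left_inv (mem_extChartAt_source x)]
    rfl
  have hgx : ContDiffAt ℝ ∞ (fun z' => (V (e x, 𝒢.unitC x z')).2) (e x) :=
    ContDiffAt.comp _ (g := fun p : E × E => (V (p.1, 𝒢.unitC x p.2)).2) hg0
      (contDiffAt_const.prodMk contDiffAt_id)
  have hdiff : DifferentiableAt ℝ (fun z => taylor k (fun z' => (V (z, 𝒢.unitC x z')).2) z) (e x) :=
    DifferentiableAt.comp (e x) (g := fun p : E × E =>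
      taylor k (fun z' => (V (p.1, 𝒢.unitC x z')).2) p.2) (f := fun z => (z, z)) hHd
      (differentiableAt_id.prodMk differentiableAt_id)
  have h2 : fderiv ℝ (fun z => taylor k (fun z' => (V (z, 𝒢.unitC x z')).2) z) (e x) v
      = fderiv ℝ (fun p : E × E => taylor k (fun z' => (V (p.1, 𝒢.unitC x z')).2) p.2)
        (e x, e x) (v, v) := by
    have hc : HasFDerivAt (fun z => taylor k (fun z' => (V (z, 𝒢.unitC x z')).2) z) _ (e x) :=
      HasFDerivAt.comp (e x) (g := fun p : E × E =>
        taylor k (fun z' => (V (p.1, 𝒢.unitC x z')).2) p.2) (f := fun z => (z, z)) hHd.hasFDerivAt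
        ((hasFDerivAt_id (e x)).prodMk (hasFDerivAt_id (e x)))
    rw [hc.fderiv]
    rfl
  -- The derivative along the diagonal splits into two partial ones. The one in the base point
  -- cancels against `θ`, which has the same `(k + 1)`-jet at `x`; the one in the frozen slot
  -- remains and commutes with taking jets.
  rw [h1.fderiv_eq, fderiv_fun_sub hdiff (hθT.differentiableAt (by simp)),
    sub_apply, h2, show (v, v) = (v, (0 : E)) + (0, v) by simp, map_add,
    ← fderiv_partial_left hHd, ← fderiv_partial_right hHd, fderiv_taylor_param k v hg,
    fderiv_taylor_eq_of_taylor_succ_eq k hgx hθs hTθ v, add_sub_cancel_right]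
  refine taylor_congr ?_
  filter_upwards [hux.eventually hV.smooth] with z' hz'
  have hf : HasFDerivAt (fun c => (V (c, 𝒢.unitC x z')).2) _ (e x) :=
    hasFDerivAt_snd.comp (e x) (HasFDerivAt.comp (e x) (g := V)
      (hz'.differentiableAt (by simp)).hasFDerivAt
      ((hasFDerivAt_id (e x)).prodMk (hasFDerivAt_const _ _)))
  rw [hf.fderiv]
  rfl

/-- The direction along `G` is common to both terms and cancels, leaving a derivative in the
`M`-slot alone. This is the source of the Spencer terms. -/
theorem derivAlong_sub (V W : E × F → E × F) (h h' : E) :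
    𝒢.derivAlong x V W h - 𝒢.derivAlong x V W h' = 𝒢.derivFst x V (h - h') := by
  funext z
  simp only [derivAlong, derivFst, Pi.sub_apply]
  rw [← Prod.snd_sub, ← map_sub]
  simp

/-- The jet of the bracket of two right invariant fields along the identities. -/
theorem taylor_lieBracket (hV : IsLocalR S V) (hW : IsLocalR S W) :
    taylor k (fun z => (VectorField.lieBracket ℝ V W
        (extChartAt 𝓘(ℝ, E) x x, 𝒢.unitC x z)).2) (extChartAt 𝓘(ℝ, E) x x)
      = taylor k (𝒢.derivAlong x W V (V (extChartAt 𝓘(ℝ, E) x x,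
          extChartAt 𝓘(ℝ, F) (𝒢.unit x) (𝒢.unit x))).1) (extChartAt 𝓘(ℝ, E) x x)
        - taylor k (𝒢.derivAlong x V W (W (extChartAt 𝓘(ℝ, E) x x,
          extChartAt 𝓘(ℝ, F) (𝒢.unit x) (𝒢.unit x))).1) (extChartAt 𝓘(ℝ, E) x x) := by
  rw [← taylor_sub (hW.contDiffAt_derivAlong hV _) (hV.contDiffAt_derivAlong hW _)]
  have hux : Tendsto (fun z => (extChartAt 𝓘(ℝ, E) x x, 𝒢.unitC x z))
      (𝓝 (extChartAt 𝓘(ℝ, E) x x)) (𝓝 (extChartAt 𝓘(ℝ, E) x x,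
        extChartAt 𝓘(ℝ, F) (𝒢.unit x) (𝒢.unit x))) :=
    tendsto_const_nhds.prodMk_nhds (tendsto_unitC 𝒢 x)
  refine taylor_congr ?_
  -- Horizontal components do not depend on the second slot, so along the identities over the frozen
  -- point `x` they keep their value at `unit x`.
  filter_upwards [hux.eventually hV.hor, hux.eventually hW.hor] with z h1 h2
  simp only [derivAlong, Pi.sub_apply, VectorField.lieBracket, Prod.snd_sub]
  rw [← h1, ← h2]

end Formulas

end LieGroupoid

namespace LieGroupoid

/-! ### Existence of local lifts in `ℛ` and in `𝒱̃_ℛ` -/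

section Lifts

variable {E F M G : Type*}
  [NormedAddCommGroup E] [NormedSpace ℝ E] [NormedAddCommGroup F] [NormedSpace ℝ F]
  [TopologicalSpace M] [ChartedSpace E M] [TopologicalSpace G] [ChartedSpace F G]
  [IsManifold 𝓘(ℝ, E) ∞ M] [IsManifold 𝓘(ℝ, F) ∞ G]

open Classical in
/-- Extension by zero of a vector field on `U`. -/
def extendVec {U : Opens M} (v : VecSection E U) (y : M) : TangentSpace 𝓘(ℝ, E) y :=
  if h : y ∈ U then v.1 ⟨y, h⟩ else 0

theorem extendVec_apply {U : Opens M} (v : VecSection E U) {y : M} (hy : y ∈ U) :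
    extendVec v y = v.1 ⟨y, hy⟩ := dif_pos hy

theorem mem_vecSection_iff {U : Opens M} {v : Π y : U, TangentSpace 𝓘(ℝ, E) (y : M)}
    {w : Π y : M, TangentSpace 𝓘(ℝ, E) y} (h : ∀ y : U, w y = v y) (c : U → M)
    (hc : ∀ a : U, (a : M) ∈ (extChartAt 𝓘(ℝ, E) (c a)).source) :
    v ∈ VecSection E U ↔ ∀ a : U,
      ContMDiffAt 𝓘(ℝ, E) 𝓘(ℝ, E) ∞ (fun y : M => chartVec (c a) y (w y)) a := by
  refine forall_congr' fun a => ?_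
  rw [← contMDiffAt_subtype_iff]
  have h1 := contMDiffAt_along_iff' (c a) (contMDiff_subtype_val (n := ∞)).contMDiffAt (hc a) v
  refine h1.trans ?_
  simp only [h]

theorem contMDiffAt_extendVec {U : Opens M} (v : VecSection E U) {x a : M} (ha : a ∈ U)
    (hx : a ∈ (extChartAt 𝓘(ℝ, E) x).source) :
    ContMDiffAt 𝓘(ℝ, E) 𝓘(ℝ, E) ∞ (fun y : M => chartVec x y (extendVec v y)) a := by
  classical
  -- The chart at `x` is imposed at the point `a` only; every other point keeps its own chart.
  have h1 := (mem_vecSection_iff (v := v.1) (w := extendVec v) (fun y => extendVec_apply v y.2)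
    (fun b => if (b : M) = a then x else b) (fun b => by
      by_cases hb : (b : M) = a
      · simp only [hb, if_true]; exact hx
      · simp only [hb, if_false]; exact mem_extChartAt_source _)).1 v.2 ⟨a, ha⟩
  simpa only [if_true] using h1

namespace Slide

variable {𝒢 : LieGroupoid E F M G} {x : M} (S : Slide 𝒢 x)

theorem mfderiv_src_vecOf_rightOp {X : G} (h : (𝒢.tgt X, (0 : F)) ∈ S.good)
    (hX : X ∈ (extChartAt 𝓘(ℝ, F) (𝒢.unit x)).source) (v : F) :
    mfderiv 𝓘(ℝ, F) 𝓘(ℝ, E) 𝒢.src X (vecOf (𝒢.unit x) X (S.rightOp (𝒢.unit x) X v)) = 0 := by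
  have h1 := S.mfderiv_src_mfderiv_move h v
  have h2 := S.chartVec_mfderiv_move (p := 𝒢.unit x) h (by rwa [S.move_zero h]) v
  rw [S.move_zero h] at h1 h2
  have h3 : vecOf (𝒢.unit x) X (S.rightOp (𝒢.unit x) X v)
      = (mfderiv 𝓘(ℝ, F) 𝓘(ℝ, F) (S.move X) 0 v : F) :=
    (congrArg (vecOf (𝒢.unit x) X) h2.symm).trans (vecOf_chartVec hX _)
  exact (congrArg (mfderiv 𝓘(ℝ, F) 𝓘(ℝ, E) 𝒢.src X) h3).trans h1

/-- Vertical vectors at the identities are fixed by the right translation by an identity. -/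
theorem rightOp_unit_of_vertical {y : M} (h : (y, (0 : F)) ∈ S.good)
    {v : TangentSpace 𝓘(ℝ, F) (𝒢.unit y)}
    (hv : mfderiv 𝓘(ℝ, F) 𝓘(ℝ, E) 𝒢.src (𝒢.unit y) v = 0) :
    S.rightOp (𝒢.unit x) (𝒢.unit y) (chartVec (𝒢.unit x) (𝒢.unit y) v)
      = chartVec (𝒢.unit x) (𝒢.unit y) v := by
  have he : (fun w => extChartAt 𝓘(ℝ, F) (𝒢.unit x) (S.move (𝒢.unit y) w)) =ᶠ[𝓝 0]
      fun w => extChartAt 𝓘(ℝ, F) (𝒢.unit x) (S.el y w) := by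
    filter_upwards [S.eventually_good_right h] with w hw
    have := 𝒢.mul_unit (S.el y w)
    rw [S.src_el hw] at this
    rw [move, 𝒢.tgt_unit, this]
  have h1 := chartVec_mfderiv (𝒢.unit x)
    ((S.contMDiffAt_el_right h).mdifferentiableAt (by simp)) (S.el_mem_source h)
    (chartVec (F := F) (𝒢.unit x) (𝒢.unit y) v)
  have h2 := fun v => S.mfderiv_el h (v := v)
  rw [S.el_zero h] at h1 h2
  rw [rightOp, he.fderiv_eq]
  refine Eq.trans ?_ (h1.symm.trans (congrArg (chartVec (F := F) (𝒢.unit x) (𝒢.unit y)) (h2 v hv)))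
  rw [mfderiv_eq_fderiv]
  rfl

theorem rightInvariant_unit {y : M} (h : (y, (0 : F)) ∈ S.good)
    {θ : Π y : M, TangentSpace 𝓘(ℝ, F) (𝒢.unit y)}
    (hθ : mfderiv 𝓘(ℝ, F) 𝓘(ℝ, E) 𝒢.src (𝒢.unit y) (θ y) = 0) :
    𝒢.rightInvariant θ (𝒢.unit y) = θ y := by
  have hs := S.unit_mem_source h
  have h1 := S.chartVec_rightInvariant (p := 𝒢.unit x) (X := 𝒢.unit y)
    (by rwa [𝒢.tgt_unit]) hs (θ := θ) (by rwa [𝒢.tgt_unit])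
  rw [𝒢.tgt_unit, S.rightOp_unit_of_vertical h hθ] at h1
  exact chartVec_injective (F := F) hs h1

/-- The section of the algebroid with given components, projected to the vertical vectors. -/
def verticalPart (f : E → F) (y : M) : TangentSpace 𝓘(ℝ, F) (𝒢.unit y) :=
  vecOf (𝒢.unit x) (𝒢.unit y)
    (S.rightOp (𝒢.unit x) (𝒢.unit y) (f (extChartAt 𝓘(ℝ, E) x y)))

theorem mfderiv_src_verticalPart (f : E → F) {y : M} (h : (y, (0 : F)) ∈ S.good) :
    mfderiv 𝓘(ℝ, F) 𝓘(ℝ, E) 𝒢.src (𝒢.unit y) (S.verticalPart f y) = 0 :=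
  S.mfderiv_src_vecOf_rightOp (by rwa [𝒢.tgt_unit]) (S.unit_mem_source h) _

theorem chartVec_verticalPart (f : E → F) {y : M} (h : (y, (0 : F)) ∈ S.good) :
    chartVec (𝒢.unit x) (𝒢.unit y) (S.verticalPart f y)
      = S.rightOp (𝒢.unit x) (𝒢.unit y) (f (extChartAt 𝓘(ℝ, E) x y)) :=
  chartVec_vecOf (S.unit_mem_source h) _

theorem contMDiffAt_rightOp_unit {y : M} (h : (y, (0 : F)) ∈ S.good) :
    ContMDiffAt 𝓘(ℝ, E) 𝓘(ℝ, F →L[ℝ] F) ∞ (fun y => S.rightOp (𝒢.unit x) (𝒢.unit y)) y :=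
  ContMDiffAt.comp y (g := S.rightOp (𝒢.unit x))
    (S.contMDiffAt_rightOp (by rwa [𝒢.tgt_unit]) (S.unit_mem_source h))
    𝒢.smooth_unit.contMDiffAt

theorem eventually_good_unit {y : M} (h : (y, (0 : F)) ∈ S.good) :
    ∀ᶠ y' in 𝓝 y, (y', (0 : F)) ∈ S.good :=
  (tendsto_id.prodMk_nhds tendsto_const_nhds : Tendsto (fun y' : M => (y', (0 : F))) (𝓝 y)
    (𝓝 (y, 0))).eventually (S.good_mem_nhds h)

theorem verticalPart_mem_localSections {f : E → F} {y : M} (h : (y, (0 : F)) ∈ S.good)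
    (hf : ∀ᶠ z in 𝓝 (extChartAt 𝓘(ℝ, E) x y), ContDiffAt ℝ ∞ f z) :
    S.verticalPart f ∈ localSections 𝒢 y := by
  have hc : ContinuousAt (extChartAt 𝓘(ℝ, E) x) y := continuousAt_extChartAt' h.1
  filter_upwards [eventually_eventually_nhds.2 (S.eventually_good_unit h), hc.eventually hf]
    with y' h1 h2
  have h1' := h1.self_of_nhds
  refine ⟨?_, S.mfderiv_src_verticalPart f h1'⟩
  rw [contMDiffAt_along_iff' (𝒢.unit x) 𝒢.smooth_unit.contMDiffAt (S.unit_mem_source h1')]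
  have h3 : ContMDiffAt 𝓘(ℝ, E) 𝓘(ℝ, F) ∞ (fun y => f (extChartAt 𝓘(ℝ, E) x y)) y' :=
    ContMDiffAt.comp y' h2.contMDiffAt (contMDiffAt_extChartAt_of_mem (F := E) h1'.1)
  refine ((S.contMDiffAt_rightOp_unit h1').clm_apply h3).congr_of_eventuallyEq ?_
  exact h1.mono fun y'' h'' => S.chartVec_verticalPart f h''

theorem localExpr_verticalPart (f : E → F) {y : M} (h : (y, (0 : F)) ∈ S.good) :
    localExpr 𝒢 x (S.verticalPart f) =ᶠ[𝓝 (extChartAt 𝓘(ℝ, E) x y)] fun z =>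
      S.rightOp (𝒢.unit x) (𝒢.unit ((extChartAt 𝓘(ℝ, E) x).symm z)) (f z) := by
  have hc : Tendsto (extChartAt 𝓘(ℝ, E) x).symm (𝓝 (extChartAt 𝓘(ℝ, E) x y)) (𝓝 y) := by
    have := continuousAt_extChartAt_symm' (I := 𝓘(ℝ, E)) h.1
    rwa [ContinuousAt, (extChartAt 𝓘(ℝ, E) x).left_inv h.1] at this
  filter_upwards [hc.eventually (S.eventually_good_unit h),
    extChartAt_target_mem_nhds' ((extChartAt 𝓘(ℝ, E) x).map_source h.1)] with z h1 h2
  unfold localExpr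
  rw [S.chartVec_verticalPart f h1, (extChartAt 𝓘(ℝ, E) x).right_inv h2]

/-- The projection by `rightOp` at the identities depends smoothly on the point and fixes the
vertical section `μ`. Applied to a map with the `k`-jet of `μ`, it therefore gives a section with
that same `k`-jet. -/
theorem toJet_verticalPart {k : ℕ} {y : M} (h : (y, (0 : F)) ∈ S.good) {f : E → F}
    (hf : ∀ᶠ z in 𝓝 (extChartAt 𝓘(ℝ, E) x y), ContDiffAt ℝ ∞ f z) {μ : localSections 𝒢 y}
    (hT : taylor k f (extChartAt 𝓘(ℝ, E) x y)
      = taylor k (localExpr 𝒢 x μ.1) (extChartAt 𝓘(ℝ, E) x y)) :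
    toJet 𝒢 k y ⟨S.verticalPart f, S.verticalPart_mem_localSections h hf⟩ = toJet 𝒢 k y μ := by
  refine toJet_eq_of_taylor 𝒢 h.1 (S.unit_mem_source h) ?_
  have hμ := contDiffAt_localExpr' 𝒢 h.1 (S.unit_mem_source h) μ.2
  have hP := contDiffAt_comp_symm x (S.contMDiffAt_rightOp_unit h) h.1
  have happ : ContDiff ℝ ∞ (fun p : (F →L[ℝ] F) × F => p.1 p.2) :=
    contDiff_fst.clm_apply contDiff_snd
  have hf0 := hf.self_of_nhds
  have h1 := taylor_comp_congr (k := k) (g₁ := fun p : (F →L[ℝ] F) × F => p.1 p.2)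
    (g₂ := fun p : (F →L[ℝ] F) × F => p.1 p.2) (hP.prodMk hf0) (hP.prodMk hμ)
    happ.contDiffAt happ.contDiffAt (taylor_prodMk_congr hP hP hf0 hμ rfl hT) rfl
  refine (taylor_congr (S.localExpr_verticalPart f h)).trans (h1.trans (taylor_congr ?_))
  have hc : Tendsto (extChartAt 𝓘(ℝ, E) x).symm (𝓝 (extChartAt 𝓘(ℝ, E) x y)) (𝓝 y) := by
    have := continuousAt_extChartAt_symm' (I := 𝓘(ℝ, E)) h.1
    rwa [ContinuousAt, (extChartAt 𝓘(ℝ, E) x).left_inv h.1] at this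
  filter_upwards [hc.eventually (S.eventually_good_unit h),
    hc.eventually (eventually_verticality μ.2)] with z h2 h3
  exact S.rightOp_unit_of_vertical h2 h3

end Slide

variable {𝒢 : LieGroupoid E F M G}

theorem eventually_contDiffAt_localExpr {x y : M} (hx : y ∈ (extChartAt 𝓘(ℝ, E) x).source)
    (hux : 𝒢.unit y ∈ (extChartAt 𝓘(ℝ, F) (𝒢.unit x)).source)
    {θ : Π y : M, TangentSpace 𝓘(ℝ, F) (𝒢.unit y)} (hθ : θ ∈ localSections 𝒢 y) :
    ∀ᶠ z in 𝓝 (extChartAt 𝓘(ℝ, E) x y), ContDiffAt ℝ ∞ (localExpr 𝒢 x θ) z := by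
  have hc : Tendsto (extChartAt 𝓘(ℝ, E) x).symm (𝓝 (extChartAt 𝓘(ℝ, E) x y)) (𝓝 y) := by
    have := continuousAt_extChartAt_symm' (I := 𝓘(ℝ, E)) hx
    rwa [ContinuousAt, (extChartAt 𝓘(ℝ, E) x).left_inv hx] at this
  have hθm : ∀ᶠ y' in 𝓝 y, θ ∈ localSections 𝒢 y' := eventually_eventually_nhds.2 hθ
  filter_upwards [hc.eventually hθm, hc.eventually (extChartAt_source_mem_nhds' hx),
    ((𝒢.smooth_unit.continuous.tendsto y).comp hc).eventually (extChartAt_source_mem_nhds' hux),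
    extChartAt_target_mem_nhds' ((extChartAt 𝓘(ℝ, E) x).map_source hx)] with z h1 h2 h3 h4
  have := contDiffAt_localExpr' 𝒢 h2 h3 h1
  rwa [(extChartAt 𝓘(ℝ, E) x).right_inv h4] at this

theorem jet_eq_toJet_of_eventuallyEq (k : ℕ) {y : M}
    {θ μ : Π y : M, TangentSpace 𝓘(ℝ, F) (𝒢.unit y)} (hθ : θ ∈ localSections 𝒢 y)
    (h : ∀ᶠ y' in 𝓝 y, μ y' = θ y') : jet 𝒢 k y μ = toJet 𝒢 k y ⟨θ, hθ⟩ := by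
  have hμ : μ ∈ localSections 𝒢 y := by
    filter_upwards [hθ, eventually_eventually_nhds.2 h] with y' h1 h2
    refine ⟨h1.1.congr_of_eventuallyEq (h2.mono fun y'' h'' => by simp only [h'']), ?_⟩
    rw [h2.self_of_nhds]
    exact h1.2
  rw [jet_of_mem 𝒢 k hμ]
  refine toJet_eq_of_taylor 𝒢 (mem_extChartAt_source y) (mem_extChartAt_source (𝒢.unit y)) ?_
  refine taylor_congr ?_
  filter_upwards [(tendsto_extChartAt_symm (E := E) y).eventually h] with z hz
  unfold localExpr
  rw [hz]

/-- Over each `a`, the jet is realized by its Taylor polynomial, which varies smoothly with `a`,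
unlike arbitrary representatives. The polynomial is made vertical by `verticalPart` and spread over
`G` by right translation; the horizontal component is copied from `p.1`, independently of the point
of `G`. -/
theorem exists_lift [CompleteSpace E] [CompleteSpace F] {k : ℕ} {U : Opens M}
    (p : JetCheck 𝒢 k U) {x : M} (hx : x ∈ U) :
    ∃ (O : Set (M × M)) (Ξ : Field E F M G), IsOpen O ∧ (x, x) ∈ O ∧ IsR 𝒢 O Ξ ∧ Lifts O Ξ p ∧
      (p ∈ JetTilde 𝒢 k U → IsTildeV 𝒢 O Ξ) := by
  obtain ⟨S⟩ := exists_slide 𝒢 x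
  set e := extChartAt 𝓘(ℝ, E) x with he
  set j := extendJet p.2 with hj
  obtain ⟨N, hN, hNo, hxN⟩ := eventually_nhds_iff.1
    ((S.eventually_good_unit S.mem_good_self).and ((show ∀ᶠ y in 𝓝 x, y ∈ U from U.isOpen.mem_nhds hx).and
      ((continuousAt_extChartAt (I := 𝓘(ℝ, E)) x).eventually (eventually_contDiffAt_jetC p.2 hx))))
  have hgood : ∀ y ∈ N, (y, (0 : F)) ∈ S.good := fun y hy => (hN y hy).1
  set f : M → E → F := fun a => taylorPoly (e a) (𝒢.jetC x j (e a)) with hf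
  have hfs : ∀ a z, ContDiffAt ℝ ∞ (f a) z := fun a z =>
    (contDiff_taylorPoly_right _ _).contDiffAt
  have hjet : ∀ a ∈ N, ∀ h : S.verticalPart (f a) ∈ localSections 𝒢 a,
      toJet 𝒢 k a ⟨S.verticalPart (f a), h⟩ = j a := by
    intro a ha h
    have hg := hgood a ha
    obtain ⟨μ, hμ⟩ := toJet_surjective 𝒢 k a (j a)
    rw [← hμ]
    refine S.toJet_verticalPart hg (.of_forall (hfs a)) ?_
    have h1 : 𝒢.jetC x j (e a) = taylor k (localExpr 𝒢 x μ.1) (e a) := by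
      unfold jetC
      rw [← he, e.left_inv hg.1, ← hμ, jetCoord_toJet' 𝒢 k hg.1 (S.unit_mem_source hg)]
    simp only [hf]
    rw [h1]
    exact taylor_taylorPoly (eventually_contDiffAt_localExpr hg.1 (S.unit_mem_source hg) μ.2)
  have hmem : ∀ a ∈ N, ∀ b ∈ N, S.verticalPart (f a) ∈ localSections 𝒢 b := fun a _ b hb =>
    S.verticalPart_mem_localSections (hgood b hb) (.of_forall (hfs a))
  have hvert : ∀ a, ∀ X, 𝒢.tgt X ∈ N → mfderiv 𝓘(ℝ, F) 𝓘(ℝ, E) 𝒢.src (𝒢.unit (𝒢.tgt X))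
      (S.verticalPart (f a) (𝒢.tgt X)) = 0 := fun a X hX =>
    S.mfderiv_src_verticalPart _ (hgood _ hX)
  let Ξ : Field E F M G := fun q =>
    ((extendVec p.1 q.1 : E), (𝒢.rightInvariant (S.verticalPart (f q.1)) q.2 : F))
  have hO : IsOpen (N ×ˢ N) := hNo.prod hNo
  have hR : IsR 𝒢 (N ×ˢ N) Ξ := by
    refine ⟨?_, ?_, fun _ _ _ _ _ => rfl, ?_, fun _ _ _ _ _ => rfl⟩
    · intro q hq
      refine ContMDiffAt.contMDiffWithinAt ?_
      have hq1 : q.1 ∈ N := hq.1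
      have hq2 : 𝒢.tgt q.2 ∈ N := hq.2
      have hg1 := hgood _ hq1
      have hg2 := hgood _ hq2
      refine (Field.smoothAt_iff (Ξ := Ξ) (g := q.2) hg1.1 (mem_extChartAt_source _)).2 ⟨?_, ?_⟩
      · exact (contMDiffAt_extendVec p.1 (hN _ hq1).2.1 hg1.1).comp q contMDiffAt_fst
      · have hop : ContMDiffAt (𝓘(ℝ, E).prod 𝓘(ℝ, F)) 𝓘(ℝ, F →L[ℝ] F) ∞
            (fun q' : M × G => S.rightOp q.2 q'.2) q :=
          ContMDiffAt.comp q (g := S.rightOp q.2)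
            (S.contMDiffAt_rightOp hg2 (mem_extChartAt_source _)) contMDiffAt_snd
        have hop2 : ContMDiffAt (𝓘(ℝ, E).prod 𝓘(ℝ, F)) 𝓘(ℝ, F →L[ℝ] F) ∞
            (fun q' : M × G => S.rightOp (𝒢.unit x) (𝒢.unit (𝒢.tgt q'.2))) q :=
          ContMDiffAt.comp q (g := fun y => S.rightOp (𝒢.unit x) (𝒢.unit y))
            (S.contMDiffAt_rightOp_unit hg2) (𝒢.smooth_tgt.contMDiffAt.comp q contMDiffAt_snd)
        have hea : ContMDiffAt (𝓘(ℝ, E).prod 𝓘(ℝ, F)) 𝓘(ℝ, E) ∞ (fun q' : M × G => e q'.1) q :=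
          ContMDiffAt.comp q (contMDiffAt_extChartAt_of_mem (F := E) hg1.1) contMDiffAt_fst
        have hey : ContMDiffAt (𝓘(ℝ, E).prod 𝓘(ℝ, F)) 𝓘(ℝ, E) ∞
            (fun q' : M × G => e (𝒢.tgt q'.2)) q :=
          ContMDiffAt.comp q (g := e) (contMDiffAt_extChartAt_of_mem (F := E) hg2.1)
            (𝒢.smooth_tgt.contMDiffAt.comp q contMDiffAt_snd)
        have hja : ContMDiffAt (𝓘(ℝ, E).prod 𝓘(ℝ, F)) 𝓘(ℝ, TaylorSpace E F k) ∞
            (fun q' : M × G => 𝒢.jetC x j (e q'.1)) q :=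
          ContMDiffAt.comp q (g := 𝒢.jetC x j) (hN _ hq1).2.2.contMDiffAt hea
        have hpoly : ContMDiffAt (𝓘(ℝ, E).prod 𝓘(ℝ, F)) 𝓘(ℝ, F) ∞
            (fun q' : M × G => f q'.1 (e (𝒢.tgt q'.2))) q :=
          ContMDiffAt.comp q
            (g := fun p : (E × TaylorSpace E F k) × E => taylorPoly p.1.1 p.1.2 p.2)
            (contDiff_taylorPoly k).contMDiff.contMDiffAt
            ((hea.prodMk_space hja).prodMk_space hey)
        refine (hop.clm_apply (hop2.clm_apply hpoly)).congr_of_eventuallyEq ?_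
        have h2 : ∀ᶠ q' : M × G in 𝓝 q, 𝒢.tgt q'.2 ∈ N :=
          (𝒢.smooth_tgt.continuous.comp continuous_snd).continuousAt.eventually
            (hNo.mem_nhds hq2)
        have h3 : ∀ᶠ q' : M × G in 𝓝 q, q'.2 ∈ (extChartAt 𝓘(ℝ, F) q.2).source :=
          continuousAt_snd.eventually (extChartAt_source_mem_nhds (I := 𝓘(ℝ, F)) q.2)
        filter_upwards [h2, h3] with q' k2 k3
        refine (S.chartVec_rightInvariant (hgood _ k2) k3 (hvert _ _ k2)).trans ?_
        rw [S.chartVec_verticalPart _ (hgood _ k2)]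
    · intro a X h
      exact S.mfderiv_src_rightInvariant (hgood _ h.2) (hvert _ _ h.2)
    · intro a X Y hXY h
      exact (act_rightInvariant 𝒢 hXY (hvert _ _ h.2)).symm
  refine ⟨N ×ˢ N, Ξ, hO, ⟨hxN, hxN⟩, hR, ?_, ?_⟩
  · intro y hy
    refine Prod.ext ?_ ?_
    · exact extendVec_apply p.1 y.2
    · refine (jet_eq_toJet_of_eventuallyEq k (hmem y hy.1 y hy.1) ?_).trans
        ((hjet y hy.1 _).trans (extendJet_apply p.2 y.2))
      filter_upwards [hNo.mem_nhds hy.1] with y' hy'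
      exact S.rightInvariant_unit (hgood _ hy') (S.mfderiv_src_verticalPart _ (hgood _ hy'))
  · intro hp
    -- The vector tangent to `G` is the `G`-component itself: its image under `tgt_*` is the anchor
    -- of the jet, which is the horizontal part by assumption.
    refine ⟨hR, fun X hX => ⟨𝒢.rightInvariant (S.verticalPart (f (𝒢.tgt X))) X, ?_⟩⟩
    have ht := 𝒢.smooth_tgt.contMDiffAt.mdifferentiableAt (x := X) (by simp)
    have hB := mfderiv_prodMk ht (mdifferentiableAt_id (I := 𝓘(ℝ, F)) (x := X))
    rw [mfderiv_id] at hB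
    refine (congrArg (fun L : F →L[ℝ] E × F => L (𝒢.rightInvariant
      (S.verticalPart (f (𝒢.tgt X))) X)) hB).trans (Prod.ext ?_ rfl)
    refine (S.mfderiv_tgt_rightInvariant (hgood _ hX.1) (hvert _ _ hX.1)).trans ?_
    have h1 : anchor 𝒢 k (𝒢.tgt X) (toJet 𝒢 k (𝒢.tgt X)
        ⟨S.verticalPart (f (𝒢.tgt X)), hmem _ hX.1 _ hX.1⟩)
        = (mfderiv 𝓘(ℝ, F) 𝓘(ℝ, E) 𝒢.tgt (𝒢.unit (𝒢.tgt X))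
          (S.verticalPart (f (𝒢.tgt X)) (𝒢.tgt X)) : E) := rfl
    have hU := (hN _ hX.1).2.1
    rw [hjet _ hX.1, hj, extendJet_apply p.2 hU, ← hp ⟨𝒢.tgt X, hU⟩,
      ← extendVec_apply p.1 hU] at h1
    exact h1.symm

end Lifts

end LieGroupoid

namespace LieGroupoid

/-! ### Brackets of lifts at a point, and their independence of the lifts -/

section GermLifts

variable {E F M G : Type*}
  [NormedAddCommGroup E] [NormedSpace ℝ E] [NormedAddCommGroup F] [NormedSpace ℝ F]
  [TopologicalSpace M] [ChartedSpace E M] [TopologicalSpace G] [ChartedSpace F G]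
  [IsManifold 𝓘(ℝ, E) ∞ M] [IsManifold 𝓘(ℝ, F) ∞ G]

/-- `Ξ` lifts `p` on a neighbourhood of `x`. -/
def GermLifts {𝒢 : LieGroupoid E F M G} {k : ℕ} {U : Opens M} (x : M) (Ξ : Field E F M G)
    (p : JetCheck 𝒢 k U) : Prop :=
  ∀ᶠ y in 𝓝 x, 𝒢.upsilon k Ξ y = (extendVec p.1 y, extendJet p.2 y)

/-- The components of a vector field on `M` in a chart. -/
def vecC (x : M) (v : Π y : M, TangentSpace 𝓘(ℝ, E) y) (z : E) : E :=
  chartVec x ((extChartAt 𝓘(ℝ, E) x).symm z) (v ((extChartAt 𝓘(ℝ, E) x).symm z))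

variable {𝒢 : LieGroupoid E F M G} {k : ℕ} {U : Opens M} {x : M} {S : Slide 𝒢 x}
  {Ξ H : Field E F M G}

theorem Lifts.germLifts {O : Set (M × M)} (hO : IsOpen O) (hxO : (x, x) ∈ O) (hx : x ∈ U)
    {p : JetCheck 𝒢 k U} (h : Lifts O Ξ p) : GermLifts x Ξ p := by
  have hd : Tendsto (fun y : M => (y, y)) (𝓝 x) (𝓝 (x, x)) := tendsto_id.prodMk_nhds tendsto_id
  filter_upwards [hd.eventually (hO.mem_nhds hxO), U.isOpen.mem_nhds hx] with y h1 h2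
  rw [extendVec_apply p.1 h2, extendJet_apply p.2 h2]
  exact h ⟨y, h2⟩ h1

theorem GermLifts.represents {p : JetCheck 𝒢 k U} (h : GermLifts x Ξ p) (hΞ : Ξ.IsLocal S) :
    Represents x (Ξ.coord x (𝒢.unit x)) (extendJet p.2) := by
  filter_upwards [hΞ.jetC_upsilon k, (tendsto_extChartAt_symm (E := E) x).eventually h]
    with z h1 h2
  rw [← h1]
  exact (congrArg (fun r => jetCoord 𝒢 k x _ r.2) h2).symm

theorem GermLifts.vecC_eq {p : JetCheck 𝒢 k U} (h : GermLifts x Ξ p) :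
    vecC x (extendVec p.1) =ᶠ[𝓝 (extChartAt 𝓘(ℝ, E) x x)]
      fun z => (Ξ.coord x (𝒢.unit x) (z, 𝒢.unitC x z)).1 := by
  filter_upwards [Field.IsLocal.chartVec_upsilon (𝒢 := 𝒢) (x := x) Ξ k,
    (tendsto_extChartAt_symm (E := E) x).eventually h] with z h1 h2
  rw [← h1, h2]
  rfl

theorem GermLifts.coord_fst {p : JetCheck 𝒢 k U} (h : GermLifts x Ξ p) (hΞ : Ξ.IsLocal S) :
    ∀ᶠ q in 𝓝 (extChartAt 𝓘(ℝ, E) x x, extChartAt 𝓘(ℝ, F) (𝒢.unit x) (𝒢.unit x)),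
      (Ξ.coord x (𝒢.unit x) q).1 = vecC x (extendVec p.1) q.1 := by
  have hfst : Tendsto (fun q : E × F => q.1) (𝓝 (extChartAt 𝓘(ℝ, E) x x,
    extChartAt 𝓘(ℝ, F) (𝒢.unit x) (𝒢.unit x))) (𝓝 (extChartAt 𝓘(ℝ, E) x x)) := continuousAt_fst
  have hu : Tendsto (fun q : E × F => (q.1, 𝒢.unitC x q.1)) (𝓝 (extChartAt 𝓘(ℝ, E) x x,
    extChartAt 𝓘(ℝ, F) (𝒢.unit x) (𝒢.unit x))) (𝓝 (extChartAt 𝓘(ℝ, E) x x,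
    extChartAt 𝓘(ℝ, F) (𝒢.unit x) (𝒢.unit x))) :=
    hfst.prodMk_nhds ((tendsto_unitC 𝒢 x).comp hfst)
  filter_upwards [hΞ.local_expr.hor, hu.eventually hΞ.local_expr.hor,
    hfst.eventually h.vecC_eq] with q h1 h2 h3
  rw [h1, h3, h2]

theorem chartVec_upsilon_self (Ξ : Field E F M G) (k : ℕ) :
    chartVec x x (𝒢.upsilon k Ξ x).1
      = (Ξ.coord x (𝒢.unit x) (extChartAt 𝓘(ℝ, E) x x,
        extChartAt 𝓘(ℝ, F) (𝒢.unit x) (𝒢.unit x))).1 := by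
  rw [Ξ.coord_apply (mem_extChartAt_source x) (mem_extChartAt_source _)]
  rfl

theorem jetC_self (j : Π y : M, Jet 𝒢 k y) :
    𝒢.jetC x j (extChartAt 𝓘(ℝ, E) x x) = jetCoord 𝒢 k x x (j x) := by
  unfold jetC
  rw [extChartAt_to_inv]

theorem vecC_self (v : Π y : M, TangentSpace 𝓘(ℝ, E) y) :
    vecC x v (extChartAt 𝓘(ℝ, E) x x) = chartVec x x (v x) := by
  unfold vecC
  rw [extChartAt_to_inv]

theorem Field.IsLocal.jetCoord_upsilon (h : Ξ.IsLocal S) (k : ℕ) :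
    jetCoord 𝒢 k x x (𝒢.upsilon k Ξ x).2 = taylor k (fun z' => (Ξ.coord x (𝒢.unit x)
      (extChartAt 𝓘(ℝ, E) x x, 𝒢.unitC x z')).2) (extChartAt 𝓘(ℝ, E) x x) := by
  rw [← (h.jetC_upsilon k).self_of_nhds, jetC_self (fun y => (𝒢.upsilon k Ξ y).2)]

theorem anchorC_eq {j : Π y : M, Jet 𝒢 k y} {V : E × F → E × F} (h : Represents x V j) :
    𝒢.anchorC x V = chartVec x x (anchor 𝒢 k x (j x)) := by
  rw [chartVec_anchor 𝒢 (mem_extChartAt_source x) (mem_extChartAt_source _), ← jetC_self,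
    h.self_of_nhds, taylor_zero_apply, unitC_apply_self]
  rfl

section Bracket

variable [CompleteSpace E] [CompleteSpace F]

/-- The projection to `M` of the bracket. -/
theorem chartVec_upsilon_bracket (m : ℕ) {p q : JetCheck 𝒢 m U} (hΞ : Ξ.IsLocal S)
    (hH : H.IsLocal S) (hp : GermLifts x Ξ p) (hq : GermLifts x H q) :
    chartVec x x (𝒢.upsilon k (fieldBracket Ξ H) x).1
      = VectorField.lieBracket ℝ (vecC x (extendVec p.1)) (vecC x (extendVec q.1))
        (extChartAt 𝓘(ℝ, E) x x) := by
  rw [chartVec_upsilon_self,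
    (Field.coord_bracket_eventuallyEq hΞ.smooth hH.smooth).self_of_nhds]
  have hu := (eventually_contDiffAt_unitC 𝒢 x).self_of_nhds
  have hd : ∀ {Ξ : Field E F M G} {p : JetCheck 𝒢 m U}, Ξ.IsLocal S → GermLifts x Ξ p →
      DifferentiableAt ℝ (vecC x (extendVec p.1)) (extChartAt 𝓘(ℝ, E) x x) := by
    intro Ξ p hΞ hp
    have h1 := hΞ.local_expr.smooth.self_of_nhds
    rw [← unitC_apply_self] at h1
    have h2 : ContDiffAt ℝ ∞ (fun z => (Ξ.coord x (𝒢.unit x) (z, 𝒢.unitC x z)).1)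
        (extChartAt 𝓘(ℝ, E) x x) :=
      contDiffAt_fst.comp _ (ContDiffAt.comp _ (g := Ξ.coord x (𝒢.unit x)) h1
        (contDiffAt_id.prodMk hu))
    exact (h2.congr_of_eventuallyEq hp.vecC_eq).differentiableAt (by simp)
  have h := lieBracket_of_related (κ := (Prod.fst : E × F → E))
    (p := (extChartAt 𝓘(ℝ, E) x x, extChartAt 𝓘(ℝ, F) (𝒢.unit x) (𝒢.unit x)))
    (V := vecC x (extendVec p.1)) (W := vecC x (extendVec q.1))
    (v := Ξ.coord x (𝒢.unit x)) (w := H.coord x (𝒢.unit x)) contDiffAt_fst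
    (hd hΞ hp) (hd hH hq)
    (hΞ.local_expr.smooth.self_of_nhds.differentiableAt (by simp))
    (hH.local_expr.smooth.self_of_nhds.differentiableAt (by simp))
    ((hp.coord_fst hΞ).mono fun q' h => by rw [fderiv_fst]; exact h.symm)
    ((hq.coord_fst hH).mono fun q' h => by rw [fderiv_fst]; exact h.symm)
  rw [fderiv_fst] at h
  exact h.symm

/-- Of the lifted sections only the horizontal parts enter, so their order `m` is free: it is `k`
for the second bracket and `k + 1` for the first. -/
theorem jetCoord_upsilon_bracket (m : ℕ) {p q : JetCheck 𝒢 m U} (hΞ : Ξ.IsLocal S)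
    (hH : H.IsLocal S) (hp : GermLifts x Ξ p) (hq : GermLifts x H q) :
    jetCoord 𝒢 k x x (𝒢.upsilon k (fieldBracket Ξ H) x).2
      = taylor k (𝒢.derivAlong x (H.coord x (𝒢.unit x)) (Ξ.coord x (𝒢.unit x))
          (chartVec x x (extendVec p.1 x))) (extChartAt 𝓘(ℝ, E) x x)
        - taylor k (𝒢.derivAlong x (Ξ.coord x (𝒢.unit x)) (H.coord x (𝒢.unit x))
          (chartVec x x (extendVec q.1 x))) (extChartAt 𝓘(ℝ, E) x x) := by
  have hux : Tendsto (fun z => (extChartAt 𝓘(ℝ, E) x x, 𝒢.unitC x z))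
      (𝓝 (extChartAt 𝓘(ℝ, E) x x)) (𝓝 (extChartAt 𝓘(ℝ, E) x x,
        extChartAt 𝓘(ℝ, F) (𝒢.unit x) (𝒢.unit x))) :=
    tendsto_const_nhds.prodMk_nhds (tendsto_unitC 𝒢 x)
  rw [(hΞ.bracket hH).jetCoord_upsilon k, ← vecC_self, ← vecC_self,
    ← (hp.coord_fst hΞ).self_of_nhds, ← (hq.coord_fst hH).self_of_nhds,
    ← taylor_lieBracket hΞ.local_expr hH.local_expr]
  refine taylor_congr ?_
  filter_upwards [hux.eventually (Field.coord_bracket_eventuallyEq hΞ.smooth hH.smooth)] with z hz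
  rw [hz]

/-- The derivative defining the Spencer operator, in coordinates. -/
def spencerC (𝒢 : LieGroupoid E F M G) (k : ℕ) (x : M) (j : Π y : M, Jet 𝒢 (k + 1) y) (v : E) :
    TaylorSpace E F k :=
  fderiv ℝ (𝒢.jetC x (fun y => jetProj 𝒢 k y (j y) - jet 𝒢 k y (rep (j x))))
    (extChartAt 𝓘(ℝ, E) x x) v

theorem extendJet_sectionProj (ξ : JetSection 𝒢 (k + 1) U) :
    extendJet (sectionProj 𝒢 k U ξ) = fun y => jetProj 𝒢 k y (extendJet ξ y) := by
  funext y
  by_cases hy : y ∈ U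
  · rw [extendJet_apply _ hy, extendJet_apply _ hy]
    rfl
  · rw [extendJet, extendJet, dif_neg hy, dif_neg hy, map_zero]

/-- The first bracket in terms of the bracket of right invariant fields on jets and of the Spencer
operator. -/
theorem jetCoord_upsilon_bracket_first {p q : JetCheck 𝒢 (k + 1) U} (hΞ : Ξ.IsLocal S)
    (hH : H.IsLocal S) (hp : GermLifts x Ξ p) (hq : GermLifts x H q) :
    jetCoord 𝒢 k x x (𝒢.upsilon k (fieldBracket Ξ H) x).2
      = VectorField.lieBracket ℝ (𝒢.rightInvariantJet k x (sectionProj 𝒢 k U p.2))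
          (𝒢.rightInvariantJet k x (sectionProj 𝒢 k U q.2)) (𝒢.unitJet k x)
        + 𝒢.spencerC k x (extendJet q.2) (chartVec x x (extendVec p.1 x)
          - chartVec x x (anchor 𝒢 (k + 1) x (extendJet p.2 x)))
        - 𝒢.spencerC k x (extendJet p.2) (chartVec x x (extendVec q.1 x)
          - chartVec x x (anchor 𝒢 (k + 1) x (extendJet q.2 x))) := by
  have hrp := hp.represents hΞ
  have hrq := hq.represents hH
  have hV := hΞ.local_expr
  have hW := hH.local_expr
  have hrp' := hrp.jetProj
  have hrq' := hrq.jetProj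
  rw [← extendJet_sectionProj] at hrp' hrq'
  -- Subtracting the bracket on jets replaces each horizontal part by its difference from the
  -- anchor, and `fderiv_jetC_sub` recognizes the remaining terms as Spencer derivatives.
  rw [jetCoord_upsilon_bracket (k + 1) hΞ hH hp hq, lieBracket_rightInvariantJet hV hW hrp' hrq',
    spencerC, spencerC, fderiv_jetC_sub hW hrq, fderiv_jetC_sub hV hrp, ← anchorC_eq hrp,
    ← anchorC_eq hrq, ← derivAlong_sub _ (Ξ.coord x (𝒢.unit x)),
    ← derivAlong_sub _ (H.coord x (𝒢.unit x)),
    taylor_sub (hW.contDiffAt_derivAlong hV _) (hW.contDiffAt_derivAlong hV _),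
    taylor_sub (hV.contDiffAt_derivAlong hW _) (hV.contDiffAt_derivAlong hW _)]
  abel

/-- The second bracket in terms of the bracket of right invariant fields on jets. -/
theorem jetCoord_upsilon_bracket_second {p q : JetCheck 𝒢 k U} (hpT : p ∈ JetTilde 𝒢 k U)
    (hqT : q ∈ JetTilde 𝒢 k U) (hx : x ∈ U) (hΞ : Ξ.IsLocal S)
    (hH : H.IsLocal S) (hp : GermLifts x Ξ p) (hq : GermLifts x H q) :
    jetCoord 𝒢 k x x (𝒢.upsilon k (fieldBracket Ξ H) x).2
      = VectorField.lieBracket ℝ (𝒢.rightInvariantJet k x p.2)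
          (𝒢.rightInvariantJet k x q.2) (𝒢.unitJet k x) := by
  have hrp := hp.represents hΞ
  have hrq := hq.represents hH
  -- In `J̃^k 𝔤` the horizontal part is the anchor, so the two formulas agree term by term.
  rw [jetCoord_upsilon_bracket k hΞ hH hp hq, lieBracket_rightInvariantJet hΞ.local_expr
    hH.local_expr hrp hrq, anchorC_eq hrp, anchorC_eq hrq, extendVec_apply _ hx,
    extendVec_apply _ hx, extendJet_apply _ hx, extendJet_apply _ hx, hpT ⟨x, hx⟩, hqT ⟨x, hx⟩]

theorem upsilon_ext (m : ℕ) {p q : TangentSpace 𝓘(ℝ, E) x × Jet 𝒢 m x}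
    (h1 : chartVec x x p.1 = chartVec x x q.1)
    (h2 : jetCoord 𝒢 m x x p.2 = jetCoord 𝒢 m x x q.2) : p = q :=
  Prod.ext (chartVec_injective (F := E) (mem_extChartAt_source x) h1)
    (jetCoord_injective 𝒢 m (mem_extChartAt_source x) (mem_extChartAt_source _) h2)

/-- The expressions found for both components involve the fields only through the sections they
lift. -/
theorem upsilon_bracket_first_unique {p q : JetCheck 𝒢 (k + 1) U} {Ξ' H' : Field E F M G}
    {S' : Slide 𝒢 x}
    (hΞ : Ξ.IsLocal S) (hH : H.IsLocal S) (hp : GermLifts x Ξ p) (hq : GermLifts x H q)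
    (hΞ' : Ξ'.IsLocal S') (hH' : H'.IsLocal S') (hp' : GermLifts x Ξ' p) (hq' : GermLifts x H' q) :
    𝒢.upsilon k (fieldBracket Ξ H) x = 𝒢.upsilon k (fieldBracket Ξ' H') x := by
  refine upsilon_ext k ?_ ?_
  · rw [chartVec_upsilon_bracket (k + 1) hΞ hH hp hq,
      chartVec_upsilon_bracket (k + 1) hΞ' hH' hp' hq']
  · rw [jetCoord_upsilon_bracket_first hΞ hH hp hq, jetCoord_upsilon_bracket_first hΞ' hH' hp' hq']

theorem upsilon_bracket_second_unique {p q : JetCheck 𝒢 k U} (hpT : p ∈ JetTilde 𝒢 k U)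
    (hqT : q ∈ JetTilde 𝒢 k U) (hx : x ∈ U) {Ξ' H' : Field E F M G} {S' : Slide 𝒢 x}
    (hΞ : Ξ.IsLocal S) (hH : H.IsLocal S) (hp : GermLifts x Ξ p) (hq : GermLifts x H q)
    (hΞ' : Ξ'.IsLocal S') (hH' : H'.IsLocal S') (hp' : GermLifts x Ξ' p) (hq' : GermLifts x H' q) :
    𝒢.upsilon k (fieldBracket Ξ H) x = 𝒢.upsilon k (fieldBracket Ξ' H') x := by
  refine upsilon_ext k ?_ ?_
  · rw [chartVec_upsilon_bracket k hΞ hH hp hq, chartVec_upsilon_bracket k hΞ' hH' hp' hq']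
  · rw [jetCoord_upsilon_bracket_second hpT hqT hx hΞ hH hp hq,
      jetCoord_upsilon_bracket_second hpT hqT hx hΞ' hH' hp' hq']

/-- The bracket of two fields tangent to the graph of `tgt` is tangent to it. -/
theorem upsilon_bracket_anchor {O : Set (M × M)} (hO : IsOpen O) (hxO : (x, x) ∈ O)
    (hΞ : IsTildeV 𝒢 O Ξ) (hH : IsTildeV 𝒢 O H) :
    (𝒢.upsilon k (fieldBracket Ξ H) x).1
      = anchor 𝒢 k x (𝒢.upsilon k (fieldBracket Ξ H) x).2 := by
  obtain ⟨S⟩ := exists_slide 𝒢 x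
  have hlΞ := hΞ.toIsR.isLocal hO hxO S
  have hlH := hH.toIsR.isLocal hO hxO S
  set φ := extChartAt 𝓘(ℝ, F) (𝒢.unit x) with hφ
  set e := extChartAt 𝓘(ℝ, E) x with he
  have hκ0 : (𝒢.tgtC x (φ (𝒢.unit x)), φ (𝒢.unit x)) = (e x, φ (𝒢.unit x)) := by
    rw [tgtC_apply_self]
  have htc := (eventually_mem_chart_symm_src_tgt 𝒢 x).self_of_nhds
  have hts : ContDiffAt ℝ ∞ (𝒢.tgtC x) (φ (𝒢.unit x)) := contDiffAt_tgtC 𝒢 x htc.1 htc.2.2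
  have hκs : ContDiffAt ℝ ∞ (fun X => (𝒢.tgtC x X, X)) (φ (𝒢.unit x)) :=
    hts.prodMk contDiffAt_id
  have hκd : ∀ᶠ X in 𝓝 (φ (𝒢.unit x)), ∀ v, fderiv ℝ (fun X => (𝒢.tgtC x X, X)) X v
      = (fderiv ℝ (𝒢.tgtC x) X v, v) := by
    filter_upwards [eventually_differentiableAt hts] with X hX v
    have hf : HasFDerivAt (fun X => (𝒢.tgtC x X, X)) _ X :=
      hX.hasFDerivAt.prodMk (hasFDerivAt_id X)
    rw [hf.fderiv]
    rfl
  have hdiag : ∀ᶠ X in 𝓝 (φ (𝒢.unit x)), (𝒢.tgt (φ.symm X), 𝒢.tgt (φ.symm X)) ∈ O := by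
    have hc : Tendsto (fun X => 𝒢.tgt (φ.symm X)) (𝓝 (φ (𝒢.unit x))) (𝓝 x) := by
      have := (𝒢.smooth_tgt.continuous.tendsto (𝒢.unit x)).comp
        (tendsto_extChartAt_symm (E := F) (𝒢.unit x))
      rwa [𝒢.tgt_unit] at this
    exact (hc.prodMk_nhds hc).eventually (hO.mem_nhds hxO)
  -- Tangency to `B(G)` says that `X ↦ (tgt X, X)` relates the `G`-component of the field on the
  -- graph to the field. The relation passes to the bracket, whose horizontal part is then `tgt_*`
  -- of its `G`-component.
  have hrel : ∀ {Ξ : Field E F M G}, IsTildeV 𝒢 O Ξ → ∀ᶠ X in 𝓝 (φ (𝒢.unit x)),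
      Ξ.coord x (𝒢.unit x) (𝒢.tgtC x X, X) = fderiv ℝ (fun X => (𝒢.tgtC x X, X)) X
        (Ξ.coord x (𝒢.unit x) (𝒢.tgtC x X, X)).2 := by
    intro Ξ hΞ
    filter_upwards [hκd, hdiag, eventually_mem_chart_symm_src_tgt 𝒢 x] with X h1 h2 h3
    rw [h1]
    refine Prod.ext ?_ rfl
    obtain ⟨w, hw⟩ := hΞ.tangent_B (φ.symm X) h2
    have ht := 𝒢.smooth_tgt.contMDiffAt.mdifferentiableAt (x := φ.symm X) (by simp)
    have hB := mfderiv_prodMk ht (mdifferentiableAt_id (I := 𝓘(ℝ, F)) (x := φ.symm X))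
    rw [mfderiv_id] at hB
    have hw' := (congrArg (fun L : F →L[ℝ] E × F => L w) hB).symm.trans hw
    have hver : Ξ.ver (𝒢.tgt (φ.symm X)) (φ.symm X) = w := (congrArg Prod.snd hw').symm
    have hhor : Ξ.hor (𝒢.tgt (φ.symm X)) (φ.symm X)
        = mfderiv 𝓘(ℝ, F) 𝓘(ℝ, E) 𝒢.tgt (φ.symm X) (Ξ.ver (𝒢.tgt (φ.symm X)) (φ.symm X)) := by
      rw [hver]
      exact (congrArg Prod.fst hw').symm
    have h4 := chartVec_mfderiv_eq_fderiv (f := 𝒢.tgt) (𝒢.unit x) x ht (φ.map_target h3.1) h3.2.2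
      (Ξ.ver (𝒢.tgt (φ.symm X)) (φ.symm X))
    rw [← hφ, φ.right_inv h3.1, ← hhor] at h4
    have h5 := Ξ.coord_apply h3.2.2 (φ.map_target h3.1)
    have h6 : (𝒢.tgtC x X, X) = (e (𝒢.tgt (φ.symm X)), φ (φ.symm X)) := by
      rw [φ.right_inv h3.1]
      rfl
    rw [h6, h5]
    exact h4
  have hdiff : ∀ {Ξ : Field E F M G}, Ξ.IsLocal S →
      DifferentiableAt ℝ (Ξ.coord x (𝒢.unit x)) (𝒢.tgtC x (φ (𝒢.unit x)), φ (𝒢.unit x)) := by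
    intro Ξ hΞ
    rw [hκ0]
    exact hΞ.local_expr.smooth.self_of_nhds.differentiableAt (by simp)
  have hdiff2 : ∀ {Ξ : Field E F M G}, Ξ.IsLocal S →
      DifferentiableAt ℝ (fun X => (Ξ.coord x (𝒢.unit x) (𝒢.tgtC x X, X)).2) (φ (𝒢.unit x)) :=
    fun {Ξ} hΞ => differentiableAt_snd.comp _ (DifferentiableAt.comp (φ (𝒢.unit x))
      (f := fun X => (𝒢.tgtC x X, X)) (hdiff hΞ) (hκs.differentiableAt (by simp)))
  have h := lieBracket_of_related (κ := fun X => (𝒢.tgtC x X, X)) (p := φ (𝒢.unit x))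
    hκs (hdiff hlΞ) (hdiff hlH) (hdiff2 hlΞ) (hdiff2 hlH) (hrel hΞ) (hrel hH)
  rw [hκd.self_of_nhds, hκ0,
    ← (Field.coord_bracket_eventuallyEq hlΞ.smooth hlH.smooth).self_of_nhds] at h
  have h1 := congrArg Prod.fst h
  have h2 := congrArg Prod.snd h
  simp only at h1 h2
  rw [← h2] at h1
  refine chartVec_injective (F := E) (mem_extChartAt_source x) ?_
  rw [chartVec_upsilon_self, chartVec_anchor 𝒢 (mem_extChartAt_source x)
    (mem_extChartAt_source _), (hlΞ.bracket hlH).jetCoord_upsilon, taylor_zero_apply,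
    unitC_apply_self]
  exact h1

end Bracket

end GermLifts

end LieGroupoid

namespace LieGroupoid

/-! ### Gluing of the pointwise brackets; `ν_k` is bijective and compatible with brackets -/

section Glue

variable {E F M G : Type*}
  [NormedAddCommGroup E] [NormedSpace ℝ E] [NormedAddCommGroup F] [NormedSpace ℝ F]
  [TopologicalSpace M] [ChartedSpace E M] [TopologicalSpace G] [ChartedSpace F G]
  [IsManifold 𝓘(ℝ, E) ∞ M] [IsManifold 𝓘(ℝ, F) ∞ G]

variable {𝒢 : LieGroupoid E F M G} {k : ℕ} {U : Opens M} {x : M} {S : Slide 𝒢 x}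
  {Ξ H : Field E F M G} {O O' : Set (M × M)}

theorem saturation_mono (𝒢 : LieGroupoid E F M G) (h : O' ⊆ O) :
    𝒢.saturation O' ⊆ 𝒢.saturation O := fun _ hp => h hp

theorem IsR.mono (hΞ : IsR 𝒢 O Ξ) (h : O' ⊆ O) : IsR 𝒢 O' Ξ where
  smooth := hΞ.smooth.mono (saturation_mono 𝒢 h)
  tangent_fibres a X hX := hΞ.tangent_fibres a X (h hX)
  hor_invariant a X Y hXY hX := hΞ.hor_invariant a X Y hXY (h hX)
  ver_invariant a X Y hXY hX := hΞ.ver_invariant a X Y hXY (h hX)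
  projectable a X X' hX hX' := hΞ.projectable a X X' (h hX) (h hX')

theorem IsTildeV.mono (hΞ : IsTildeV 𝒢 O Ξ) (h : O' ⊆ O) : IsTildeV 𝒢 O' Ξ where
  toIsR := hΞ.toIsR.mono h
  tangent_B X hX := hΞ.tangent_B X (h hX)

theorem Lifts.mono {p : JetCheck 𝒢 k U} (hΞ : Lifts O Ξ p) (h : O' ⊆ O) : Lifts O' Ξ p :=
  fun y hy => hΞ y (h hy)

/-- Simultaneous local lifts of two sections. -/
theorem exists_lift_pair [CompleteSpace E] [CompleteSpace F] (p q : JetCheck 𝒢 k U) (hx : x ∈ U) :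
    ∃ (O : Set (M × M)) (Ξ H : Field E F M G), IsOpen O ∧ (x, x) ∈ O ∧ IsR 𝒢 O Ξ ∧ IsR 𝒢 O H ∧
      Lifts O Ξ p ∧ Lifts O H q ∧ (p ∈ JetTilde 𝒢 k U → IsTildeV 𝒢 O Ξ) ∧
      (q ∈ JetTilde 𝒢 k U → IsTildeV 𝒢 O H) := by
  obtain ⟨O₁, Ξ, h1, h2, h3, h4, h5⟩ := exists_lift p hx
  obtain ⟨O₂, H, k1, k2, k3, k4, k5⟩ := exists_lift q hx
  exact ⟨O₁ ∩ O₂, Ξ, H, h1.inter k1, ⟨h2, k2⟩, h3.mono inter_subset_left,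
    k3.mono inter_subset_right, h4.mono inter_subset_left, k4.mono inter_subset_right,
    fun h => (h5 h).mono inter_subset_left, fun h => (k5 h).mono inter_subset_right⟩

theorem Field.IsLocal.contMDiffAt_jetCoord (h : Ξ.IsLocal S) (k : ℕ) :
    ContMDiffAt 𝓘(ℝ, E) 𝓘(ℝ, TaylorSpace E F k) ∞
      (fun y : M => jetCoord 𝒢 k x y (𝒢.upsilon k Ξ y).2) x := by
  have hu := (eventually_contDiffAt_unitC 𝒢 x).self_of_nhds
  have hs := h.local_expr.smooth.self_of_nhds
  rw [← unitC_apply_self] at hs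
  have h1 : ContDiffAt ℝ ∞ (fun z => taylor k (fun z' => (Ξ.coord x (𝒢.unit x)
      (z, 𝒢.unitC x z')).2) z) (extChartAt 𝓘(ℝ, E) x x) :=
    contDiffAt_taylor_param (P := E) k
      (g := fun p : E × E => (Ξ.coord x (𝒢.unit x) (p.1, 𝒢.unitC x p.2)).2) (ζ := fun z => z)
      (contDiffAt_snd.comp _ (ContDiffAt.comp _ (g := Ξ.coord x (𝒢.unit x)) hs
        (contDiffAt_fst.prodMk (ContDiffAt.comp _ (g := 𝒢.unitC x) hu contDiffAt_snd))))
      contDiffAt_id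
  refine (ContMDiffAt.comp x (h1.congr_of_eventuallyEq (h.jetC_upsilon k)).contMDiffAt
    (contMDiffAt_extChartAt (I := 𝓘(ℝ, E)))).congr_of_eventuallyEq ?_
  filter_upwards [extChartAt_source_mem_nhds (I := 𝓘(ℝ, E)) x] with y hy
  unfold jetC
  rw [Function.comp_apply, (extChartAt 𝓘(ℝ, E) x).left_inv hy]

theorem Field.IsLocal.contMDiffAt_chartVec (h : Ξ.IsLocal S) (k : ℕ) :
    ContMDiffAt 𝓘(ℝ, E) 𝓘(ℝ, E) ∞ (fun y : M => chartVec x y (𝒢.upsilon k Ξ y).1) x := by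
  have hu := (eventually_contDiffAt_unitC 𝒢 x).self_of_nhds
  have hs := h.local_expr.smooth.self_of_nhds
  rw [← unitC_apply_self] at hs
  have h1 : ContDiffAt ℝ ∞ (fun z => (Ξ.coord x (𝒢.unit x) (z, 𝒢.unitC x z)).1)
      (extChartAt 𝓘(ℝ, E) x x) :=
    contDiffAt_fst.comp _ (ContDiffAt.comp _ (g := Ξ.coord x (𝒢.unit x)) hs
      (contDiffAt_id.prodMk hu))
  refine (ContMDiffAt.comp x (h1.congr_of_eventuallyEq
    (Field.IsLocal.chartVec_upsilon (𝒢 := 𝒢) (x := x) Ξ k)).contMDiffAt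
    (contMDiffAt_extChartAt (I := 𝓘(ℝ, E)))).congr_of_eventuallyEq ?_
  filter_upwards [extChartAt_source_mem_nhds (I := 𝓘(ℝ, E)) x] with y hy
  rw [Function.comp_apply, (extChartAt 𝓘(ℝ, E) x).left_inv hy]

variable [CompleteSpace E] [CompleteSpace F]

/-- If `Υ_k([Ξ, H])` only depends on the sections lifted by `Ξ` and `H`, the local values of the
bracket are those of a section. -/
theorem exists_bracket_section {m : ℕ} (p q : JetCheck 𝒢 m U)
    (huniq : ∀ x ∈ U, ∀ (S : Slide 𝒢 x) (Ξ H Ξ' H' : Field E F M G), Ξ.IsLocal S → H.IsLocal S →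
      GermLifts x Ξ p → GermLifts x H q → Ξ'.IsLocal S → H'.IsLocal S →
      GermLifts x Ξ' p → GermLifts x H' q →
      𝒢.upsilon k (fieldBracket Ξ H) x = 𝒢.upsilon k (fieldBracket Ξ' H') x) :
    ∃ r : JetCheck 𝒢 k U, ∀ x : U, ∀ (S : Slide 𝒢 (x : M)) (Ξ H : Field E F M G),
      Ξ.IsLocal S → H.IsLocal S → GermLifts (x : M) Ξ p → GermLifts (x : M) H q →
      𝒢.upsilon k (fieldBracket Ξ H) x = (r.1.1 x, r.2.1 x) := by
  choose O Ξ H hO hxO hΞ hH hp hq _ _ using fun x : U => exists_lift_pair p q x.2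
  -- The lifts chosen at `x` also compute the value at every `y` with `(y, y)` in their domain. Near
  -- `x` the pointwise values thus come from a single pair of smooth fields, which gives smoothness.
  have hval : ∀ (x y : U), ((y : M), (y : M)) ∈ O x →
      𝒢.upsilon k (fieldBracket (Ξ y) (H y)) y = 𝒢.upsilon k (fieldBracket (Ξ x) (H x)) y := by
    intro x y hy
    obtain ⟨S⟩ := exists_slide 𝒢 (y : M)
    exact huniq y y.2 S _ _ _ _ ((hΞ y).isLocal (hO y) (hxO y) S)
      ((hH y).isLocal (hO y) (hxO y) S) ((hp y).germLifts (hO y) (hxO y) y.2)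
      ((hq y).germLifts (hO y) (hxO y) y.2) ((hΞ x).isLocal (hO x) hy S)
      ((hH x).isLocal (hO x) hy S) ((hp x).germLifts (hO x) hy y.2)
      ((hq x).germLifts (hO x) hy y.2)
  have hev : ∀ x : U, ∀ᶠ y : U in 𝓝 x, 𝒢.upsilon k (fieldBracket (Ξ y) (H y)) y
      = 𝒢.upsilon k (fieldBracket (Ξ x) (H x)) y := by
    intro x
    have hd : Tendsto (fun y : U => ((y : M), (y : M))) (𝓝 x) (𝓝 ((x : M), (x : M))) :=
      (continuous_subtype_val.prodMk continuous_subtype_val).tendsto x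
    exact (hd.eventually ((hO x).mem_nhds (hxO x))).mono fun y hy => hval x y hy
  have hloc : ∀ (x : U) (S : Slide 𝒢 (x : M)), (fieldBracket (Ξ x) (H x)).IsLocal S := fun x S =>
    ((hΞ x).isLocal (hO x) (hxO x) S).bracket ((hH x).isLocal (hO x) (hxO x) S)
  refine ⟨(⟨fun y => (𝒢.upsilon k (fieldBracket (Ξ y) (H y)) y).1, ?_⟩,
    ⟨fun y => (𝒢.upsilon k (fieldBracket (Ξ y) (H y)) y).2, ?_⟩), ?_⟩
  · intro x
    obtain ⟨S⟩ := exists_slide 𝒢 (x : M)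
    refine (contMDiffAt_along_iff' (x : M) (contMDiff_subtype_val (n := ∞)).contMDiffAt
      (mem_extChartAt_source _) _).2 ?_
    refine (ContMDiffAt.comp x ((hloc x S).contMDiffAt_chartVec k)
      (contMDiff_subtype_val (n := ∞)).contMDiffAt).congr_of_eventuallyEq ?_
    filter_upwards [hev x] with y hy
    rw [hy]
    rfl
  · intro x
    obtain ⟨S⟩ := exists_slide 𝒢 (x : M)
    refine (ContMDiffAt.comp x ((hloc x S).contMDiffAt_jetCoord k)
      (contMDiff_subtype_val (n := ∞)).contMDiffAt).congr_of_eventuallyEq ?_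
    filter_upwards [hev x] with y hy
    rw [hy]
    rfl
  · intro x S Ξ' H' h1 h2 h3 h4
    exact huniq x x.2 S _ _ _ _ h1 h2 h3 h4 ((hΞ x).isLocal (hO x) (hxO x) S)
      ((hH x).isLocal (hO x) (hxO x) S) ((hp x).germLifts (hO x) (hxO x) x.2)
      ((hq x).germLifts (hO x) (hxO x) x.2)

theorem isFirstBracket_firstBracket (p q : JetCheck 𝒢 (k + 1) U) :
    IsFirstBracket p q (firstBracket p q) := by
  have h : ∃ r, IsFirstBracket p q r := by
    obtain ⟨r, hr⟩ := exists_bracket_section (k := k) p q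
      fun x _ S Ξ H Ξ' H' h1 h2 h3 h4 h5 h6 h7 h8 =>
        upsilon_bracket_first_unique h1 h2 h3 h4 h5 h6 h7 h8
    refine ⟨r, fun x => ⟨?_, ?_⟩⟩
    · obtain ⟨O, Ξ, H, h1, h2, h3, h4, h5, h6, -, -⟩ := exists_lift_pair p q x.2
      exact ⟨O, Ξ, H, h1, h2, h3, h4, h5, h6⟩
    · intro O Ξ H hO hxO hΞ hH hp hq
      obtain ⟨S⟩ := exists_slide 𝒢 (x : M)
      exact hr x S Ξ H (hΞ.isLocal hO hxO S) (hH.isLocal hO hxO S) (hp.germLifts hO hxO x.2)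
        (hq.germLifts hO hxO x.2)
  rw [firstBracket, dif_pos h]
  exact h.choose_spec

theorem isSecondBracket_secondBracket (ξ η : JetTilde 𝒢 k U) :
    IsSecondBracket ξ η (secondBracket ξ η) := by
  have h : ∃ ζ, IsSecondBracket ξ η ζ := by
    obtain ⟨r, hr⟩ := exists_bracket_section (k := k) ξ.1 η.1
      fun x hx S Ξ H Ξ' H' h1 h2 h3 h4 h5 h6 h7 h8 =>
        upsilon_bracket_second_unique ξ.2 η.2 hx h1 h2 h3 h4 h5 h6 h7 h8
    have hr' : ∀ (x : U) (O : Set (M × M)) (Ξ H : Field E F M G), IsOpen O →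
        ((x : M), (x : M)) ∈ O → IsTildeV 𝒢 O Ξ → IsTildeV 𝒢 O H → Lifts O Ξ ξ.1 →
        Lifts O H η.1 → 𝒢.upsilon k (fieldBracket Ξ H) x = (r.1.1 x, r.2.1 x) := by
      intro x O Ξ H hO hxO hΞ hH hp hq
      obtain ⟨S⟩ := exists_slide 𝒢 (x : M)
      exact hr x S Ξ H (hΞ.isLocal hO hxO S) (hH.isLocal hO hxO S) (hp.germLifts hO hxO x.2)
        (hq.germLifts hO hxO x.2)
    have hex : ∀ x : U, ∃ (O : Set (M × M)) (Ξ H : Field E F M G), IsOpen O ∧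
        ((x : M), (x : M)) ∈ O ∧ IsTildeV 𝒢 O Ξ ∧ IsTildeV 𝒢 O H ∧ Lifts O Ξ ξ.1 ∧
        Lifts O H η.1 := by
      intro x
      obtain ⟨O, Ξ, H, h1, h2, -, -, h5, h6, h7, h8⟩ := exists_lift_pair ξ.1 η.1 x.2
      exact ⟨O, Ξ, H, h1, h2, h7 ξ.2, h8 η.2, h5, h6⟩
    -- The section `r` was built from lifts that are merely in `ℛ`. To see that it lies in `J̃^k 𝔤`,
    -- its values are recomputed with lifts tangent to `B(G)`.
    refine ⟨⟨r, fun x => ?_⟩, fun x => ⟨hex x, hr' x⟩⟩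
    obtain ⟨O, Ξ, H, h1, h2, h3, h4, h5, h6⟩ := hex x
    have h7 := upsilon_bracket_anchor (k := k) h1 h2 h3 h4
    rwa [hr' x O Ξ H h1 h2 h3 h4 h5 h6] at h7
  rw [secondBracket, dif_pos h]
  exact h.choose_spec

/-- The second bracket can be computed with any local right invariant fields. -/
theorem upsilon_bracket_second (ξ η : JetTilde 𝒢 k U) (x : U) {S : Slide 𝒢 (x : M)}
    (hΞ : Ξ.IsLocal S) (hH : H.IsLocal S) (hp : GermLifts (x : M) Ξ ξ.1)
    (hq : GermLifts (x : M) H η.1) : 𝒢.upsilon k (fieldBracket Ξ H) x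
      = ((secondBracket ξ η).1.1.1 x, (secondBracket ξ η).1.2.1 x) := by
  obtain ⟨⟨O, Ξ', H', h1, h2, h3, h4, h5, h6⟩, h7⟩ := isSecondBracket_secondBracket ξ η x
  rw [← h7 O Ξ' H' h1 h2 h3 h4 h5 h6]
  exact upsilon_bracket_second_unique ξ.2 η.2 x.2 hΞ hH hp hq (h3.isLocal h1 h2 S)
    (h4.isLocal h1 h2 S) (h5.germLifts h1 h2 x.2) (h6.germLifts h1 h2 x.2)

/-- The first bracket can be computed with any local right invariant fields. -/
theorem upsilon_bracket_first (p q : JetCheck 𝒢 (k + 1) U) (x : U) {S : Slide 𝒢 (x : M)}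
    (hΞ : Ξ.IsLocal S) (hH : H.IsLocal S) (hp : GermLifts (x : M) Ξ p)
    (hq : GermLifts (x : M) H q) : 𝒢.upsilon k (fieldBracket Ξ H) x
      = ((firstBracket p q).1.1 x, (firstBracket p q).2.1 x) := by
  obtain ⟨⟨O, Ξ', H', h1, h2, h3, h4, h5, h6⟩, h7⟩ := isFirstBracket_firstBracket p q x
  rw [← h7 O Ξ' H' h1 h2 h3 h4 h5 h6]
  exact upsilon_bracket_first_unique hΞ hH hp hq (h3.isLocal h1 h2 S)
    (h4.isLocal h1 h2 S) (h5.germLifts h1 h2 x.2) (h6.germLifts h1 h2 x.2)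

/-- Local right invariant fields lifting a section. -/
theorem exists_isLocal_germLifts (p : JetCheck 𝒢 k U) (hx : x ∈ U) (S : Slide 𝒢 x) :
    ∃ Ξ : Field E F M G, Ξ.IsLocal S ∧ GermLifts x Ξ p := by
  obtain ⟨O, Ξ, h1, h2, h3, h4, -⟩ := exists_lift p hx
  exact ⟨Ξ, h3.isLocal h1 h2 S, h4.germLifts h1 h2 hx⟩

theorem isAlgebroidBracket_nu (ξ η : JetTilde 𝒢 k U) :
    IsAlgebroidBracket (nu 𝒢 k U ξ) (nu 𝒢 k U η) (nu 𝒢 k U (secondBracket ξ η)) := by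
  intro x
  obtain ⟨S⟩ := exists_slide 𝒢 (x : M)
  obtain ⟨Ξ, h1, h2⟩ := exists_isLocal_germLifts ξ.1 x.2 S
  obtain ⟨H, h3, h4⟩ := exists_isLocal_germLifts η.1 x.2 S
  have h5 := upsilon_bracket_second ξ η x h1 h3 h2 h4
  have h6 := jetCoord_upsilon_bracket_second ξ.2 η.2 x.2 h1 h3 h2 h4
  rw [h5] at h6
  exact h6

theorem IsAlgebroidBracket.unique {ξ η ζ ζ' : JetSection 𝒢 k U} (h : IsAlgebroidBracket ξ η ζ)
    (h' : IsAlgebroidBracket ξ η ζ') : ζ = ζ' :=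
  Subtype.ext (funext fun x => jetCoord_injective 𝒢 k (mem_extChartAt_source _)
    (mem_extChartAt_source _) ((h x).trans (h' x).symm))

theorem nu_injective (𝒢 : LieGroupoid E F M G) (k : ℕ) (U : Opens M) :
    Function.Injective (nu 𝒢 k U) := by
  intro ξ η h
  have h2 : ξ.1.2 = η.1.2 := h
  refine Subtype.ext (Prod.ext (Subtype.ext (funext fun x => ?_)) h2)
  rw [ξ.2 x, η.2 x, h2]

/-- The missing component has to be `t_* ξ_k`. Its smoothness is seen in charts, where it is the
derivative of `tgtC` at the identities applied to the entry of order `0` of the jet. -/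
theorem nu_surjective (𝒢 : LieGroupoid E F M G) (k : ℕ) (U : Opens M) :
    Function.Surjective (nu 𝒢 k U) := by
  intro ξ
  have h : (fun x : U => anchor 𝒢 k x (ξ.1 x)) ∈ VecSection E U := by
    refine (mem_vecSection_iff (w := fun y => anchor 𝒢 k y (extendJet ξ y))
      (fun y => by rw [extendJet_apply ξ y.2]) (fun a => a)
      (fun a => mem_extChartAt_source _)).2 fun a => ?_
    have hj := (eventually_contDiffAt_jetC ξ a.2).self_of_nhds
    have hu := (eventually_contDiffAt_unitC 𝒢 (a : M)).self_of_nhds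
    have htc := (eventually_mem_chart_symm_src_tgt 𝒢 (a : M)).self_of_nhds
    have ht : ContDiffAt ℝ ∞ (fderiv ℝ (𝒢.tgtC (a : M)))
        (𝒢.unitC (a : M) (extChartAt 𝓘(ℝ, E) (a : M) a)) := by
      rw [unitC_apply_self]
      exact (contDiffAt_tgtC 𝒢 (a : M) htc.1 htc.2.2).fderiv_right (by simp)
    have hj0 : ContDiffAt ℝ ∞ (fun z => 𝒢.jetC (a : M) (extendJet ξ) z 0 (fun _ => 0))
        (extChartAt 𝓘(ℝ, E) (a : M) a) := by
      have h0 := contDiffAt_pi.1 hj 0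
      exact (ContinuousMultilinearMap.apply ℝ (fun _ : Fin ((0 : Fin (k + 1)) : ℕ) => E) F
        (fun _ => 0)).contDiff.contDiffAt.comp _ h0
    have h1 : ContDiffAt ℝ ∞ (fun z => fderiv ℝ (𝒢.tgtC (a : M)) (𝒢.unitC (a : M) z)
        (𝒢.jetC (a : M) (extendJet ξ) z 0 (fun _ => 0))) (extChartAt 𝓘(ℝ, E) (a : M) a) :=
      (ContDiffAt.comp _ (g := fderiv ℝ (𝒢.tgtC (a : M))) ht hu).clm_apply hj0
    refine (ContMDiffAt.comp (a : M) h1.contMDiffAt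
      (contMDiffAt_extChartAt (I := 𝓘(ℝ, E)))).congr_of_eventuallyEq ?_
    filter_upwards [eventually_mem_chart 𝒢 (a : M)] with y hy
    rw [← extChartAt_source (I := 𝓘(ℝ, E)), ← extChartAt_source (I := 𝓘(ℝ, F))] at hy
    rw [chartVec_anchor 𝒢 hy.1 hy.2, Function.comp_apply]
    unfold jetC
    rw [(extChartAt 𝓘(ℝ, E) (a : M)).left_inv hy.1]
  exact ⟨⟨(⟨_, h⟩, ξ), fun _ => rfl⟩, rfl⟩

theorem nu_bijective (𝒢 : LieGroupoid E F M G) (k : ℕ) (U : Opens M) :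
    Function.Bijective (nu 𝒢 k U) := ⟨nu_injective 𝒢 k U, nu_surjective 𝒢 k U⟩

/-- Every section is `ν_k` of a section of `J̃^k 𝔤`, and the second bracket there supplies a smooth
section with the required values. -/
theorem isAlgebroidBracket_algebroidBracket (ξ η : JetSection 𝒢 k U) :
    IsAlgebroidBracket ξ η (algebroidBracket ξ η) := by
  have h : ∃ ζ, IsAlgebroidBracket ξ η ζ := by
    obtain ⟨ξ, rfl⟩ := nu_surjective 𝒢 k U ξ
    obtain ⟨η, rfl⟩ := nu_surjective 𝒢 k U η
    exact ⟨_, isAlgebroidBracket_nu ξ η⟩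
  rw [algebroidBracket, dif_pos h]
  exact h.choose_spec

theorem algebroidBracket_nu (ξ η : JetTilde 𝒢 k U) :
    algebroidBracket (nu 𝒢 k U ξ) (nu 𝒢 k U η) = nu 𝒢 k U (secondBracket ξ η) :=
  (isAlgebroidBracket_algebroidBracket _ _).unique (isAlgebroidBracket_nu ξ η)

end Glue

end LieGroupoid

namespace LieGroupoid

/-! ### Lie algebra identities and compatibility with restriction -/

section Lie

variable {E F M G : Type*}
  [NormedAddCommGroup E] [NormedSpace ℝ E] [NormedAddCommGroup F] [NormedSpace ℝ F]
  [TopologicalSpace M] [ChartedSpace E M] [TopologicalSpace G] [ChartedSpace F G]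

theorem taylor_add_smul {k : ℕ} {f g : E → F} {z : E} (hf : ContDiffAt ℝ ∞ f z)
    (hg : ContDiffAt ℝ ∞ g z) (c : ℝ) :
    taylor k (f + c • g) z = taylor k f z + c • taylor k g z := by
  rw [taylor_add hf (g := c • g) (hg.const_smul c)]
  exact congrArg _ (funext fun _ =>
    iteratedFDeriv_const_smul_apply (hg.of_le (mod_cast le_top)))

variable [IsManifold 𝓘(ℝ, E) ∞ M] [IsManifold 𝓘(ℝ, F) ∞ G]

variable {𝒢 : LieGroupoid E F M G} {k : ℕ} {U : Opens M} {x : M} {S : Slide 𝒢 x}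
  {V V' W : E × F → E × F}

theorem IsLocalR.add_smul (hV : IsLocalR S V) (hV' : IsLocalR S V') (c : ℝ) :
    IsLocalR S (V + c • V') where
  smooth := by
    filter_upwards [hV.smooth, hV'.smooth] with q h1 h2
    exact h1.add (h2.const_smul c)
  hor := by
    filter_upwards [hV.hor, hV'.hor] with q h1 h2
    simp only [Pi.add_apply, Pi.smul_apply, Prod.fst_add, Prod.smul_fst, h1, h2]
  ver := by
    filter_upwards [hV.ver, hV'.ver] with q h1 h2
    simp only [Pi.add_apply, Pi.smul_apply, Prod.snd_add, Prod.smul_snd, h1, h2, map_add, map_smul]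
  vertical := by
    filter_upwards [hV.vertical, hV'.vertical] with q h1 h2
    simp only [Pi.add_apply, Pi.smul_apply, Prod.snd_add, Prod.smul_snd, map_add, map_smul, h1, h2,
      smul_zero, add_zero]

theorem IsLocalR.zero (S : Slide 𝒢 x) : IsLocalR S (0 : E × F → E × F) where
  smooth := .of_forall fun _ => contDiffAt_const
  hor := .of_forall fun _ => rfl
  ver := .of_forall fun _ => (map_zero _).symm
  vertical := .of_forall fun _ => map_zero _

theorem IsLocalR.contDiffAt_snd_unitC (hV : IsLocalR S V) :
    ∀ᶠ z in 𝓝 (extChartAt 𝓘(ℝ, E) x x), ContDiffAt ℝ ∞ (fun z' => (V (z, 𝒢.unitC x z')).2) z := by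
  have hz : Tendsto (fun z => (z, 𝒢.unitC x z)) (𝓝 (extChartAt 𝓘(ℝ, E) x x))
      (𝓝 (extChartAt 𝓘(ℝ, E) x x, extChartAt 𝓘(ℝ, F) (𝒢.unit x) (𝒢.unit x))) :=
    tendsto_id.prodMk_nhds (tendsto_unitC 𝒢 x)
  filter_upwards [hz.eventually hV.smooth, eventually_contDiffAt_unitC 𝒢 x] with z h1 h2
  exact contDiffAt_snd.comp _ (ContDiffAt.comp _ (g := V) h1 (contDiffAt_const.prodMk h2))

theorem Represents.add_smul (hV : IsLocalR S V) (hV' : IsLocalR S V')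
    {ξ ξ' : JetSection 𝒢 k U} (hx : x ∈ U) (h : Represents x V (extendJet ξ))
    (h' : Represents x V' (extendJet ξ')) (c : ℝ) :
    Represents x (V + c • V') (extendJet (ξ + c • ξ')) := by
  filter_upwards [h, h', hV.contDiffAt_snd_unitC, hV'.contDiffAt_snd_unitC,
    (tendsto_extChartAt_symm (E := E) x).eventually (U.isOpen.mem_nhds hx),
    (tendsto_extChartAt_symm (E := E) x).eventually (eventually_mem_chart 𝒢 x)]
    with z h1 h2 h3 h4 h5 h6
  unfold jetC at h1 h2 ⊢
  rw [extendJet_apply _ h5] at h1 h2 ⊢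
  have h7 : (ξ + c • ξ').1 ⟨_, h5⟩ = ξ.1 ⟨_, h5⟩ + c • ξ'.1 ⟨_, h5⟩ := rfl
  rw [h7, jetCoord_add 𝒢 k h6.1 h6.2, jetCoord_smul 𝒢 k h6.1 h6.2, h1, h2,
    ← taylor_add_smul h3 h4]
  rfl

theorem jetCoord_zero (𝒢 : LieGroupoid E F M G) (k : ℕ) {x₀ x : M}
    (hx : x ∈ (chartAt E x₀).source) (hux : 𝒢.unit x ∈ (chartAt F (𝒢.unit x₀)).source) :
    jetCoord 𝒢 k x₀ x 0 = 0 := by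
  have h := jetCoord_smul 𝒢 k hx hux 0 0
  rwa [smul_zero, zero_smul] at h

theorem Represents.zero (hx : x ∈ U) :
    Represents x (0 : E × F → E × F) (extendJet (0 : JetSection 𝒢 k U)) := by
  filter_upwards [(tendsto_extChartAt_symm (E := E) x).eventually (U.isOpen.mem_nhds hx),
    (tendsto_extChartAt_symm (E := E) x).eventually (eventually_mem_chart 𝒢 x)] with z h1 h2
  unfold jetC
  rw [extendJet_apply _ h1]
  refine Eq.trans ?_ (taylor_zero_fun k z).symm
  exact jetCoord_zero 𝒢 k h2.1 h2.2

/-- The bracket of right invariant fields on jets, in terms of representing fields. -/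
def jetBracketC (𝒢 : LieGroupoid E F M G) (k : ℕ) (x : M) (V W : E × F → E × F) :
    TaylorSpace E F k :=
  taylor k (𝒢.derivAlong x W V (𝒢.anchorC x V)) (extChartAt 𝓘(ℝ, E) x x)
    - taylor k (𝒢.derivAlong x V W (𝒢.anchorC x W)) (extChartAt 𝓘(ℝ, E) x x)

theorem jetBracketC_swap (V W : E × F → E × F) :
    𝒢.jetBracketC k x V W = -𝒢.jetBracketC k x W V := (neg_sub _ _).symm

theorem anchorC_add_smul (c : ℝ) :
    𝒢.anchorC x (V + c • V') = 𝒢.anchorC x V + c • 𝒢.anchorC x V' := by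
  simp only [anchorC, Pi.add_apply, Pi.smul_apply, Prod.snd_add, Prod.smul_snd, map_add, map_smul]

theorem derivAlong_add_smul_right (h h' : E) (c : ℝ) :
    𝒢.derivAlong x W (V + c • V') (h + c • h')
      = 𝒢.derivAlong x W V h + c • 𝒢.derivAlong x W V' h' := by
  funext z
  set L := fderiv ℝ W (extChartAt 𝓘(ℝ, E) x x, 𝒢.unitC x z) with hL
  set q := (extChartAt 𝓘(ℝ, E) x x, 𝒢.unitC x z)
  have h1 := L.map_add (h, (V q).2) (c • (h', (V' q).2))
  rw [L.map_smul] at h1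
  exact congrArg Prod.snd h1

theorem derivAlong_add_smul_left (hV : IsLocalR S V) (hV' : IsLocalR S V') (h : E) (c : ℝ) :
    𝒢.derivAlong x (V + c • V') W h =ᶠ[𝓝 (extChartAt 𝓘(ℝ, E) x x)]
      𝒢.derivAlong x V W h + c • 𝒢.derivAlong x V' W h := by
  have hux : Tendsto (fun z => (extChartAt 𝓘(ℝ, E) x x, 𝒢.unitC x z))
      (𝓝 (extChartAt 𝓘(ℝ, E) x x)) (𝓝 (extChartAt 𝓘(ℝ, E) x x,
        extChartAt 𝓘(ℝ, F) (𝒢.unit x) (𝒢.unit x))) :=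
    tendsto_const_nhds.prodMk_nhds (tendsto_unitC 𝒢 x)
  filter_upwards [hux.eventually hV.smooth, hux.eventually hV'.smooth] with z h1 h2
  have h1' := h1.differentiableAt (by simp)
  have h2' := h2.differentiableAt (by simp)
  have h3 := (h1'.hasFDerivAt.add (h2'.hasFDerivAt.const_smul c)).fderiv
  simp only [derivAlong, Pi.add_apply, Pi.smul_apply]
  rw [h3]
  rfl

theorem jetBracketC_add_smul (hV : IsLocalR S V) (hV' : IsLocalR S V') (hW : IsLocalR S W)
    (c : ℝ) : 𝒢.jetBracketC k x (V + c • V') W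
      = 𝒢.jetBracketC k x V W + c • 𝒢.jetBracketC k x V' W := by
  unfold jetBracketC
  rw [anchorC_add_smul, derivAlong_add_smul_right,
    taylor_congr (derivAlong_add_smul_left hV hV' _ c),
    taylor_add_smul (hW.contDiffAt_derivAlong hV _) (hW.contDiffAt_derivAlong hV' _),
    taylor_add_smul (hV.contDiffAt_derivAlong hW _) (hV'.contDiffAt_derivAlong hW _), smul_sub]
  abel

variable [CompleteSpace E] [CompleteSpace F]

/-- The bracket on jets does not see horizontal parts, so the horizontal part of the lift may be
taken to be zero. -/
theorem exists_represents (ξ : JetSection 𝒢 k U) (hx : x ∈ U) (S : Slide 𝒢 x) :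
    ∃ V : E × F → E × F, IsLocalR S V ∧ Represents x V (extendJet ξ) := by
  obtain ⟨Ξ, h1, h2⟩ := exists_isLocal_germLifts ((0, ξ) : JetCheck 𝒢 k U) hx S
  exact ⟨_, h1.local_expr, h2.represents h1⟩

theorem jetCoord_algebroidBracket {ξ η : JetSection 𝒢 k U} (x : U) {S : Slide 𝒢 (x : M)}
    (hV : IsLocalR S V) (hW : IsLocalR S W) (hξ : Represents (x : M) V (extendJet ξ))
    (hη : Represents (x : M) W (extendJet η)) :
    jetCoord 𝒢 k (x : M) x ((algebroidBracket ξ η).1 x) = 𝒢.jetBracketC k (x : M) V W := by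
  rw [isAlgebroidBracket_algebroidBracket ξ η x, lieBracket_rightInvariantJet hV hW hξ hη]
  rfl

theorem jetSection_ext {ξ η : JetSection 𝒢 k U}
    (h : ∀ x : U, jetCoord 𝒢 k (x : M) x (ξ.1 x) = jetCoord 𝒢 k (x : M) x (η.1 x)) : ξ = η :=
  Subtype.ext (funext fun x => jetCoord_injective 𝒢 k (mem_extChartAt_source _)
    (mem_extChartAt_source _) (h x))

theorem algebroidBracket_add_smul (ξ ξ' η : JetSection 𝒢 k U) (c : ℝ) :
    algebroidBracket (ξ + c • ξ') η = algebroidBracket ξ η + c • algebroidBracket ξ' η := by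
  refine jetSection_ext fun x => ?_
  obtain ⟨S⟩ := exists_slide 𝒢 (x : M)
  obtain ⟨V, h1, h2⟩ := exists_represents ξ x.2 S
  obtain ⟨V', h3, h4⟩ := exists_represents ξ' x.2 S
  obtain ⟨W, h5, h6⟩ := exists_represents η x.2 S
  have h7 : (algebroidBracket ξ η + c • algebroidBracket ξ' η).1 x
    = (algebroidBracket ξ η).1 x + c • (algebroidBracket ξ' η).1 x := rfl
  have hm := (eventually_mem_chart 𝒢 (x : M)).self_of_nhds
  rw [h7, jetCoord_add 𝒢 k hm.1 hm.2, jetCoord_smul 𝒢 k hm.1 hm.2,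
    jetCoord_algebroidBracket x (h1.add_smul h3 c) h5 (h2.add_smul h1 h3 x.2 h4 c) h6,
    jetCoord_algebroidBracket x h1 h5 h2 h6, jetCoord_algebroidBracket x h3 h5 h4 h6,
    jetBracketC_add_smul h1 h3 h5]

theorem algebroidBracket_swap (ξ η : JetSection 𝒢 k U) :
    algebroidBracket ξ η = -algebroidBracket η ξ := by
  rw [← neg_one_smul ℝ]
  refine jetSection_ext fun x => ?_
  obtain ⟨S⟩ := exists_slide 𝒢 (x : M)
  obtain ⟨V, h1, h2⟩ := exists_represents ξ x.2 S
  obtain ⟨W, h5, h6⟩ := exists_represents η x.2 S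
  have hm := (eventually_mem_chart 𝒢 (x : M)).self_of_nhds
  have h7 : ((-1 : ℝ) • algebroidBracket η ξ).1 x = (-1 : ℝ) • (algebroidBracket η ξ).1 x := rfl
  rw [h7, jetCoord_smul 𝒢 k hm.1 hm.2, jetCoord_algebroidBracket x h1 h5 h2 h6,
    jetCoord_algebroidBracket x h5 h1 h6 h2, neg_one_smul]
  exact jetBracketC_swap V W

theorem algebroidBracket_self (ξ : JetSection 𝒢 k U) : algebroidBracket ξ ξ = 0 := by
  have h1 := algebroidBracket_swap ξ ξ
  rw [eq_neg_iff_add_eq_zero, ← two_smul ℝ] at h1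
  exact (smul_eq_zero.1 h1).resolve_left two_ne_zero

theorem extendJet_resJet {U' : Opens M} (h : U' ≤ U) (ξ : JetSection 𝒢 k U) {y : M} (hy : y ∈ U') :
    extendJet (resJet h ξ) y = extendJet ξ y := by
  rw [extendJet_apply _ hy, extendJet_apply _ (h hy)]
  rfl

theorem Represents.resJet {U' : Opens M} (h : U' ≤ U) {ξ : JetSection 𝒢 k U} (hx : x ∈ U')
    (hξ : Represents x V (extendJet ξ)) : Represents x V (extendJet (resJet h ξ)) := by
  filter_upwards [hξ, (tendsto_extChartAt_symm (E := E) x).eventually (U'.isOpen.mem_nhds hx)]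
    with z k1 k2
  rw [← k1]
  unfold jetC
  rw [extendJet_resJet h ξ k2]

theorem jetCoord_extendJet_algebroidBracket {ξ η : JetSection 𝒢 k U} (hx : x ∈ U)
    (hV : IsLocalR S V) (hW : IsLocalR S W) (hξ : Represents x V (extendJet ξ))
    (hη : Represents x W (extendJet η)) :
    jetCoord 𝒢 k x x (extendJet (algebroidBracket ξ η) x) = 𝒢.jetBracketC k x V W := by
  rw [extendJet_apply _ hx]
  exact jetCoord_algebroidBracket ⟨x, hx⟩ hV hW hξ hη

/-- A field representing `ξ` near `x` also represents its restriction, and the value of the bracket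
at `x` depends only on the representing fields. -/
theorem resJet_algebroidBracket {U' : Opens M} (h : U' ≤ U) (ξ η : JetSection 𝒢 k U) :
    resJet h (algebroidBracket ξ η) = algebroidBracket (resJet h ξ) (resJet h η) := by
  refine jetSection_ext fun x => ?_
  obtain ⟨S⟩ := exists_slide 𝒢 (x : M)
  obtain ⟨V, h1, h2⟩ := exists_represents ξ (h x.2) S
  obtain ⟨W, h5, h6⟩ := exists_represents η (h x.2) S
  have h7 := jetCoord_extendJet_algebroidBracket (h x.2) h1 h5 h2 h6
  rw [← extendJet_resJet h (algebroidBracket ξ η) x.2, extendJet_apply _ x.2] at h7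
  rw [jetCoord_algebroidBracket x h1 h5 (h2.resJet h x.2) (h6.resJet h x.2)]
  exact h7

theorem resTilde_secondBracket {U' : Opens M} (h : U' ≤ U) (ξ η : JetTilde 𝒢 k U) :
    resTilde h (secondBracket ξ η) = secondBracket (resTilde h ξ) (resTilde h η) := by
  apply nu_injective
  rw [← algebroidBracket_nu]
  change resJet h (nu 𝒢 k U (secondBracket ξ η)) = algebroidBracket (resJet h (nu 𝒢 k U ξ))
    (resJet h (nu 𝒢 k U η))
  rw [← algebroidBracket_nu, resJet_algebroidBracket]

/-- The coordinates of an iterated second bracket. -/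
theorem jetCoord_secondBracket_secondBracket (ξ η ζ : JetTilde 𝒢 k U) (x : U)
    {S : Slide 𝒢 (x : M)} {O : Set (M × M)} {Ξ H Z : Field E F M G} (hO : IsOpen O)
    (hxO : ((x : M), (x : M)) ∈ O) (hΞ : Ξ.IsLocal S) (hH : IsTildeV 𝒢 O H)
    (hZ : IsTildeV 𝒢 O Z) (hp : GermLifts (x : M) Ξ ξ.1) (hq : Lifts O H η.1)
    (hr : Lifts O Z ζ.1) :
    ContDiffAt ℝ ∞ (fun z => (VectorField.lieBracket ℝ (Ξ.coord x (𝒢.unit x))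
      (VectorField.lieBracket ℝ (H.coord x (𝒢.unit x)) (Z.coord x (𝒢.unit x)))
        (extChartAt 𝓘(ℝ, E) (x : M) x, 𝒢.unitC x z)).2) (extChartAt 𝓘(ℝ, E) (x : M) x) ∧
    jetCoord 𝒢 k (x : M) x ((nu 𝒢 k U (secondBracket ξ (secondBracket η ζ))).1 x)
      = taylor k (fun z => (VectorField.lieBracket ℝ (Ξ.coord x (𝒢.unit x))
        (VectorField.lieBracket ℝ (H.coord x (𝒢.unit x)) (Z.coord x (𝒢.unit x)))
        (extChartAt 𝓘(ℝ, E) (x : M) x, 𝒢.unitC x z)).2) (extChartAt 𝓘(ℝ, E) (x : M) x) := by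
  have hlH := hH.toIsR.isLocal hO hxO S
  have hlZ := hZ.toIsR.isLocal hO hxO S
  have hB := hlH.bracket hlZ
  -- The bracket `fieldBracket H Z` itself lifts the inner section: the characterization of the
  -- second bracket applies, with the same `O`, at every diagonal point near `x`. It can then be
  -- used in the outer bracket, for which local right invariance suffices.
  have hBl : GermLifts (x : M) (fieldBracket H Z) (secondBracket η ζ).1 := by
    have hd : Tendsto (fun y : M => (y, y)) (𝓝 (x : M)) (𝓝 ((x : M), (x : M))) :=
      tendsto_id.prodMk_nhds tendsto_id
    filter_upwards [hd.eventually (hO.mem_nhds hxO), U.isOpen.mem_nhds x.2] with y h1 h2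
    rw [(isSecondBracket_secondBracket η ζ ⟨y, h2⟩).2 O H Z hO h1 hH hZ hq hr,
      extendVec_apply _ h2, extendJet_apply _ h2]
  have h1 := upsilon_bracket_second ξ (secondBracket η ζ) x hΞ hB hp hBl
  have h2 := (hΞ.bracket hB).jetCoord_upsilon k
  rw [h1] at h2
  refine ⟨((hΞ.local_expr.lieBracket
    (hlH.local_expr.lieBracket hlZ.local_expr)).contDiffAt_snd_unitC).self_of_nhds,
    h2.trans (taylor_congr ?_)⟩
  have hux : Tendsto (fun z => (extChartAt 𝓘(ℝ, E) (x : M) x, 𝒢.unitC x z))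
      (𝓝 (extChartAt 𝓘(ℝ, E) (x : M) x)) (𝓝 (extChartAt 𝓘(ℝ, E) (x : M) x,
        extChartAt 𝓘(ℝ, F) (𝒢.unit x) (𝒢.unit x))) :=
    tendsto_const_nhds.prodMk_nhds (tendsto_unitC 𝒢 (x : M))
  have h3 := Field.coord_bracket_eventuallyEq hΞ.smooth hB.smooth
  have h4 := eventually_eventually_nhds.2
    (Field.coord_bracket_eventuallyEq hlH.smooth hlZ.smooth)
  filter_upwards [hux.eventually h3, hux.eventually h4] with z k1 k2
  rw [k1, Filter.EventuallyEq.lieBracket_vectorField_eq (EventuallyEq.refl _ _) k2]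

/-- The three iterated brackets are jets of iterated brackets of one triple of fields, so their sum
vanishes by the Jacobi identity for vector fields on `E × F`. -/
theorem secondBracket_jacobi (ξ η ζ : JetTilde 𝒢 k U) :
    secondBracket ξ (secondBracket η ζ) + secondBracket η (secondBracket ζ ξ)
      + secondBracket ζ (secondBracket ξ η) = 0 := by
  apply nu_injective
  rw [map_add, map_add, map_zero]
  refine jetSection_ext fun x => ?_
  obtain ⟨S⟩ := exists_slide 𝒢 (x : M)
  obtain ⟨O₁, Ξ, H, h1, h2, -, -, h5, h6, h7, h8⟩ := exists_lift_pair ξ.1 η.1 x.2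
  obtain ⟨O₂, Z, k1, k2, -, k4, k5⟩ := exists_lift ζ.1 x.2
  set O := O₁ ∩ O₂
  have hO : IsOpen O := h1.inter k1
  have hxO : ((x : M), (x : M)) ∈ O := ⟨h2, k2⟩
  have hΞ : IsTildeV 𝒢 O Ξ := (h7 ξ.2).mono inter_subset_left
  have hH : IsTildeV 𝒢 O H := (h8 η.2).mono inter_subset_left
  have hZ : IsTildeV 𝒢 O Z := (k5 ζ.2).mono inter_subset_right
  have lΞ : Lifts O Ξ ξ.1 := h5.mono inter_subset_left
  have lH : Lifts O H η.1 := h6.mono inter_subset_left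
  have lZ : Lifts O Z ζ.1 := k4.mono inter_subset_right
  have sΞ := hΞ.toIsR.isLocal hO hxO S
  have sH := hH.toIsR.isLocal hO hxO S
  have sZ := hZ.toIsR.isLocal hO hxO S
  obtain ⟨a1, a2⟩ := jetCoord_secondBracket_secondBracket ξ η ζ x hO hxO sΞ hH hZ
    (lΞ.germLifts hO hxO x.2) lH lZ
  obtain ⟨b1, b2⟩ := jetCoord_secondBracket_secondBracket η ζ ξ x hO hxO sH hZ hΞ
    (lH.germLifts hO hxO x.2) lZ lΞ
  obtain ⟨c1, c2⟩ := jetCoord_secondBracket_secondBracket ζ ξ η x hO hxO sZ hΞ hH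
    (lZ.germLifts hO hxO x.2) lΞ lH
  have hm := (eventually_mem_chart 𝒢 (x : M)).self_of_nhds
  have hsum : ∀ a b c : JetSection 𝒢 k U, (a + b + c).1 x = a.1 x + b.1 x + c.1 x :=
    fun _ _ _ => rfl
  have hzero : jetCoord 𝒢 k (x : M) x ((0 : JetSection 𝒢 k U).1 x) = 0 :=
    jetCoord_zero 𝒢 k hm.1 hm.2
  rw [hzero, hsum, jetCoord_add 𝒢 k hm.1 hm.2, jetCoord_add 𝒢 k hm.1 hm.2, a2, b2, c2,
    ← taylor_add a1 b1]
  refine (taylor_add (ContDiffAt.add a1 b1) c1).symm.trans (Eq.trans (taylor_congr ?_)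
    (taylor_zero_fun k (extChartAt 𝓘(ℝ, E) (x : M) x)))
  have hux : Tendsto (fun z => (extChartAt 𝓘(ℝ, E) (x : M) x, 𝒢.unitC x z))
      (𝓝 (extChartAt 𝓘(ℝ, E) (x : M) x)) (𝓝 (extChartAt 𝓘(ℝ, E) (x : M) x,
        extChartAt 𝓘(ℝ, F) (𝒢.unit x) (𝒢.unit x))) :=
    tendsto_const_nhds.prodMk_nhds (tendsto_unitC 𝒢 (x : M))
  filter_upwards [hux.eventually sΞ.local_expr.smooth, hux.eventually sH.local_expr.smooth,
    hux.eventually sZ.local_expr.smooth] with z d1 d2 d3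
  have hn : minSmoothness ℝ 2 ≤ (∞ : ℕ∞ω) := by
    rw [minSmoothness_of_isRCLikeNormedField]
    exact WithTop.coe_le_coe.2 (le_top : (2 : ℕ∞) ≤ ⊤)
  have hj := VectorField.leibniz_identity_lieBracket hn d1 d2 d3
  have hs1 : VectorField.lieBracket ℝ (Z.coord x (𝒢.unit x)) (Ξ.coord x (𝒢.unit x))
      = -VectorField.lieBracket ℝ (Ξ.coord x (𝒢.unit x)) (Z.coord x (𝒢.unit x)) :=
    funext fun q => VectorField.lieBracket_swap
  have hs2 := VectorField.lieBracket_swap (𝕜 := ℝ) (V := Z.coord x (𝒢.unit x))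
    (W := VectorField.lieBracket ℝ (Ξ.coord x (𝒢.unit x)) (H.coord x (𝒢.unit x)))
    (x := (extChartAt 𝓘(ℝ, E) (x : M) x, 𝒢.unitC x z))
  have hs3 : VectorField.lieBracket ℝ (H.coord x (𝒢.unit x))
      (-VectorField.lieBracket ℝ (Ξ.coord x (𝒢.unit x)) (Z.coord x (𝒢.unit x)))
        (extChartAt 𝓘(ℝ, E) (x : M) x, 𝒢.unitC x z)
      = -VectorField.lieBracket ℝ (H.coord x (𝒢.unit x))
        (VectorField.lieBracket ℝ (Ξ.coord x (𝒢.unit x)) (Z.coord x (𝒢.unit x)))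
        (extChartAt 𝓘(ℝ, E) (x : M) x, 𝒢.unitC x z) := by
    simp only [VectorField.lieBracket, Pi.neg_apply, map_neg, fderiv_neg, neg_apply]
    abel
  simp only [Pi.add_apply, Pi.zero_apply]
  rw [← Prod.snd_add, ← Prod.snd_add, hs1, hs3, hs2, hj]
  simp

/-- Linearity and antisymmetry are pulled back along `ν_k` from the formula on jets. The Jacobi
identity is instead proved in `J̃^k 𝔤`, where iterated brackets are again brackets of vector fields.
-/
theorem isLieBracket_secondBracket (𝒢 : LieGroupoid E F M G) (k : ℕ) (U : Opens M) :
    IsLieBracket (fun ξ η : JetTilde 𝒢 k U => secondBracket ξ η) where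
  add_left ξ η ζ := by
    apply nu_injective
    have h := algebroidBracket_add_smul (nu 𝒢 k U ξ) (nu 𝒢 k U η) (nu 𝒢 k U ζ) 1
    simp only [one_smul] at h
    rw [← algebroidBracket_nu, map_add, map_add, h, algebroidBracket_nu, algebroidBracket_nu]
  smul_left c ξ η := by
    apply nu_injective
    -- With both sections zero and `c = 1`, additivity says that the bracket with zero vanishes.
    have h0 := algebroidBracket_add_smul (0 : JetSection 𝒢 k U) 0 (nu 𝒢 k U η) 1
    simp only [one_smul, add_zero, left_eq_add] at h0
    have h := algebroidBracket_add_smul 0 (nu 𝒢 k U ξ) (nu 𝒢 k U η) c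
    rw [zero_add, h0, zero_add] at h
    rw [← algebroidBracket_nu, map_smul, map_smul, h, algebroidBracket_nu]
  self ξ := by
    apply nu_injective
    rw [← algebroidBracket_nu, algebroidBracket_self, map_zero]
  skew ξ η := by
    apply nu_injective
    rw [← algebroidBracket_nu, map_neg, ← algebroidBracket_nu, ← algebroidBracket_swap]
  jacobi := secondBracket_jacobi

theorem IsLieBracket.map {A B : Type*} [AddCommGroup A] [Module ℝ A] [AddCommGroup B] [Module ℝ B]
    {a : A → A → A} {b : B → B → B} (h : IsLieBracket a) (f : A →ₗ[ℝ] B)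
    (hf : Function.Surjective f) (hab : ∀ x y, b (f x) (f y) = f (a x y)) : IsLieBracket b where
  add_left := hf.forall₃.2 fun x y z => by
    rw [← map_add, hab, hab, hab, h.add_left, map_add]
  smul_left c := hf.forall₂.2 fun x y => by
    rw [← map_smul, hab, hab, h.smul_left, map_smul]
  self := hf.forall.2 fun x => by rw [hab, h.self, map_zero]
  skew := hf.forall₂.2 fun x y => by rw [hab, hab, h.skew, map_neg]
  jacobi := hf.forall₃.2 fun x y z => by
    rw [hab, hab, hab, hab, hab, hab, ← map_add, ← map_add, h.jacobi, map_zero]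

theorem isLieBracket_algebroidBracket (𝒢 : LieGroupoid E F M G) (k : ℕ) (U : Opens M) :
    IsLieBracket (fun ξ η : JetSection 𝒢 k U => algebroidBracket ξ η) :=
  (isLieBracket_secondBracket 𝒢 k U).map (nu 𝒢 k U) (nu_surjective 𝒢 k U) algebroidBracket_nu

end Lie

end LieGroupoid

namespace LieGroupoid

/-! ### The Spencer operator and the first bracket -/

section Spencer

variable {E F M G : Type*}
  [NormedAddCommGroup E] [NormedSpace ℝ E] [NormedAddCommGroup F] [NormedSpace ℝ F]
  [TopologicalSpace M] [ChartedSpace E M] [TopologicalSpace G] [ChartedSpace F G]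
  [IsManifold 𝓘(ℝ, E) ∞ M] [IsManifold 𝓘(ℝ, F) ∞ G]

/-- The derivative of a map on an open subset, in the preferred chart of the manifold. -/
theorem mfderiv_comp_val {W : Type*} [NormedAddCommGroup W] [NormedSpace ℝ W] {U : Opens M}
    (x : U) {f : M → W}
    (hf : DifferentiableAt ℝ (fun z => f ((extChartAt 𝓘(ℝ, E) (x : M)).symm z))
      (extChartAt 𝓘(ℝ, E) (x : M) x)) (v : E) :
    (mfderiv 𝓘(ℝ, E) 𝓘(ℝ, W) (fun y : U => f y) x v : W)
      = fderiv ℝ (fun z => f ((extChartAt 𝓘(ℝ, E) (x : M)).symm z))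
        (extChartAt 𝓘(ℝ, E) (x : M) x) v := by
  have hd : MDifferentiableAt 𝓘(ℝ, E) 𝓘(ℝ, W) f (x : M) := by
    refine (MDifferentiableAt.comp (x : M) hf.mdifferentiableAt
      (mdifferentiableAt_extChartAt (mem_chart_source E (x : M)))).congr_of_eventuallyEq ?_
    filter_upwards [extChartAt_source_mem_nhds (I := 𝓘(ℝ, E)) (x : M)] with y hy
    rw [Function.comp_apply, (extChartAt 𝓘(ℝ, E) (x : M)).left_inv hy]
  have hU : MDifferentiableAt 𝓘(ℝ, E) 𝓘(ℝ, W) (fun y : U => f y) x :=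
    hd.comp x ((contMDiff_subtype_val (n := ∞)).contMDiffAt.mdifferentiableAt (by simp))
  rw [hU.mfderiv]
  have h1 : writtenInExtChartAt 𝓘(ℝ, E) 𝓘(ℝ, W) x (fun y : U => f y)
      =ᶠ[𝓝 (extChartAt 𝓘(ℝ, E) (x : M) x)]
      fun z => f ((extChartAt 𝓘(ℝ, E) (x : M)).symm z) := by
    have h2 := Opens.chartAt_subtype_val_symm_eventuallyEq (H := E) U (x := x)
    have h3 : extChartAt 𝓘(ℝ, E) (x : M) x = chartAt E (x : M) x := by simp
    rw [h3]
    filter_upwards [h2] with z hz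
    simp only [writtenInExtChartAt, extChartAt_coe_symm, Function.comp_apply,
      extChartAt_model_space_eq_id, PartialEquiv.refl_coe, id, modelWithCornersSelf_coe_symm] at hz ⊢
    rw [hz]
  rw [modelWithCornersSelf_coe, range_id, fderivWithin_univ]
  exact congrArg (fun L : E →L[ℝ] W => L v) h1.fderiv_eq

variable {𝒢 : LieGroupoid E F M G} {k : ℕ} {U : Opens M} {x : M}

variable [CompleteSpace E] [CompleteSpace F]

/-- Without differentiability `mfderiv` would take its default value `0`; this ensures that the
Spencer operator is a genuine derivative. -/
theorem differentiableAt_jetC_sub (ξ : JetSection 𝒢 (k + 1) U) (hx : x ∈ U) :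
    DifferentiableAt ℝ (𝒢.jetC x (fun y => jetProj 𝒢 k y (extendJet ξ y)
      - jet 𝒢 k y (rep (extendJet ξ x)))) (extChartAt 𝓘(ℝ, E) x x) := by
  obtain ⟨hθ, -⟩ := exists_rep (extendJet ξ x)
  set θ := rep (extendJet ξ x) with hθd
  have hθT : ContDiffAt ℝ ∞ (taylor k (localExpr 𝒢 x θ)) (extChartAt 𝓘(ℝ, E) x x) :=
    contDiffAt_taylor_param (P := E) k (g := fun p : E × E => localExpr 𝒢 x θ p.2)
      (ζ := fun z => z) (ContDiffAt.comp _ (g := localExpr 𝒢 x θ)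
        (contDiffAt_localExpr' 𝒢 (mem_extChartAt_source x) (mem_extChartAt_source _) hθ)
        contDiffAt_snd) contDiffAt_id
  have hξ := (eventually_contDiffAt_jetC (sectionProj 𝒢 k U ξ) hx).self_of_nhds
  refine ((hξ.sub hθT).congr_of_eventuallyEq ?_).differentiableAt (by simp)
  have hθm : ∀ᶠ y in 𝓝 x, θ ∈ localSections 𝒢 y := eventually_eventually_nhds.2 hθ
  filter_upwards [eventually_mem_chart_symm 𝒢 x, (tendsto_extChartAt_symm (E := E) x).eventually hθm]
    with z h2 h3
  have h4 := (extChartAt 𝓘(ℝ, E) x).map_target h2.1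
  rw [extendJet_sectionProj]
  unfold jetC
  rw [jetCoord_sub' 𝒢 k h4 h2.2, jet_of_mem 𝒢 k h3, jetCoord_toJet' 𝒢 k h4 h2.2,
    (extChartAt 𝓘(ℝ, E) x).right_inv h2.1]

theorem isSpencer_iff {v : VecSection E U} {ξ : JetSection 𝒢 (k + 1) U}
    {ζ : JetSection 𝒢 k U} : IsSpencer v ξ ζ ↔ ∀ x : U,
      jetCoord 𝒢 k (x : M) x (ζ.1 x) = 𝒢.spencerC k (x : M) (extendJet ξ) (v.1 x) := by
  refine forall_congr' fun x => ?_
  have h := mfderiv_comp_val x (f := fun y : M => jetCoord 𝒢 k (x : M) y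
    (jetProj 𝒢 k y (extendJet ξ y) - jet 𝒢 k y (rep (extendJet ξ x))))
    (differentiableAt_jetC_sub ξ x.2) (v.1 x)
  have h2 : (fun y : U => jetCoord 𝒢 k (x : M) y
      (jetProj 𝒢 k y (extendJet ξ y) - jet 𝒢 k y (rep (extendJet ξ x))))
      = fun y : U => jetCoord 𝒢 k (x : M) y
        (jetProj 𝒢 k y (ξ.1 y) - jet 𝒢 k y (rep (ξ.1 x))) := by
    funext y
    rw [extendJet_apply ξ y.2, extendJet_apply ξ x.2]
  rw [h2] at h
  exact ⟨fun h3 => h3.trans h, fun h3 => h3.trans h.symm⟩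

theorem spencerC_sub (j : Π y : M, Jet 𝒢 (k + 1) y) (v w : E) :
    𝒢.spencerC k x j (v - w) = 𝒢.spencerC k x j v - 𝒢.spencerC k x j w := map_sub _ _ _

theorem spencerC_zero_right (j : Π y : M, Jet 𝒢 (k + 1) y) : 𝒢.spencerC k x j 0 = 0 := map_zero _

theorem spencerC_zero_left (S : Slide 𝒢 x) (hx : x ∈ U) (v : E) :
    𝒢.spencerC k x (extendJet (0 : JetSection 𝒢 (k + 1) U)) v = 0 := by
  rw [spencerC, fderiv_jetC_sub (IsLocalR.zero S) (Represents.zero hx),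
    ← taylor_zero_fun k (extChartAt 𝓘(ℝ, E) x x)]
  congr 1
  funext z
  simp only [derivFst]
  rw [show fderiv ℝ (0 : E × F → E × F) = 0 from fderiv_zero]
  rfl

/-- The first bracket in coordinates. -/
theorem jetCoord_firstBracket (p q : JetCheck 𝒢 (k + 1) U) (x : U) :
    jetCoord 𝒢 k (x : M) x ((firstBracket p q).2.1 x)
      = jetCoord 𝒢 k (x : M) x
          ((algebroidBracket (sectionProj 𝒢 k U p.2) (sectionProj 𝒢 k U q.2)).1 x)
        + (𝒢.spencerC k (x : M) (extendJet q.2) (p.1.1 x)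
          - 𝒢.spencerC k (x : M) (extendJet q.2) (anchor 𝒢 (k + 1) x (p.2.1 x)))
        - (𝒢.spencerC k (x : M) (extendJet p.2) (q.1.1 x)
          - 𝒢.spencerC k (x : M) (extendJet p.2) (anchor 𝒢 (k + 1) x (q.2.1 x))) := by
  obtain ⟨S⟩ := exists_slide 𝒢 (x : M)
  obtain ⟨Ξ, h1, h2⟩ := exists_isLocal_germLifts p x.2 S
  obtain ⟨H, h3, h4⟩ := exists_isLocal_germLifts q x.2 S
  have h5 := upsilon_bracket_first p q x h1 h3 h2 h4
  have h6 := jetCoord_upsilon_bracket_first h1 h3 h2 h4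
  rw [h5, spencerC_sub, spencerC_sub] at h6
  rw [extendVec_apply _ x.2, extendVec_apply _ x.2, extendJet_apply _ x.2, extendJet_apply _ x.2,
    chartVec_self, chartVec_self, chartVec_self, chartVec_self] at h6
  rw [isAlgebroidBracket_algebroidBracket _ _ x]
  exact h6

/-- The anchor component of the first bracket of two sections with vanishing anchor component. -/
theorem firstBracket_fst_of_eq_zero (ξ η : JetSection 𝒢 (k + 1) U) :
    (firstBracket ((0, ξ) : JetCheck 𝒢 (k + 1) U) (0, η)).1 = 0 := by
  refine Subtype.ext (funext fun x => ?_)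
  obtain ⟨S⟩ := exists_slide 𝒢 (x : M)
  obtain ⟨Ξ, h1, h2⟩ := exists_isLocal_germLifts ((0, ξ) : JetCheck 𝒢 (k + 1) U) x.2 S
  obtain ⟨H, h3, h4⟩ := exists_isLocal_germLifts ((0, η) : JetCheck 𝒢 (k + 1) U) x.2 S
  have h5 := upsilon_bracket_first _ _ x h1 h3 h2 h4
  have h6 := chartVec_upsilon_bracket (k := k) (k + 1) h1 h3 h2 h4
  have h7 : vecC (x : M) (extendVec (0 : VecSection E U)) = 0 := by
    funext z
    unfold vecC
    by_cases hz : (extChartAt 𝓘(ℝ, E) (x : M)).symm z ∈ U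
    · rw [extendVec_apply _ hz]
      exact chartVec_zero _ _
    · rw [extendVec, dif_neg hz]
      exact chartVec_zero _ _
  rw [h5, h7, VectorField.lieBracket_self] at h6
  rw [chartVec_self] at h6
  exact h6

/-- In the first bracket of `(v, 0)` and `(0, ξ)` all terms of `jetCoord_firstBracket` vanish except
`i(v) D ξ`, so the first bracket provides the smooth section. -/
theorem exists_isSpencer (v : VecSection E U) (ξ : JetSection 𝒢 (k + 1) U) :
    ∃ ζ : JetSection 𝒢 k U, IsSpencer v ξ ζ := by
  refine ⟨(firstBracket ((v, 0) : JetCheck 𝒢 (k + 1) U) (0, ξ)).2, isSpencer_iff.2 fun x => ?_⟩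
  obtain ⟨S⟩ := exists_slide 𝒢 (x : M)
  have h0 : sectionProj 𝒢 k U (0 : JetSection 𝒢 (k + 1) U) = 0 :=
    Subtype.ext (funext fun y => map_zero (jetProj 𝒢 k y))
  have hb : algebroidBracket (0 : JetSection 𝒢 k U) (sectionProj 𝒢 k U ξ) = 0 := by
    have h := (isLieBracket_algebroidBracket 𝒢 k U).smul_left 0 0 (sectionProj 𝒢 k U ξ)
    simpa only [zero_smul] using h
  have ha : 𝒢.spencerC k (x : M) (extendJet ξ)
      (anchor 𝒢 (k + 1) x ((0 : JetSection 𝒢 (k + 1) U).1 x)) = 0 :=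
    (congrArg (𝒢.spencerC k (x : M) (extendJet ξ)) (map_zero (anchor 𝒢 (k + 1) (x : M)))).trans
      (spencerC_zero_right _)
  have h1 : 𝒢.spencerC k (x : M) (extendJet (0 : JetSection 𝒢 (k + 1) U))
      ((0 : VecSection E U).1 x) = 0 := spencerC_zero_left S x.2 _
  have h2 : 𝒢.spencerC k (x : M) (extendJet (0 : JetSection 𝒢 (k + 1) U))
      (anchor 𝒢 (k + 1) x (ξ.1 x)) = 0 := spencerC_zero_left S x.2 _
  have hm := (eventually_mem_chart 𝒢 (x : M)).self_of_nhds
  have hz : jetCoord 𝒢 k (x : M) x ((0 : JetSection 𝒢 k U).1 x) = 0 :=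
    jetCoord_zero 𝒢 k hm.1 hm.2
  rw [jetCoord_firstBracket]
  simp only
  rw [h0, hb, hz, ha, h1, h2, zero_add, sub_zero, sub_zero, sub_zero]

theorem isSpencer_spencer (v : VecSection E U) (ξ : JetSection 𝒢 (k + 1) U) :
    IsSpencer v ξ (spencer v ξ) := by
  rw [spencer, dif_pos (exists_isSpencer v ξ)]
  exact (exists_isSpencer v ξ).choose_spec

theorem anchor_jetProj (𝒢 : LieGroupoid E F M G) (k : ℕ) (x : M) (j : Jet 𝒢 (k + 1) x) :
    anchor 𝒢 k x (jetProj 𝒢 k x j) = anchor 𝒢 (k + 1) x j := by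
  obtain ⟨θ, rfl⟩ := toJet_surjective 𝒢 (k + 1) x j
  rfl

/-- The second bracket in terms of the Spencer operator and the first bracket. -/
theorem nu_secondBracket_eq (ξ η : JetTilde 𝒢 k U) (ξ' η' : JetSection 𝒢 (k + 1) U)
    (hξ : sectionProj 𝒢 k U ξ' = nu 𝒢 k U ξ) (hη : sectionProj 𝒢 k U η' = nu 𝒢 k U η) :
    nu 𝒢 k U (secondBracket ξ η) = spencer ξ.1.1 η' - spencer η.1.1 ξ'
      + (firstBracket ((0, ξ') : JetCheck 𝒢 (k + 1) U) (0, η')).2 := by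
  refine jetSection_ext fun x => ?_
  have hm := (eventually_mem_chart 𝒢 (x : M)).self_of_nhds
  have hsum : ∀ a b c : JetSection 𝒢 k U, (a - b + c).1 x = a.1 x - b.1 x + c.1 x :=
    fun _ _ _ => rfl
  have hanchor : ∀ {ξ : JetTilde 𝒢 k U} {ξ' : JetSection 𝒢 (k + 1) U},
      sectionProj 𝒢 k U ξ' = nu 𝒢 k U ξ → anchor 𝒢 (k + 1) x (ξ'.1 x) = ξ.1.1.1 x := by
    intro ξ ξ' h
    rw [ξ.2 x, ← anchor_jetProj]
    exact congrArg (fun s : JetSection 𝒢 k U => anchor 𝒢 k x (s.1 x)) h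
  rw [hsum, jetCoord_add 𝒢 k hm.1 hm.2,
    jetCoord_sub' 𝒢 k (mem_extChartAt_source _) (mem_extChartAt_source _),
    isSpencer_iff.1 (isSpencer_spencer _ _) x, isSpencer_iff.1 (isSpencer_spencer _ _) x,
    jetCoord_firstBracket]
  simp only
  have h0 : ∀ j : Π y : M, Jet 𝒢 (k + 1) y,
      𝒢.spencerC k (x : M) j ((0 : VecSection E U).1 x) = 0 := spencerC_zero_right
  -- With zero horizontal parts the first bracket is the algebroid bracket minus `i(ξ_H) D η` plus
  -- `i(η_H) D ξ`, which the two Spencer terms compensate.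
  rw [hξ, hη, algebroidBracket_nu, hanchor hξ, hanchor hη, h0, h0]
  abel

end Spencer

end LieGroupoid

end

/-! ### Assembly of the theorem -/

open LieGroupoid in
theorem proposition3p3 {E F M G : Type*}
    [NormedAddCommGroup E] [NormedSpace ℝ E] [FiniteDimensional ℝ E]
    [NormedAddCommGroup F] [NormedSpace ℝ F] [FiniteDimensional ℝ F]
    [TopologicalSpace M] [ChartedSpace E M] [IsManifold 𝓘(ℝ, E) ∞ M] [T2Space M]
    [TopologicalSpace G] [ChartedSpace F G] [IsManifold 𝓘(ℝ, F) ∞ G] [T2Space G]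
    (𝒢 : LieGroupoid E F M G) (k : ℕ) :
    -- the second bracket and the algebroid bracket are well defined
    (∀ (U : Opens M) (ξ η : JetTilde 𝒢 k U), IsSecondBracket ξ η (secondBracket ξ η)) ∧
    (∀ (U : Opens M) (ξ η : JetSection 𝒢 k U), IsAlgebroidBracket ξ η (algebroidBracket ξ η)) ∧
    -- the second bracket projects to the algebroid bracket
    (∀ (U : Opens M) (ξ η : JetTilde 𝒢 k U),
      algebroidBracket (nu 𝒢 k U ξ) (nu 𝒢 k U η) = nu 𝒢 k U (secondBracket ξ η)) ∧
    -- `Γ(J̃^k 𝔤)` and `Γ(J^k 𝔤)` are sheaves of Lie algebras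
    (∀ U : Opens M, IsLieBracket (fun ξ η : JetTilde 𝒢 k U => secondBracket ξ η)) ∧
    (∀ U : Opens M, IsLieBracket (fun ξ η : JetSection 𝒢 k U => algebroidBracket ξ η)) ∧
    (∀ (U V : Opens M) (h : V ≤ U) (ξ η : JetTilde 𝒢 k U),
      resTilde h (secondBracket ξ η) = secondBracket (resTilde h ξ) (resTilde h η)) ∧
    (∀ (U V : Opens M) (h : V ≤ U) (ξ η : JetSection 𝒢 k U),
      resJet h (algebroidBracket ξ η) = algebroidBracket (resJet h ξ) (resJet h η)) ∧
    -- `ν_k` is an isomorphism of sheaves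
    (∀ U : Opens M, Function.Bijective (nu 𝒢 k U)) ∧
    (∀ (U V : Opens M) (h : V ≤ U) (ξ : JetTilde 𝒢 k U),
      nu 𝒢 k V (resTilde h ξ) = resJet h (nu 𝒢 k U ξ)) ∧
    -- the first bracket and the Spencer operator are well defined
    (∀ (U : Opens M) (p q : JetCheck 𝒢 (k + 1) U), IsFirstBracket p q (firstBracket p q)) ∧
    (∀ (U : Opens M) (v : VecSection E U) (ξ : JetSection 𝒢 (k + 1) U),
      IsSpencer v ξ (spencer v ξ)) ∧
    -- the bracket in terms of the Spencer operator and the first bracket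
    (∀ (U : Opens M) (ξ η : JetTilde 𝒢 k U) (ξ' η' : JetSection 𝒢 (k + 1) U),
      sectionProj 𝒢 k U ξ' = nu 𝒢 k U ξ → sectionProj 𝒢 k U η' = nu 𝒢 k U η →
      ((0 : VecSection E U), nu 𝒢 k U (secondBracket ξ η)) =
        ((0 : VecSection E U), spencer ξ.1.1 η' - spencer η.1.1 ξ') +
          firstBracket ((0 : VecSection E U), ξ') ((0 : VecSection E U), η')) := by
  have := FiniteDimensional.complete ℝ E
  have := FiniteDimensional.complete ℝ F
  refine ⟨fun U => isSecondBracket_secondBracket, fun U => isAlgebroidBracket_algebroidBracket,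
    fun U => algebroidBracket_nu, isLieBracket_secondBracket 𝒢 k,
    isLieBracket_algebroidBracket 𝒢 k, fun U V h => resTilde_secondBracket h,
    fun U V h => resJet_algebroidBracket h, nu_bijective 𝒢 k, fun U V h ξ => rfl,
    fun U => isFirstBracket_firstBracket, fun U => isSpencer_spencer,
    fun U ξ η ξ' η' hξ hη => Prod.ext ?_ (nu_secondBracket_eq ξ η ξ' η' hξ hη)⟩
  -- The `𝒯`-component of the first bracket is the bracket of two zero vector fields.
  exact ((zero_add _).trans (firstBracket_fst_of_eq_zero ξ' η')).symm
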